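/- All manifolds and maps are smooth. A *symplectic fibration* $(V,\omega)$ is a closed, connected, oriented $3$-manifold $V$ together with a fibre bundle projection $V\to S^1$, whose fibre is a closed connected surface, and a closed $2$-form $\omega$ on $V$ that restricts to an area form on each fibre. Its genus is the genus of the fibre. It is *trivial* if it is isomorphic, as a bundle over $S^1$ with a $2$-form, to the projection $\Sigma\times S^1\to S^1$, where $\Sigma$ is a closed connected surface and $\Sigma\times S^1$ carries the pull-back under $\Sigma\times S^1\to\Sigma$ of an area form on $\Sigma$ (of arbitrary total area; $V$ may carry either of its two orientations). A *cobordism* from a symplectic fibration $(V^0,\omega^0)$ to a symplectic fibration $(V^1,\omega^1)$ is a compact, connected $4$-manifold $W$ with a symplectic form $\Omega$ such that, with $W$ oriented by $\Omega\wedge\Omega$, the oriented boundary $\partial W$ equals $V^1\sqcup(-V^0)$, where $-V^0$ is $V^0$ with the reversed orientation, and $\Omega|_{TV^i}=\omega^i$ for $i=0,1$. **Lemma.** Let $g,g'>0$ be integers. Let $(V,\omega)$ be any trivial symplectic fibration of genus $g$ and $(V',\omega')$ any trivial symplectic fibration of genus $g'$. Then there is a cobordism from $(V,\omega)$ to $(V',\omega')$.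 -/

import Mathlib

open Set Topology
open scoped Manifold ContDiff

universe u

noncomputable section

namespace SympFib

/-! ### Differential forms on manifolds, possibly with boundary -/

section Forms

variable {E : Type*} [NormedAddCommGroup E] [NormedSpace ℝ E]
  {H : Type*} [TopologicalSpace H]
  {M : Type*} [TopologicalSpace M] [ChartedSpace H M]
  {E' : Type*} [NormedAddCommGroup E'] [NormedSpace ℝ E']
  {H' : Type*} [TopologicalSpace H']
  {N : Type*} [TopologicalSpace N] [ChartedSpace H' N]

/-- A (not necessarily continuous) real differential `k`-form on the manifold `M`: an alternating
`k`-linear form on each tangent space. -/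
abbrev DiffForm (I : ModelWithCorners ℝ E H) (M : Type*) [TopologicalSpace M] [ChartedSpace H M]
    (k : ℕ) : Type _ :=
  ∀ x : M, TangentSpace I x [⋀^Fin k]→L[ℝ] ℝ

/-- The coordinate expression of `η` in the preferred chart around `x₀`: the pull-back of `η` under
the inverse of that chart. It is meaningful on the target of the chart, an open subset of the model
(half-)space `range I`. -/
def DiffForm.inChart {I : ModelWithCorners ℝ E H} {k : ℕ} (η : DiffForm I M k) (x₀ : M) :
    E → E [⋀^Fin k]→L[ℝ] ℝ := fun y =>
  (η ((extChartAt I x₀).symm y)).compContinuousLinearMap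
    (mfderivWithin 𝓘(ℝ, E) I (extChartAt I x₀).symm (range I) y)

/-- `η` is smooth, up to and including the boundary: all its coordinate expressions are. -/
def DiffForm.IsSmooth {I : ModelWithCorners ℝ E H} {k : ℕ} (η : DiffForm I M k) : Prop :=
  ∀ x₀ : M, ContDiffOn ℝ ∞ (η.inChart x₀) (extChartAt I x₀).target

/-- `dη = 0`, computed in coordinates (used for smooth `η`). -/
def DiffForm.IsClosed {I : ModelWithCorners ℝ E H} {k : ℕ} (η : DiffForm I M k) : Prop :=
  ∀ x₀ : M, ∀ y ∈ (extChartAt I x₀).target,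
    extDerivWithin (η.inChart x₀) (extChartAt I x₀).target y = 0

/-- The pull-back `f^* η` of a form under a map `f : M → N` (used for smooth `f`). -/
def DiffForm.pullback (I : ModelWithCorners ℝ E H) {J : ModelWithCorners ℝ E' H'} {k : ℕ}
    (f : M → N) (η : DiffForm J N k) : DiffForm I M k := fun x =>
  (η (f x)).compContinuousLinearMap (mfderiv I J f x)

/-- A form that vanishes at no point. In top degree, such a smooth form is a volume (area) form. -/
def DiffForm.NowhereZero {I : ModelWithCorners ℝ E H} {k : ℕ} (η : DiffForm I M k) : Prop :=
  ∀ x : M, η x ≠ 0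

/-- Nondegeneracy of a `2`-form. -/
def DiffForm.Nondegenerate {I : ModelWithCorners ℝ E H} (η : DiffForm I M 2) : Prop :=
  ∀ (x : M) (v : TangentSpace I x), (∀ w : TangentSpace I x, η x ![v, w] = 0) → v = 0

/-- A symplectic form: a smooth, closed, nondegenerate `2`-form. -/
structure DiffForm.IsSymplectic {I : ModelWithCorners ℝ E H} (η : DiffForm I M 2) : Prop where
  smooth : η.IsSmooth
  closed : η.IsClosed
  nondegenerate : η.Nondegenerate

/-- The value `(η ∧ η)(v₁, v₂, v₃, v₄)` of the exterior square of a `2`-form. -/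
def DiffForm.wedgeSelf {I : ModelWithCorners ℝ E H} (η : DiffForm I M 2) (x : M)
    (v₁ v₂ v₃ v₄ : TangentSpace I x) : ℝ :=
  2 * (η x ![v₁, v₂] * η x ![v₃, v₄] - η x ![v₁, v₃] * η x ![v₂, v₄]
    + η x ![v₁, v₄] * η x ![v₂, v₃])

end Forms

/-! ### Surfaces -/

/-- A closed connected smooth surface. -/
structure ClosedSurface : Type (u + 1) where
  /-- the underlying set -/
  carrier : Type u
  [top : TopologicalSpace carrier]
  [charts : ChartedSpace (EuclideanSpace ℝ (Fin 2)) carrier]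
  [smooth : IsManifold (𝓡 2) ∞ carrier]
  [t2 : T2Space carrier]
  [compact : CompactSpace carrier]
  [connected : ConnectedSpace carrier]

namespace ClosedSurface

instance : CoeSort ClosedSurface.{u} (Type u) := ⟨ClosedSurface.carrier⟩

attribute [instance] top charts smooth t2 compact connected

/-- There are `n` pairwise disjoint smoothly embedded circles in `S` whose union does not
disconnect `S`. -/
def HasNonseparatingCircles (S : ClosedSurface.{u}) (n : ℕ) : Prop :=
  ∃ γ : Fin n → Circle → S,
    (∀ i, ContMDiff (𝓡 1) (𝓡 2) ∞ (γ i)) ∧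
    (∀ i z, Function.Injective (mfderiv (𝓡 1) (𝓡 2) (γ i) z)) ∧
    (∀ i, Function.Injective (γ i)) ∧
    (Pairwise fun i j => Disjoint (range (γ i)) (range (γ j))) ∧
    IsConnected (⋃ i, range (γ i))ᶜ

/-- The (orientable) surface `S` has genus `g`: `g` is the largest number of pairwise disjoint
simple closed curves in `S` whose union does not disconnect `S`. -/
def HasGenus (S : ClosedSurface.{u}) (g : ℕ) : Prop :=
  IsGreatest {n : ℕ | S.HasNonseparatingCircles n} g

end ClosedSurface

/-! ### Symplectic fibrations over the circle -/

/-- A symplectic fibration `(V, ω)`: a closed, connected, oriented `3`-manifold `V`, a smooth fibre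
bundle `V → S¹` whose fibre is a closed connected surface, and a closed `2`-form `ω` on `V`
that restricts to an area form on each fibre. -/
structure SymplecticFibration : Type (u + 1) where
  /-- the total space `V` -/
  total : Type u
  [top : TopologicalSpace total]
  [charts : ChartedSpace (EuclideanSpace ℝ (Fin 3)) total]
  [smooth : IsManifold (𝓡 3) ∞ total]
  [t2 : T2Space total]
  [compact : CompactSpace total]
  [connected : ConnectedSpace total]
  /-- A volume form representing the orientation of `V`; a tangent frame is positive if `vol` is
  positive on it. Nothing below depends on more than the sign of `vol`. -/
  vol : DiffForm (𝓡 3) total 3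
  vol_smooth : vol.IsSmooth
  vol_nowhereZero : vol.NowhereZero
  /-- the bundle projection `V → S¹` -/
  proj : total → Circle
  /-- the fibre -/
  fibre : ClosedSurface.{u}
  /-- `proj` is a smooth fibre bundle: there are smooth local trivializations around every point
  of the circle. -/
  locally_trivial : ∀ z : Circle, ∃ e : Bundle.Trivialization fibre proj, z ∈ e.baseSet ∧
    ContMDiffOn (𝓡 3) ((𝓡 1).prod (𝓡 2)) ∞ e e.source ∧
    ContMDiffOn ((𝓡 1).prod (𝓡 2)) (𝓡 3) ∞ e.toOpenPartialHomeomorph.symm e.target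
  /-- the `2`-form `ω` -/
  form : DiffForm (𝓡 3) total 2
  form_smooth : form.IsSmooth
  form_closed : form.IsClosed
  /-- `ω` restricts to an area form on each fibre; the tangent plane of the fibre through `x` is the
  kernel of the differential of the projection. -/
  form_area : ∀ (x : total) (v w : TangentSpace (𝓡 3) x),
    mfderiv (𝓡 3) (𝓡 1) proj x v = 0 → mfderiv (𝓡 3) (𝓡 1) proj x w = 0 →
    LinearIndependent ℝ ![v, w] → form x ![v, w] ≠ 0

namespace SymplecticFibration

attribute [instance] top charts smooth t2 compact connected

instance : CoeSort SymplecticFibration.{u} (Type u) := ⟨SymplecticFibration.total⟩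

/-- The genus of a symplectic fibration is the genus of its fibre. -/
def HasGenus (V : SymplecticFibration.{u}) (g : ℕ) : Prop := V.fibre.HasGenus g

/-- `V` is a trivial symplectic fibration: it is isomorphic, as a bundle with `2`-form, to
`Σ × S¹ → S¹` with the pull-back of an area form on the fibre `Σ`. -/
def IsTrivial (V : SymplecticFibration.{u}) : Prop :=
  ∃ (σ : DiffForm (𝓡 2) V.fibre 2)
    (Φ : Diffeomorph ((𝓡 2).prod (𝓡 1)) (𝓡 3) (V.fibre × Circle) V ∞),
    σ.IsSmooth ∧ σ.NowhereZero ∧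
    (∀ p, V.proj (Φ p) = p.2) ∧
    V.form.pullback ((𝓡 2).prod (𝓡 1)) Φ =
      σ.pullback ((𝓡 2).prod (𝓡 1)) (Prod.fst : V.fibre × Circle → V.fibre)

end SymplecticFibration

/-! ### Cobordisms -/

section Boundary

variable {W : Type*} [TopologicalSpace W] [ChartedSpace (EuclideanHalfSpace 4) W]

/-- A tangent vector at a boundary point `q` of `W` points outward if its `0`-th component in a
chart around `q`, with values in the half-space `{x | 0 ≤ x 0}`, is negative. -/
def IsOutward {q : W} (n : TangentSpace (𝓡∂ 4) q) : Prop :=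
  mvfderiv (𝓡∂ 4) (extChartAt (𝓡∂ 4) q) q n 0 < 0

variable (Ω : DiffForm (𝓡∂ 4) W 2) (V : SymplecticFibration.{u}) (j : V → W)

/-- The immersion `j` of `V` onto boundary components of `W` preserves orientations, where `W` is
oriented by `Ω ∧ Ω` and `∂W` by the convention "outward normal first". -/
def PreservesOrientation : Prop :=
  ∀ (x : V) (n : TangentSpace (𝓡∂ 4) (j x)) (v : Fin 3 → TangentSpace (𝓡 3) x),
    IsOutward n → 0 < V.vol x v →
    0 < Ω.wedgeSelf (j x) n (mfderiv (𝓡 3) (𝓡∂ 4) j x (v 0)) (mfderiv (𝓡 3) (𝓡∂ 4) j x (v 1))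
      (mfderiv (𝓡 3) (𝓡∂ 4) j x (v 2))

/-- The immersion `j` of `V` onto boundary components of `W` reverses orientations. -/
def ReversesOrientation : Prop :=
  ∀ (x : V) (n : TangentSpace (𝓡∂ 4) (j x)) (v : Fin 3 → TangentSpace (𝓡 3) x),
    IsOutward n → 0 < V.vol x v →
    Ω.wedgeSelf (j x) n (mfderiv (𝓡 3) (𝓡∂ 4) j x (v 0)) (mfderiv (𝓡 3) (𝓡∂ 4) j x (v 1))
      (mfderiv (𝓡 3) (𝓡∂ 4) j x (v 2)) < 0

end Boundary

/-- A cobordism from `(V₀, ω₀)` to `(V₁, ω₁)`: a compact connected symplectic `4`-manifold `(W, Ω)`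
with `∂(W, Ω) = (V₁, ω₁) ⊔ (-V₀, ω₀)`. The identification of the boundary is given by injective
immersions `j₀ : V₀ → W` and `j₁ : V₁ → W` with disjoint images whose union is `∂W`. -/
structure Cobordism (V₀ V₁ : SymplecticFibration.{u}) : Type (u + 1) where
  /-- the underlying `4`-manifold `W` with boundary -/
  total : Type u
  [top : TopologicalSpace total]
  [charts : ChartedSpace (EuclideanHalfSpace 4) total]
  [smooth : IsManifold (𝓡∂ 4) ∞ total]
  [t2 : T2Space total]
  [compact : CompactSpace total]
  [connected : ConnectedSpace total]
  /-- the symplectic form `Ω` on `W` -/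
  form : DiffForm (𝓡∂ 4) total 2
  form_symplectic : form.IsSymplectic
  /-- the inclusion of the boundary component `V₀` -/
  j₀ : V₀ → total
  /-- the inclusion of the boundary component `V₁` -/
  j₁ : V₁ → total
  j₀_smooth : ContMDiff (𝓡 3) (𝓡∂ 4) ∞ j₀
  j₁_smooth : ContMDiff (𝓡 3) (𝓡∂ 4) ∞ j₁
  j₀_injective : Function.Injective j₀
  j₁_injective : Function.Injective j₁
  j₀_immersion : ∀ x, Function.Injective (mfderiv (𝓡 3) (𝓡∂ 4) j₀ x)
  j₁_immersion : ∀ x, Function.Injective (mfderiv (𝓡 3) (𝓡∂ 4) j₁ x)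
  disjoint : Disjoint (range j₀) (range j₁)
  boundary_eq : (𝓡∂ 4).boundary total = range j₀ ∪ range j₁
  j₀_form : form.pullback (𝓡 3) j₀ = V₀.form
  j₁_form : form.pullback (𝓡 3) j₁ = V₁.form
  j₀_orientation : ReversesOrientation form V₀ j₀
  j₁_orientation : PreservesOrientation form V₁ j₁

end SympFib

end

/-! The cobordism is a symplectic sum of two products along tori. Let F be a torus with an open disc
removed and let σ be the area form on the fibre Σ of V. Then Σ × F with the form σ + dx ∧ dy is
symplectic and has boundary Σ × S¹. In a collar dx ∧ dy = ½ d(r²) ∧ dθ, so the restriction to the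
boundary is the pull-back of σ, that is ω. The same construction applies to V', and it remains to
join the two products away from their collars. The genera and the areas of Σ and Σ' are unrelated,
so the joining has to take place along surfaces that look the same on both sides.

Positive genus provides a circle γ in Σ which does not separate. Near γ there are coordinates with σ
= ds ∧ da, where a is an angle and s vanishes on γ (`exists_annular_coordinate`). Because γ does not
separate, the angle extends to a smooth map h from Σ to the circle (`exists_angular_extension`). The
torus γ × {y = −1} is Lagrangian for σ + dx ∧ dy. Let `twist` be a circle-valued function on F which
is constant on the collar and equal to x near y = −1. The form dh ∧ d(twist) is closed and vanishes
on the collar. Being a product of a covector of each factor, it does not destroy nondegeneracy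
(`eq_zero_of_forall_sum_eq_zero`), and it makes the torus symplectic. Near the torus, with y
measured from −1, the identity ds ∧ da + dx ∧ dy + da ∧ dx = d(a − y) ∧ d(x − s) + ds ∧ dy exhibits
a standard tube T² × D with a product form (`sideForm_eq_pullback_tubeForm`). The tube no longer
depends on the surface.

Both core tori are removed and the punctured tubes are glued by the identity on T² and by the area
preserving inversion |w|² ↦ δ² − |w|², arg w ↦ −arg w on the punctured disc
(`tubeForm_pullback_flip`). The relation |w|² + |w'|² = δ² makes the result Hausdorff and compact,
and it is connected because the cores do not disconnect the two products (`exists_tube_gluing`,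
`exists_glued`).

The extension of the angle is obtained by hand, from functions with one zero and one pole. A
quotient (z − b)/(z − a), with b and a on the two sides of γ, winds once around γ. Its zero and its
pole are cancelled by a second such function, which is 1 near γ; it exists because b and a can be
joined in the complement of γ (`exists_isDipole`).

Orientations are a matter of signs. A reflection of the circle factor preserves a form pulled back
from Σ and reverses the orientation of Σ × S¹. Each end can therefore be parametrized so that the
inclusion reverses, or preserves, the given orientation (`exists_reflection`). That the sign is the
same at all points follows from the connectedness of V (`sign_fibreVolume`). -/

noncomputable section

namespace SympFib

/-! ### Smooth dependence of pulled-back alternating forms. -/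

section AlternatingSmooth

variable {E F : Type*} [NormedAddCommGroup E] [NormedSpace ℝ E]
  [NormedAddCommGroup F] [NormedSpace ℝ F] {k : ℕ}

/-- Alternatization of continuous multilinear forms, as a continuous linear map. -/
def alternatizationCLM (E : Type*) [NormedAddCommGroup E] [NormedSpace ℝ E] (k : ℕ) :
    ContinuousMultilinearMap ℝ (fun _ : Fin k => E) ℝ →L[ℝ] E [⋀^Fin k]→L[ℝ] ℝ :=
  LinearMap.mkContinuous
    { toFun := fun f => ContinuousMultilinearMap.alternatization f
      map_add' := fun f g => map_add _ f g
      map_smul' := fun c f => by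
        ext v
        simp [ContinuousMultilinearMap.alternatization_apply_apply, Finset.mul_sum,
          mul_left_comm, Units.smul_def] }
    (Fintype.card (Equiv.Perm (Fin k))) (fun f => by
      refine ContinuousAlternatingMap.opNorm_le_bound _ (by positivity) fun v => ?_
      simp only [LinearMap.coe_mk, AddHom.coe_mk,
        ContinuousMultilinearMap.alternatization_apply_apply]
      refine (norm_sum_le _ _).trans ?_
      have : ∀ σ ∈ (Finset.univ : Finset (Equiv.Perm (Fin k))),
          ‖Equiv.Perm.sign σ • f (v ∘ σ)‖ ≤ ‖f‖ * ∏ i, ‖v i‖ := by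
        intro σ _
        have h1 : ‖Equiv.Perm.sign σ • f (v ∘ σ)‖ = ‖f (v ∘ σ)‖ := by
          rcases Int.units_eq_one_or (Equiv.Perm.sign σ) with h | h <;> simp [h]
        rw [h1]
        refine (f.le_opNorm _).trans_eq ?_
        congr 1
        exact Equiv.prod_comp σ (fun i => ‖v i‖)
      refine (Finset.sum_le_sum this).trans_eq ?_
      simp [mul_assoc])

theorem alternatizationCLM_toContinuousMultilinearMap (f : E [⋀^Fin k]→L[ℝ] ℝ) :
    alternatizationCLM E k f.toContinuousMultilinearMap = (k.factorial : ℝ) • f := by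
  ext v
  have h := AlternatingMap.coe_alternatization f.toAlternatingMap
  have h2 := congrArg (fun g => g v) h
  simp only [MultilinearMap.alternatization_apply, Fintype.card_fin] at h2
  change ContinuousMultilinearMap.alternatization f.toContinuousMultilinearMap v = _
  rw [ContinuousMultilinearMap.alternatization_apply_apply]
  simpa [Function.comp_def] using h2

/-- For multilinear maps, composition is continuous and multilinear in the inner maps, hence smooth.
Alternating forms are reduced to this case: alternatization is continuous and linear, and it
multiplies an alternating form by k!, so dividing by k! recovers the pull-back. -/
theorem contDiffOn_compContinuousLinearMap {G : Type*} [NormedAddCommGroup G] [NormedSpace ℝ G]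
    {n : WithTop ℕ∞} {s : Set G} {f : G → F [⋀^Fin k]→L[ℝ] ℝ} {L : G → E →L[ℝ] F}
    (hf : ContDiffOn ℝ n f s) (hL : ContDiffOn ℝ n L s) :
    ContDiffOn ℝ n (fun x => (f x).compContinuousLinearMap (L x)) s := by
  have h1 : (fun x => (f x).compContinuousLinearMap (L x)) = fun x =>
      ((k.factorial : ℝ)⁻¹ : ℝ) • alternatizationCLM E k
        (ContinuousMultilinearMap.compContinuousLinearMapContinuousMultilinear ℝ
          (fun _ : Fin k => E) (fun _ : Fin k => F) ℝ (fun _ => L x)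
          ((f x).toContinuousMultilinearMap)) := by
    ext x v
    have : ContinuousMultilinearMap.compContinuousLinearMapContinuousMultilinear ℝ
          (fun _ : Fin k => E) (fun _ : Fin k => F) ℝ (fun _ => L x)
          ((f x).toContinuousMultilinearMap) =
        ((f x).compContinuousLinearMap (L x)).toContinuousMultilinearMap := by
      ext v; rfl
    rw [this, alternatizationCLM_toContinuousMultilinearMap, smul_smul,
      inv_mul_cancel₀ (by positivity), one_smul]
  rw [h1]
  refine ContDiffOn.const_smul _ ((alternatizationCLM E k).contDiff.comp_contDiffOn ?_)
  refine ContDiffOn.clm_apply ?_ ?_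
  · refine (ContinuousMultilinearMap.contDiff _).comp_contDiffOn ?_
    exact contDiffOn_pi.2 fun _ => hL
  · exact (ContinuousAlternatingMap.toContinuousMultilinearMapLI (𝕜 := ℝ)).contDiff.comp_contDiffOn hf

end AlternatingSmooth

/-! ### A local criterion for smooth closed forms. -/

section SmoothClosed

variable {E : Type*} [NormedAddCommGroup E] [NormedSpace ℝ E]
  {H : Type*} [TopologicalSpace H] {I : ModelWithCorners ℝ E H}
  {M : Type*} [TopologicalSpace M] [ChartedSpace H M] {k : ℕ}

/-- A smooth closed form. -/
structure DiffForm.IsSmoothClosed (η : DiffForm I M k) : Prop where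
  smooth : η.IsSmooth
  closed : η.IsClosed

/-- Near `x`, the form `η` is the pull-back of a smooth closed form under a smooth map to a normed
space. -/
def DiffForm.LocallyInduced (η : DiffForm I M k) (x : M) : Prop :=
  ∃ (F : Type) (_ : NormedAddCommGroup F) (_ : NormedSpace ℝ F) (t : Set F)
    (ζ : F → F [⋀^Fin k]→L[ℝ] ℝ) (g : M → F) (O : Set M), IsOpen O ∧ x ∈ O ∧
    ContDiffOn ℝ ∞ ζ t ∧ (∀ y ∈ t, extDerivWithin ζ t y = 0) ∧
    ContMDiffOn I 𝓘(ℝ, F) ∞ g O ∧ MapsTo g O t ∧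
    ∀ y ∈ O, η y = (ζ (g y)).compContinuousLinearMap (mfderiv I 𝓘(ℝ, F) g y)

/-- Exterior differentiation commutes with pull-back. In a chart φ the form is locally the pull-back
of ζ under g ∘ φ⁻¹, hence smooth and closed. The glued form is checked in this way, since it is
known only as a local pull-back. -/
theorem DiffForm.isSmoothClosed_of_locallyInduced [IsManifold I ∞ M] {η : DiffForm I M k}
    (h : ∀ x, η.LocallyInduced x) : η.IsSmoothClosed := by
  have key : ∀ x₀ : M, ∀ y ∈ (extChartAt I x₀).target,
      ContDiffWithinAt ℝ ∞ (η.inChart x₀) (extChartAt I x₀).target y ∧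
      extDerivWithin (η.inChart x₀) (extChartAt I x₀).target y = 0 := by
    intro x₀ y hy
    obtain ⟨F, _, _, t, ζ, g, O, hO, hxO, hζ, hζ0, hg, hgt, hη⟩ := h ((extChartAt I x₀).symm y)
    set T := (extChartAt I x₀).target with hT
    have hTu : UniqueDiffOn ℝ T := uniqueDiffOn_extChartAt_target x₀
    set φ := (extChartAt I x₀).symm with hφ
    have hφc : ContinuousOn φ T := continuousOn_extChartAt_symm x₀
    obtain ⟨U, hU, hUT⟩ := (continuousOn_iff'.1 hφc) O hO
    set s := T ∩ U with hs
    have hsu : UniqueDiffOn ℝ s := hTu.inter hU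
    have hys : y ∈ s := ⟨hy, by
      have : y ∈ φ ⁻¹' O ∩ T := ⟨hxO, hy⟩
      rw [hUT] at this; exact this.1⟩
    have hsO : MapsTo φ s O := fun z hz => by
      have : z ∈ U ∩ T := ⟨hz.2, hz.1⟩
      rw [← hUT] at this; exact this.1
    have hGs : ContDiffOn ℝ ∞ (g ∘ φ) s := by
      rw [← contMDiffOn_iff_contDiffOn]
      exact hg.comp ((contMDiffOn_extChartAt_symm x₀).mono inter_subset_left) hsO
    have hst : MapsTo (g ∘ φ) s t := fun z hz => hgt (hsO hz)
    have heq : ∀ z ∈ s, η.inChart x₀ z =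
        (ζ ((g ∘ φ) z)).compContinuousLinearMap (fderivWithin ℝ (g ∘ φ) s z) := by
      intro z hz
      have hzT : z ∈ (extChartAt I x₀).target := hz.1
      have h1 : fderivWithin ℝ (g ∘ φ) s z = fderivWithin ℝ (g ∘ φ) (range I) z := by
        apply fderivWithin_congr_set
        have : s ∈ 𝓝[range I] z := by
          refine Filter.inter_mem (extChartAt_target_mem_nhdsWithin_of_mem hzT)
            (mem_nhdsWithin_of_mem_nhds (hU.mem_nhds hz.2))
        rw [nhdsWithin_eq_iff_eventuallyEq.symm]
        exact le_antisymm (nhdsWithin_mono _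
          (inter_subset_left.trans (extChartAt_target_subset_range x₀)))
          (nhdsWithin_le_of_mem this)
      have hgd : MDifferentiableAt I 𝓘(ℝ, F) g (φ z) :=
        ((hg (φ z) (hsO hz)).contMDiffAt (hO.mem_nhds (hsO hz))).mdifferentiableAt (by simp)
      have h2 : fderivWithin ℝ (g ∘ φ) (range I) z =
          (mfderiv I 𝓘(ℝ, F) g (φ z)).comp (mfderivWithin 𝓘(ℝ, E) I φ (range I) z) := by
        rw [← mfderivWithin_eq_fderivWithin]
        exact mfderiv_comp_mfderivWithin z hgd (mdifferentiableWithinAt_extChartAt_symm hzT)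
          (I.uniqueMDiffOn _ (extChartAt_target_subset_range x₀ hzT))
      rw [h1, h2]
      simp only [DiffForm.inChart]
      rw [← hφ, hη _ (hsO hz)]
      rfl
    have hGd : ContDiffOn ℝ ∞ (fderivWithin ℝ (g ∘ φ) s) s :=
      hGs.fderivWithin hsu (by simp)
    have hsm : ContDiffOn ℝ ∞ (η.inChart x₀) s :=
      (contDiffOn_compContinuousLinearMap (hζ.comp hGs hst) hGd).congr heq
    have hsT : s ∈ 𝓝[T] y := Filter.inter_mem self_mem_nhdsWithin
      (mem_nhdsWithin_of_mem_nhds (hU.mem_nhds hys.2))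
    refine ⟨(hsm y hys).mono_of_mem_nhdsWithin hsT, ?_⟩
    have hsT' : T =ᶠ[𝓝 y] s := by
      filter_upwards [hU.mem_nhds hys.2] with z hz
      simp only [hs, eq_iff_iff]
      exact ⟨fun h => ⟨h, hz⟩, fun h => h.1⟩
    have hcl : extDerivWithin (η.inChart x₀) T y = extDerivWithin (η.inChart x₀) s y := by
      unfold extDerivWithin
      rw [fderivWithin_congr_set hsT']
    rw [hcl, extDerivWithin_congr' heq hys,
      extDerivWithin_pullback (r := ∞) (t := t) ((hζ _ (hst hys)).differentiableWithinAt (by simp))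
        (hGs y hys) (by rw [minSmoothness_of_isRCLikeNormedField]; exact WithTop.coe_le_coe.2 (le_top : (2 : ℕ∞) ≤ ⊤)) hsu ?_ hys hst, hζ0 _ (hst hys)]
    · ext v; simp
    -- Commuting d with a pull-back uses the symmetry of second derivatives within s. At a boundary
    -- point s is only a piece of a half-space, and symmetry holds because y is a limit of interior
    -- points.
    · have h3 : y ∈ closure (interior T) := by
        exact extChartAt_target_subset_closure_interior hy
      have h4 : interior s = interior T ∩ U := by rw [hs, interior_inter, hU.interior_eq]
      rw [h4, inter_comm]
      exact hU.inter_closure ⟨hys.2, h3⟩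
  exact ⟨fun x₀ y hy => (key x₀ y hy).1, fun x₀ y hy => (key x₀ y hy).2⟩

end SmoothClosed

/-! ### Pull-backs and sums of smooth closed forms. -/

section Pullback

variable {E : Type*} [NormedAddCommGroup E] [NormedSpace ℝ E]
  {H : Type*} [TopologicalSpace H] {I : ModelWithCorners ℝ E H}
  {M : Type*} [TopologicalSpace M] [ChartedSpace H M] {k : ℕ}
  {E' : Type} [NormedAddCommGroup E'] [NormedSpace ℝ E']
  {H' : Type*} [TopologicalSpace H'] {J : ModelWithCorners ℝ E' H'}
  {N : Type*} [TopologicalSpace N] [ChartedSpace H' N]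

/-- The coordinate expression of ζ around f x serves as the inducing form, and the chart composed
with f as the map. Only the behaviour of f on the open set O matters, so f may be a partially
defined map extended arbitrarily. -/
theorem DiffForm.IsSmoothClosed.locallyInduced_of_eq_pullback [IsManifold J ∞ N]
    {ζ : DiffForm J N k}
    (hζ : ζ.IsSmoothClosed) {f : M → N} {O : Set M} (hO : IsOpen O)
    (hf : ContMDiffOn I J ∞ f O) {η : DiffForm I M k}
    (h : ∀ y ∈ O, η y = ζ.pullback I f y) {x : M} (hx : x ∈ O) : η.LocallyInduced x := by
  set e := extChartAt J (f x) with he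
  refine ⟨E', inferInstance, inferInstance, e.target, ζ.inChart (f x), e ∘ f,
    O ∩ f ⁻¹' e.source, hf.continuousOn.isOpen_inter_preimage hO (isOpen_extChartAt_source (f x)),
    ⟨hx, mem_extChartAt_source (f x)⟩, hζ.smooth _, hζ.closed _, ?_, ?_, ?_⟩
  · refine (contMDiffOn_extChartAt (n := ∞) (x := f x)).comp (hf.mono inter_subset_left) ?_
    intro z hz; simpa [he] using hz.2
  · intro z hz; exact e.map_source hz.2
  · rintro z ⟨hzO, hz⟩
    have hfz : MDifferentiableAt I J f z :=
      ((hf z hzO).contMDiffAt (hO.mem_nhds hzO)).mdifferentiableAt (by simp)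
    have hez : MDifferentiableAt J 𝓘(ℝ, E') e (f z) :=
      mdifferentiableAt_extChartAt (by simpa [he] using hz)
    rw [h z hzO, mfderiv_comp z hez hfz]
    ext v
    simp only [DiffForm.pullback, DiffForm.inChart,
      ContinuousAlternatingMap.compContinuousLinearMap_apply, Function.comp_apply]
    have hl : e.symm (e (f z)) = f z := e.left_inv hz
    have h2 := mfderivWithin_extChartAt_symm_comp_mfderiv_extChartAt' (I := J) hz
    have h3 : ∀ i, mfderiv I J f z (v i) = mfderivWithin 𝓘(ℝ, E') J e.symm (range J) (e (f z))
        ((mfderiv J 𝓘(ℝ, E') e (f z)) (mfderiv I J f z (v i))) := fun i => by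
      have := congrArg (fun L => L (mfderiv I J f z (v i))) h2
      exact this.symm
    -- The two values of ζ lie in fibres over points that are only propositionally equal. Both
    -- fibres are the model space, which allows the transport.
    have h4 : ∀ (p : N) (_ : p = f z) (w : Fin k → E'),
        (ζ p : E' [⋀^Fin k]→L[ℝ] ℝ) w = (ζ (f z) : E' [⋀^Fin k]→L[ℝ] ℝ) w := by
      rintro p rfl w; rfl
    refine Eq.trans ?_ (h4 _ hl _).symm
    congr 1
    ext i
    exact h3 i

theorem DiffForm.pullback_comp {E₂ : Type*} [NormedAddCommGroup E₂] [NormedSpace ℝ E₂]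
    {H₂ : Type*} [TopologicalSpace H₂] {J₂ : ModelWithCorners ℝ E₂ H₂}
    {P : Type*} [TopologicalSpace P] [ChartedSpace H₂ P] (ζ : DiffForm J₂ P k)
    {g : N → P} {f : M → N} {x : M} (hg : MDifferentiableAt J J₂ g (f x))
    (hf : MDifferentiableAt I J f x) :
    ζ.pullback I (g ∘ f) x = (ζ.pullback J g).pullback I f x := by
  simp only [DiffForm.pullback, mfderiv_comp x hg hf]
  rfl

theorem DiffForm.pullback_congr {ζ : DiffForm J N k} {f g : M → N} {x : M} (h : f =ᶠ[𝓝 x] g) :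
    ζ.pullback I f x = ζ.pullback I g x := by
  simp only [DiffForm.pullback]
  rw [h.mfderiv_eq]
  have h1 := h.self_of_nhds
  revert h1
  generalize mfderiv I J g x = L
  intro h1
  ext v
  change (ζ (f x) : E' [⋀^Fin k]→L[ℝ] ℝ) _ = (ζ (g x) : E' [⋀^Fin k]→L[ℝ] ℝ) _
  rw [h1]

theorem DiffForm.IsSmoothClosed.pullback [IsManifold J ∞ N] [IsManifold I ∞ M]
    {ζ : DiffForm J N k} (hζ : ζ.IsSmoothClosed) {f : M → N} (hf : ContMDiff I J ∞ f) :
    (ζ.pullback I f).IsSmoothClosed :=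
  DiffForm.isSmoothClosed_of_locallyInduced fun _ =>
    hζ.locallyInduced_of_eq_pullback isOpen_univ hf.contMDiffOn (fun _ _ => rfl) (mem_univ _)

theorem DiffForm.IsSmoothClosed.add {η ζ : DiffForm I M k} (hη : η.IsSmoothClosed)
    (hζ : ζ.IsSmoothClosed) : DiffForm.IsSmoothClosed (fun x => η x + ζ x : DiffForm I M k) := by
  have h : ∀ x₀, DiffForm.inChart (fun x => η x + ζ x : DiffForm I M k) x₀ =
      η.inChart x₀ + ζ.inChart x₀ := by
    intro x₀; ext y v; rfl
  refine ⟨fun x₀ => ?_, fun x₀ y hy => ?_⟩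
  · rw [h]; exact (hη.smooth x₀).add (hζ.smooth x₀)
  · rw [h, extDerivWithin_add (uniqueDiffOn_extChartAt_target x₀ y hy)
      ((hη.smooth x₀ y hy).differentiableWithinAt (by simp))
      ((hζ.smooth x₀ y hy).differentiableWithinAt (by simp)), hη.closed x₀ y hy,
      hζ.closed x₀ y hy, add_zero]

end Pullback

/-! ### Exterior products of covectors. -/

section Wedge

variable {V : Type*} [AddCommGroup V] [Module ℝ V] [TopologicalSpace V]

/-- The exterior product of two covectors. -/
def wedge (a b : V →L[ℝ] ℝ) : V [⋀^Fin 2]→L[ℝ] ℝ :=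
  ContinuousMultilinearMap.alternatization
    ((ContinuousMultilinearMap.mkPiAlgebra ℝ (Fin 2) ℝ).compContinuousLinearMap ![a, b])

theorem wedge_apply (a b : V →L[ℝ] ℝ) (v : Fin 2 → V) :
    wedge a b v = a (v 0) * b (v 1) - a (v 1) * b (v 0) := by
  have : (Finset.univ : Finset (Equiv.Perm (Fin 2))) = {1, Equiv.swap 0 1} := by decide
  rw [wedge, ContinuousMultilinearMap.alternatization_apply_apply, this,
    Finset.sum_pair (by decide)]
  simp [Fin.prod_univ_two, sub_eq_add_neg]

theorem wedge_comp {V' : Type*} [AddCommGroup V'] [Module ℝ V'] [TopologicalSpace V']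
    (a b : V →L[ℝ] ℝ) (L : V' →L[ℝ] V) :
    (wedge a b).compContinuousLinearMap L = wedge (a.comp L) (b.comp L) := by
  ext v; simp [wedge_apply]

end Wedge

/-! ### Differentials and angular forms of functions. -/

section OneForms

variable {E : Type*} [NormedAddCommGroup E] [NormedSpace ℝ E]
  {H : Type*} [TopologicalSpace H] {I : ModelWithCorners ℝ E H}
  {M : Type*} [TopologicalSpace M] [ChartedSpace H M]
  {E' : Type*} [NormedAddCommGroup E'] [NormedSpace ℝ E']
  {H' : Type*} [TopologicalSpace H'] {J : ModelWithCorners ℝ E' H'}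
  {N : Type*} [TopologicalSpace N] [ChartedSpace H' N]
  {F G : Type*} [NormedAddCommGroup F] [NormedSpace ℝ F] [NormedAddCommGroup G] [NormedSpace ℝ G]
  {x : M}

theorem mvfderiv_comp_of_hasFDerivAt {w : M → F} {f : F → G} {f' : F →L[ℝ] G}
    (hf : HasFDerivAt f f' (w x)) (hw : MDifferentiableAt I 𝓘(ℝ, F) w x) :
    mvfderiv I (fun y => f (w y)) x = f'.comp (mvfderiv I w x) := by
  have h := (hf.hasMFDerivAt.comp x hw.hasMFDerivAt).mfderiv
  ext v
  exact congrArg (fun L => L v) h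

theorem mvfderiv_prodMk {w₁ : M → F} {w₂ : M → G} (h₁ : MDifferentiableAt I 𝓘(ℝ, F) w₁ x)
    (h₂ : MDifferentiableAt I 𝓘(ℝ, G) w₂ x) :
    MDifferentiableAt I 𝓘(ℝ, F × G) (fun y => (w₁ y, w₂ y)) x ∧
    mvfderiv I (fun y => (w₁ y, w₂ y)) x = (mvfderiv I w₁ x).prod (mvfderiv I w₂ x) := by
  have h : HasMFDerivAt I 𝓘(ℝ, F × G) (fun y => (w₁ y, w₂ y)) x
      (ContinuousLinearMap.prod (M₁ := E) (M₂ := F) (M₃ := G) (mfderiv I 𝓘(ℝ, F) w₁ x)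
        (mfderiv I 𝓘(ℝ, G) w₂ x)) :=
    ⟨h₁.continuousAt.prodMk h₂.continuousAt, h₁.hasMFDerivAt.2.prodMk h₂.hasMFDerivAt.2⟩
  exact ⟨h.mdifferentiableAt, ContinuousLinearMap.ext fun v => congrArg (fun L => L v) h.mfderiv⟩

theorem mvfderiv_comp' {g : N → F} {f : M → N} (hg : MDifferentiableAt J 𝓘(ℝ, F) g (f x))
    (hf : MDifferentiableAt I J f x) :
    mvfderiv I (fun y => g (f y)) x = (mvfderiv J g (f x)).comp (mfderiv I J f x) := by
  have h := mfderiv_comp x hg hf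
  ext v
  exact congrArg (fun L => L v) h

theorem mvfderiv_congr {f g : M → F} (h : f =ᶠ[𝓝 x] g) : mvfderiv I f x = mvfderiv I g x := by
  ext v
  have h2 := h.mfderiv_eq (I := I) (I' := 𝓘(ℝ, F))
  exact congrArg (fun L => L v) h2

variable (I) in
/-- The angular form `Im (dw / w)` of a complex valued function. -/
def ang (w : M → ℂ) (x : M) : TangentSpace I x →L[ℝ] ℝ :=
  (Complex.imCLM.comp (ContinuousLinearMap.mul ℝ ℂ (w x)⁻¹)).comp (mvfderiv I w x)

theorem ang_apply (w : M → ℂ) (v : TangentSpace I x) :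
    ang I w x v = ((w x)⁻¹ * mvfderiv I w x v).im := rfl

theorem ang_congr {f g : M → ℂ} (h : f =ᶠ[𝓝 x] g) : ang I f x = ang I g x := by
  rw [ang, ang, mvfderiv_congr h, h.self_of_nhds]

theorem ang_comp {w : N → ℂ} {f : M → N} (hg : MDifferentiableAt J 𝓘(ℝ, ℂ) w (f x))
    (hf : MDifferentiableAt I J f x) :
    ang I (fun y => w (f y)) x = (ang J w (f x)).comp (mfderiv I J f x) := by
  rw [ang, mvfderiv_comp' hg hf]; rfl

theorem ang_const (c : ℂ) : ang I (fun _ : M => c) x = 0 := by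
  rw [ang]
  have : mvfderiv I (fun _ : M => c) x = 0 := mvfderiv_const c
  rw [this]; simp

theorem ang_mul {w₁ w₂ : M → ℂ} (h₁ : MDifferentiableAt I 𝓘(ℝ, ℂ) w₁ x)
    (h₂ : MDifferentiableAt I 𝓘(ℝ, ℂ) w₂ x) (h₁' : w₁ x ≠ 0) (h₂' : w₂ x ≠ 0) :
    ang I (fun y => w₁ y * w₂ y) x = ang I w₁ x + ang I w₂ x := by
  obtain ⟨h, h'⟩ := mvfderiv_prodMk h₁ h₂
  have hm : HasFDerivAt (fun p : ℂ × ℂ => p.1 * p.2) _ (w₁ x, w₂ x) :=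
    (hasFDerivAt_fst (𝕜 := ℝ)).mul hasFDerivAt_snd
  have := mvfderiv_comp_of_hasFDerivAt (w := fun y => (w₁ y, w₂ y))
    (f := fun p : ℂ × ℂ => p.1 * p.2) hm h
  ext v
  rw [ang_apply, this, h']
  simp only [add_apply, ang_apply, ← Complex.add_im]
  congr 1
  simp
  field_simp
  ring

/-- The logarithmic derivative of a real factor is real, so radial rescaling does not change the
angular form. -/
theorem ang_ofReal_mul {r : M → ℝ} {w : M → ℂ} (h₁ : MDifferentiableAt I 𝓘(ℝ, ℝ) r x)
    (h₂ : MDifferentiableAt I 𝓘(ℝ, ℂ) w x) (h₁' : r x ≠ 0) (h₂' : w x ≠ 0) :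
    ang I (fun y => (r y : ℂ) * w y) x = ang I w x := by
  have hr : HasFDerivAt (fun t : ℝ => (t : ℂ)) Complex.ofRealCLM (r x) :=
    Complex.ofRealCLM.hasFDerivAt
  have hd : MDifferentiableAt I 𝓘(ℝ, ℂ) (fun y => (r y : ℂ)) x :=
    hr.differentiableAt.mdifferentiableAt.comp x h₁
  rw [ang_mul hd h₂ (by exact_mod_cast h₁') h₂']
  have : ang I (fun y => (r y : ℂ)) x = 0 := by
    ext v
    rw [ang_apply, mvfderiv_comp_of_hasFDerivAt hr h₁]
    simp [← Complex.ofReal_inv]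
  rw [this, zero_add]

theorem ang_conj {w : M → ℂ} (h : MDifferentiableAt I 𝓘(ℝ, ℂ) w x) :
    ang I (fun y => (starRingEnd ℂ) (w y)) x = - ang I w x := by
  have hr : HasFDerivAt (fun t : ℂ => (starRingEnd ℂ) t) (Complex.conjCLE : ℂ →L[ℝ] ℂ) (w x) :=
    (Complex.conjCLE : ℂ →L[ℝ] ℂ).hasFDerivAt
  ext v
  rw [ang_apply, mvfderiv_comp_of_hasFDerivAt hr h]
  simp only [neg_apply, ang_apply, ContinuousLinearMap.comp_apply,
    ContinuousLinearEquiv.coe_coe, Complex.conjCLE_apply]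
  rw [← Complex.conj_inv, ← map_mul, Complex.conj_im]

theorem ang_cexp {f : M → ℂ} (h : MDifferentiableAt I 𝓘(ℝ, ℂ) f x) :
    ang I (fun y => Complex.exp (f y)) x = Complex.imCLM.comp (mvfderiv I f x) := by
  have he : HasFDerivAt Complex.exp _ (f x) :=
    (Complex.hasDerivAt_exp (f x)).hasFDerivAt.restrictScalars ℝ
  ext v
  rw [ang_apply, mvfderiv_comp_of_hasFDerivAt he h]
  simp [mul_comm, Complex.exp_ne_zero]

theorem ang_cexp_mul_I {f : M → ℝ} (h : MDifferentiableAt I 𝓘(ℝ, ℝ) f x) :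
    ang I (fun y => Complex.exp (f y * Complex.I)) x = mvfderiv I f x := by
  have hr : HasFDerivAt (fun t : ℝ => (t : ℂ) * Complex.I)
      ((ContinuousLinearMap.mul ℝ ℂ).flip Complex.I ∘L Complex.ofRealCLM) (f x) :=
    ((ContinuousLinearMap.mul ℝ ℂ).flip Complex.I ∘L Complex.ofRealCLM).hasFDerivAt
  have hd : MDifferentiableAt I 𝓘(ℝ, ℂ) (fun y => (f y : ℂ) * Complex.I) x :=
    hr.differentiableAt.mdifferentiableAt.comp x h
  rw [ang_cexp hd, mvfderiv_comp_of_hasFDerivAt hr h]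
  ext v
  simp

theorem ang_inv {w : M → ℂ} (h : MDifferentiableAt I 𝓘(ℝ, ℂ) w x) (h' : w x ≠ 0) :
    ang I (fun y => (w y)⁻¹) x = - ang I w x := by
  have he : HasFDerivAt (fun z : ℂ => z⁻¹) _ (w x) :=
    (hasDerivAt_inv h').hasFDerivAt.restrictScalars ℝ
  ext v
  rw [ang_apply, mvfderiv_comp_of_hasFDerivAt he h]
  simp only [neg_apply, ang_apply, ← Complex.neg_im]
  congr 1
  simp
  field_simp

/-- This is dx ∧ dy = ½ d(r²) ∧ dθ. In this shape the area form is easy to transform under maps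
given in terms of r² and θ, such as the inversion used for gluing, and to restrict to a circle r =
const. -/
theorem wedge_re_im_eq {w : M → ℂ} (h : MDifferentiableAt I 𝓘(ℝ, ℂ) w x) (h' : w x ≠ 0) :
    wedge (mvfderiv I (fun y => (w y).re) x) (mvfderiv I (fun y => (w y).im) x) =
      (1 / 2 : ℝ) • wedge (mvfderiv I (fun y => Complex.normSq (w y)) x) (ang I w x) := by
  have hre := mvfderiv_comp_of_hasFDerivAt (f := fun z : ℂ => z.re) Complex.reCLM.hasFDerivAt h
  have him := mvfderiv_comp_of_hasFDerivAt (f := fun z : ℂ => z.im) Complex.imCLM.hasFDerivAt h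
  have hn : HasFDerivAt (fun z : ℂ => Complex.normSq z)
      ((2 * (w x).re) • Complex.reCLM + (2 * (w x).im) • Complex.imCLM) (w x) := by
    have h1 : HasFDerivAt (fun z : ℂ => z.re * z.re + z.im * z.im) _ (w x) :=
      (Complex.reCLM.hasFDerivAt.mul Complex.reCLM.hasFDerivAt).add
        (Complex.imCLM.hasFDerivAt.mul Complex.imCLM.hasFDerivAt)
    refine h1.congr_fderiv ?_
    ext v
    simp; ring
  have hns := mvfderiv_comp_of_hasFDerivAt hn h
  ext v
  rw [hre, him, hns]
  simp only [ContinuousAlternatingMap.smul_apply, wedge_apply, ang_apply,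
    ContinuousLinearMap.comp_apply, add_apply, smul_apply,
    Complex.reCLM_apply, Complex.imCLM_apply, smul_eq_mul, Complex.mul_im, Complex.inv_re,
    Complex.inv_im]
  have hne : Complex.normSq (w x) ≠ 0 := by simpa using h'
  generalize mvfderiv I w x (v 0) = a
  generalize mvfderiv I w x (v 1) = b
  rw [Complex.normSq_apply] at *
  generalize (w x).re = p at *
  generalize (w x).im = q at *
  have hne' : p ^ 2 + q ^ 2 ≠ 0 := by simpa [sq] using hne
  field_simp
  ring

/-- Near `x`, the `1`-form `a` is the differential of a smooth function. -/
def LocallyExact (a : ∀ y : M, TangentSpace I y →L[ℝ] ℝ) (x : M) : Prop :=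
  ∃ (f : M → ℝ) (O : Set M), IsOpen O ∧ x ∈ O ∧ ContMDiffOn I 𝓘(ℝ, ℝ) ∞ f O ∧
    ∀ y ∈ O, a y = mvfderiv I f y

theorem locallyExact_mvfderiv {f : M → ℝ} {O : Set M} (hO : IsOpen O) (hx : x ∈ O)
    (hf : ContMDiffOn I 𝓘(ℝ, ℝ) ∞ f O) : LocallyExact (fun y => mvfderiv I f y) x :=
  ⟨f, O, hO, hx, hf, fun _ _ => rfl⟩

/-- Near x the quotient w y / w x stays in the slit plane, and the imaginary part of its principal
logarithm is a smooth primitive. -/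
theorem locallyExact_ang {w : M → ℂ} {O : Set M} (hO : IsOpen O) (hx : x ∈ O)
    (hw : ContMDiffOn I 𝓘(ℝ, ℂ) ∞ w O) (h0 : ∀ y ∈ O, w y ≠ 0) :
    LocallyExact (fun y => ang I w y) x := by
  have hc : ContinuousOn (fun y => w y * (w x)⁻¹) O := hw.continuousOn.mul continuousOn_const
  set O' := O ∩ (fun y => w y * (w x)⁻¹) ⁻¹' Complex.slitPlane with hO'
  have hO'o : IsOpen O' := hc.isOpen_inter_preimage hO Complex.isOpen_slitPlane
  have hlog : ∀ z : ℂ, z * (w x)⁻¹ ∈ Complex.slitPlane →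
      HasFDerivAt (fun z : ℂ => (Complex.log (z * (w x)⁻¹)).im)
        (Complex.imCLM.comp (ContinuousLinearMap.mul ℝ ℂ z⁻¹)) z := by
    intro z hz
    have hz0 : z * (w x)⁻¹ ≠ 0 := Complex.slitPlane_ne_zero hz
    have hz1 : z ≠ 0 := left_ne_zero_of_mul hz0
    have hz2 : w x ≠ 0 := fun h => hz0 (by simp [h])
    have h1 : HasDerivAt (fun z : ℂ => Complex.log (z * (w x)⁻¹)) ((w x)⁻¹ / (z * (w x)⁻¹)) z := by
      have := (((hasDerivAt_id z).mul_const (w x)⁻¹)).clog hz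
      simpa using this
    refine (Complex.imCLM.hasFDerivAt.comp z (h1.hasFDerivAt.restrictScalars ℝ)).congr_fderiv ?_
    ext v
    simp only [ContinuousLinearMap.comp_apply, Complex.imCLM_apply,
      ContinuousLinearMap.coe_restrictScalars', ContinuousLinearMap.mul_apply']
    congr 1
    simp
    field_simp
  have hsm : ContDiffOn ℝ ∞ (fun z : ℂ => (Complex.log (z * (w x)⁻¹)).im)
      {z | z * (w x)⁻¹ ∈ Complex.slitPlane} := by
    intro z hz
    refine ContDiffAt.contDiffWithinAt ?_
    refine Complex.imCLM.contDiff.contDiffAt.comp (f := fun z => Complex.log (z * (w x)⁻¹)) z ?_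
    refine ContDiffAt.restrict_scalars ℝ (𝕜' := ℂ) ?_
    exact (Complex.contDiffAt_log hz).comp z (contDiffAt_id.mul contDiffAt_const)
  refine ⟨fun y => (Complex.log (w y * (w x)⁻¹)).im, O', hO'o, ⟨hx, ?_⟩, ?_, ?_⟩
  · simp [h0 x hx]
  · exact hsm.contMDiffOn.comp (hw.mono inter_subset_left) (fun y hy => hy.2)
  · intro y hy
    have hwy : MDifferentiableAt I 𝓘(ℝ, ℂ) w y :=
      ((hw y hy.1).contMDiffAt (hO.mem_nhds hy.1)).mdifferentiableAt (by simp)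
    rw [mvfderiv_comp_of_hasFDerivAt (hlog (w y) hy.2) hwy]
    rfl

/-- With local primitives f and g, the product is the pull-back under (f, g) of the constant form dx
∧ dy on the plane, and a constant form is closed. -/
theorem LocallyExact.wedge {a b : ∀ y : M, TangentSpace I y →L[ℝ] ℝ} (ha : LocallyExact a x)
    (hb : LocallyExact b x) :
    DiffForm.LocallyInduced (fun y => wedge (a y) (b y) : DiffForm I M 2) x := by
  obtain ⟨f, O, hO, hx, hf, hfa⟩ := ha
  obtain ⟨g, O', hO', hx', hg, hgb⟩ := hb
  refine ⟨ℝ × ℝ, inferInstance, inferInstance, univ,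
    fun _ => SympFib.wedge (ContinuousLinearMap.fst ℝ ℝ ℝ) (ContinuousLinearMap.snd ℝ ℝ ℝ),
    fun y => (f y, g y), O ∩ O', hO.inter hO', ⟨hx, hx'⟩, contDiffOn_const, ?_, ?_,
    mapsTo_univ _ _, ?_⟩
  · intro y _
    rw [extDerivWithin, fderivWithin_fun_const]
    exact map_zero (ContinuousAlternatingMap.alternatizeUncurryFinCLM ℝ (ℝ × ℝ) ℝ)
  · exact (hf.mono inter_subset_left).prodMk_space (hg.mono inter_subset_right)
  · intro y hy
    have h1 : MDifferentiableAt I 𝓘(ℝ, ℝ) f y :=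
      ((hf y hy.1).contMDiffAt (hO.mem_nhds hy.1)).mdifferentiableAt (by simp)
    have h2 : MDifferentiableAt I 𝓘(ℝ, ℝ) g y :=
      ((hg y hy.2).contMDiffAt (hO'.mem_nhds hy.2)).mdifferentiableAt (by simp)
    have h3 := (mvfderiv_prodMk h1 h2).2
    simp only
    rw [hfa y hy.1, hgb y hy.2]
    have h4 : (SympFib.wedge (ContinuousLinearMap.fst ℝ ℝ ℝ)
        (ContinuousLinearMap.snd ℝ ℝ ℝ)).compContinuousLinearMap
        (mvfderiv I (fun y => (f y, g y)) y) =
        SympFib.wedge (mvfderiv I f y) (mvfderiv I g y) := by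
      rw [wedge_comp, h3]; rfl
    exact h4.symm

end OneForms

/-! ### Manifold structure on a union of two pieces. -/

section Cover

variable {E E₁ E₂ : Type*} [NormedAddCommGroup E] [NormedSpace ℝ E]
  [NormedAddCommGroup E₁] [NormedSpace ℝ E₁] [NormedAddCommGroup E₂] [NormedSpace ℝ E₂]
  {H H₁ H₂ : Type*} [TopologicalSpace H] [TopologicalSpace H₁] [TopologicalSpace H₂]
  {W X Y : Type*} [TopologicalSpace W] [TopologicalSpace X] [TopologicalSpace Y]
  [ChartedSpace H₁ X] [ChartedSpace H₂ Y]

theorem contDiffOn_of_contMDiffOn_model {I : ModelWithCorners ℝ E H} {f : H → H} {s : Set H}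
    (h : ContMDiffOn I I ∞ f s) :
    ContDiffOn ℝ ∞ (I ∘ f ∘ I.symm) (I.symm ⁻¹' s ∩ range I) := by
  intro z hz
  obtain ⟨hz, y, rfl⟩ := hz
  have hy : y ∈ s := by simpa using hz
  have := (contMDiffOn_iff.1 h).2 y (f y)
  simp only [chartAt_self_eq, mfld_simps] at this
  exact (this.mono (by rw [inter_comm])) _ ⟨hz, mem_range_self y⟩

/-- A presentation of the space `W` as the union of an open subset of a manifold `X` and an open
subset of a manifold `Y`, with smooth change of coordinates, together with smooth open embeddings
of the model spaces of `X` and `Y` into a common model space. -/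
structure SmoothCover (I : ModelWithCorners ℝ E H) (I₁ : ModelWithCorners ℝ E₁ H₁)
    (I₂ : ModelWithCorners ℝ E₂ H₂) (W X Y : Type*) [TopologicalSpace W] [TopologicalSpace X]
    [TopologicalSpace Y] [ChartedSpace H₁ X] [ChartedSpace H₂ Y] where
  /-- the first piece -/
  e₁ : OpenPartialHomeomorph W X
  /-- the second piece -/
  e₂ : OpenPartialHomeomorph W Y
  cover : ∀ w, w ∈ e₁.source ∨ w ∈ e₂.source
  /-- the embedding of the first model space -/
  j₁ : OpenPartialHomeomorph H₁ H
  /-- the embedding of the second model space -/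
  j₂ : OpenPartialHomeomorph H₂ H
  j₁_source : j₁.source = univ
  j₂_source : j₂.source = univ
  j₁_smooth : ContMDiffOn I₁ I ∞ j₁ j₁.source
  j₂_smooth : ContMDiffOn I₂ I ∞ j₂ j₂.source
  j₁_symm_smooth : ContMDiffOn I I₁ ∞ j₁.symm j₁.target
  j₂_symm_smooth : ContMDiffOn I I₂ ∞ j₂.symm j₂.target
  trans₁₂ : ContMDiffOn I₁ I₂ ∞ (e₂ ∘ e₁.symm) (e₁.symm ≫ₕ e₂).source
  trans₂₁ : ContMDiffOn I₂ I₁ ∞ (e₁ ∘ e₂.symm) (e₂.symm ≫ₕ e₁).source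

variable {I : ModelWithCorners ℝ E H} {I₁ : ModelWithCorners ℝ E₁ H₁}
    {I₂ : ModelWithCorners ℝ E₂ H₂}

theorem contMDiffOn_transition {e₁ : OpenPartialHomeomorph W X} {e₂ : OpenPartialHomeomorph W Y}
    {d₁ : OpenPartialHomeomorph X H} {d₂ : OpenPartialHomeomorph Y H}
    (h : ContMDiffOn I₁ I₂ ∞ (e₂ ∘ e₁.symm) (e₁.symm ≫ₕ e₂).source)
    (h₁ : ContMDiffOn I I₁ ∞ d₁.symm d₁.target) (h₂ : ContMDiffOn I₂ I ∞ d₂ d₂.source) :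
    ContMDiffOn I I ∞ ((e₁ ≫ₕ d₁).symm ≫ₕ (e₂ ≫ₕ d₂))
      ((e₁ ≫ₕ d₁).symm ≫ₕ (e₂ ≫ₕ d₂)).source := by
  have hs : ((e₁ ≫ₕ d₁).symm ≫ₕ (e₂ ≫ₕ d₂)).source ⊆ d₁.target := by
    intro z hz; simp only [mfld_simps] at hz; exact hz.1.1
  refine (h₂.comp (h.comp (h₁.mono hs) ?_) ?_).congr ?_
  · intro z hz; simp only [mfld_simps] at hz ⊢; exact ⟨hz.1.2, hz.2.1⟩
  · intro z hz; simp only [mfld_simps] at hz ⊢; exact hz.2.2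
  · intro z hz; simp only [mfld_simps]

theorem contMDiffOn_self_transition [IsManifold I₁ ∞ X] (e₁ : OpenPartialHomeomorph W X) :
    ContMDiffOn I₁ I₁ ∞ (e₁ ∘ e₁.symm) (e₁.symm ≫ₕ e₁).source := by
  refine contMDiffOn_id.congr fun z hz => ?_
  simp only [mfld_simps] at hz
  simp [hz]

namespace SmoothCover

variable (𝒞 : SmoothCover I I₁ I₂ W X Y)

/-- The chart of `X` around `x`, with values in the common model space. -/
def chart₁ (x : X) : OpenPartialHomeomorph X H := chartAt H₁ x ≫ₕ 𝒞.j₁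

/-- The chart of `Y` around `y`, with values in the common model space. -/
def chart₂ (y : Y) : OpenPartialHomeomorph Y H := chartAt H₂ y ≫ₕ 𝒞.j₂

theorem mem_chart₁_source (x : X) : x ∈ (𝒞.chart₁ x).source := by
  simp [chart₁, 𝒞.j₁_source]

theorem mem_chart₂_source (y : Y) : y ∈ (𝒞.chart₂ y).source := by
  simp [chart₂, 𝒞.j₂_source]

theorem chart₁_smooth [IsManifold I₁ ∞ X] (x : X) :
    ContMDiffOn I₁ I ∞ (𝒞.chart₁ x) (𝒞.chart₁ x).source ∧
    ContMDiffOn I I₁ ∞ (𝒞.chart₁ x).symm (𝒞.chart₁ x).target := by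
  constructor
  · refine 𝒞.j₁_smooth.comp (t := 𝒞.j₁.source) ((contMDiffOn_chart (x := x)).mono ?_) ?_ <;>
    intro z hz <;> simp only [chart₁, mfld_simps] at hz ⊢ <;> tauto
  · refine (contMDiffOn_chart_symm (x := x)).comp (𝒞.j₁_symm_smooth.mono ?_) ?_ <;>
    intro z hz <;> simp only [chart₁, mfld_simps] at hz ⊢ <;> tauto

theorem chart₂_smooth [IsManifold I₂ ∞ Y] (y : Y) :
    ContMDiffOn I₂ I ∞ (𝒞.chart₂ y) (𝒞.chart₂ y).source ∧
    ContMDiffOn I I₂ ∞ (𝒞.chart₂ y).symm (𝒞.chart₂ y).target := by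
  constructor
  · refine 𝒞.j₂_smooth.comp (t := 𝒞.j₂.source) ((contMDiffOn_chart (x := y)).mono ?_) ?_ <;>
    intro z hz <;> simp only [chart₂, mfld_simps] at hz ⊢ <;> tauto
  · refine (contMDiffOn_chart_symm (x := y)).comp (𝒞.j₂_symm_smooth.mono ?_) ?_ <;>
    intro z hz <;> simp only [chart₂, mfld_simps] at hz ⊢ <;> tauto

open Classical in
/-- The charted space structure induced by a smooth cover. -/
@[reducible] def chartedSpace : ChartedSpace H W where
  atlas := range (fun x => 𝒞.e₁ ≫ₕ 𝒞.chart₁ x) ∪ range (fun y => 𝒞.e₂ ≫ₕ 𝒞.chart₂ y)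
  -- On the overlap the first piece has priority. Later statements about the boundary coordinate of
  -- a chart distinguish cases accordingly.
  chartAt w := if w ∈ 𝒞.e₁.source then 𝒞.e₁ ≫ₕ 𝒞.chart₁ (𝒞.e₁ w)
    else 𝒞.e₂ ≫ₕ 𝒞.chart₂ (𝒞.e₂ w)
  mem_chart_source w := by
    by_cases h : w ∈ 𝒞.e₁.source
    · simp [h, mem_chart₁_source]
    · simp [h, mem_chart₂_source, (𝒞.cover w).resolve_left h]
  chart_mem_atlas w := by
    by_cases h : w ∈ 𝒞.e₁.source
    · simp [h]
    · simp [h]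

theorem chartAt_of_mem {w : W} (h : w ∈ 𝒞.e₁.source) :
    letI := 𝒞.chartedSpace
    chartAt H w = 𝒞.e₁ ≫ₕ 𝒞.chart₁ (𝒞.e₁ w) :=
  if_pos h

theorem chartAt_of_notMem {w : W} (h : w ∉ 𝒞.e₁.source) :
    letI := 𝒞.chartedSpace
    chartAt H w = 𝒞.e₂ ≫ₕ 𝒞.chart₂ (𝒞.e₂ w) :=
  if_neg h

variable [IsManifold I₁ ∞ X] [IsManifold I₂ ∞ Y]

/-- A transition map is the change of coordinates between the pieces, conjugated by charts of X or Y
and by the embeddings of the model spaces. The four cases are the four ordered pairs of pieces. -/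
theorem isManifold : letI := 𝒞.chartedSpace; IsManifold I ∞ W := by
  let _ := 𝒞.chartedSpace
  refine isManifold_of_contDiffOn I ∞ W ?_
  rintro e e' (⟨x, rfl⟩ | ⟨y, rfl⟩) (⟨x', rfl⟩ | ⟨y', rfl⟩) <;>
    apply contDiffOn_of_contMDiffOn_model
  · exact contMDiffOn_transition (contMDiffOn_self_transition (I₁ := I₁) _)
      (𝒞.chart₁_smooth x).2 (𝒞.chart₁_smooth x').1
  · exact contMDiffOn_transition 𝒞.trans₁₂ (𝒞.chart₁_smooth x).2 (𝒞.chart₂_smooth y').1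
  · exact contMDiffOn_transition 𝒞.trans₂₁ (𝒞.chart₂_smooth y).2 (𝒞.chart₁_smooth x').1
  · exact contMDiffOn_transition (contMDiffOn_self_transition (I₁ := I₂) _)
      (𝒞.chart₂_smooth y).2 (𝒞.chart₂_smooth y').1

theorem e₁_smooth : letI := 𝒞.chartedSpace; ContMDiffOn I I₁ ∞ 𝒞.e₁ 𝒞.e₁.source := by
  let _ := 𝒞.chartedSpace
  have := 𝒞.isManifold
  intro w hw
  set c := 𝒞.e₁ ≫ₕ 𝒞.chart₁ (𝒞.e₁ w) with hc
  have hcm : c ∈ atlas H W := Or.inl ⟨_, rfl⟩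
  have hcs : ContMDiffOn I I ∞ c c.source :=
    contMDiffOn_of_mem_maximalAtlas (IsManifold.subset_maximalAtlas hcm)
  have hwc : w ∈ c.source := by simp [hc, hw, mem_chart₁_source]
  have h := (𝒞.chart₁_smooth (𝒞.e₁ w)).2.comp hcs (fun z hz => by
    simp only [hc, mfld_simps] at hz ⊢
    exact (𝒞.chart₁ (𝒞.e₁ w)).map_source hz.2)
  refine ((h.congr fun z hz => ?_) w hwc).contMDiffAt (c.open_source.mem_nhds hwc)
    |>.contMDiffWithinAt
  simp only [hc, mfld_simps] at hz ⊢
  simp [hz.2]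

theorem e₁_symm_smooth : letI := 𝒞.chartedSpace; ContMDiffOn I₁ I ∞ 𝒞.e₁.symm 𝒞.e₁.target := by
  let _ := 𝒞.chartedSpace
  have := 𝒞.isManifold
  intro x hx
  set c := 𝒞.e₁ ≫ₕ 𝒞.chart₁ x with hc
  have hcm : c ∈ atlas H W := Or.inl ⟨_, rfl⟩
  have hcs : ContMDiffOn I I ∞ c.symm c.target :=
    contMDiffOn_symm_of_mem_maximalAtlas (IsManifold.subset_maximalAtlas hcm)
  have hO : IsOpen (𝒞.e₁.target ∩ (𝒞.chart₁ x).source) :=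
    𝒞.e₁.open_target.inter (𝒞.chart₁ x).open_source
  have h := hcs.comp ((𝒞.chart₁_smooth x).1.mono
    (inter_subset_right (s := 𝒞.e₁.target))) (fun z hz => by
    simp only [hc, mfld_simps] at hz ⊢
    simp [hz.1, hz.2])
  refine ((h.congr fun z hz => ?_) x ⟨hx, 𝒞.mem_chart₁_source x⟩).contMDiffAt
    (hO.mem_nhds ⟨hx, 𝒞.mem_chart₁_source x⟩) |>.contMDiffWithinAt
  simp only [hc, mfld_simps] at hz ⊢
  simp [hz.2]

theorem e₂_smooth : letI := 𝒞.chartedSpace; ContMDiffOn I I₂ ∞ 𝒞.e₂ 𝒞.e₂.source := by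
  let _ := 𝒞.chartedSpace
  have := 𝒞.isManifold
  intro w hw
  set c := 𝒞.e₂ ≫ₕ 𝒞.chart₂ (𝒞.e₂ w) with hc
  have hcm : c ∈ atlas H W := Or.inr ⟨_, rfl⟩
  have hcs : ContMDiffOn I I ∞ c c.source :=
    contMDiffOn_of_mem_maximalAtlas (IsManifold.subset_maximalAtlas hcm)
  have hwc : w ∈ c.source := by simp [hc, hw, mem_chart₂_source]
  have h := (𝒞.chart₂_smooth (𝒞.e₂ w)).2.comp hcs (fun z hz => by
    simp only [hc, mfld_simps] at hz ⊢
    exact (𝒞.chart₂ (𝒞.e₂ w)).map_source hz.2)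
  refine ((h.congr fun z hz => ?_) w hwc).contMDiffAt (c.open_source.mem_nhds hwc)
    |>.contMDiffWithinAt
  simp only [hc, mfld_simps] at hz ⊢
  simp [hz.2]

theorem e₂_symm_smooth : letI := 𝒞.chartedSpace; ContMDiffOn I₂ I ∞ 𝒞.e₂.symm 𝒞.e₂.target := by
  let _ := 𝒞.chartedSpace
  have := 𝒞.isManifold
  intro y hy
  set c := 𝒞.e₂ ≫ₕ 𝒞.chart₂ y with hc
  have hcm : c ∈ atlas H W := Or.inr ⟨_, rfl⟩
  have hcs : ContMDiffOn I I ∞ c.symm c.target :=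
    contMDiffOn_symm_of_mem_maximalAtlas (IsManifold.subset_maximalAtlas hcm)
  have hO : IsOpen (𝒞.e₂.target ∩ (𝒞.chart₂ y).source) :=
    𝒞.e₂.open_target.inter (𝒞.chart₂ y).open_source
  have h := hcs.comp ((𝒞.chart₂_smooth y).1.mono
    (inter_subset_right (s := 𝒞.e₂.target))) (fun z hz => by
    simp only [hc, mfld_simps] at hz ⊢
    simp [hz.1, hz.2])
  refine ((h.congr fun z hz => ?_) y ⟨hy, 𝒞.mem_chart₂_source y⟩).contMDiffAt
    (hO.mem_nhds ⟨hy, 𝒞.mem_chart₂_source y⟩) |>.contMDiffWithinAt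
  simp only [hc, mfld_simps] at hz ⊢
  simp [hz.2]

end SmoothCover

end Cover

/-! ### Gluing two topological spaces along open subsets. -/

section Glue

variable {X Y : Type u} [TopologicalSpace X] [TopologicalSpace Y]

/-- Gluing two Hausdorff spaces along open subsets, when the graph of the gluing map is closed. -/
theorem exists_gluing [T2Space X] [T2Space Y] (e : OpenPartialHomeomorph X Y)
    (hgraph : _root_.IsClosed {p : X × Y | p.1 ∈ e.source ∧ e p.1 = p.2}) :
    ∃ (W : Type u) (_ : TopologicalSpace W) (f : X → W) (g : Y → W), T2Space W ∧
      IsOpenEmbedding f ∧ IsOpenEmbedding g ∧ (∀ w, w ∈ range f ∨ w ∈ range g) ∧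
      ∀ x y, f x = g y ↔ x ∈ e.source ∧ e x = y := by
  let r : X ⊕ Y → X ⊕ Y → Prop := fun p q => match p, q with
    | .inl x, .inl x' => x = x'
    | .inr y, .inr y' => y = y'
    | .inl x, .inr y => x ∈ e.source ∧ e x = y
    | .inr y, .inl x => x ∈ e.source ∧ e x = y
  have hr : Equivalence r := by
    refine ⟨?_, ?_, ?_⟩
    · rintro (x | y) <;> rfl
    · rintro (x | y) (x' | y') h <;> simp only [r] at h ⊢ <;> first | exact h.symm | exact h
    · rintro (x | y) (x' | y') (x'' | y'') h h' <;> simp only [r] at h h' ⊢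
      · exact h.trans h'
      · rw [h]; exact h'
      · exact e.injOn h.1 h'.1 (h.2.trans h'.2.symm)
      · rw [← h']; exact h
      · rw [← h']; exact h
      · exact h.2.symm.trans h'.2
      · rw [h]; exact h'
      · exact h.trans h'
  let S : Setoid (X ⊕ Y) := ⟨r, hr⟩
  let π : X ⊕ Y → Quotient S := Quotient.mk S
  have hπ : ∀ p q, π p = π q ↔ r p q := fun p q => Quotient.eq (r := S)
  -- The saturation of an open set only adds its image and preimage under `e`, which are open; hence
  -- the projection to the quotient is open.
  have hsat : ∀ U : Set (X ⊕ Y), IsOpen U → IsOpen (π ⁻¹' (π '' U)) := by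
    intro U hU
    rw [isOpen_sum_iff] at hU ⊢
    constructor
    · have : Sum.inl ⁻¹' (π ⁻¹' (π '' U)) =
          (Sum.inl ⁻¹' U) ∪ (e.source ∩ e ⁻¹' (Sum.inr ⁻¹' U)) := by
        ext x
        simp only [mem_preimage, mem_image, mem_union, mem_inter_iff]
        constructor
        · rintro ⟨(x' | y'), hU', h⟩ <;> rw [hπ] at h <;> simp only [r] at h
          · left; rwa [← h]
          · right; exact ⟨h.1, by rw [h.2]; exact hU'⟩
        · rintro (h | h)
          · exact ⟨_, h, rfl⟩
          · exact ⟨_, h.2, (hπ _ _).2 ⟨h.1, rfl⟩⟩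
      rw [this]
      exact hU.1.union (e.isOpen_inter_preimage hU.2)
    · have : Sum.inr ⁻¹' (π ⁻¹' (π '' U)) =
          (Sum.inr ⁻¹' U) ∪ (e.target ∩ e.symm ⁻¹' (Sum.inl ⁻¹' U)) := by
        ext y
        simp only [mem_preimage, mem_image, mem_union, mem_inter_iff]
        constructor
        · rintro ⟨(x' | y'), hU', h⟩ <;> rw [hπ] at h <;> simp only [r] at h
          · right
            refine ⟨by rw [← h.2]; exact e.map_source h.1, ?_⟩
            rw [← h.2, e.left_inv h.1]; exact hU'
          · left; rwa [← h]
        · rintro (h | h)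
          · exact ⟨_, h, rfl⟩
          · exact ⟨_, h.2, (hπ _ _).2 ⟨e.map_target h.1, e.right_inv h.1⟩⟩
      rw [this]
      exact hU.2.union (e.symm.isOpen_inter_preimage hU.1)
  have hopen : IsOpenMap π := fun U hU => (isQuotientMap_quot_mk.isOpen_preimage).1 (hsat U hU)
  have hcont : Continuous π := continuous_quot_mk
  have hq : IsOpenQuotientMap π := ⟨Quotient.mk_surjective, hcont, hopen⟩
  refine ⟨Quotient S, inferInstance, π ∘ Sum.inl, π ∘ Sum.inr, ?_, ?_, ?_, ?_, ?_⟩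
  -- For an open quotient map, Hausdorff means that the relation is closed. It consists of the two
  -- diagonals, the graph of `e` and the transposed graph.
  · rw [t2Space_iff_of_isOpenQuotientMap hq]
    have h1 : _root_.IsClosed {q : X × X | q.1 = q.2} := isClosed_diagonal
    have h2 : _root_.IsClosed {q : Y × Y | q.1 = q.2} := isClosed_diagonal
    have h3 : {q : (X ⊕ Y) × (X ⊕ Y) | π q.1 = π q.2} =
        (Prod.map Sum.inl Sum.inl '' {q : X × X | q.1 = q.2}) ∪
        (Prod.map Sum.inr Sum.inr '' {q : Y × Y | q.1 = q.2}) ∪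
        (Prod.map Sum.inl Sum.inr '' {p : X × Y | p.1 ∈ e.source ∧ e p.1 = p.2}) ∪
        (Prod.map Sum.inr Sum.inl '' (Prod.swap ⁻¹'
          {p : X × Y | p.1 ∈ e.source ∧ e p.1 = p.2})) := by
      ext ⟨p | p, q | q⟩ <;> simp [hπ, r]
    rw [h3]
    refine ((IsClosed.union ?_ ?_).union ?_).union ?_
    · exact (IsClosedEmbedding.inl.prodMap IsClosedEmbedding.inl).isClosedMap _ h1
    · exact (IsClosedEmbedding.inr.prodMap IsClosedEmbedding.inr).isClosedMap _ h2
    · exact (IsClosedEmbedding.inl.prodMap IsClosedEmbedding.inr).isClosedMap _ hgraph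
    · exact (IsClosedEmbedding.inr.prodMap IsClosedEmbedding.inl).isClosedMap _
        (hgraph.preimage continuous_swap)
  · exact .of_continuous_injective_isOpenMap (hcont.comp continuous_inl)
      (fun x x' h => (hπ _ _).1 h) (hopen.comp isOpenMap_inl)
  · exact .of_continuous_injective_isOpenMap (hcont.comp continuous_inr)
      (fun x x' h => (hπ _ _).1 h) (hopen.comp isOpenMap_inr)
  · intro w
    obtain ⟨p | p, rfl⟩ := Quotient.mk_surjective w
    · exact Or.inl ⟨p, rfl⟩
    · exact Or.inr ⟨p, rfl⟩
  · intro x y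
    exact hπ _ _

end Glue

/-! ### The inverse function theorem along a compact set. -/

section InverseFunction

variable {E : Type*} [NormedAddCommGroup E] [NormedSpace ℝ E]
  {M : Type*} [TopologicalSpace M] [ChartedSpace E M]
  {F : Type*} [NormedAddCommGroup F] [NormedSpace ℝ F]

theorem hasFDerivAt_comp_chartAt_symm {f : M → F} {x : M}
    (hf : MDifferentiableAt 𝓘(ℝ, E) 𝓘(ℝ, F) f x) :
    HasFDerivAt (f ∘ (chartAt E x).symm) (mvfderiv 𝓘(ℝ, E) f x : E →L[ℝ] F)
      (chartAt E x x) := by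
  have h := hf.hasMFDerivAt.2
  simp only [writtenInExtChartAt, mfld_simps] at h
  exact hasFDerivWithinAt_univ.1 h

theorem contDiffAt_comp_chartAt_symm {f : M → F} {x : M}
    (hf : ContMDiffAt 𝓘(ℝ, E) 𝓘(ℝ, F) ∞ f x) :
    ContDiffAt ℝ ∞ (f ∘ (chartAt E x).symm) (chartAt E x x) := by
  have h := (contMDiffAt_iff.1 hf).2
  simp only [mfld_simps, contDiffWithinAt_univ] at h
  exact h

/-- The inverse function theorem on manifolds, around a compact set on which the map is
injective. -/
theorem exists_openPartialHomeomorph_of_bijective [CompleteSpace E] [CompleteSpace F]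
    [IsManifold 𝓘(ℝ, E) ∞ M]
    {f : M → F} {O K : Set M}
    (hO : IsOpen O) (hf : ContMDiffOn 𝓘(ℝ, E) 𝓘(ℝ, F) ∞ f O)
    (hd : ∀ x ∈ O, Function.Bijective (mvfderiv 𝓘(ℝ, E) f x)) (hK : IsCompact K) (hKO : K ⊆ O)
    (hKi : InjOn f K) (hne : K.Nonempty) :
    ∃ e : OpenPartialHomeomorph M F, K ⊆ e.source ∧ e.source ⊆ O ∧ ⇑e = f ∧
      ContMDiffOn 𝓘(ℝ, F) 𝓘(ℝ, E) ∞ e.symm e.target := by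
  have hfa : ∀ x ∈ O, ContMDiffAt 𝓘(ℝ, E) 𝓘(ℝ, F) ∞ f x := fun x hx =>
    (hf x hx).contMDiffAt (hO.mem_nhds hx)
  have hequiv : ∀ x ∈ O, ∃ L : E ≃L[ℝ] F, HasFDerivAt (f ∘ (chartAt E x).symm)
      (L : E →L[ℝ] F) (chartAt E x x) := by
    intro x hx
    have h1 := hasFDerivAt_comp_chartAt_symm ((hfa x hx).mdifferentiableAt (by simp))
    have hb : Function.Bijective (mvfderiv 𝓘(ℝ, E) f x : E →L[ℝ] F) := hd x hx
    exact ⟨ContinuousLinearEquiv.ofBijective (mvfderiv 𝓘(ℝ, E) f x : E →L[ℝ] F)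
      (LinearMap.ker_eq_bot.2 hb.1) (LinearMap.range_eq_top.2 hb.2), h1⟩
  have hloc : ∀ x ∈ O, ∃ e : OpenPartialHomeomorph M F, x ∈ e.source ∧ EqOn e f e.source := by
    intro x hx
    obtain ⟨L, hL⟩ := hequiv x hx
    have h2 := contDiffAt_comp_chartAt_symm (hfa x hx)
    refine ⟨(chartAt E x).trans (h2.toOpenPartialHomeomorph _ hL (by simp)), ?_, ?_⟩
    · simp only [mfld_simps, true_and]
      exact h2.mem_toOpenPartialHomeomorph_source hL (by simp)
    · intro y hy
      simp only [mfld_simps] at hy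
      simp [hy.1]
  -- A continuous map which is injective on a compact set and locally injective at its points is
  -- injective on a neighbourhood of that set.
  obtain ⟨t, htO, hKt, hti⟩ := hKi.exists_isOpen_superset hK
    (fun x hx => (hfa x (hKO hx)).continuousAt) (fun x hx => by
      obtain ⟨e, he, hef⟩ := hloc x (hKO hx)
      exact ⟨e.source, e.open_source.mem_nhds he, e.injOn.congr hef⟩)
  have : Nonempty M := ⟨hne.some⟩
  have hi : InjOn f (t ∩ O) := hti.mono inter_subset_left
  let e : OpenPartialHomeomorph M F := OpenPartialHomeomorph.ofContinuousOpenRestrict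
    (hi.toPartialEquiv f (t ∩ O)) (hf.continuousOn.mono inter_subset_right) (by
      intro U hU
      rw [isOpen_iff_mem_nhds]
      rintro _ ⟨⟨x, hx⟩, hxU, rfl⟩
      obtain ⟨e', he', hef⟩ := hloc x hx.2
      obtain ⟨U', hU', rfl⟩ := isOpen_induced_iff.1 hU
      have hUo : IsOpen (U' ∩ (t ∩ O)) := hU'.inter (htO.inter hO)
      have h3 : e' '' (e'.source ∩ (U' ∩ (t ∩ O))) ∈ 𝓝 (f x) := by
        rw [← hef he']
        exact (e'.isOpen_image_source_inter hUo).mem_nhds ⟨x, ⟨he', hxU, hx⟩, rfl⟩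
      refine Filter.mem_of_superset h3 ?_
      rintro _ ⟨y, ⟨hy1, hy2, hy3⟩, rfl⟩
      exact ⟨⟨y, hy3⟩, hy2, (hef hy1).symm⟩) (htO.inter hO)
  have hes : e.source = t ∩ O := rfl
  have hef : ⇑e = f := rfl
  refine ⟨e, ?_, ?_, hef, ?_⟩
  · rw [hes]; exact subset_inter hKt hKO
  · rw [hes]; exact inter_subset_right
  · intro z hz
    refine ContMDiffAt.contMDiffWithinAt ?_
    have hx : e.symm z ∈ O := (e.map_target hz).2
    set x := e.symm z with hxdef
    obtain ⟨L, hL⟩ := hequiv x hx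
    set φ := chartAt E x with hφ
    let e' : OpenPartialHomeomorph E F := φ.symm.trans e
    have hφx : φ x ∈ φ.target := mem_chart_target E x
    have hz' : z ∈ e'.target := by
      simp only [e', mfld_simps]
      refine ⟨hz, ?_⟩
      rw [← hxdef]; exact mem_chart_source E x
    have h4 : e'.symm z = φ x := by simp [e', ← hxdef]
    -- Smoothness of the inverse is local, so it is read off in the chart at the preimage of z,
    -- where the derivative is invertible.
    have h5 : ContDiffAt ℝ ∞ e'.symm z := by
      refine e'.contDiffAt_symm (f₀' := L) hz' ?_ ?_
      · rw [h4]; exact hL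
      · rw [h4]; exact contDiffAt_comp_chartAt_symm (hfa x hx)
    have h6 : ContMDiffAt 𝓘(ℝ, F) 𝓘(ℝ, E) ∞ (φ.symm ∘ e'.symm) z := by
      refine ContMDiffAt.comp z ?_ h5.contMDiffAt
      rw [h4]
      exact contMDiffAt_symm_of_mem_maximalAtlas (IsManifold.chart_mem_maximalAtlas x) hφx
    refine h6.congr_of_eventuallyEq ?_
    filter_upwards [e'.open_target.mem_nhds hz'] with y hy
    simp only [e', mfld_simps] at hy ⊢
    simp [hy.2]

end InverseFunction

/-! ### Two-covectors on a plane. -/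

section PlaneForms

variable {V : Type*} [AddCommGroup V] [Module ℝ V] [TopologicalSpace V]

/-- If the two coordinate covectors are independent, Cramer's rule solves L v = c. Injectivity then
follows by counting dimensions. -/
theorem bijective_of_wedge_ne_zero (hV : Module.finrank ℝ V = 2) {L : V →L[ℝ] ℂ}
    (h : wedge (Complex.reCLM.comp L) (Complex.imCLM.comp L) ≠ 0) : Function.Bijective L := by
  have : FiniteDimensional ℝ V := Module.finite_of_finrank_pos (by omega)
  have hs : Function.Surjective (L : V →ₗ[ℝ] ℂ) := by
    by_contra hn
    apply h
    ext v
    rw [wedge_apply]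
    simp only [ContinuousLinearMap.comp_apply, Complex.reCLM_apply, Complex.imCLM_apply]
    by_contra hd
    apply hn
    intro c
    obtain ⟨d, hdd⟩ : ∃ d, d = (L (v 0)).re * (L (v 1)).im - (L (v 1)).re * (L (v 0)).im :=
      ⟨_, rfl⟩
    rw [← hdd] at hd
    change d ≠ 0 at hd
    refine ⟨((c.re * (L (v 1)).im - c.im * (L (v 1)).re) / d) • v 0 +
      ((c.im * (L (v 0)).re - c.re * (L (v 0)).im) / d) • v 1, ?_⟩
    apply Complex.ext
    · simp; field_simp; linear_combination (-c.re) * hdd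
    · simp; field_simp; linear_combination (-c.im) * hdd
  have hi := (LinearMap.injective_iff_surjective_of_finrank_eq_finrank (f := (L : V →ₗ[ℝ] ℂ))
    (by rw [hV]; exact Complex.finrank_real_complex.symm)).2 hs
  exact ⟨hi, hs⟩

/-- On a plane, a `2`-covector is determined by one value. -/
theorem eq_smul_wedge_of_bijective {L : V →L[ℝ] ℂ} (hL : Function.Bijective L)
    (σ : V [⋀^Fin 2]→L[ℝ] ℝ) {e₀ e₁ : V} (h₀ : L e₀ = 1) (h₁ : L e₁ = Complex.I) :
    σ = σ ![e₀, e₁] • wedge (Complex.reCLM.comp L) (Complex.imCLM.comp L) := by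
  have hv : ∀ v : V, v = (L v).re • e₀ + (L v).im • e₁ := by
    intro v
    apply hL.1
    simp [h₀, h₁, Complex.re_add_im]
  have hz : ∀ v : V, σ ![v, v] = 0 := fun v =>
    σ.map_eq_zero_of_eq _ (i := 0) (j := 1) (by simp) (by decide)
  ext v
  have h2 : v = ![v 0, v 1] := by ext i; fin_cases i <;> rfl
  have hadd : ∀ a b c : V, σ ![a + b, c] = σ ![a, c] + σ ![b, c] := fun a b c =>
    σ.toAlternatingMap.map_vecCons_add (n := 1) ![c] a b
  have hsm : ∀ (r : ℝ) (a c : V), σ ![r • a, c] = r * σ ![a, c] := fun r a c =>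
    σ.toAlternatingMap.map_vecCons_smul (n := 1) ![c] r a
  have hsw' : ∀ a b : V, σ ![b, a] = - σ ![a, b] := fun a b => by
    have h := σ.toAlternatingMap.map_swap ![a, b] (i := 0) (j := 1) (by decide)
    rw [ContinuousAlternatingMap.coe_toAlternatingMap] at h
    rw [← h]
    congr 1
    ext i; fin_cases i <;> simp
  have hadd' : ∀ a b c : V, σ ![a, b + c] = σ ![a, b] + σ ![a, c] := fun a b c => by
    rw [hsw', hadd, hsw' a b, hsw' a c]; ring
  have hsm' : ∀ (r : ℝ) (a c : V), σ ![a, r • c] = r * σ ![a, c] := fun r a c => by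
    rw [hsw', hsm, hsw' a c]; ring
  rw [h2, hv (v 0), hv (v 1)]
  rw [hadd, hadd', hadd', hsm, hsm, hsm, hsm, hsm', hsm', hsm', hsm', hz, hz, hsw' e₀ e₁]
  simp [wedge_apply, h₀, h₁]
  ring

end PlaneForms

/-! ### Two-forms on surfaces and their densities in complex charts. -/

section Density

variable {E : Type} [NormedAddCommGroup E] [NormedSpace ℝ E]
  {H : Type*} [TopologicalSpace H] {I : ModelWithCorners ℝ E H}
  {M : Type*} [TopologicalSpace M] [ChartedSpace H M]

/-- The pull-back of the standard area form of the complex plane. -/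
def planeForm (I : ModelWithCorners ℝ E H) (w : M → ℂ) : DiffForm I M 2 := fun x =>
  wedge (Complex.reCLM.comp (mvfderiv I w x)) (Complex.imCLM.comp (mvfderiv I w x))

theorem planeForm_eq_wedge {w : M → ℂ} {x : M} (h : MDifferentiableAt I 𝓘(ℝ, ℂ) w x) :
    planeForm I w x =
      wedge (mvfderiv I (fun y => (w y).re) x) (mvfderiv I (fun y => (w y).im) x) := by
  rw [planeForm,
    ← mvfderiv_comp_of_hasFDerivAt (f := fun z : ℂ => z.re) Complex.reCLM.hasFDerivAt h,
    ← mvfderiv_comp_of_hasFDerivAt (f := fun z : ℂ => z.im) Complex.imCLM.hasFDerivAt h]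

theorem planeForm_apply (w : M → ℂ) (x : M) (v : Fin 2 → TangentSpace I x) :
    planeForm I w x v = (starRingEnd ℂ (mvfderiv I w x (v 0)) * mvfderiv I w x (v 1)).im := by
  simp [planeForm, wedge_apply]
  ring

/-- The exterior derivative is a 3-form on a plane, and any three vectors of a plane are linearly
dependent. -/
theorem DiffForm.IsSmooth.isSmoothClosed (hE : Module.finrank ℝ E = 2) {σ : DiffForm I M 2}
    (hσ : σ.IsSmooth) : σ.IsSmoothClosed := by
  refine ⟨hσ, fun x₀ y _ => ?_⟩
  have : FiniteDimensional ℝ E := Module.finite_of_finrank_pos (by omega)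
  ext v
  refine AlternatingMap.map_linearDependent
    (extDerivWithin (σ.inChart x₀) (extChartAt I x₀).target y).toAlternatingMap v fun h => ?_
  have := h.fintype_card_le_finrank
  simp [hE] at this

theorem mvfderiv_symm_apply (e : OpenPartialHomeomorph M ℂ)
    (he : ContMDiffOn I 𝓘(ℝ, ℂ) ∞ e e.source) (he' : ContMDiffOn 𝓘(ℝ, ℂ) I ∞ e.symm e.target)
    {x : M} (hx : x ∈ e.source) :
    (∀ c : ℂ, mvfderiv I e x (mfderiv 𝓘(ℝ, ℂ) I e.symm (e x) c) = c) ∧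
    ∀ v : TangentSpace I x, mfderiv 𝓘(ℝ, ℂ) I e.symm (e x) (mvfderiv I e x v) = v := by
  have hex : MDifferentiableAt I 𝓘(ℝ, ℂ) e x :=
    ((he x hx).contMDiffAt (e.open_source.mem_nhds hx)).mdifferentiableAt (by simp)
  have hz := e.map_source hx
  have hd : MDifferentiableAt 𝓘(ℝ, ℂ) I e.symm (e x) :=
    ((he' _ hz).contMDiffAt (e.open_target.mem_nhds hz)).mdifferentiableAt (by simp)
  constructor
  · intro c
    have h1 : MDifferentiableAt I 𝓘(ℝ, ℂ) e (e.symm (e x)) := by rwa [e.left_inv hx]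
    have h2 := mfderiv_comp (e x) h1 hd
    have h3 : (e ∘ e.symm) =ᶠ[𝓝 (e x)] id := by
      filter_upwards [e.open_target.mem_nhds hz] with z hz using e.right_inv hz
    rw [h3.mfderiv_eq, mfderiv_id] at h2
    have h4 := congrArg (fun L => L c) h2
    rw [e.left_inv hx] at h4
    exact h4.symm
  · intro v
    have h2 := mfderiv_comp x hd hex
    have h3 : (e.symm ∘ e) =ᶠ[𝓝 x] id := by
      filter_upwards [e.open_source.mem_nhds hx] with z hz using e.left_inv hz
    rw [h3.mfderiv_eq, mfderiv_id] at h2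
    exact (congrArg (fun L => L v) h2).symm

theorem bijective_mvfderiv (e : OpenPartialHomeomorph M ℂ)
    (he : ContMDiffOn I 𝓘(ℝ, ℂ) ∞ e e.source) (he' : ContMDiffOn 𝓘(ℝ, ℂ) I ∞ e.symm e.target)
    {x : M} (hx : x ∈ e.source) : Function.Bijective (mvfderiv I e x) := by
  obtain ⟨key, key'⟩ := mvfderiv_symm_apply e he he' hx
  exact ⟨fun v w h => by rw [← key' v, ← key' w, h], fun c => ⟨_, key c⟩⟩

theorem planeForm_ne_zero_of_bijective {w : M → ℂ} {x : M}
    (h : Function.Bijective (mvfderiv I w x)) : planeForm I w x ≠ 0 := by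
  obtain ⟨a, ha⟩ := h.2 1
  obtain ⟨b, hb⟩ := h.2 Complex.I
  intro h0
  have := congrArg (fun L => L ![a, b]) h0
  simp [planeForm_apply, ha, hb] at this

theorem isSmoothClosed_planeForm [IsManifold I ∞ M] {w : M → ℂ}
    (hw : ContMDiff I 𝓘(ℝ, ℂ) ∞ w) : (planeForm I w).IsSmoothClosed := by
  refine DiffForm.isSmoothClosed_of_locallyInduced fun x => ?_
  have h : planeForm I w = (fun x => wedge (mvfderiv I (fun y => (w y).re) x)
      (mvfderiv I (fun y => (w y).im) x) : DiffForm I M 2) :=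
    funext fun x => planeForm_eq_wedge (hw.mdifferentiableAt (by simp))
  rw [h]
  exact LocallyExact.wedge
    (locallyExact_mvfderiv isOpen_univ (mem_univ _)
      (Complex.reCLM.contDiff.contMDiff.comp hw).contMDiffOn)
    (locallyExact_mvfderiv isOpen_univ (mem_univ _)
      (Complex.imCLM.contDiff.contMDiff.comp hw).contMDiffOn)

/-- The density at z is the value of σ on the images of 1 and i under the derivative of the inverse
chart. Smoothness of σ is defined through the preferred charts only, while e is arbitrary; so σ is
first written near the point as induced by a smooth form on a normed space. -/
theorem exists_density [IsManifold I ∞ M] (hE : Module.finrank ℝ E = 2) {σ : DiffForm I M 2}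
    (hσ : σ.IsSmooth) (e : OpenPartialHomeomorph M ℂ) (he : ContMDiffOn I 𝓘(ℝ, ℂ) ∞ e e.source)
    (he' : ContMDiffOn 𝓘(ℝ, ℂ) I ∞ e.symm e.target) :
    ∃ f : ℂ → ℝ, ContDiffOn ℝ ∞ f e.target ∧
      ∀ x ∈ e.source, σ x = f (e x) • planeForm I e x := by
  have hd : ∀ z ∈ e.target, MDifferentiableAt 𝓘(ℝ, ℂ) I e.symm z := fun z hz =>
    ((he' z hz).contMDiffAt (e.open_target.mem_nhds hz)).mdifferentiableAt (by simp)
  refine ⟨fun z => σ (e.symm z) ![mfderiv 𝓘(ℝ, ℂ) I e.symm z (1 : ℂ),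
    mfderiv 𝓘(ℝ, ℂ) I e.symm z Complex.I], ?_, ?_⟩
  · intro z₀ hz₀
    obtain ⟨F, _, _, t, ζ, g, O, hO, hxO, hζ, -, hg, hgt, hη⟩ :=
      (hσ.isSmoothClosed hE).locallyInduced_of_eq_pullback (f := id) (η := σ) (x := e.symm z₀)
        isOpen_univ contMDiffOn_id (fun y _ => by
          simp only [DiffForm.pullback, mfderiv_id]; rfl) (mem_univ _)
    set s := e.target ∩ e.symm ⁻¹' O with hs
    have hso : IsOpen s := e.symm.isOpen_inter_preimage hO
    have hG : ContDiffOn ℝ ∞ (g ∘ e.symm) s := by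
      rw [← contMDiffOn_iff_contDiffOn]
      exact hg.comp (he'.mono inter_subset_left) fun z hz => hz.2
    have h1 : ContDiffOn ℝ ∞ (fun z => (ζ ((g ∘ e.symm) z)).compContinuousLinearMap
        (fderivWithin ℝ (g ∘ e.symm) s z)) s :=
      contDiffOn_compContinuousLinearMap (hζ.comp hG fun z hz => hgt hz.2)
        (hG.fderivWithin hso.uniqueDiffOn (by simp))
    have h2 : ContDiffOn ℝ ∞ (fun z => (ζ ((g ∘ e.symm) z)).compContinuousLinearMap
        (fderivWithin ℝ (g ∘ e.symm) s z) ![1, Complex.I]) s :=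
      ((ContinuousMultilinearMap.apply ℝ (fun _ : Fin 2 => ℂ) ℝ
        ![1, Complex.I]).comp (ContinuousAlternatingMap.toContinuousMultilinearMapCLM ℝ)
        ).contDiff.comp_contDiffOn h1
    refine ((h2.congr fun z hz => ?_) z₀ ⟨hz₀, hxO⟩).contDiffAt (hso.mem_nhds ⟨hz₀, hxO⟩)
      |>.contDiffWithinAt
    have hgd : MDifferentiableAt I 𝓘(ℝ, F) g (e.symm z) :=
      ((hg _ hz.2).contMDiffAt (hO.mem_nhds hz.2)).mdifferentiableAt (by simp)
    rw [hη _ hz.2, fderivWithin_of_isOpen hso hz, ← mfderiv_eq_fderiv,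
      mfderiv_comp z hgd (hd z hz.1)]
    change (ζ _ : F [⋀^Fin 2]→L[ℝ] ℝ) _ = (ζ _ : F [⋀^Fin 2]→L[ℝ] ℝ) _
    congr 1
    ext i
    fin_cases i <;> rfl
  · intro x hx
    obtain ⟨key, key'⟩ := mvfderiv_symm_apply e he he' hx
    have hb := bijective_mvfderiv e he he' hx
    refine (eq_smul_wedge_of_bijective hb (σ x) (key 1) (key Complex.I)).trans ?_
    have h5 : ∀ y (_ : y = x) (a b : E), (σ y : E [⋀^Fin 2]→L[ℝ] ℝ) ![a, b] =
      (σ x : E [⋀^Fin 2]→L[ℝ] ℝ) ![a, b] := by rintro y rfl a b; rfl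
    rw [planeForm]
    congr 1
    exact (h5 _ (e.left_inv hx) _ _).symm

end Density

section Surface

variable {S : Type u} [TopologicalSpace S] [ChartedSpace (EuclideanSpace ℝ (Fin 2)) S]

/-- A complex valued chart of a surface. -/
def planeChart (x : S) : OpenPartialHomeomorph S ℂ :=
  (chartAt (EuclideanSpace ℝ (Fin 2)) x).trans
    Complex.orthonormalBasisOneI.repr.symm.toHomeomorph.toOpenPartialHomeomorph

theorem mem_planeChart_source (x : S) : x ∈ (planeChart x).source := by
  simp [planeChart]

variable [IsManifold (𝓡 2) ∞ S]

theorem planeChart_smooth (x : S) :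
    ContMDiffOn (𝓡 2) 𝓘(ℝ, ℂ) ∞ (planeChart x) (planeChart x).source ∧
    ContMDiffOn 𝓘(ℝ, ℂ) (𝓡 2) ∞ (planeChart x).symm (planeChart x).target := by
  constructor
  · refine (Complex.orthonormalBasisOneI.repr.symm.contDiff.contMDiff.comp_contMDiffOn
      (contMDiffOn_chart (x := x) (I := 𝓡 2))).mono ?_
    simp [planeChart]
  · refine (contMDiffOn_chart_symm (x := x) (I := 𝓡 2)).comp
      Complex.orthonormalBasisOneI.repr.contDiff.contMDiff.contMDiffOn ?_
    intro z hz
    simpa [planeChart] using hz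

/-- In a chart the form is a continuous density times a nowhere vanishing form, and the nonvanishing
of the density is an open condition. -/
theorem isOpen_setOf_planeForm_ne_zero {w : S → ℂ} (hw : ContMDiff (𝓡 2) 𝓘(ℝ, ℂ) ∞ w) :
    IsOpen {x | planeForm (𝓡 2) w x ≠ 0} := by
  rw [isOpen_iff_mem_nhds]
  intro x hx
  obtain ⟨h1, h2⟩ := planeChart_smooth x
  obtain ⟨f, hf, hfe⟩ := exists_density (by simp) (isSmoothClosed_planeForm hw).smooth
    (planeChart x) h1 h2
  have hfx : f (planeChart x x) ≠ 0 := by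
    intro h; apply hx; rw [hfe x (mem_planeChart_source x), h, zero_smul]
  have hxs := mem_planeChart_source x
  have hc : ContinuousAt (fun y => f (planeChart x y)) x :=
    ContinuousAt.comp (hf.continuousOn.continuousAt
      ((planeChart x).open_target.mem_nhds ((planeChart x).map_source hxs)))
      ((planeChart x).continuousAt hxs)
  filter_upwards [hc.eventually_ne hfx, (planeChart x).open_source.mem_nhds hxs] with y hy hys
  rw [hfe y hys]
  exact smul_ne_zero hy (planeForm_ne_zero_of_bijective (bijective_mvfderiv _ h1 h2 hys))

end Surface

theorem mvfderiv_eq_fderiv {E F : Type*} [NormedAddCommGroup E] [NormedSpace ℝ E]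
    [NormedAddCommGroup F] [NormedSpace ℝ F] (f : E → F) (x : E) :
    mvfderiv 𝓘(ℝ, E) f x = fderiv ℝ f x := by
  ext v
  exact congrArg (fun L => L v) (mfderiv_eq_fderiv (f := f) (x := x))

/-! ### Plane coordinates under holomorphic maps and reflections. -/

section PlaneFormComp

variable {E : Type} [NormedAddCommGroup E] [NormedSpace ℝ E]
  {H : Type*} [TopologicalSpace H] {I : ModelWithCorners ℝ E H}
  {M : Type*} [TopologicalSpace M] [ChartedSpace H M] {x : M}

/-- The Jacobian of a holomorphic map is |f'|²; composing a coordinate with such a map does not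
change its orientation. -/
theorem planeForm_holomorphic {w : M → ℂ} {f : ℂ → ℂ} {f' : ℂ} (hf : HasDerivAt f f' (w x))
    (hw : MDifferentiableAt I 𝓘(ℝ, ℂ) w x) :
    planeForm I (fun y => f (w y)) x = Complex.normSq f' • planeForm I w x := by
  ext v
  rw [planeForm_apply, mvfderiv_comp_of_hasFDerivAt (hf.hasFDerivAt.restrictScalars ℝ) hw,
    ContinuousAlternatingMap.smul_apply, planeForm_apply]
  simp [Complex.normSq_apply]
  ring

/-- The reflection in the imaginary axis has determinant −1 and fixes that axis. It corrects the
orientation of a coordinate without moving a curve that lies on the imaginary axis. -/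
theorem planeForm_neg_conj {w : M → ℂ} (hw : MDifferentiableAt I 𝓘(ℝ, ℂ) w x) :
    planeForm I (fun y => - starRingEnd ℂ (w y)) x = - planeForm I w x := by
  ext v
  have hr : HasFDerivAt (fun t : ℂ => - (starRingEnd ℂ) t)
      (-(Complex.conjCLE : ℂ →L[ℝ] ℂ)) (w x) :=
    (Complex.conjCLE : ℂ →L[ℝ] ℂ).hasFDerivAt.neg
  rw [planeForm_apply, mvfderiv_comp_of_hasFDerivAt hr hw,
    ContinuousAlternatingMap.neg_apply, planeForm_apply]
  simp
  ring

end PlaneFormComp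

theorem hasDerivAt_coe_mul_circleExp (θ : Circle) (t : ℝ) :
    HasDerivAt (fun t : ℝ => ((θ * Circle.exp t : Circle) : ℂ))
      (Complex.I * (θ * Circle.exp t : Circle)) t := by
  have h : HasDerivAt (fun t : ℝ => (θ : ℂ) * Complex.exp (t * Complex.I)) _ t :=
    (((Complex.ofRealCLM.hasDerivAt (x := t)).mul_const Complex.I).cexp).const_mul (θ : ℂ)
  simp only [Circle.coe_mul, Circle.coe_exp]
  refine h.congr_deriv ?_
  have h1 : Complex.ofRealCLM 1 = 1 := by simp
  have h2 : Complex.ofRealCLM t = (t : ℂ) := rfl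
  rw [h1, h2, one_mul]
  ring

theorem contMDiff_mul_circleExp (θ : Circle) :
    ContMDiff 𝓘(ℝ, ℝ) (𝓡 1) ∞ (fun t : ℝ => θ * Circle.exp t) :=
  contMDiff_const.mul contMDiff_circleExp

theorem contMDiff_circle_coe : ContMDiff (𝓡 1) 𝓘(ℝ, ℂ) ∞ (fun z : Circle => (z : ℂ)) :=
  have : Fact (Module.finrank ℝ ℂ = 1 + 1) := finrank_real_complex_fact'
  contMDiff_coe_sphere

theorem eq_mul_circleExp_arg (θ₀ θ : Circle) : θ = θ₀ * Circle.exp (Complex.arg (θ₀⁻¹ * θ : Circle)) := by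
  rw [Circle.exp_arg]; group

/-! ### Coordinates along an embedded circle: local construction. -/

section Curve

variable {S : Type u} [TopologicalSpace S] [ChartedSpace (EuclideanSpace ℝ (Fin 2)) S]
  [IsManifold (𝓡 2) ∞ S] [T2Space S]

/-- Around every point of an embedded circle in an oriented surface there is a positive complex
coordinate which restricts to the parameter along the circle. -/
theorem exists_local_coordinate_along {γ : Circle → S} (hγ : ContMDiff (𝓡 1) (𝓡 2) ∞ γ)
    (hγi : Function.Injective γ)
    (hγd : ∀ z, Function.Injective (mfderiv (𝓡 1) (𝓡 2) γ z))
    {σ : DiffForm (𝓡 2) S 2} (hσ : σ.IsSmooth) (hσ0 : σ.NowhereZero) (θ₀ : Circle) :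
    ∃ (U : Set S) (Z : S → ℂ), IsOpen U ∧ γ θ₀ ∈ U ∧ ContMDiffOn (𝓡 2) 𝓘(ℝ, ℂ) ∞ Z U ∧
      (∀ θ, γ θ ∈ U → Z (γ θ) = θ) ∧
      ∀ x ∈ U, ∃ r : ℝ, 0 < r ∧ planeForm (𝓡 2) Z x = r • σ x := by
  set c := planeChart (γ θ₀) with hc
  obtain ⟨hc1, hc2⟩ := planeChart_smooth (γ θ₀)
  rw [← hc] at hc1 hc2
  have hmc : γ θ₀ ∈ c.source := mem_planeChart_source _
  set g : ℝ → S := fun t => γ (θ₀ * Circle.exp t) with hg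
  have hgs : ContMDiff 𝓘(ℝ, ℝ) (𝓡 2) ∞ g := hγ.comp (contMDiff_mul_circleExp θ₀)
  have hg0 : g 0 = γ θ₀ := by simp [hg]
  set u : ℝ → ℂ := fun t => c (g t) with hu
  set T := g ⁻¹' c.source with hT
  have hTo : IsOpen T := c.open_source.preimage hgs.continuous
  have h0T : (0 : ℝ) ∈ T := by simp [hT, hg0, hmc]
  have hus : ContDiffOn ℝ ∞ u T := by
    rw [← contMDiffOn_iff_contDiffOn]
    exact hc1.comp hgs.contMDiffOn fun t ht => ht
  have hd0 : deriv u 0 ≠ 0 := by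
    have h1 : MDifferentiableAt (𝓡 2) 𝓘(ℝ, ℂ) c (g 0) := by
      rw [hg0]
      exact ((hc1 _ hmc).contMDiffAt (c.open_source.mem_nhds hmc)).mdifferentiableAt (by simp)
    have h2 : MDifferentiableAt (𝓡 1) (𝓡 2) γ (θ₀ * Circle.exp 0) :=
      hγ.mdifferentiableAt (by simp)
    have h3 : MDifferentiableAt 𝓘(ℝ, ℝ) (𝓡 1) (fun t : ℝ => θ₀ * Circle.exp t) 0 :=
      (contMDiff_mul_circleExp θ₀).mdifferentiableAt (by simp)
    have h4 : MDifferentiableAt 𝓘(ℝ, ℝ) (𝓡 2) g 0 := hgs.mdifferentiableAt (by simp)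
    set τ := mfderiv 𝓘(ℝ, ℝ) (𝓡 1) (fun t : ℝ => θ₀ * Circle.exp t) 0 (1 : ℝ) with hτ
    have hτ0 : τ ≠ 0 := by
      intro h
      have h5 := mvfderiv_comp' (J := 𝓡 1) (g := fun z : Circle => (z : ℂ))
        (contMDiff_circle_coe.mdifferentiableAt (by simp)) h3
      have h6 : mvfderiv 𝓘(ℝ, ℝ) (fun t : ℝ => ((θ₀ * Circle.exp t : Circle) : ℂ)) 0 (1 : ℝ) =
        mvfderiv (𝓡 1) (fun z : Circle => (z : ℂ)) _ τ := congrArg (fun L => L (1 : ℝ)) h5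
      rw [h, map_zero] at h6
      have h7 := (hasDerivAt_coe_mul_circleExp θ₀ 0).hasFDerivAt
      have h8 : mvfderiv 𝓘(ℝ, ℝ) (fun t : ℝ => ((θ₀ * Circle.exp t : Circle) : ℂ)) 0 =
        fderiv ℝ (fun t : ℝ => ((θ₀ * Circle.exp t : Circle) : ℂ)) 0 :=
        mvfderiv_eq_fderiv _ _
      rw [h8, h7.fderiv] at h6
      have h9 : (1 : ℝ) • (Complex.I * ((θ₀ * Circle.exp 0 : Circle) : ℂ)) = 0 := h6
      simp at h9
    have hgτ : mfderiv 𝓘(ℝ, ℝ) (𝓡 2) g 0 (1 : ℝ) = mfderiv (𝓡 1) (𝓡 2) γ (θ₀ * Circle.exp 0) τ := by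
      have := mfderiv_comp (0 : ℝ) h2 h3
      exact congrArg (fun L => L (1 : ℝ)) this
    intro h
    have h5 := mvfderiv_comp' h1 h4
    have h6 := congrArg (fun L => L (1 : ℝ)) h5
    have h7 : mvfderiv 𝓘(ℝ, ℝ) (fun y => c (g y)) 0 (1 : ℝ) = deriv u 0 := by
      rw [mvfderiv_eq_fderiv]; rfl
    rw [h7, h] at h6
    have hb := (bijective_mvfderiv c hc1 hc2 (x := g 0) (by rwa [hg0])).1
    have h8 : mfderiv 𝓘(ℝ, ℝ) (𝓡 2) g 0 (1 : ℝ) = 0 := hb (by rw [map_zero]; exact h6.symm)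
    rw [hgτ] at h8
    exact hτ0 (hγd _ (h8.trans (map_zero _).symm))
  -- A normal vector of the curve in the chart. The map `G` below sends the imaginary axis to the
  -- curve and moves in the direction `n` with the real part. The imaginary axis is chosen because
  -- the exponential wraps it around the unit circle.
  set n : ℂ := -Complex.I * deriv u 0 with hn
  have hdc : ContinuousOn (deriv u) T := hus.continuousOn_deriv_of_isOpen hTo (by simp)
  -- The parameters at which the Jacobian of `G` is positive.
  set T' := T ∩ (fun t => ((starRingEnd ℂ) n * deriv u t).im) ⁻¹' Ioi 0 with hT'
  have hT'o : IsOpen T' := ContinuousOn.isOpen_inter_preimage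
    (Complex.continuous_im.comp_continuousOn (continuousOn_const.mul hdc)) hTo isOpen_Ioi
  have h0T' : (0 : ℝ) ∈ T' := by
    refine ⟨h0T, ?_⟩
    have : ((starRingEnd ℂ) n * deriv u 0) = Complex.I * Complex.normSq (deriv u 0) := by
      rw [hn, map_mul, mul_assoc, mul_comm ((starRingEnd ℂ) (deriv u 0)), Complex.mul_conj]; simp
    simp only [mem_preimage, mem_Ioi]
    rw [this]
    simpa using hd0
  set G : ℂ → ℂ := fun ζ => u ζ.im + (ζ.re : ℂ) * n with hG
  set O : Set ℂ := Complex.im ⁻¹' T' with hO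
  have hOo : IsOpen O := hT'o.preimage Complex.continuous_im
  have hGs : ContDiffOn ℝ ∞ G O := by
    refine (hus.comp Complex.imCLM.contDiff.contDiffOn fun ζ hζ => hζ.1).add ?_
    exact ((Complex.ofRealCLM.contDiff.comp Complex.reCLM.contDiff).mul contDiff_const).contDiffOn
  have hGd : ∀ ζ ∈ O, HasFDerivAt G
      (Complex.imCLM.smulRight (deriv u ζ.im) + Complex.reCLM.smulRight n) ζ := by
    intro ζ hζ
    have h1 : HasDerivAt u (deriv u ζ.im) ζ.im :=
      ((hus ζ.im hζ.1).contDiffAt (hTo.mem_nhds hζ.1)).differentiableAt (by simp) |>.hasDerivAt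
    have h2 : HasFDerivAt (fun ζ : ℂ => u ζ.im) _ ζ :=
      h1.hasFDerivAt.comp ζ Complex.imCLM.hasFDerivAt
    have h3 : HasFDerivAt (fun ζ : ℂ => (ζ.re : ℂ) * n) (Complex.reCLM.smulRight n) ζ := by
      have h := (Complex.reCLM.smulRight n).hasFDerivAt (x := ζ)
      have h' : (fun ζ : ℂ => (ζ.re : ℂ) * n) = Complex.reCLM.smulRight n := by
        ext ζ; simp
      rw [h']; exact h
    refine (h2.add h3).congr_fderiv ?_
    ext v
    simp
  obtain ⟨e, he0, heO, heG, hes⟩ := exists_openPartialHomeomorph_of_bijective (K := {0}) hOo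
    hGs.contMDiffOn (fun ζ hζ => by
      apply bijective_of_wedge_ne_zero Complex.finrank_real_complex
      intro h
      have h1 := congrArg (fun L => L ![(1 : ℂ), Complex.I]) h
      change planeForm 𝓘(ℝ, ℂ) G ζ ![(1 : ℂ), Complex.I] = 0 at h1
      rw [planeForm_apply, mvfderiv_eq_fderiv, (hGd ζ hζ).fderiv] at h1
      have h2 := hζ.2
      simp only [mem_preimage, mem_Ioi] at h2
      have h3 : (1 : ℂ).im • deriv u ζ.im + (1 : ℂ).re • n = n := by simp
      have h4 : Complex.I.im • deriv u ζ.im + Complex.I.re • n = deriv u ζ.im := by simp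
      refine h2.ne' (Eq.trans ?_ h1)
      change _ = ((starRingEnd ℂ) ((1 : ℂ).im • deriv u ζ.im + (1 : ℂ).re • n) *
        (Complex.I.im • deriv u ζ.im + Complex.I.re • n)).im
      rw [h3, h4]) isCompact_singleton (by simpa [hO] using h0T') (injOn_singleton _ _)
      (singleton_nonempty _)
  have he0 : (0 : ℂ) ∈ e.source := he0 rfl
  have hesm : ContMDiffOn 𝓘(ℝ, ℂ) 𝓘(ℝ, ℂ) ∞ e e.source := by
    rw [heG]; exact hGs.contMDiffOn.mono heO
  set k : OpenPartialHomeomorph S ℂ := c.trans e.symm with hk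
  have hk1 : ContMDiffOn (𝓡 2) 𝓘(ℝ, ℂ) ∞ k k.source := by
    refine hes.comp (hc1.mono ?_) ?_ <;> intro x hx <;> simp [hk] at hx ⊢ <;> tauto
  have hk2 : ContMDiffOn 𝓘(ℝ, ℂ) (𝓡 2) ∞ k.symm k.target := by
    refine hc2.comp (hesm.mono ?_) ?_ <;> intro x hx <;> simp [hk] at hx ⊢ <;> tauto
  have hkline : ∀ t : ℝ, t * Complex.I ∈ e.source → g t ∈ k.source ∧ k (g t) = t * Complex.I := by
    intro t ht
    have h1 : e (t * Complex.I) = c (g t) := by rw [heG]; simp [hG, hu]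
    have h2 : t ∈ T := by simpa using (heO ht).1
    have h3 := e.map_source ht
    rw [h1] at h3
    refine ⟨?_, ?_⟩
    · simp only [hk, mfld_simps]; exact ⟨h2, h3⟩
    · simp only [hk, mfld_simps]; rw [← h1, e.left_inv ht]
  have hk0 : γ θ₀ ∈ k.source ∧ k (γ θ₀) = 0 := by
    have := hkline 0 (by simpa using he0)
    rw [hg0] at this; simpa using this
  obtain ⟨f, hf, hfe⟩ := exists_density (by simp) hσ k hk1 hk2
  have hkd : ∀ x ∈ k.source, MDifferentiableAt (𝓡 2) 𝓘(ℝ, ℂ) k x := fun x hx =>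
    ((hk1 x hx).contMDiffAt (k.open_source.mem_nhds hx)).mdifferentiableAt (by simp)
  have hf0 : f 0 ≠ 0 := by
    intro h
    apply hσ0 (γ θ₀)
    rw [hfe _ hk0.1, hk0.2, h, zero_smul]
  -- The coordinate `k` is positive or negative according to the sign of its density at the base
  -- point. In the negative case it is reflected in the imaginary axis, which fixes the curve.
  obtain ⟨L, hLs, hLl, hLf⟩ : ∃ L : ℂ → ℂ, ContDiff ℝ ∞ L ∧
      (∀ t : ℝ, L (t * Complex.I) = t * Complex.I) ∧
      ∀ x ∈ k.source, 0 < f 0 * f (k x) → ∃ r : ℝ, 0 < r ∧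
        planeForm (𝓡 2) (fun y => L (k y)) x = r • σ x := by
    rcases hf0.lt_or_gt with h | h
    · refine ⟨fun z => - starRingEnd ℂ z, Complex.conjCLE.contDiff.neg, by simp, ?_⟩
      intro x hx hfx
      have hfx' : f (k x) < 0 := by nlinarith
      refine ⟨-(f (k x))⁻¹, by simpa using hfx', ?_⟩
      rw [planeForm_neg_conj (hkd x hx), hfe x hx, smul_smul, neg_mul, inv_mul_cancel₀ hfx'.ne]
      exact (neg_one_smul ℝ _).symm
    · refine ⟨id, contDiff_id, by simp, ?_⟩
      intro x hx hfx
      have hfx' : 0 < f (k x) := by nlinarith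
      refine ⟨(f (k x))⁻¹, by simpa using hfx', ?_⟩
      rw [hfe x hx, smul_smul]
      simp [hfx'.ne']
  set N : Set Circle := {θ | ((θ₀⁻¹ * θ : Circle) : ℂ) ∈ Complex.slitPlane ∧
    (Complex.arg (θ₀⁻¹ * θ : Circle) : ℂ) * Complex.I ∈ e.source} with hN
  have hNo : IsOpen N := by
    have h1 : Continuous fun θ : Circle => ((θ₀⁻¹ * θ : Circle) : ℂ) := by fun_prop
    have h2 : ContinuousOn (fun θ : Circle => (Complex.arg (θ₀⁻¹ * θ : Circle) : ℂ) * Complex.I)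
        {θ | ((θ₀⁻¹ * θ : Circle) : ℂ) ∈ Complex.slitPlane} := by
      refine ContinuousOn.mul (Complex.continuous_ofReal.comp_continuousOn ?_) continuousOn_const
      exact fun θ hθ => (ContinuousAt.comp (f := fun θ : Circle => ((θ₀⁻¹ * θ : Circle) : ℂ))
        (Complex.continuousAt_arg hθ) h1.continuousAt).continuousWithinAt
    exact h2.isOpen_inter_preimage (Complex.isOpen_slitPlane.preimage h1) e.open_source
  have hθN : θ₀ ∈ N := by simp [hN, he0]
  -- Removing the compact set γ(Nᶜ) ensures that γ enters `U` only with parameters close to θ₀,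
  -- where the branch of the argument is valid. Injectivity of γ keeps γ θ₀ in `U`.
  set U := k.source ∩ k ⁻¹' (k.target ∩ f ⁻¹' {y | 0 < f 0 * y}) ∩ (γ '' Nᶜ)ᶜ with hU
  have hUo : IsOpen U := by
    refine (k.isOpen_inter_preimage (hf.continuousOn.isOpen_inter_preimage k.open_target
      (isOpen_lt continuous_const (by fun_prop)))).inter ?_
    exact (hNo.isClosed_compl.isCompact.image hγ.continuous).isClosed.isOpen_compl
  have hkL : ContMDiffOn (𝓡 2) 𝓘(ℝ, ℂ) ∞ (fun y => L (k y)) U :=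
    hLs.contMDiff.comp_contMDiffOn (hk1.mono fun x hx => hx.1.1)
  -- The exponential is holomorphic, hence keeps positivity, and it turns the coordinate t·i of a
  -- point of the curve into its parameter θ₀ exp(it).
  refine ⟨U, fun x => θ₀ * Complex.exp (L (k x)), hUo, ⟨⟨hk0.1, ?_, ?_⟩, ?_⟩, ?_, ?_, ?_⟩
  · exact k.map_source hk0.1
  · simp only [mem_preimage, mem_ofPred_eq, hk0.2]; exact mul_self_pos.2 hf0
  · rintro ⟨θ, hθ, h⟩
    rw [hγi h] at hθ; exact hθ hθN
  · exact (contDiff_const.mul Complex.contDiff_exp).contMDiff.comp_contMDiffOn hkL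
  · intro θ hθ
    have hθN : θ ∈ N := by
      by_contra h
      exact hθ.2 ⟨θ, h, rfl⟩
    have h1 := (hkline _ hθN.2).2
    simp only [hg] at h1
    rw [← eq_mul_circleExp_arg] at h1
    change (θ₀ : ℂ) * Complex.exp (L (k (γ θ))) = θ
    rw [h1, hLl]
    conv_rhs => rw [eq_mul_circleExp_arg θ₀ θ]
    simp
  · intro x hx
    obtain ⟨r, hr, h⟩ := hLf x hx.1.1 hx.1.2.2
    have hd : HasDerivAt (fun z : ℂ => (θ₀ : ℂ) * Complex.exp z) (θ₀ * Complex.exp (L (k x)))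
      (L (k x)) := (Complex.hasDerivAt_exp _).const_mul _
    have hm : MDifferentiableAt (𝓡 2) 𝓘(ℝ, ℂ) (fun y => L (k y)) x :=
      ((hkL x hx).contMDiffAt (hUo.mem_nhds hx)).mdifferentiableAt (by simp)
    refine ⟨Complex.normSq (θ₀ * Complex.exp (L (k x))) * r,
      mul_pos (Complex.normSq_pos.2 (mul_ne_zero (Circle.coe_ne_zero _) (Complex.exp_ne_zero _)))
        hr, ?_⟩
    rw [planeForm_holomorphic (w := fun y => L (k y)) hd hm, h, smul_smul]

end Curve

/-! ### Coordinates along an embedded circle: patching. -/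

section Curve

variable {S : Type u} [TopologicalSpace S] [ChartedSpace (EuclideanSpace ℝ (Fin 2)) S]

/-- Where f vanishes, the derivative of ρ drops out of the product rule. A partition of unity
therefore averages the derivatives of functions which have the same value at the point. -/
theorem mvfderiv_fun_smul_of_eq_zero {ρ : S → ℝ} {f : S → ℂ} {x : S}
    (hρ : MDifferentiableAt (𝓡 2) 𝓘(ℝ, ℝ) ρ x)
    (hf : x ∈ tsupport ρ → MDifferentiableAt (𝓡 2) 𝓘(ℝ, ℂ) f x ∧ f x = 0) :
    MDifferentiableAt (𝓡 2) 𝓘(ℝ, ℂ) (fun y => ρ y • f y) x ∧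
    mvfderiv (𝓡 2) (fun y => ρ y • f y) x = ρ x • mvfderiv (𝓡 2) f x := by
  by_cases h : x ∈ tsupport ρ
  · obtain ⟨h1, h2⟩ := hf h
    refine ⟨hρ.smul h1, ?_⟩
    have h3 := mvfderiv_smul hρ h1
    rw [show (fun y => ρ y • f y) = ρ • f from rfl, h3, h2]
    ext v
    simp
  · have h1 : (fun y => ρ y • f y) =ᶠ[𝓝 x] fun _ => 0 := by
      filter_upwards [(isClosed_tsupport ρ).isOpen_compl.mem_nhds h] with y hy
      rw [image_eq_zero_of_notMem_tsupport hy, zero_smul]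
    refine ⟨(mdifferentiableAt_const).congr_of_eventuallyEq h1, ?_⟩
    rw [mvfderiv_congr h1, image_eq_zero_of_notMem_tsupport h, zero_smul]
    exact mvfderiv_const _

theorem mvfderiv_fun_sum {ι : Type*} (t : Finset ι) {f : ι → S → ℂ} {x : S}
    (hf : ∀ i ∈ t, MDifferentiableAt (𝓡 2) 𝓘(ℝ, ℂ) (f i) x) :
    MDifferentiableAt (𝓡 2) 𝓘(ℝ, ℂ) (fun y => ∑ i ∈ t, f i y) x ∧
    mvfderiv (𝓡 2) (fun y => ∑ i ∈ t, f i y) x = ∑ i ∈ t, mvfderiv (𝓡 2) (f i) x := by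
  classical
  induction t using Finset.induction_on with
  | empty => exact ⟨by simpa using mdifferentiableAt_const, by simpa using mvfderiv_const _⟩
  | insert i t hi ih =>
    obtain ⟨h1, h2⟩ := ih fun j hj => hf j (Finset.mem_insert_of_mem hj)
    have h3 := hf i (Finset.mem_insert_self i t)
    simp only [Finset.sum_insert hi]
    exact ⟨h3.add h1, (mvfderiv_add h3 h1).trans (by rw [h2])⟩

/-- An embedded circle in an oriented closed surface extends to a smooth function which restricts to
the parameter of the circle and is a positive complex coordinate along the circle. -/
theorem exists_extension_along [IsManifold (𝓡 2) ∞ S] [T2Space S] [CompactSpace S] {γ : Circle → S}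
    (hγ : ContMDiff (𝓡 1) (𝓡 2) ∞ γ) (hγi : Function.Injective γ)
    (hγd : ∀ z, Function.Injective (mfderiv (𝓡 1) (𝓡 2) γ z))
    {σ : DiffForm (𝓡 2) S 2} (hσ : σ.IsSmooth) (hσ0 : σ.NowhereZero) :
    ∃ Z : S → ℂ, ContMDiff (𝓡 2) 𝓘(ℝ, ℂ) ∞ Z ∧ (∀ θ, Z (γ θ) = θ) ∧
      ∀ θ, ∃ r : ℝ, 0 < r ∧ σ (γ θ) = r • planeForm (𝓡 2) Z (γ θ) := by
  choose U Zl hUo hU hZs hZγ hZσ using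
    exists_local_coordinate_along hγ hγi hγd hσ hσ0
  obtain ⟨t, ht⟩ := (isCompact_univ (X := Circle)).elim_nhds_subcover (fun θ => γ ⁻¹' U θ)
    fun θ _ => hγ.continuous.continuousAt.preimage_mem_nhds ((hUo θ).mem_nhds (hU θ))
  have hcl : _root_.IsClosed (range γ) := (isCompact_range hγ.continuous).isClosed
  -- The complement of the circle, with the zero function, completes the coordinate domains to a
  -- cover of the surface. It contributes nothing on the circle.
  let W : Option t → Set S := fun o => o.elim (range γ)ᶜ fun θ => U θ
  let F : Option t → S → ℂ := fun o => o.elim (fun _ => 0) fun θ => Zl θ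
  have hWo : ∀ o, IsOpen (W o) := by
    rintro (_ | θ)
    · exact hcl.isOpen_compl
    · exact hUo θ
  have hFs : ∀ o, ContMDiffOn (𝓡 2) 𝓘(ℝ, ℂ) ∞ (F o) (W o) := by
    rintro (_ | θ)
    · exact contMDiffOn_const
    · exact hZs θ
  have hFγ : ∀ o θ, γ θ ∈ W o → F o (γ θ) = θ := by
    rintro (_ | θ') θ h
    · exact absurd (mem_range_self θ) h
    · exact hZγ θ' θ h
  have hFσ : ∀ o θ, γ θ ∈ W o → ∃ r : ℝ, 0 < r ∧ planeForm (𝓡 2) (F o) (γ θ) = r • σ (γ θ) := by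
    rintro (_ | θ') θ h
    · exact absurd (mem_range_self θ) h
    · exact hZσ θ' _ h
  have hcov : (univ : Set S) ⊆ ⋃ o, W o := by
    intro x _
    by_cases hx : x ∈ range γ
    · obtain ⟨θ, rfl⟩ := hx
      obtain ⟨θ', hθ', h⟩ := mem_iUnion₂.1 (ht.2 (mem_univ θ))
      exact mem_iUnion.2 ⟨some ⟨θ', hθ'⟩, h⟩
    · exact mem_iUnion.2 ⟨none, hx⟩
  obtain ⟨ρ, hρ⟩ := SmoothPartitionOfUnity.exists_isSubordinate (𝓡 2) isClosed_univ W hWo hcov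
  have hFd : ∀ o, ∀ x ∈ W o, ContMDiffAt (𝓡 2) 𝓘(ℝ, ℂ) ∞ (F o) x := fun o x hx =>
    (hFs o x hx).contMDiffAt ((hWo o).mem_nhds hx)
  have hsum : ∀ x, ∑ o, ρ o x = 1 := fun x => by
    rw [← finsum_eq_sum_of_fintype]; exact ρ.sum_eq_one (mem_univ x)
  set Z : S → ℂ := fun x => ∑ o, ρ o x • F o x with hZ
  have hZsm : ContMDiff (𝓡 2) 𝓘(ℝ, ℂ) ∞ Z := by
    have := ρ.contMDiff_finsum_smul (n := ⊤) (g := F) fun o x hx => hFd o x (hρ o hx)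
    simpa only [finsum_eq_sum_of_fintype] using this
  have hZγ' : ∀ θ, Z (γ θ) = θ := by
    intro θ
    have h1 : ∀ o, ρ o (γ θ) • F o (γ θ) = ρ o (γ θ) • (θ : ℂ) := by
      intro o
      by_cases h : γ θ ∈ W o
      · rw [hFγ o θ h]
      · rw [image_eq_zero_of_notMem_tsupport fun h' => h (hρ o h'), zero_smul, zero_smul]
    simp only [hZ, h1, ← Finset.sum_smul, hsum, one_smul]
  refine ⟨Z, hZsm, hZγ', fun θ => ?_⟩
  set x := γ θ with hx
  have hρd : ∀ o, MDifferentiableAt (𝓡 2) 𝓘(ℝ, ℝ) (ρ o) x := fun o =>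
    (ρ o).contMDiff.mdifferentiableAt (by simp)
  -- The local functions all take the value θ at `x`. After subtracting θ, the derivatives of the
  -- partition functions do not contribute.
  have hder : mvfderiv (𝓡 2) Z x = ∑ o, ρ o x • mvfderiv (𝓡 2) (F o) x := by
    have h1 : Z = fun y => (∑ o, ρ o y • (F o y - θ)) + (θ : ℂ) := by
      ext y
      simp only [hZ, smul_sub, Finset.sum_sub_distrib, ← Finset.sum_smul, hsum, one_smul,
        sub_add_cancel]
    have h2 : ∀ o, x ∈ tsupport (ρ o) →
        MDifferentiableAt (𝓡 2) 𝓘(ℝ, ℂ) (fun y => F o y - θ) x ∧ F o x - θ = 0 := by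
      intro o ho
      refine ⟨((hFd o x (hρ o ho)).mdifferentiableAt (by simp)).sub mdifferentiableAt_const, ?_⟩
      rw [hFγ o θ (hρ o ho), sub_self]
    have h3 := fun o => mvfderiv_fun_smul_of_eq_zero (hρd o) (h2 o)
    obtain ⟨h4, h5⟩ := mvfderiv_fun_sum Finset.univ fun o _ => (h3 o).1
    rw [h1]
    refine (mvfderiv_add h4 mdifferentiableAt_const).trans ?_
    rw [h5, mvfderiv_const, add_zero]
    refine Finset.sum_congr rfl fun o _ => ?_
    rw [(h3 o).2]
    by_cases ho : x ∈ tsupport (ρ o)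
    · congr 1
      refine (mvfderiv_sub ((hFd o x (hρ o ho)).mdifferentiableAt (by simp))
        mdifferentiableAt_const).trans ?_
      rw [mvfderiv_const, sub_zero]
    · rw [image_eq_zero_of_notMem_tsupport ho, zero_smul, zero_smul]
  have h3 : MDifferentiableAt 𝓘(ℝ, ℝ) (𝓡 1) (fun t : ℝ => θ * Circle.exp t) 0 :=
    (contMDiff_mul_circleExp θ).mdifferentiableAt (by simp)
  have hg : MDifferentiableAt 𝓘(ℝ, ℝ) (𝓡 2) (fun t : ℝ => γ (θ * Circle.exp t)) 0 :=
    (hγ.comp (contMDiff_mul_circleExp θ)).mdifferentiableAt (by simp)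
  have hx0 : γ (θ * Circle.exp 0) = x := by simp [hx]
  set a : TangentSpace (𝓡 2) x :=
    mfderiv 𝓘(ℝ, ℝ) (𝓡 2) (fun t : ℝ => γ (θ * Circle.exp t)) 0 (1 : ℝ) with ha
  have hder_a : ∀ f : S → ℂ, MDifferentiableAt (𝓡 2) 𝓘(ℝ, ℂ) f x →
      (∀ᶠ t in 𝓝 (0 : ℝ), f (γ (θ * Circle.exp t)) = (θ * Circle.exp t : Circle)) →
      mvfderiv (𝓡 2) f x a = Complex.I * θ := by
    intro f hf hft
    rw [← hx0] at hf
    have h1 := mvfderiv_comp' (f := fun t : ℝ => γ (θ * Circle.exp t)) hf hg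
    have h2 : mvfderiv 𝓘(ℝ, ℝ) (fun t : ℝ => f (γ (θ * Circle.exp t))) 0 =
        fderiv ℝ (fun t : ℝ => ((θ * Circle.exp t : Circle) : ℂ)) 0 := by
      rw [mvfderiv_congr hft, mvfderiv_eq_fderiv]
    rw [(hasDerivAt_coe_mul_circleExp θ 0).hasFDerivAt.fderiv] at h2
    have h4 : (1 : ℝ) • (Complex.I * ((θ * Circle.exp 0 : Circle) : ℂ)) =
        mvfderiv (𝓡 2) f (γ (θ * Circle.exp 0)) a :=
      congrArg (fun L => L (1 : ℝ)) (h2.symm.trans h1)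
    simp only [Circle.exp_zero, mul_one, one_smul] at h4
    have h5 : ∀ y (_ : y = x) (v : EuclideanSpace ℝ (Fin 2)),
        (mvfderiv (𝓡 2) f y : EuclideanSpace ℝ (Fin 2) →L[ℝ] ℂ) v =
        (mvfderiv (𝓡 2) f x : EuclideanSpace ℝ (Fin 2) →L[ℝ] ℂ) v := by
      rintro y rfl v; rfl
    exact (h5 _ hx0 a).symm.trans h4.symm
  have hnear : ∀ o, x ∈ W o →
      ∀ᶠ t in 𝓝 (0 : ℝ), F o (γ (θ * Circle.exp t)) = (θ * Circle.exp t : Circle) := by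
    intro o ho
    have hc : ContinuousAt (fun t : ℝ => γ (θ * Circle.exp t)) 0 := hg.continuousAt
    have : W o ∈ 𝓝 (γ (θ * Circle.exp 0)) := by rw [hx0]; exact (hWo o).mem_nhds ho
    filter_upwards [hc.preimage_mem_nhds this] with t ht using hFγ o _ ht
  have hFa : ∀ o, x ∈ W o → mvfderiv (𝓡 2) (F o) x a = Complex.I * θ := fun o ho =>
    hder_a _ ((hFd o x ho).mdifferentiableAt (by simp)) (hnear o ho)
  have hZa : mvfderiv (𝓡 2) Z x a = Complex.I * θ :=
    hder_a Z (hZsm.mdifferentiableAt (by simp)) (Filter.Eventually.of_forall fun t => hZγ' _)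
  have hr : ∀ o, ∃ r : ℝ, 0 < r ∧ (x ∈ W o → planeForm (𝓡 2) (F o) x = r • σ x) := by
    intro o
    by_cases h : x ∈ W o
    · obtain ⟨r, hr, h'⟩ := hFσ o θ h
      exact ⟨r, hr, fun _ => h'⟩
    · exact ⟨1, one_pos, fun h' => absurd h' h⟩
  choose r hr0 hr using hr
  -- Positive determinants need not survive averaging. Here all local coordinates have the same
  -- derivative on the tangent vector `a` of the circle, so the determinant with first vector `a` is
  -- linear in the coordinate and its average keeps the sign.
  have hab : ∀ b, planeForm (𝓡 2) Z x ![a, b] = (∑ o, ρ o x * r o) * σ x ![a, b] := by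
    intro b
    rw [planeForm_apply, Finset.sum_mul, hder]
    simp only [Matrix.cons_val_zero, Matrix.cons_val_one]
    rw [← hder, hZa]
    have h1 : (∑ o, ρ o x • mvfderiv (𝓡 2) (F o) x) b = ∑ o, ρ o x • mvfderiv (𝓡 2) (F o) x b := by
      simp
    rw [hder, h1, Finset.mul_sum, Complex.im_sum]
    refine Finset.sum_congr rfl fun o _ => ?_
    by_cases ho : x ∈ W o
    · have h2 := congrArg (fun L => L ![a, b]) (hr o ho)
      simp only [planeForm_apply, Matrix.cons_val_zero, Matrix.cons_val_one, hFa o ho] at h2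
      have h3 : (r o • σ x) ![a, b] = r o * σ x ![a, b] := rfl
      rw [h3] at h2
      rw [mul_assoc, ← h2, mul_smul_comm, Complex.smul_im, smul_eq_mul]
    · rw [image_eq_zero_of_notMem_tsupport fun h' => ho (hρ o h'), zero_smul]
      simp
  have hR : 0 < ∑ o, ρ o x * r o := by
    have h0 : ∀ o, 0 ≤ ρ o x * r o := fun o => mul_nonneg (ρ.nonneg o x) (hr0 o).le
    refine (Finset.sum_nonneg fun o _ => h0 o).lt_of_ne' fun h => ?_
    rw [Finset.sum_eq_zero_iff_of_nonneg fun o _ => h0 o] at h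
    have h1 : ∀ o, ρ o x = 0 := fun o => by
      simpa [(hr0 o).ne'] using h o (Finset.mem_univ o)
    have := hsum x
    simp [h1] at this
  set R := ∑ o, ρ o x * r o with hRdef
  have ha0 : a ≠ 0 := by
    intro h
    rw [h, map_zero] at hZa
    exact mul_ne_zero Complex.I_ne_zero (Circle.coe_ne_zero θ) hZa.symm
  -- The vector `b` is chosen to have the image i·(iθ) under a local coordinate. Since `a` has the
  -- image iθ, the determinant of the pair is 1.
  have hσab : ∃ b, σ x ![a, b] ≠ 0 := by
    have hxW : ∃ o, x ∈ W o := mem_iUnion.1 (hcov (mem_univ x))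
    obtain ⟨o, ho⟩ := hxW
    have hne : planeForm (𝓡 2) (F o) x ≠ 0 := by
      rw [hr o ho]; exact smul_ne_zero (hr0 o).ne' (hσ0 x)
    obtain ⟨b, hb⟩ := (bijective_of_wedge_ne_zero (by
      change Module.finrank ℝ (EuclideanSpace ℝ (Fin 2)) = 2; simp) hne).2
      (Complex.I * (Complex.I * θ))
    refine ⟨b, fun h => ?_⟩
    have h2 := congrArg (fun L => L ![a, b]) (hr o ho)
    have h3 : (r o • σ x) ![a, b] = r o * σ x ![a, b] := rfl
    simp only [planeForm_apply, Matrix.cons_val_zero, Matrix.cons_val_one, hFa o ho, hb, h3, h,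
      mul_zero] at h2
    have h4 : (starRingEnd ℂ) (Complex.I * θ) * (Complex.I * (Complex.I * θ)) = Complex.I := by
      have h5 : (starRingEnd ℂ) (θ : ℂ) * θ = 1 := by
        rw [mul_comm, Complex.mul_conj, Circle.normSq_coe]; simp
      rw [map_mul, Complex.conj_I]
      linear_combination (-Complex.I * Complex.I * Complex.I) * h5 - Complex.I * Complex.I_sq
    rw [h4] at h2
    simp at h2
  obtain ⟨b, hb⟩ := hσab
  have hne : planeForm (𝓡 2) Z x ≠ 0 := by
    intro h
    have := hab b
    rw [h] at this
    exact mul_ne_zero hR.ne' hb this.symm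
  have hbij := bijective_of_wedge_ne_zero (by
      change Module.finrank ℝ (EuclideanSpace ℝ (Fin 2)) = 2; simp) hne
  obtain ⟨e₀, he₀⟩ := hbij.2 1
  obtain ⟨e₁, he₁⟩ := hbij.2 Complex.I
  have hprop : σ x = σ x ![e₀, e₁] • planeForm (𝓡 2) Z x :=
    eq_smul_wedge_of_bijective hbij (σ x) he₀ he₁
  refine ⟨σ x ![e₀, e₁], ?_, hprop⟩
  have h5 : σ x ![a, b] = σ x ![e₀, e₁] * (R * σ x ![a, b]) := by
    rw [← hab b]
    exact congrArg (fun L => L ![a, b]) hprop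
  have h6 : σ x ![e₀, e₁] * R = 1 := by
    apply mul_right_cancel₀ hb
    rw [one_mul, mul_assoc]; exact h5.symm
  exact pos_of_mul_pos_left (by rw [h6]; exact one_pos) hR.le

end Curve

/-! ### Integrals depending smoothly on parameters. -/

section ParametricIntegral

/-- An integral over the unit interval depends smoothly on parameters. -/
theorem contDiffOn_integral_unitInterval {P : Type*} [NormedAddCommGroup P] [NormedSpace ℝ P]
    {F : P → ℝ → ℝ} {s : Set P} (hs : IsOpen s)
    (hF : ContDiffOn ℝ ∞ (fun q : P × ℝ => F q.1 q.2) (s ×ˢ Ioo (-1) 2)) :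
    ContDiffOn ℝ ∞ (fun p => ∫ t in (0 : ℝ)..1, F p t) s := by
  -- The bump function is 1 on [−1/8, 9/8], which contains [0, 1], and is supported in [−1/2, 3/2],
  -- inside the interval (−1, 2) on which `F` is smooth.
  obtain ⟨χ, hχ⟩ : ∃ χ : ContDiffBump (1 / 2 : ℝ), χ.rIn = 1 / 2 + 1 / 8 ∧ χ.rOut = 1 :=
    ⟨⟨1 / 2 + 1 / 8, 1, by norm_num, by norm_num⟩, rfl, rfl⟩
  have hχ1 : ∀ t ∈ Icc (0 : ℝ) 1, χ t = 1 := fun t ht => by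
    refine χ.one_of_mem_closedBall ?_
    rw [hχ.1, Metric.mem_closedBall, Real.dist_eq, abs_le]
    constructor <;> linarith [ht.1, ht.2]
  have hχt : tsupport χ = Icc (-1 / 2) (3 / 2) := by
    rw [χ.tsupport_eq, hχ.2, Real.closedBall_eq_Icc]; norm_num
  have hG : ContDiffOn ℝ ∞ (fun q : P × ℝ => χ q.2 * F q.1 q.2) (s ×ˢ univ) := by
    rintro ⟨p, t⟩ ⟨hp, -⟩
    by_cases ht : t ∈ tsupport χ
    · have h1 : t ∈ Ioo (-1 : ℝ) 2 := by
        rw [hχt] at ht; constructor <;> linarith [ht.1, ht.2]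
      have h2 := (hF (p, t) ⟨hp, h1⟩).contDiffAt ((hs.prod isOpen_Ioo).mem_nhds ⟨hp, h1⟩)
      exact ((χ.contDiff.contDiffAt.comp (p, t) contDiffAt_snd).mul h2).contDiffWithinAt
    · refine ContDiffAt.contDiffWithinAt ?_
      refine (contDiffAt_const (c := (0 : ℝ))).congr_of_eventuallyEq ?_
      have : (Prod.snd : P × ℝ → ℝ) ⁻¹' (tsupport χ)ᶜ ∈ 𝓝 (p, t) :=
        ((isClosed_tsupport _).isOpen_compl.preimage continuous_snd).mem_nhds ht
      filter_upwards [this] with q hq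
      rw [image_eq_zero_of_notMem_tsupport hq, zero_mul]
  have hloc : MeasureTheory.LocallyIntegrable ((Ioc (0 : ℝ) 1).indicator fun _ => (1 : ℝ)) :=
    ((MeasureTheory.integrable_indicator_iff measurableSet_Ioc).2
      (by simp)).locallyIntegrable
  -- The integral is the value at 1 of the convolution of the indicator of (0, 1] with the cut-off
  -- integrand, and convolution with a compactly supported smooth family is smooth in the
  -- parameters.
  have key := MeasureTheory.contDiffOn_convolution_right_with_param_comp (n := ⊤) (μ := MeasureTheory.volume)
    (ContinuousLinearMap.mul ℝ ℝ) (v := fun _ : P => (1 : ℝ)) contDiffOn_const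
    (g := fun p t => χ t * F p t) (k := Icc (-1 / 2) (3 / 2)) hs isCompact_Icc
    (fun p t _ ht => by
      have h0 : χ t = 0 := image_eq_zero_of_notMem_tsupport (by rwa [hχt])
      simp only [h0, zero_mul]) hloc hG
  refine key.congr fun p hp => ?_
  rw [MeasureTheory.convolution]
  have h1 : ∀ t : ℝ, (ContinuousLinearMap.mul ℝ ℝ ((Ioc (0 : ℝ) 1).indicator (fun _ => 1) t))
      (χ (1 - t) * F p (1 - t)) = (Ioc (0 : ℝ) 1).indicator (fun t => F p (1 - t)) t := by
    intro t
    by_cases ht : t ∈ Ioc (0 : ℝ) 1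
    · rw [indicator_of_mem ht, indicator_of_mem ht,
        hχ1 (1 - t) ⟨by linarith [ht.2], by linarith [ht.1]⟩]
      simp
    · rw [indicator_of_notMem ht, indicator_of_notMem ht]; simp
  simp only [h1]
  rw [MeasureTheory.integral_indicator measurableSet_Ioc,
    ← intervalIntegral.integral_of_le zero_le_one,
    intervalIntegral.integral_comp_sub_left (fun t => F p t)]
  simp

end ParametricIntegral

/-! ### Polar coordinates and radial primitives. -/

section Polar

theorem contDiffAt_log_norm {z : ℂ} (hz : z ≠ 0) :
    ContDiffAt ℝ ∞ (fun z : ℂ => Real.log ‖z‖) z :=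
  (contDiffAt_norm ℝ hz).log (by simpa using hz)

theorem hasFDerivAt_log_norm {z : ℂ} (hz : z ≠ 0) :
    HasFDerivAt (fun z : ℂ => Real.log ‖z‖)
      (Complex.reCLM.comp (ContinuousLinearMap.mul ℝ ℂ z⁻¹)) z := by
  have h1 : ∀ z : ℂ, Real.log ‖z‖ = Real.log (z.re * z.re + z.im * z.im) / 2 := fun z => by
    rw [Complex.norm_def, Complex.normSq_apply, Real.log_sqrt]
    nlinarith [mul_self_nonneg z.re, mul_self_nonneg z.im]
  have hn : z.re * z.re + z.im * z.im ≠ 0 := by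
    rw [← Complex.normSq_apply]; simpa using hz
  have h2 : HasFDerivAt (fun z : ℂ => z.re * z.re + z.im * z.im) _ z :=
    (Complex.reCLM.hasFDerivAt.mul Complex.reCLM.hasFDerivAt).add
      (Complex.imCLM.hasFDerivAt.mul Complex.imCLM.hasFDerivAt)
  have h3 := (h2.log hn).mul_const (2 : ℝ)⁻¹
  have h4 : (fun z : ℂ => Real.log ‖z‖) =
      fun z : ℂ => Real.log (z.re * z.re + z.im * z.im) * (2 : ℝ)⁻¹ := by
    ext z; rw [h1]; ring
  rw [h4]
  refine h3.congr_fderiv ?_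
  ext v
  change (2 : ℝ)⁻¹ * ((z.re * z.re + z.im * z.im)⁻¹ * (z.re * v.re + z.re * v.re +
    (z.im * v.im + z.im * v.im))) = (z⁻¹ * v).re
  rw [Complex.mul_re, Complex.inv_re, Complex.inv_im, Complex.normSq_apply]
  field_simp
  ring

variable {E : Type} [NormedAddCommGroup E] [NormedSpace ℝ E]
  {H : Type*} [TopologicalSpace H] {I : ModelWithCorners ℝ E H}
  {M : Type*} [TopologicalSpace M] [ChartedSpace H M] {x : M}

theorem mvfderiv_log_norm_apply {w : M → ℂ} (hw : MDifferentiableAt I 𝓘(ℝ, ℂ) w x)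
    (h0 : w x ≠ 0) (v : TangentSpace I x) :
    mvfderiv I (fun y => Real.log ‖w y‖) x v = ((w x)⁻¹ * mvfderiv I w x v).re := by
  rw [mvfderiv_comp_of_hasFDerivAt (hasFDerivAt_log_norm h0) hw]; rfl

/-- The pull-back of the cylindrical area form `d log r ∧ dθ` of the punctured plane. -/
def polarForm (I : ModelWithCorners ℝ E H) (w : M → ℂ) : DiffForm I M 2 := fun x =>
  wedge (mvfderiv I (fun y => Real.log ‖w y‖) x) (ang I w x)

/-- This is r dr ∧ dθ = r² · d log r ∧ dθ. -/
theorem planeForm_eq_polarForm {w : M → ℂ} (hw : MDifferentiableAt I 𝓘(ℝ, ℂ) w x)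
    (h0 : w x ≠ 0) : planeForm I w x = Complex.normSq (w x) • polarForm I w x := by
  ext v
  have h1 : (Complex.normSq (w x) • polarForm I w x) v =
    Complex.normSq (w x) * polarForm I w x v := rfl
  rw [h1, planeForm_apply, polarForm, wedge_apply]
  simp only [ang_apply, mvfderiv_log_norm_apply hw h0]
  have h2 : ∀ v, mvfderiv I w x v = w x * ((w x)⁻¹ * mvfderiv I w x v) := fun v => by
    rw [mul_inv_cancel_left₀ h0]
  rw [h2 (v 0), h2 (v 1)]
  simp only [inv_mul_cancel_left₀ h0]
  generalize (w x)⁻¹ * mvfderiv I w x (v 0) = a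
  generalize (w x)⁻¹ * mvfderiv I w x (v 1) = b
  simp [Complex.normSq_apply]
  ring

/-- The differential of s(w) is its radial derivative times d log r plus a multiple of dθ, and dθ
kills the second summand. The radial derivative is the value of s' on the vector w itself. -/
theorem wedge_comp_ang {w : M → ℂ} {s : ℂ → ℝ} {s' : ℂ →L[ℝ] ℝ} (hs : HasFDerivAt s s' (w x))
    (hw : MDifferentiableAt I 𝓘(ℝ, ℂ) w x) (h0 : w x ≠ 0) :
    wedge (mvfderiv I (fun y => s (w y)) x) (ang I w x) = s' (w x) • polarForm I w x := by
  ext v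
  have h1 : (s' (w x) • polarForm I w x) v = s' (w x) * polarForm I w x v := rfl
  rw [h1, polarForm, wedge_apply, wedge_apply]
  simp only [ang_apply, mvfderiv_log_norm_apply hw h0, mvfderiv_comp_of_hasFDerivAt hs hw]
  have h2 : ∀ v, s' (mvfderiv I w x v) =
      ((w x)⁻¹ * mvfderiv I w x v).re * s' (w x) +
      ((w x)⁻¹ * mvfderiv I w x v).im * s' (Complex.I * w x) := fun v => by
    have h3 : mvfderiv I w x v = ((w x)⁻¹ * mvfderiv I w x v).re • w x +
        ((w x)⁻¹ * mvfderiv I w x v).im • (Complex.I * w x) := by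
      have h4 : mvfderiv I w x v = ((w x)⁻¹ * mvfderiv I w x v) * w x := by
        field_simp
      conv_lhs => rw [h4, ← Complex.re_add_im ((w x)⁻¹ * mvfderiv I w x v)]
      simp only [Complex.real_smul]
      ring
    conv_lhs => rw [h3]
    rw [map_add, map_smul, map_smul, smul_eq_mul, smul_eq_mul]
  change s' (mvfderiv I w x (v 0)) * _ - s' (mvfderiv I w x (v 1)) * _ = _
  rw [h2, h2]
  ring

/-- The open annulus of logarithmic width `2 * ε` around the unit circle. -/
def annulus (ε : ℝ) : Set ℂ := {z | z ≠ 0 ∧ |Real.log ‖z‖| < ε}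

theorem isOpen_annulus (ε : ℝ) : IsOpen (annulus ε) := by
  rw [isOpen_iff_mem_nhds]
  rintro z ⟨hz, h⟩
  filter_upwards [isOpen_ne.mem_nhds hz,
    (contDiffAt_log_norm hz).continuousAt.abs.eventually_lt continuousAt_const h] with y h1 h2
  exact ⟨h1, h2⟩

theorem coe_mem_annulus (θ : Circle) {ε : ℝ} (hε : 0 < ε) : (θ : ℂ) ∈ annulus ε :=
  ⟨Circle.coe_ne_zero θ, by rw [Circle.norm_coe, Real.log_one, abs_zero]; exact hε⟩

theorem annulus_mono {ε δ : ℝ} (h : ε ≤ δ) : annulus ε ⊆ annulus δ :=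
  fun _ hz => ⟨hz.1, hz.2.trans_le h⟩

theorem exp_log_norm_mul (z : ℂ) (hz : z ≠ 0) :
    ∃ θ : Circle, z = Real.exp (Real.log ‖z‖) * θ := by
  refine ⟨Circle.exp z.arg, ?_⟩
  rw [Real.exp_log (norm_pos_iff.2 hz), Circle.coe_exp, Complex.norm_mul_exp_arg_mul_I]

/-- A neighbourhood of the unit circle contains an annulus. -/
theorem exists_annulus_subset {V : Set ℂ} (hV : IsOpen V) (h : ∀ θ : Circle, (θ : ℂ) ∈ V) :
    ∃ ε > 0, annulus ε ⊆ V := by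
  have hc : Continuous fun p : Circle × ℝ => (Real.exp p.2 : ℂ) * p.1 := by fun_prop
  obtain ⟨u, v, -, hv, hu, hv0, huv⟩ := generalized_tube_lemma (s := (univ : Set Circle))
    isCompact_univ (t := {(0 : ℝ)}) isCompact_singleton (hV.preimage hc) (by
      rintro ⟨θ, t⟩ ⟨-, rfl⟩; simpa using h θ)
  obtain ⟨ε, hε, hεv⟩ := Metric.isOpen_iff.1 hv 0 (hv0 rfl)
  refine ⟨ε, hε, fun z hz => ?_⟩
  obtain ⟨θ, hθ⟩ := exp_log_norm_mul z hz.1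
  rw [hθ]
  exact huv (a := (θ, Real.log ‖z‖)) ⟨hu (mem_univ θ), hεv (by simpa using hz.2)⟩

end Polar

/-- A radial primitive: on an annulus, a function `s` with `r ∂s/∂r = f`, vanishing on the unit
circle. -/
theorem exists_radial_primitive {f : ℂ → ℝ} {ε : ℝ} (hf : ContDiffOn ℝ ∞ f (annulus ε))
    (hε : 0 < ε) : ∃ s : ℂ → ℝ, ContDiffOn ℝ ∞ s (annulus (ε / 2)) ∧
      (∀ θ : Circle, s θ = 0) ∧ ∀ z ∈ annulus (ε / 2), fderiv ℝ s z z = f z := by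
  -- The point on the ray through z whose logarithmic radius is t·log‖z‖: for t = 0 it lies on the
  -- unit circle, for t = 1 it is z.
  set g : ℂ → ℝ → ℂ := fun z t => (Real.exp (t * Real.log ‖z‖ - Real.log ‖z‖) : ℂ) * z with hg
  have hgn : ∀ z ≠ 0, ∀ t, g z t ≠ 0 ∧ Real.log ‖g z t‖ = t * Real.log ‖z‖ := by
    intro z hz t
    have h1 : ‖z‖ ≠ 0 := norm_ne_zero_iff.2 hz
    constructor
    · simp [hg, hz]
    · simp only [hg]
      rw [norm_mul, Complex.norm_real, Real.norm_of_nonneg (Real.exp_pos _).le,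
        Real.log_mul (Real.exp_pos _).ne' h1, Real.log_exp]
      ring
  -- Smooth dependence of the integral requires t slightly beyond [0, 1]. For |t| < 2 the
  -- logarithmic radius at most doubles, which is why the annulus is halved.
  have hgm : ∀ q ∈ annulus (ε / 2) ×ˢ Ioo (-1 : ℝ) 2, g q.1 q.2 ∈ annulus ε := by
    rintro ⟨z, t⟩ ⟨hz, ht⟩
    obtain ⟨h1, h2⟩ := hgn z hz.1 t
    refine ⟨h1, ?_⟩
    simp only
    rw [h2, abs_mul]
    have h3 : |t| < 2 := abs_lt.2 ⟨by linarith [ht.1], ht.2⟩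
    have h4 := hz.2
    nlinarith [abs_nonneg (Real.log ‖z‖), abs_nonneg t]
  have hlog : ContDiffOn ℝ ∞ (fun z : ℂ => Real.log ‖z‖) (annulus (ε / 2)) := fun z hz =>
    (contDiffAt_log_norm hz.1).contDiffWithinAt
  have hgs : ContDiffOn ℝ ∞ (fun q : ℂ × ℝ => g q.1 q.2) (annulus (ε / 2) ×ˢ Ioo (-1 : ℝ) 2) := by
    have h1 : ContDiffOn ℝ ∞ (fun q : ℂ × ℝ => Real.log ‖q.1‖)
        (annulus (ε / 2) ×ˢ Ioo (-1 : ℝ) 2) :=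
      hlog.comp contDiffOn_fst fun q hq => hq.1
    exact (Complex.ofRealCLM.contDiff.comp_contDiffOn
      (Real.contDiff_exp.comp_contDiffOn ((contDiffOn_snd.mul h1).sub h1))).mul contDiffOn_fst
  have hint := contDiffOn_integral_unitInterval (isOpen_annulus (ε / 2))
    (F := fun z t => f (g z t)) (hf.comp hgs hgm)
  -- After substitution this is the integral of f along the ray with respect to log r, starting at
  -- the unit circle. Writing it over the fixed interval [0, 1] makes smoothness in z accessible.
  set s : ℂ → ℝ := fun z => Real.log ‖z‖ * ∫ t in (0 : ℝ)..1, f (g z t) with hs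
  have hss : ContDiffOn ℝ ∞ s (annulus (ε / 2)) := hlog.mul hint
  refine ⟨s, hss, fun θ => by
    simp only [hs]; rw [Circle.norm_coe, Real.log_one, zero_mul], fun z hz => ?_⟩
  set l := Real.log ‖z‖ with hl
  have h1 : ∀ τ : ℝ, s (Real.exp τ * z) =
      ∫ t in (0 : ℝ)..(τ + l), f ((Real.exp (t - l) : ℂ) * z) := by
    intro τ
    have h2 : Real.log ‖(Real.exp τ : ℂ) * z‖ = τ + l := by
      rw [norm_mul, Complex.norm_real, Real.norm_of_nonneg (Real.exp_pos _).le,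
        Real.log_mul (Real.exp_pos _).ne' (norm_ne_zero_iff.2 hz.1), Real.log_exp]
    have h3 := intervalIntegral.mul_integral_comp_mul_right (a := 0) (b := 1)
      (f := fun t : ℝ => f ((Real.exp (t - l) : ℂ) * z)) (τ + l)
    rw [zero_mul, one_mul] at h3
    rw [← h3]
    simp only [hs, hg, h2]
    congr 1
    refine intervalIntegral.integral_congr fun t _ => ?_
    rw [← mul_assoc, ← Complex.ofReal_mul, ← Real.exp_add]
    congr 4
    ring
  -- The radial derivative is obtained by scaling z by e^τ and differentiating at τ = 0, once by the
  -- chain rule and once by the fundamental theorem of calculus.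
  have h4 : HasDerivAt (fun τ : ℝ => s (Real.exp τ * z)) (fderiv ℝ s z z) 0 := by
    have h5 : HasDerivAt (fun τ : ℝ => (Real.exp τ : ℂ) * z) z 0 := by
      have := ((Real.hasDerivAt_exp 0).ofReal_comp).mul_const z
      simpa using this
    have h6 : HasFDerivAt s (fderiv ℝ s z) ((Real.exp 0 : ℝ) * z) := by
      rw [Real.exp_zero, Complex.ofReal_one, one_mul]
      exact (((hss z hz).contDiffAt ((isOpen_annulus _).mem_nhds hz)).differentiableAt
        (by simp)).hasFDerivAt
    exact h6.comp_hasDerivAt (0 : ℝ) h5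
  set φ : ℝ → ℝ := fun t => f ((Real.exp (t - l) : ℂ) * z) with hφ
  have hφm : ∀ t, |t| < ε → (Real.exp (t - l) : ℂ) * z ∈ annulus ε := by
    intro t ht
    refine ⟨mul_ne_zero (by exact_mod_cast (Real.exp_pos _).ne') hz.1, ?_⟩
    rw [norm_mul, Complex.norm_real, Real.norm_of_nonneg (Real.exp_pos _).le,
        Real.log_mul (Real.exp_pos _).ne' (norm_ne_zero_iff.2 hz.1), Real.log_exp,
        sub_add_cancel]
    exact ht
  have hφc : ContinuousOn φ {t | |t| < ε} := by
    refine hf.continuousOn.comp (Continuous.continuousOn (by fun_prop)) hφm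
  have hle : |l| < ε := hz.2.trans (by linarith)
  have hopen : IsOpen {t : ℝ | |t| < ε} := isOpen_lt continuous_abs continuous_const
  have h7 : HasDerivAt (fun u => ∫ t in (0 : ℝ)..u, φ t) (φ l) l := by
    refine intervalIntegral.integral_hasDerivAt_right ?_ ?_ (hφc.continuousAt (hopen.mem_nhds hle))
    · refine (hφc.mono fun t ht => ?_).intervalIntegrable
      have := Set.abs_sub_left_of_mem_uIcc ht
      simp only [sub_zero] at this
      exact this.trans_lt hle
    · exact hφc.stronglyMeasurableAtFilter hopen l hle
  have h8 : HasDerivAt (fun τ : ℝ => s (Real.exp τ * z)) (φ l) 0 := by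
    have : (fun τ : ℝ => s (Real.exp τ * z)) = fun τ => ∫ t in (0 : ℝ)..(τ + l), φ t :=
      funext h1
    rw [this]
    have h9 : HasDerivAt (fun τ : ℝ => τ + l) 1 0 := (hasDerivAt_id 0).add_const l
    have h7' : HasDerivAt (fun u => ∫ t in (0 : ℝ)..u, φ t) (φ l) (0 + l) := by rwa [zero_add]
    have h10 := h7'.comp (0 : ℝ) h9
    rw [mul_one] at h10
    exact h10
  rw [h4.unique h8]
  simp [hφ]

/-! ### Annular normal form of an area form near a circle. -/

section Annulus

variable {S : Type u} [TopologicalSpace S] [ChartedSpace (EuclideanSpace ℝ (Fin 2)) S]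
  [IsManifold (𝓡 2) ∞ S] [T2Space S]

/-- The standard form of an area form near an embedded circle. -/
theorem exists_annular_coordinate [CompactSpace S] {γ : Circle → S}
    (hγ : ContMDiff (𝓡 1) (𝓡 2) ∞ γ) (hγi : Function.Injective γ)
    (hγd : ∀ z, Function.Injective (mfderiv (𝓡 1) (𝓡 2) γ z))
    {σ : DiffForm (𝓡 2) S 2} (hσ : σ.IsSmooth) (hσ0 : σ.NowhereZero) :
    ∃ (ε : ℝ) (e : OpenPartialHomeomorph S ℂ), 0 < ε ∧ e.target = annulus ε ∧
      ContMDiffOn (𝓡 2) 𝓘(ℝ, ℂ) ∞ e e.source ∧ ContMDiffOn 𝓘(ℝ, ℂ) (𝓡 2) ∞ e.symm e.target ∧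
      (∀ θ, γ θ ∈ e.source ∧ e (γ θ) = θ) ∧ ∀ x ∈ e.source, σ x = polarForm (𝓡 2) e x := by
  have hfin : ∀ x : S, Module.finrank ℝ (TangentSpace (𝓡 2) x) = 2 := fun x => by
    change Module.finrank ℝ (EuclideanSpace ℝ (Fin 2)) = 2; simp
  obtain ⟨Z, hZ, hZγ, hZσ⟩ := exists_extension_along hγ hγi hγd hσ hσ0
  have hK : IsCompact (range γ) := isCompact_range hγ.continuous
  have hne : (range γ).Nonempty := range_nonempty γ
  -- On the circle `Z` is injective with invertible derivative, so it is a coordinate on a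
  -- neighbourhood of the circle.
  obtain ⟨e₁, h1K, h1O, h1Z, h1s⟩ := exists_openPartialHomeomorph_of_bijective
    (isOpen_setOf_planeForm_ne_zero hZ) hZ.contMDiffOn
    (fun x hx => bijective_of_wedge_ne_zero (hfin x) hx) hK (by
      rintro _ ⟨θ, rfl⟩ h0
      obtain ⟨r, -, h⟩ := hZσ θ
      rw [h0, smul_zero] at h
      exact hσ0 _ h) (by
      rintro _ ⟨θ, rfl⟩ _ ⟨θ', rfl⟩ h
      rw [hZγ, hZγ] at h
      rw [Circle.ext h]) hne
  have h1s' : ContMDiffOn (𝓡 2) 𝓘(ℝ, ℂ) ∞ e₁ e₁.source := by rw [h1Z]; exact hZ.contMDiffOn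
  have h1γ : ∀ θ, γ θ ∈ e₁.source := fun θ => h1K (mem_range_self θ)
  obtain ⟨f, hf, hfσ⟩ := exists_density (by simp) hσ e₁ h1s' h1s
  have hfθ : ∀ θ : Circle, 0 < f θ := by
    intro θ
    obtain ⟨r, hr, h⟩ := hZσ θ
    have h2 := hfσ _ (h1γ θ)
    rw [h1Z, hZγ, h] at h2
    have h3 : planeForm (𝓡 2) Z (γ θ) ≠ 0 := by
      intro h0; rw [h0, smul_zero] at h; exact hσ0 _ h
    rwa [← smul_left_injective ℝ h3 h2]
  have hV : IsOpen (e₁.target ∩ f ⁻¹' Ioi 0) :=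
    hf.continuousOn.isOpen_inter_preimage e₁.open_target isOpen_Ioi
  obtain ⟨ε, hε, hεV⟩ := exists_annulus_subset hV fun θ =>
    ⟨by have := e₁.map_source (h1γ θ); rwa [h1Z, hZγ] at this, hfθ θ⟩
  have hF : ContDiffOn ℝ ∞ (fun z => f z * Complex.normSq z) (annulus ε) := by
    refine (hf.mono fun z hz => (hεV hz).1).mul (ContDiff.contDiffOn ?_)
    have : ⇑Complex.normSq = fun z => z.re * z.re + z.im * z.im :=
      funext Complex.normSq_apply
    rw [this]
    exact (Complex.reCLM.contDiff.mul Complex.reCLM.contDiff).add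
      (Complex.imCLM.contDiff.mul Complex.imCLM.contDiff)
  -- In the coordinate Z the form is f·|z|² · d log r ∧ dθ. A function s with radial derivative
  -- f·|z|² turns this into ds ∧ dθ.
  obtain ⟨s, hs, hs0, hsd⟩ := exists_radial_primitive hF hε
  set A := annulus (ε / 2) with hA
  have hAo : IsOpen A := isOpen_annulus _
  set O := e₁.source ∩ e₁ ⁻¹' A with hO
  have hOo : IsOpen O := e₁.isOpen_inter_preimage hAo
  -- The angle of Z is kept and the logarithmic radius is replaced by s. As s vanishes on the unit
  -- circle, w still restricts to the parameter along γ.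
  set w : S → ℂ := fun x => ((Real.exp (s (Z x)) / ‖Z x‖ : ℝ) : ℂ) * Z x with hw
  have hZA : ∀ x ∈ O, Z x ∈ A := fun x hx => by have := hx.2; rwa [h1Z] at this
  have hrad : ContDiffOn ℝ ∞ (fun z : ℂ => Real.exp (s z) / ‖z‖) A := by
    refine (Real.contDiff_exp.comp_contDiffOn hs).div (fun z hz => ?_) fun z hz => ?_
    · exact (contDiffAt_norm ℝ hz.1).contDiffWithinAt
    · exact norm_ne_zero_iff.2 hz.1
  have hws : ContMDiffOn (𝓡 2) 𝓘(ℝ, ℂ) ∞ w O := by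
    have h2 : ContDiffOn ℝ ∞ (fun z : ℂ => ((Real.exp (s z) / ‖z‖ : ℝ) : ℂ) * z) A :=
      (Complex.ofRealCLM.contDiff.comp_contDiffOn hrad).mul contDiffOn_id
    exact h2.contMDiffOn.comp hZ.contMDiffOn hZA
  have hwn : ∀ x ∈ O, w x ≠ 0 ∧ Real.log ‖w x‖ = s (Z x) := by
    intro x hx
    have h2 : ‖Z x‖ ≠ 0 := norm_ne_zero_iff.2 (hZA x hx).1
    have h3 : ‖w x‖ = Real.exp (s (Z x)) := by
      simp only [hw]
      rw [norm_mul, Complex.norm_real, Real.norm_of_nonneg (by positivity), div_mul_cancel₀ _ h2]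
    refine ⟨norm_ne_zero_iff.1 (by rw [h3]; exact (Real.exp_pos _).ne'), by rw [h3, Real.log_exp]⟩
  have hwd : ∀ x ∈ O, MDifferentiableAt (𝓡 2) 𝓘(ℝ, ℂ) w x := fun x hx =>
    ((hws x hx).contMDiffAt (hOo.mem_nhds hx)).mdifferentiableAt (by simp)
  have hZd : ∀ x, MDifferentiableAt (𝓡 2) 𝓘(ℝ, ℂ) Z x := fun x =>
    hZ.mdifferentiableAt (by simp)
  have hwσ : ∀ x ∈ O, polarForm (𝓡 2) w x = σ x := by
    intro x hx
    have hz := hZA x hx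
    have h2 : HasFDerivAt s (fderiv ℝ s (Z x)) (Z x) :=
      (((hs _ hz).contDiffAt (hAo.mem_nhds hz)).differentiableAt (by simp)).hasFDerivAt
    have h3 : ang (𝓡 2) w x = ang (𝓡 2) Z x := by
      refine ang_ofReal_mul ?_ (hZd x) ?_ hz.1
      · exact ((hrad _ hz).contDiffAt (hAo.mem_nhds hz)).differentiableAt (by simp)
          |>.mdifferentiableAt.comp x (hZd x)
      · have := norm_pos_iff.2 hz.1
        positivity
    have h4 : mvfderiv (𝓡 2) (fun y => Real.log ‖w y‖) x =
        mvfderiv (𝓡 2) (fun y => s (Z y)) x := by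
      refine mvfderiv_congr ?_
      filter_upwards [hOo.mem_nhds hx] with y hy using (hwn y hy).2
    rw [polarForm, h3, h4, wedge_comp_ang h2 (hZd x) hz.1, hsd _ hz, hfσ x hx.1, h1Z,
      planeForm_eq_polarForm (hZd x) hz.1, smul_smul]
  have hwγ : ∀ θ, w (γ θ) = θ := fun θ => by
    simp only [hw, hZγ, hs0]
    rw [Circle.norm_coe]; simp
  have hγO : ∀ θ, γ θ ∈ O := fun θ => ⟨h1γ θ, by
    rw [mem_preimage, h1Z, hZγ]; exact coe_mem_annulus θ (by linarith)⟩
  obtain ⟨e₂, h2K, h2O, h2w, h2s⟩ := exists_openPartialHomeomorph_of_bijective hOo hws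
    (fun x hx => bijective_of_wedge_ne_zero (hfin x) (by
      change planeForm (𝓡 2) w x ≠ 0
      rw [planeForm_eq_polarForm (hwd x hx) (hwn x hx).1, hwσ x hx]
      exact smul_ne_zero (by simpa using (hwn x hx).1) (hσ0 x))) hK
    (by rintro _ ⟨θ, rfl⟩; exact hγO θ) (by
      rintro _ ⟨θ, rfl⟩ _ ⟨θ', rfl⟩ h
      rw [hwγ, hwγ] at h
      rw [Circle.ext h]) hne
  have h2γ : ∀ θ, γ θ ∈ e₂.source := fun θ => h2K (mem_range_self θ)
  obtain ⟨δ, hδ, hδV⟩ := exists_annulus_subset e₂.open_target fun θ => by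
    have := e₂.map_source (h2γ θ); rwa [h2w, hwγ] at this
  have hres := e₂.isOpen_inter_preimage (isOpen_annulus δ)
  let e := e₂.restrOpen _ hres
  have hesrc : e.source ⊆ O := fun x hx => h2O hx.1
  have het : e.target = annulus δ := by
    ext z
    constructor
    · intro hz
      have h3 := e.map_target hz
      have h4 : e (e.symm z) = z := e.right_inv hz
      rw [← h4]; exact h3.2.2
    · intro hz
      have h3 := hδV hz
      have h5 : e₂.symm z ∈ e.source := ⟨e₂.map_target h3, e₂.map_target h3, by
        rw [mem_preimage, e₂.right_inv h3]; exact hz⟩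
      have h6 := e.map_source h5
      have h7 : e (e₂.symm z) = z := e₂.right_inv h3
      rwa [h7] at h6
  have hew : ⇑e = w := h2w
  refine ⟨δ, e, hδ, het, ?_, ?_, fun θ => ⟨⟨h2γ θ, h2γ θ, ?_⟩, ?_⟩, fun x hx => ?_⟩
  · rw [hew]; exact hws.mono hesrc
  · refine h2s.mono ?_
    rw [het]; exact hδV
  · rw [mem_preimage, h2w, hwγ]; exact coe_mem_annulus θ hδ
  · rw [hew]; exact hwγ θ
  · rw [hew]; exact (hwσ x (hesrc hx)).symm

end Annulus

/-! ### Modification of nonvanishing functions near a closed set. -/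

section Modification

variable {S : Type u} [TopologicalSpace S] [ChartedSpace (EuclideanSpace ℝ (Fin 2)) S]

theorem ContMDiffOn.cexp {f : S → ℂ} {O : Set S} (hf : ContMDiffOn (𝓡 2) 𝓘(ℝ, ℂ) ∞ f O) :
    ContMDiffOn (𝓡 2) 𝓘(ℝ, ℂ) ∞ (fun x => Complex.exp (f x)) O :=
  (Complex.contDiff_exp (𝕜 := ℝ)).contMDiff.comp_contMDiffOn hf

theorem ContMDiffOn.clog {f : S → ℂ} {O : Set S} (hf : ContMDiffOn (𝓡 2) 𝓘(ℝ, ℂ) ∞ f O)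
    (h : ∀ x ∈ O, f x ∈ Complex.slitPlane) :
    ContMDiffOn (𝓡 2) 𝓘(ℝ, ℂ) ∞ (fun x => Complex.log (f x)) O := by
  have h1 : ContDiffOn ℝ ∞ Complex.log Complex.slitPlane := fun z hz =>
    ((Complex.contDiffAt_log hz).restrict_scalars ℝ).contDiffWithinAt
  exact h1.contMDiffOn.comp hf h

theorem ContMDiffOn.cinv {f : S → ℂ} {O : Set S} (hf : ContMDiffOn (𝓡 2) 𝓘(ℝ, ℂ) ∞ f O)
    (h : ∀ x ∈ O, f x ≠ 0) :
    ContMDiffOn (𝓡 2) 𝓘(ℝ, ℂ) ∞ (fun x => (f x)⁻¹) O := by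
  have h1 : ContDiffOn ℝ ∞ (fun z : ℂ => z⁻¹) {z | z ≠ 0} := fun z hz =>
    (contDiffAt_inv ℝ hz).contDiffWithinAt
  exact h1.contMDiffOn.comp hf h

theorem ContMDiffOn.cmul {f g : S → ℂ} {O : Set S} (hf : ContMDiffOn (𝓡 2) 𝓘(ℝ, ℂ) ∞ f O)
    (hg : ContMDiffOn (𝓡 2) 𝓘(ℝ, ℂ) ∞ g O) :
    ContMDiffOn (𝓡 2) 𝓘(ℝ, ℂ) ∞ (fun x => f x * g x) O :=
  (contDiff_fst.mul contDiff_snd : ContDiff ℝ ∞ fun p : ℂ × ℂ => p.1 * p.2).contMDiff.comp_contMDiffOn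
    (hf.prodMk_space hg)

variable [IsManifold (𝓡 2) ∞ S] [T2Space S] [CompactSpace S]

/-- If `h = g * exp v` on `N \ Z`, then `h` can be modified inside `N` such that it agrees with `g`
near `Z`. -/
theorem exists_modification {Z N O : Set S} (hZ : _root_.IsClosed Z) (hN : IsOpen N) (hZN : Z ⊆ N)
    (hO : IsOpen O) {h g v : S → ℂ}
    (hh : ContMDiffOn (𝓡 2) 𝓘(ℝ, ℂ) ∞ h O) (hh0 : ∀ x ∈ O, h x ≠ 0)
    (hg : ContMDiffOn (𝓡 2) 𝓘(ℝ, ℂ) ∞ g N) (hg0 : ∀ x ∈ N, g x ≠ 0)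
    (hv : ContMDiffOn (𝓡 2) 𝓘(ℝ, ℂ) ∞ v (N \ Z))
    (hgv : ∀ x ∈ N \ Z, h x = g x * Complex.exp (v x)) :
    ∃ (h' : S → ℂ) (C N' : Set S), _root_.IsClosed C ∧ C ⊆ N ∧ IsOpen N' ∧ Z ⊆ N' ∧ N' ⊆ N ∧
      (∀ x ∉ C, h' x = h x) ∧ (∀ x ∈ N', h' x = g x) ∧
      ContMDiffOn (𝓡 2) 𝓘(ℝ, ℂ) ∞ h' (O \ Z ∪ N) ∧ ∀ x ∈ O \ Z ∪ N, h' x ≠ 0 := by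
  obtain ⟨t, ht, htc, htN⟩ := exists_mem_nhdsSet_isClosed_subset (hN.mem_nhdsSet.2 hZN) hZ
  obtain ⟨χ, hχ1, hχ0, -⟩ := exists_contMDiffMap_one_nhds_of_subset_interior (𝓡 2) (n := ⊤) hZ
    (subset_interior_iff_mem_nhdsSet.2 ht)
  obtain ⟨N₁, hN₁, hZN₁, hN₁χ⟩ := mem_nhdsSet_iff_exists.1 hχ1
  have htχ : ∀ x ∉ t, χ x = 0 := hχ0
  have hZt : Z ⊆ t := subset_of_mem_nhdsSet ht
  classical
  -- The factor exp((1 − χ) v) interpolates, through nonvanishing functions, between g near Z and h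
  -- where χ vanishes. On Z nothing is known about v, so g itself is used there.
  set h' : S → ℂ := fun x => if x ∈ N then
    (if x ∈ Z then g x else g x * Complex.exp ((1 - χ x : ℝ) * v x)) else h x with hh'
  have e1 : ∀ x ∉ t, h' x = h x := by
    intro x hx
    by_cases hxN : x ∈ N
    · have hxZ : x ∉ Z := fun h => hx (hZt h)
      simp only [hh', if_pos hxN, if_neg hxZ, htχ x hx]
      rw [hgv x ⟨hxN, hxZ⟩]; simp
    · simp only [hh', if_neg hxN]
  have e2 : ∀ x ∈ N₁ ∩ N, h' x = g x := by
    intro x hx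
    simp only [hh', if_pos hx.2]
    split_ifs with hxZ
    · rfl
    · rw [show χ x = 1 from hN₁χ hx.1]; simp
  have e3 : ∀ x ∈ N \ Z, h' x = g x * Complex.exp ((1 - χ x : ℝ) * v x) := by
    intro x hx
    simp only [hh', if_pos hx.1, if_neg hx.2]
  have hNZ : IsOpen (N \ Z) := hN.sdiff hZ
  have s3 : ContMDiffOn (𝓡 2) 𝓘(ℝ, ℂ) ∞ h' (N \ Z) := by
    refine ContMDiffOn.congr ?_ e3
    refine ContMDiffOn.cmul (hg.mono sdiff_subset) (ContMDiffOn.cexp (ContMDiffOn.cmul ?_ hv))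
    have h1 : ContMDiff (𝓡 2) 𝓘(ℝ, ℂ) ∞ (fun x => ((1 - χ x : ℝ) : ℂ)) :=
      (Complex.ofRealCLM.contDiff.comp (contDiff_const.sub contDiff_id) :
        ContDiff ℝ ∞ fun t : ℝ => ((1 - t : ℝ) : ℂ)).contMDiff.comp χ.contMDiff
    exact h1.contMDiffOn
  have s2 : ContMDiffOn (𝓡 2) 𝓘(ℝ, ℂ) ∞ h' (N₁ ∩ N) :=
    (hg.mono inter_subset_right).congr e2
  have s1 : ContMDiffOn (𝓡 2) 𝓘(ℝ, ℂ) ∞ h' (O ∩ tᶜ) :=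
    (hh.mono inter_subset_left).congr fun x hx => e1 x hx.2
  refine ⟨h', t, N₁ ∩ N, htc, htN, hN₁.inter hN, subset_inter hZN₁ hZN, inter_subset_right,
    e1, e2, ?_, ?_⟩
  · intro x hx
    refine ContMDiffAt.contMDiffWithinAt ?_
    by_cases hxZ : x ∈ Z
    · exact (s2 x ⟨hZN₁ hxZ, hZN hxZ⟩).contMDiffAt
        ((hN₁.inter hN).mem_nhds ⟨hZN₁ hxZ, hZN hxZ⟩)
    · by_cases hxN : x ∈ N
      · exact (s3 x ⟨hxN, hxZ⟩).contMDiffAt (hNZ.mem_nhds ⟨hxN, hxZ⟩)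
      · have h1 : x ∈ O ∩ tᶜ := ⟨(hx.resolve_right hxN).1, fun h => hxN (htN h)⟩
        exact (s1 x h1).contMDiffAt ((hO.inter htc.isOpen_compl).mem_nhds h1)
  · intro x hx
    by_cases hxN : x ∈ N
    · by_cases hxZ : x ∈ Z
      · rw [e2 x ⟨hZN₁ hxZ, hxN⟩]; exact hg0 x hxN
      · rw [e3 x ⟨hxN, hxZ⟩]; exact mul_ne_zero (hg0 x hxN) (Complex.exp_ne_zero _)
    · rw [e1 x fun h => hxN (htN h)]
      exact hh0 x (hx.resolve_right hxN).1

end Modification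

/-! ### Positive charts and their comparison. -/

section PositiveChart

variable {S : Type u} [TopologicalSpace S] [ChartedSpace (EuclideanSpace ℝ (Fin 2)) S]

/-- A complex valued chart of a surface which is positive with respect to an area form. -/
structure IsPositiveChart (σ : DiffForm (𝓡 2) S 2) (e : OpenPartialHomeomorph S ℂ) : Prop where
  smooth : ContMDiffOn (𝓡 2) 𝓘(ℝ, ℂ) ∞ e e.source
  symm_smooth : ContMDiffOn 𝓘(ℝ, ℂ) (𝓡 2) ∞ e.symm e.target
  pos : ∀ x ∈ e.source, ∃ r : ℝ, 0 < r ∧ planeForm (𝓡 2) e x = r • σ x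

/-- A linear map of the plane with positive determinant is homotopic to a complex linear one. -/
theorem exists_re_div_pos {F : ℂ → ℂ} {F' : ℂ →L[ℝ] ℂ} (hF : HasFDerivAt F F' 0) (h0 : F 0 = 0)
    (hdet : 0 < ((starRingEnd ℂ) (F' 1) * F' Complex.I).im) :
    ∃ a : ℂ, a ≠ 0 ∧ ∀ᶠ w in 𝓝 (0 : ℂ), w ≠ 0 → 0 < (F w / (a * w)).re := by
  -- The complex linear and antilinear parts of the derivative. The determinant is |α|² − |β|², so
  -- positivity makes the linear part dominate and keeps F w / (α w) within distance 1 of 1.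
  set α : ℂ := (F' 1 - Complex.I * F' Complex.I) / 2 with hα
  set β : ℂ := (F' 1 + Complex.I * F' Complex.I) / 2 with hβ
  have hlin : ∀ w, F' w = α * w + β * (starRingEnd ℂ) w := by
    intro w
    have h1 : w = w.re • (1 : ℂ) + w.im • Complex.I := by simp [Complex.re_add_im]
    have h2 : F' w = w.re * F' 1 + w.im * F' Complex.I := by
      conv_lhs => rw [h1]
      rw [map_add, map_smul, map_smul]; simp
    have h3 : (starRingEnd ℂ) w = w.re - w.im * Complex.I := by
      apply Complex.ext <;> simp
    have h4 : w = w.re + w.im * Complex.I := (Complex.re_add_im w).symm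
    rw [h2, h3, hα, hβ]
    conv_rhs => rw [h4]
    simp only [Complex.add_re, Complex.ofReal_re, Complex.mul_re, Complex.I_re, Complex.ofReal_im,
      Complex.I_im, Complex.add_im, Complex.mul_im]
    push_cast
    linear_combination (w.im * F' Complex.I) * Complex.I_sq
  have hαβ : ‖β‖ < ‖α‖ := by
    refine lt_of_pow_lt_pow_left₀ 2 (norm_nonneg _) ?_
    rw [← Complex.normSq_eq_norm_sq, ← Complex.normSq_eq_norm_sq, ← sub_pos]
    have : Complex.normSq α - Complex.normSq β = ((starRingEnd ℂ) (F' 1) * F' Complex.I).im := by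
      rw [hα, hβ]
      generalize F' 1 = a
      generalize F' Complex.I = b
      simp [Complex.normSq_apply]
      ring
    rw [this]; exact hdet
  have hα0 : 0 < ‖α‖ := (norm_nonneg _).trans_lt hαβ
  refine ⟨α, norm_pos_iff.1 hα0, ?_⟩
  have hlo := hF.isLittleO.def (sub_pos.2 hαβ |> half_pos)
  filter_upwards [hlo] with w hw hw0
  rw [h0, sub_zero, sub_zero, hlin] at hw
  have hwn : 0 < ‖w‖ := norm_pos_iff.2 hw0
  have h1 : ‖F w - α * w‖ < ‖α * w‖ := by
    have h2 : F w - α * w = (F w - (α * w + β * (starRingEnd ℂ) w)) + β * (starRingEnd ℂ) w := by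
      ring
    have h3 : ‖β * (starRingEnd ℂ) w‖ = ‖β‖ * ‖w‖ := by rw [norm_mul, RCLike.norm_conj]
    rw [h2]
    refine (norm_add_le _ _).trans_lt ?_
    rw [h3, norm_mul]
    nlinarith
  have h4 : ‖F w / (α * w) - 1‖ < 1 := by
    have h5 : α * w ≠ 0 := mul_ne_zero (norm_pos_iff.1 hα0) hw0
    rw [div_sub_one h5, norm_div, div_lt_one (norm_pos_iff.2 h5)]
    exact h1
  have h6 := (Complex.abs_re_le_norm _).trans_lt h4
  rw [Complex.sub_re, Complex.one_re, abs_lt] at h6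
  linarith [h6.1]

/-- Two positive charts around a point differ by the exponential of a function. -/
theorem IsPositiveChart.exists_eq_mul_exp {σ : DiffForm (𝓡 2) S 2}
    {e e' : OpenPartialHomeomorph S ℂ} (he : IsPositiveChart σ e) (he' : IsPositiveChart σ e')
    {q : S} (hq : q ∈ e.source) (hq' : q ∈ e'.source) :
    ∃ (N : Set S) (v : S → ℂ), IsOpen N ∧ q ∈ N ∧ N ⊆ e.source ∩ e'.source ∧
      ContMDiffOn (𝓡 2) 𝓘(ℝ, ℂ) ∞ v (N \ {q}) ∧
      ∀ x ∈ N \ {q}, e' x - e' q = (e x - e q) * Complex.exp (v x) := by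
  set F : ℂ → ℂ := fun w => e' (e.symm (w + e q)) - e' q with hF
  have hz := e.map_source hq
  have hd : MDifferentiableAt 𝓘(ℝ, ℂ) (𝓡 2) e.symm (e q) :=
    ((he.symm_smooth _ hz).contMDiffAt (e.open_target.mem_nhds hz)).mdifferentiableAt (by simp)
  have hd' : MDifferentiableAt (𝓡 2) 𝓘(ℝ, ℂ) e' q :=
    ((he'.smooth _ hq').contMDiffAt (e'.open_source.mem_nhds hq')).mdifferentiableAt (by simp)
  set L := mfderiv 𝓘(ℝ, ℂ) (𝓡 2) e.symm (e q) with hL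
  have hcomp : HasMFDerivAt 𝓘(ℝ, ℂ) 𝓘(ℝ, ℂ) (e' ∘ e.symm) (e q)
      ((mfderiv (𝓡 2) 𝓘(ℝ, ℂ) e' q).comp L) := by
    have h1 : HasMFDerivAt (𝓡 2) 𝓘(ℝ, ℂ) e' (e.symm (e q)) (mfderiv (𝓡 2) 𝓘(ℝ, ℂ) e' q) := by
      rw [e.left_inv hq]; exact hd'.hasMFDerivAt
    exact h1.comp (e q) hd.hasMFDerivAt
  have hF0 : HasFDerivAt F ((mvfderiv (𝓡 2) e' q).comp L : ℂ →L[ℝ] ℂ) 0 := by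
    have h1 : HasFDerivAt (e' ∘ e.symm) ((mvfderiv (𝓡 2) e' q).comp L : ℂ →L[ℝ] ℂ) (0 + e q) := by
      rw [zero_add]; exact hcomp.hasFDerivAt
    exact ((h1.comp (0 : ℂ) ((hasFDerivAt_id (0 : ℂ)).add_const (e q))).congr_fderiv
      (ContinuousLinearMap.comp_id _)).sub_const _
  obtain ⟨hk, -⟩ := mvfderiv_symm_apply e he.smooth he.symm_smooth hq
  obtain ⟨r, hr, hrσ⟩ := he.pos q hq
  obtain ⟨r', hr', hrσ'⟩ := he'.pos q hq'
  obtain ⟨a, ha, hpos⟩ := exists_re_div_pos hF0 (by simp [hF, e.left_inv hq]) (by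
    have h1 := congrArg (fun A => A ![L (1 : ℂ), L Complex.I]) hrσ
    have h2 := congrArg (fun A => A ![L (1 : ℂ), L Complex.I]) hrσ'
    change planeForm (𝓡 2) e q ![L (1 : ℂ), L Complex.I] =
      r * σ q ![L (1 : ℂ), L Complex.I] at h1
    change planeForm (𝓡 2) e' q ![L (1 : ℂ), L Complex.I] =
      r' * σ q ![L (1 : ℂ), L Complex.I] at h2
    rw [planeForm_apply] at h1 h2
    change ((starRingEnd ℂ) (mvfderiv (𝓡 2) e q (L (1 : ℂ))) *
      mvfderiv (𝓡 2) e q (L Complex.I)).im = _ at h1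
    change ((starRingEnd ℂ) (mvfderiv (𝓡 2) e' q (L (1 : ℂ))) *
      mvfderiv (𝓡 2) e' q (L Complex.I)).im = _ at h2
    rw [hk, hk] at h1
    change 0 < ((starRingEnd ℂ) (mvfderiv (𝓡 2) e' q (L (1 : ℂ))) *
      mvfderiv (𝓡 2) e' q (L Complex.I)).im
    rw [h2]
    have h3 : r * σ q ![L (1 : ℂ), L Complex.I] = 1 := by rw [← h1]; simp
    exact mul_pos hr' (pos_of_mul_pos_right (by rw [h3]; exact one_pos) hr.le))
  have hc : ContinuousAt (fun x => e x - e q) q := (e.continuousAt hq).sub continuousAt_const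
  have hev : ∀ᶠ x in 𝓝 q, x ∈ e.source ∧ x ∈ e'.source ∧
      (e x - e q ≠ 0 → 0 < (F (e x - e q) / (a * (e x - e q))).re) := by
    have h1 : Filter.Tendsto (fun x => e x - e q) (𝓝 q) (𝓝 0) := by
      have := hc.tendsto; simpa using this
    filter_upwards [e.open_source.mem_nhds hq, e'.open_source.mem_nhds hq', h1.eventually hpos]
      with x h2 h3 h4 using ⟨h2, h3, h4⟩
  obtain ⟨N, hN, hNo, hqN⟩ := eventually_nhds_iff.1 hev
  have hFe : ∀ x ∈ N, F (e x - e q) = e' x - e' q := fun x hx => by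
    simp [hF, e.left_inv (hN x hx).1]
  have hne : ∀ x ∈ N \ {q}, e x - e q ≠ 0 := fun x hx h =>
    hx.2 (e.injOn (hN x hx.1).1 hq (sub_eq_zero.1 h))
  have hre : ∀ x ∈ N \ {q}, 0 < ((e' x - e' q) / (a * (e x - e q))).re := fun x hx => by
    rw [← hFe x hx.1]; exact (hN x hx.1).2.2 (hne x hx)
  have hsub : N \ {q} ⊆ e.source := fun x hx => (hN x hx.1).1
  have hsub' : N \ {q} ⊆ e'.source := fun x hx => (hN x hx.1).2.1
  -- The quotient of the two centred coordinates, normalized by a, has positive real part, so its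
  -- principal logarithm is smooth on the punctured neighbourhood.
  refine ⟨N, fun x => Complex.log ((e' x - e' q) * (a * (e x - e q))⁻¹) + Complex.log a, hNo, hqN,
    fun x hx => ⟨(hN x hx).1, (hN x hx).2.1⟩, ?_, ?_⟩
  · refine ContMDiffOn.add (ContMDiffOn.clog ?_ fun x hx => Or.inl (hre x hx)) contMDiffOn_const
    refine ContMDiffOn.cmul ((he'.smooth.mono hsub').sub contMDiffOn_const) ?_
    refine ContMDiffOn.cinv (ContMDiffOn.cmul contMDiffOn_const
      ((he.smooth.mono hsub).sub contMDiffOn_const)) fun x hx => mul_ne_zero ha (hne x hx)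
  · intro x hx
    have h1 := hne x hx
    have h2 : (e' x - e' q) * (a * (e x - e q))⁻¹ ≠ 0 := fun h => by
      have := hre x hx
      rw [div_eq_mul_inv, h] at this; simp at this
    rw [Complex.exp_add, Complex.exp_log h2, Complex.exp_log ha]
    field_simp

/-- Restrict a chart to the set where its density has the same sign as at p, and reflect it if that
sign is negative. -/
theorem exists_isPositiveChart [IsManifold (𝓡 2) ∞ S] {σ : DiffForm (𝓡 2) S 2}
    (hσ : σ.IsSmooth) (hσ0 : σ.NowhereZero) (p : S) :
    ∃ e : OpenPartialHomeomorph S ℂ, IsPositiveChart σ e ∧ p ∈ e.source := by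
  obtain ⟨c1, c2⟩ := planeChart_smooth p
  have hp := mem_planeChart_source p
  obtain ⟨f, hf, hfσ⟩ := exists_density (by simp) hσ (planeChart p) c1 c2
  set c := planeChart p with hc
  have hf0 : f (c p) ≠ 0 := by
    intro h; apply hσ0 p; rw [hfσ p hp, h, zero_smul]
  have hcd : ∀ x ∈ c.source, MDifferentiableAt (𝓡 2) 𝓘(ℝ, ℂ) c x := fun x hx =>
    ((c1 x hx).contMDiffAt (c.open_source.mem_nhds hx)).mdifferentiableAt (by simp)
  rcases hf0.lt_or_gt with h | h
  · set U := c.source ∩ c ⁻¹' (c.target ∩ f ⁻¹' Iio 0) with hU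
    have hUo : IsOpen U := c.isOpen_inter_preimage
      (hf.continuousOn.isOpen_inter_preimage c.open_target isOpen_Iio)
    let n : ℂ ≃ₜ ℂ := Complex.conjCLE.toHomeomorph.trans (Homeomorph.neg ℂ)
    have hn : ContDiff ℝ ∞ (fun z : ℂ => - (starRingEnd ℂ) z) := Complex.conjCLE.contDiff.neg
    have hn' : ContDiff ℝ ∞ (fun z : ℂ => (starRingEnd ℂ) (-z)) :=
      Complex.conjCLE.contDiff.comp contDiff_neg
    refine ⟨(c.restrOpen U hUo).trans n.toOpenPartialHomeomorph, ⟨?_, ?_, ?_⟩, ?_⟩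
    · exact hn.contMDiff.comp_contMDiffOn (c1.mono fun x hx => hx.1.1)
    · exact c2.comp hn'.contMDiff.contMDiffOn fun z hz => hz.2.1
    · intro x hx
      have hxU : x ∈ U := hx.1.2
      have hfx : f (c x) < 0 := hxU.2.2
      refine ⟨-(f (c x))⁻¹, by simpa using hfx, ?_⟩
      refine (planeForm_neg_conj (hcd x hxU.1)).trans ?_
      rw [hfσ x hxU.1, smul_smul, neg_mul, inv_mul_cancel₀ hfx.ne]
      exact (neg_one_smul ℝ _).symm
    · exact ⟨⟨hp, hp, c.map_source hp, h⟩, mem_univ _⟩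
  · set U := c.source ∩ c ⁻¹' (c.target ∩ f ⁻¹' Ioi 0) with hU
    have hUo : IsOpen U := c.isOpen_inter_preimage
      (hf.continuousOn.isOpen_inter_preimage c.open_target isOpen_Ioi)
    refine ⟨c.restrOpen U hUo, ⟨c1.mono fun x hx => hx.1, c2.mono fun z hz => hz.1, ?_⟩,
      ⟨hp, hp, c.map_source hp, h⟩⟩
    intro x hx
    have hfx : 0 < f (c x) := hx.2.2.2
    refine ⟨(f (c x))⁻¹, by simpa using hfx, ?_⟩
    change planeForm (𝓡 2) c x = _
    rw [hfσ x hx.1, smul_smul, inv_mul_cancel₀ hfx.ne']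
    exact (one_smul ℝ _).symm

end PositiveChart

/-! ### Functions with one zero and one pole. -/

section Dipole

variable {S : Type u} [TopologicalSpace S] [ChartedSpace (EuclideanSpace ℝ (Fin 2)) S]

/-- The function `h` has a simple positive zero at `p`. -/
def HasZero (σ : DiffForm (𝓡 2) S 2) (p : S) (h : S → ℂ) : Prop :=
  ∃ (c : OpenPartialHomeomorph S ℂ) (N : Set S) (v : S → ℂ), IsPositiveChart σ c ∧ IsOpen N ∧
    p ∈ N ∧ N ⊆ c.source ∧ ContMDiffOn (𝓡 2) 𝓘(ℝ, ℂ) ∞ v (N \ {p}) ∧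
    ∀ x ∈ N \ {p}, h x = (c x - c p) * Complex.exp (v x)

variable {σ : DiffForm (𝓡 2) S 2} {p q : S} {h g : S → ℂ}

theorem exists_eq_exp {u : S → ℂ} {N : Set S} (hN : IsOpen N) (hp : p ∈ N)
    (hu : ContMDiffOn (𝓡 2) 𝓘(ℝ, ℂ) ∞ u N) (h0 : u p ≠ 0) :
    ∃ (N' : Set S) (v : S → ℂ), IsOpen N' ∧ p ∈ N' ∧ N' ⊆ N ∧
      ContMDiffOn (𝓡 2) 𝓘(ℝ, ℂ) ∞ v N' ∧ ∀ x ∈ N', u x = Complex.exp (v x) := by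
  have hc : ContMDiffOn (𝓡 2) 𝓘(ℝ, ℂ) ∞ (fun x => u x * (u p)⁻¹) N :=
    ContMDiffOn.cmul hu contMDiffOn_const
  refine ⟨N ∩ (fun x => u x * (u p)⁻¹) ⁻¹' Complex.slitPlane,
    fun x => Complex.log (u x * (u p)⁻¹) + Complex.log (u p),
    hc.continuousOn.isOpen_inter_preimage hN Complex.isOpen_slitPlane,
    ⟨hp, by simp [h0]⟩, inter_subset_left, ?_, ?_⟩
  · exact (ContMDiffOn.clog (hc.mono inter_subset_left) fun x hx => hx.2).add contMDiffOn_const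
  · intro x hx
    rw [Complex.exp_add, Complex.exp_log (Complex.slitPlane_ne_zero hx.2), Complex.exp_log h0]
    field_simp

theorem HasZero.congr (hh : HasZero σ p h) {O : Set S} (hO : IsOpen O) (hp : p ∈ O)
    (hg : ∀ x ∈ O \ {p}, g x = h x) : HasZero σ p g := by
  obtain ⟨c, N, v, hc, hN, hpN, hNc, hv, hhv⟩ := hh
  refine ⟨c, N ∩ O, v, hc, hN.inter hO, ⟨hpN, hp⟩, inter_subset_left.trans hNc,
    hv.mono (sdiff_subset_sdiff_left inter_subset_left), fun x hx => ?_⟩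
  rw [hg x ⟨hx.1.2, hx.2⟩, hhv x ⟨hx.1.1, hx.2⟩]

/-- Near p the nonvanishing factor is an exponential and is absorbed into the exponent. -/
theorem HasZero.mul (hh : HasZero σ p h) {u : S → ℂ} {O : Set S} (hO : IsOpen O) (hp : p ∈ O)
    (hu : ContMDiffOn (𝓡 2) 𝓘(ℝ, ℂ) ∞ u O) (h0 : u p ≠ 0) : HasZero σ p fun x => h x * u x := by
  obtain ⟨c, N, v, hc, hN, hpN, hNc, hv, hhv⟩ := hh
  obtain ⟨N', v', hN', hpN', hN'O, hv', huv'⟩ := exists_eq_exp hO hp hu h0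
  refine ⟨c, N ∩ N', fun x => v x + v' x, hc, hN.inter hN', ⟨hpN, hpN'⟩,
    inter_subset_left.trans hNc, ?_, fun x hx => ?_⟩
  · exact (hv.mono (sdiff_subset_sdiff_left inter_subset_left)).add
      (hv'.mono fun x hx => hx.1.2)
  · change h x * u x = (c x - c p) * Complex.exp (v x + v' x)
    rw [hhv x ⟨hx.1.1, hx.2⟩, huv' x hx.1.2, Complex.exp_add, mul_assoc]

theorem IsPositiveChart.hasZero {c : OpenPartialHomeomorph S ℂ} (hc : IsPositiveChart σ c)
    (hp : p ∈ c.source) : HasZero σ p fun x => c x - c p :=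
  ⟨c, c.source, fun _ => 0, hc, c.open_source, hp, Subset.rfl, contMDiffOn_const, by simp⟩

/-- Zeros and poles cancel. -/
theorem HasZero.mul_inv (hh : HasZero σ p h) (hg : HasZero σ p fun x => (g x)⁻¹) :
    ∃ (N : Set S) (v : S → ℂ), IsOpen N ∧ p ∈ N ∧ ContMDiffOn (𝓡 2) 𝓘(ℝ, ℂ) ∞ v (N \ {p}) ∧
      ∀ x ∈ N \ {p}, h x * g x = Complex.exp (v x) := by
  obtain ⟨c, N, v, hc, hN, hpN, hNc, hv, hhv⟩ := hh
  obtain ⟨c', N', v', hc', hN', hpN', hNc', hv', hgv'⟩ := hg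
  obtain ⟨M, w, hM, hpM, hMc, hw, hcw⟩ := hc.exists_eq_mul_exp hc' (hNc hpN) (hNc' hpN')
  refine ⟨N ∩ N' ∩ M, fun x => v x - v' x - w x, (hN.inter hN').inter hM, ⟨⟨hpN, hpN'⟩, hpM⟩,
    ?_, fun x hx => ?_⟩
  · exact ((hv.mono fun x hx => ⟨hx.1.1.1, hx.2⟩).sub (hv'.mono fun x hx => ⟨hx.1.1.2, hx.2⟩)).sub
      (hw.mono fun x hx => ⟨hx.1.2, hx.2⟩)
  · have h1 := hhv x ⟨hx.1.1.1, hx.2⟩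
    have h2 : (g x)⁻¹ = (c' x - c' p) * Complex.exp (v' x) := hgv' x ⟨hx.1.1.2, hx.2⟩
    have h3 := hcw x ⟨hx.1.2, hx.2⟩
    have h4 : c x - c p ≠ 0 := fun h =>
      hx.2 (c.injOn (hMc hx.1.2).1 (hMc hpM).1 (sub_eq_zero.1 h))
    change h x * g x = Complex.exp (v x - v' x - w x)
    have h7 : Complex.exp (v x - v' x - w x) =
        Complex.exp (v x) * (Complex.exp (v' x))⁻¹ * (Complex.exp (w x))⁻¹ := by
      rw [Complex.exp_sub, Complex.exp_sub, div_eq_mul_inv, div_eq_mul_inv]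
    rw [h7, h1, ← inv_inv (g x), h2, h3]
    have h5 := Complex.exp_ne_zero (v' x)
    have h6 := Complex.exp_ne_zero (w x)
    field_simp

/-- The function `h` is smooth and nonvanishing outside of a positive zero at `p` and a
positive pole at `q`, and equal to `1` near `K`. -/
structure IsDipole (σ : DiffForm (𝓡 2) S 2) (K : Set S) (p q : S) (h : S → ℂ) : Prop where
  smooth : ContMDiffOn (𝓡 2) 𝓘(ℝ, ℂ) ∞ h {p, q}ᶜ
  ne_zero : ∀ x ∈ ({p, q}ᶜ : Set S), h x ≠ 0
  eq_one : ∃ N, IsOpen N ∧ K ⊆ N ∧ ∀ x ∈ N, h x = 1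
  zero : HasZero σ p h
  pole : HasZero σ q fun x => (h x)⁻¹

theorem IsDipole.symm {K : Set S} (hh : IsDipole σ K p q h) :
    IsDipole σ K q p fun x => (h x)⁻¹ where
  smooth := by rw [pair_comm]; exact ContMDiffOn.cinv hh.smooth hh.ne_zero
  ne_zero x hx := inv_ne_zero (hh.ne_zero x (by rwa [pair_comm]))
  eq_one := by
    obtain ⟨N, hN, hK, h1⟩ := hh.eq_one
    exact ⟨N, hN, hK, fun x hx => by rw [h1 x hx, inv_one]⟩
  zero := hh.pole
  pole := by simpa only [inv_inv] using hh.zero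

variable [IsManifold (𝓡 2) ∞ S] [T2Space S] [CompactSpace S]

/-- In the product, the pole of h and the zero of g at q cancel up to an exponential factor, so the
product can be changed to 1 near q. The change is confined to a set which avoids K, p and r. -/
theorem IsDipole.trans {K : Set S} (hK : _root_.IsClosed K) {r : S} (hpq : p ≠ q) (hqr : q ≠ r)
    (hpr : p ≠ r) (hqK : q ∉ K) (hh : IsDipole σ K p q h) (hg : IsDipole σ K q r g) :
    ∃ f, IsDipole σ K p r f := by
  obtain ⟨N, v, hN, hqN, hv, hhg⟩ := hg.zero.mul_inv hh.pole
  have hO : IsOpen ({p, q, r}ᶜ : Set S) := (toFinite _).isClosed.isOpen_compl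
  have hpr' : IsOpen ({p, r}ᶜ : Set S) := (toFinite _).isClosed.isOpen_compl
  have hN₁ : IsOpen (N ∩ Kᶜ ∩ {p, r}ᶜ) := (hN.inter hK.isOpen_compl).inter hpr'
  have hs : ContMDiffOn (𝓡 2) 𝓘(ℝ, ℂ) ∞ (fun x => g x * h x) {p, q, r}ᶜ :=
    ContMDiffOn.cmul (hg.smooth.mono fun x hx => by simp at hx ⊢; tauto)
      (hh.smooth.mono fun x hx => by simp at hx ⊢; tauto)
  obtain ⟨f, C, N', hC, hCN, hN', hqN', -, hfC, -, hfs, hf0⟩ :=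
    exists_modification (Z := {q}) (g := fun _ => 1) isClosed_singleton hN₁
      (by simp [hqN, hqK, hpq.symm, hqr]) hO hs
      (fun x hx => mul_ne_zero (hg.ne_zero x (by simp at hx ⊢; tauto))
        (hh.ne_zero x (by simp at hx ⊢; tauto)))
      contMDiffOn_const (fun _ _ => one_ne_zero)
      (hv.mono fun x hx => ⟨hx.1.1.1, hx.2⟩)
      (fun x hx => by rw [one_mul]; exact hhg x ⟨hx.1.1.1, hx.2⟩)
  have hsub : ({p, r}ᶜ : Set S) ⊆ {p, q, r}ᶜ \ {q} ∪ N ∩ Kᶜ ∩ {p, r}ᶜ := by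
    intro x hx
    by_cases hxq : x = q
    · right; subst hxq; exact ⟨⟨hqN, hqK⟩, hx⟩
    · left; simp at hx ⊢; tauto
  have hpC : p ∉ C := fun h => (hCN h).2 (by simp)
  have hrC : r ∉ C := fun h => (hCN h).2 (by simp)
  refine ⟨f, hfs.mono hsub, fun x hx => hf0 x (hsub hx), ?_, ?_, ?_⟩
  · obtain ⟨N₁, h1, h2, h3⟩ := hh.eq_one
    obtain ⟨N₂, h4, h5, h6⟩ := hg.eq_one
    refine ⟨N₁ ∩ N₂ ∩ Cᶜ, (h1.inter h4).inter hC.isOpen_compl, ?_, ?_⟩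
    · exact subset_inter (subset_inter h2 h5) fun x hx hxC => (hCN hxC).1.2 hx
    · rintro x ⟨⟨hx1, hx2⟩, hx3⟩
      rw [hfC x hx3, h3 x hx1, h6 x hx2, one_mul]
  · have hqr' : IsOpen ({q, r}ᶜ : Set S) := (toFinite _).isClosed.isOpen_compl
    have hpm : p ∈ ({q, r}ᶜ : Set S) := by simp [hpq, hpr]
    refine (hh.zero.mul hqr' hpm hg.smooth (hg.ne_zero p hpm)).congr hC.isOpen_compl hpC ?_
    intro x hx
    rw [hfC x hx.1, mul_comm]
  · have hqr' : IsOpen ({p, q}ᶜ : Set S) := (toFinite _).isClosed.isOpen_compl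
    have hrm : r ∈ ({p, q}ᶜ : Set S) := by simp [hqr.symm, hpr.symm]
    refine (hg.pole.mul hqr' hrm (ContMDiffOn.cinv hh.smooth hh.ne_zero)
      (inv_ne_zero (hh.ne_zero r hrm))).congr hC.isOpen_compl hrC ?_
    intro x hx
    rw [hfC x hx.1, mul_inv]

theorem one_sub_mem_slitPlane {z : ℂ} (hz : ‖z‖ < 1) : 1 - z ∈ Complex.slitPlane := by
  left
  have := (Complex.re_le_norm z).trans_lt hz
  simpa using this

/-- In a disc take t / (t − b), where t is the coordinate centred at p and b is its value at q. For
‖t‖ > ρ > ‖b‖ this is exp(−log(1 − b/t)), so it can be changed into the constant 1 away from the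
disc of radius 2ρ. -/
theorem exists_isDipole_of_near {K : Set S} {e : OpenPartialHomeomorph S ℂ}
    (he : IsPositiveChart σ e) (hp : p ∈ e.source) {ρ : ℝ} (hρ : 0 < ρ)
    (hρe : Metric.closedBall (e p) (2 * ρ) ⊆ e.target)
    (hρK : ∀ x ∈ e.source, e x ∈ Metric.closedBall (e p) (2 * ρ) → x ∉ K)
    (hq : q ∈ e.source) (hpq : p ≠ q) (hqρ : e q ∈ Metric.ball (e p) ρ) :
    ∃ f, IsDipole σ K p q f := by
  set b : ℂ := e q - e p with hb
  have hb0 : b ≠ 0 := fun h => hpq (e.injOn hq hp (sub_eq_zero.1 h)).symm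
  have hbρ : ‖b‖ < ρ := by simpa [dist_eq_norm] using hqρ
  set t : S → ℂ := fun x => e x - e p with ht
  have hts : ContMDiffOn (𝓡 2) 𝓘(ℝ, ℂ) ∞ t e.source := he.smooth.sub contMDiffOn_const
  have htb : ∀ x, t x - b = e x - e q := fun x => by simp [ht, hb]
  have ht0 : ∀ x ∈ e.source, x ≠ p → t x ≠ 0 := fun x hx hxp h =>
    hxp (e.injOn hx hp (sub_eq_zero.1 h))
  have htb0 : ∀ x ∈ e.source, x ≠ q → t x - b ≠ 0 := fun x hx hxq h =>
    hxq (e.injOn hx hq (sub_eq_zero.1 (by rwa [← htb])))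
  have htbs : ContMDiffOn (𝓡 2) 𝓘(ℝ, ℂ) ∞ (fun x => t x - b) e.source :=
    hts.sub contMDiffOn_const
  have hO : IsOpen (e.source ∩ {p, q}ᶜ) :=
    e.open_source.inter (toFinite _).isClosed.isOpen_compl
  set Z : Set S := (e.source ∩ e ⁻¹' Metric.ball (e p) (2 * ρ))ᶜ with hZ
  have hZc : _root_.IsClosed Z := (e.isOpen_inter_preimage Metric.isOpen_ball).isClosed_compl
  have hDsub : Metric.closedBall (e p) ρ ⊆ Metric.closedBall (e p) (2 * ρ) :=
    Metric.closedBall_subset_closedBall (by linarith)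
  set N : Set S := (e.symm '' Metric.closedBall (e p) ρ)ᶜ with hN
  have hNo : IsOpen N := ((isCompact_closedBall (e p) ρ).image_of_continuousOn
    (e.symm.continuousOn.mono (hDsub.trans hρe))).isClosed.isOpen_compl
  have hNmem : ∀ x ∈ e.source, ‖t x‖ ≤ ρ → x ∉ N := fun x hx hxt hxN =>
    hxN ⟨e x, by simpa [dist_eq_norm, ht] using hxt, e.left_inv hx⟩
  have hNnot : ∀ x, x ∉ N → x ∈ e.source ∧ ‖t x‖ ≤ ρ := by
    intro x hx
    obtain ⟨z, hz, rfl⟩ := not_notMem.1 hx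
    have hz' := hρe (hDsub hz)
    refine ⟨e.map_target hz', ?_⟩
    simp only [ht]
    rw [e.right_inv hz', ← dist_eq_norm]; exact hz
  have hZN : Z ⊆ N := by
    intro x hxZ
    by_contra hxN
    obtain ⟨h1, h2⟩ := hNnot x hxN
    refine hxZ ⟨h1, ?_⟩
    rw [mem_preimage, Metric.mem_ball, dist_eq_norm]
    exact h2.trans_lt (by linarith)
  have hNZ : ∀ x ∈ N \ Z, x ∈ e.source ∧ ρ < ‖t x‖ := by
    intro x hx
    have h1 := (not_notMem.1 hx.2).1
    exact ⟨h1, not_le.1 fun h => hNmem x h1 h hx.1⟩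
  have hNZt : ∀ x ∈ N \ Z, t x ≠ 0 := fun x hx =>
    norm_pos_iff.1 (hρ.trans (hNZ x hx).2)
  have hslit : ∀ x ∈ N \ Z, 1 - b * (t x)⁻¹ ∈ Complex.slitPlane := by
    intro x hx
    have h1 := (hNZ x hx).2
    refine one_sub_mem_slitPlane ?_
    rw [norm_mul, norm_inv, ← div_eq_mul_inv, div_lt_one (hρ.trans h1)]
    exact hbρ.trans h1
  obtain ⟨f, C, N', hC, hCN, hN', hZN', -, hfC, hf1, hfs, hf0⟩ :=
    exists_modification (h := fun x => t x * (t x - b)⁻¹) (g := fun _ => 1)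
      (v := fun x => -Complex.log (1 - b * (t x)⁻¹)) hZc hNo hZN hO
      (ContMDiffOn.cmul (hts.mono inter_subset_left) (ContMDiffOn.cinv
        (htbs.mono inter_subset_left) fun x hx => htb0 x hx.1 fun h => hx.2 (by simp [h])))
      (fun x hx => mul_ne_zero (ht0 x hx.1 fun h => hx.2 (by simp [h]))
        (inv_ne_zero (htb0 x hx.1 fun h => hx.2 (by simp [h]))))
      contMDiffOn_const (fun _ _ => one_ne_zero)
      (by
        refine ContMDiffOn.neg (ContMDiffOn.clog (contMDiffOn_const.sub
          (ContMDiffOn.cmul contMDiffOn_const (ContMDiffOn.cinv ?_ hNZt))) hslit)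
        exact hts.mono fun x hx => (hNZ x hx).1)
      (fun x hx => by
        have h1 := hNZt x hx
        have h2 := Complex.slitPlane_ne_zero (hslit x hx)
        have h3 : t x - b ≠ 0 := by
          intro h; apply h2; rw [← sub_eq_zero.1 h, mul_inv_cancel₀ h1, sub_self]
        rw [one_mul, Complex.exp_neg, Complex.exp_log h2]
        field_simp)
  have hsub : ({p, q}ᶜ : Set S) ⊆ (e.source ∩ {p, q}ᶜ) \ Z ∪ N := by
    intro x hx
    by_cases hxN : x ∈ N
    · exact Or.inr hxN
    · exact Or.inl ⟨⟨(hNnot x hxN).1, hx⟩, fun h => hxN (hZN h)⟩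
  have hpC : p ∉ C := fun h => hNmem p hp (by simp [ht, hρ.le]) (hCN h)
  have hqC : q ∉ C := fun h => hNmem q hq hbρ.le (hCN h)
  refine ⟨f, hfs.mono hsub, fun x hx => hf0 x (hsub hx), ⟨N', hN', ?_, hf1⟩, ?_, ?_⟩
  · refine Subset.trans ?_ hZN'
    intro x hxK hx
    exact hρK x hx.1 (Metric.ball_subset_closedBall hx.2) hxK
  · refine ((he.hasZero hp).mul (u := fun x => (t x - b)⁻¹) (O := e.source ∩ {q}ᶜ)
      (e.open_source.inter isClosed_singleton.isOpen_compl) ⟨hp, hpq⟩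
      (ContMDiffOn.cinv (htbs.mono inter_subset_left) fun x hx => htb0 x hx.1 hx.2)
      (inv_ne_zero (htb0 p hp hpq))).congr hC.isOpen_compl hpC fun x hx => hfC x hx.1
  · refine ((he.hasZero hq).mul (u := fun x => (t x)⁻¹) (O := e.source ∩ {p}ᶜ)
      (e.open_source.inter isClosed_singleton.isOpen_compl) ⟨hq, hpq.symm⟩
      (ContMDiffOn.cinv (hts.mono inter_subset_left) fun x hx => ht0 x hx.1 hx.2)
      (inv_ne_zero (ht0 q hq hpq.symm))).congr hC.isOpen_compl hqC fun x hx => ?_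
    rw [hfC x hx.1, mul_inv, inv_inv, htb, mul_comm]

/-- On a surface, any two points in a connected open set are the zero and the pole of a function
which is trivial outside of this set. -/
theorem exists_isDipole (hσ : σ.IsSmooth) (hσ0 : σ.NowhereZero) {K : Set S}
    (hK : _root_.IsClosed K) (hKc : IsPreconnected Kᶜ) (hpq : p ≠ q) (hp : p ∉ K) (hq : q ∉ K) :
    ∃ f, IsDipole σ K p q f := by
  -- Being equal or joined by a dipole holds in both directions between nearby points and is
  -- transitive on the complement of K. On a connected set such a relation holds between any two
  -- points.
  refine (IsPreconnected.induction₂' hKc (fun p q => p = q ∨ ∃ f, IsDipole σ K p q f) ?_ ?_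
    (x := p) (y := q) hp hq).resolve_left hpq
  · intro x hx
    obtain ⟨e, he, hxe⟩ := exists_isPositiveChart hσ hσ0 x
    have hV : IsOpen (e.target ∩ e.symm ⁻¹' Kᶜ) := e.symm.isOpen_inter_preimage hK.isOpen_compl
    obtain ⟨r, hr, hrV⟩ := Metric.nhds_basis_closedBall.mem_iff.1
      (hV.mem_nhds ⟨e.map_source hxe, by rwa [mem_preimage, e.left_inv hxe]⟩)
    refine Filter.Eventually.filter_mono nhdsWithin_le_nhds ?_
    filter_upwards [e.open_source.mem_nhds hxe,
      (e.continuousAt hxe).preimage_mem_nhds (Metric.ball_mem_nhds (e x) (half_pos hr))] with y hy hyr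
    by_cases hxy : x = y
    · exact ⟨Or.inl hxy, Or.inl hxy.symm⟩
    · have h2 : 2 * (r / 2) = r := by ring
      obtain ⟨f, hf⟩ := exists_isDipole_of_near he hxe (half_pos hr) (K := K)
        (by rw [h2]; exact fun z hz => (hrV hz).1) (by
          rw [h2]
          intro z hz hzr hzK
          have := (hrV hzr).2
          rw [mem_preimage, e.left_inv hz] at this
          exact this hzK) hy hxy hyr
      exact ⟨Or.inr ⟨f, hf⟩, Or.inr ⟨_, hf.symm⟩⟩
  · rintro x y z hx hy hz (rfl | ⟨f, hf⟩) (rfl | ⟨g, hg⟩)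
    · exact Or.inl rfl
    · exact Or.inr ⟨g, hg⟩
    · exact Or.inr ⟨f, hf⟩
    · by_cases hxy : x = y
      · subst hxy; exact Or.inr ⟨g, hg⟩
      by_cases hyz : y = z
      · subst hyz; exact Or.inr ⟨f, hf⟩
      by_cases hxz : x = z
      · exact Or.inl hxz
      exact Or.inr (hf.trans hK hxy hyz hxz hy hg)

end Dipole

/-! ### Extension of the angular coordinate over the surface. -/

section Angular

variable {S : Type u} [TopologicalSpace S] [ChartedSpace (EuclideanSpace ℝ (Fin 2)) S]
  {σ : DiffForm (𝓡 2) S 2}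

theorem contDiffOn_mul_inv_norm :
    ContDiffOn ℝ ∞ (fun z : ℂ => z * ((‖z‖ : ℝ) : ℂ)⁻¹) {z | z ≠ 0} := by
  intro z hz
  have h1 : ContDiffAt ℝ ∞ (fun z : ℂ => ((‖z‖ : ℝ) : ℂ)) z :=
    Complex.ofRealCLM.contDiff.contDiffAt.comp z (contDiffAt_norm ℝ hz)
  exact (contDiffAt_id.mul (h1.inv (by simpa using hz))).contDiffWithinAt

theorem norm_mul_inv_norm {z : ℂ} (hz : z ≠ 0) : ‖z * ((‖z‖ : ℝ) : ℂ)⁻¹‖ = 1 := by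
  have : ‖z‖ ≠ 0 := norm_ne_zero_iff.2 hz
  rw [norm_mul, norm_inv, Complex.norm_real, norm_norm, mul_inv_cancel₀ this]

theorem exp_mem_annulus {t ε : ℝ} (h : |t| < ε) : ((Real.exp t : ℝ) : ℂ) ∈ annulus ε := by
  refine ⟨by simp, ?_⟩
  rwa [Complex.norm_real, Real.norm_of_nonneg (Real.exp_pos t).le, Real.log_exp]

/-- A smooth function on an annulus with a zero and a pole extends by constants. -/
theorem exists_annular_dipole [IsManifold (𝓡 2) ∞ S] [T2Space S] [CompactSpace S]
    {e : OpenPartialHomeomorph S ℂ} (he : IsPositiveChart σ e) {t ε : ℝ} (ht : 0 < t)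
    (htε : t < ε) (het : e.target = annulus ε) :
    ∃ h, IsDipole σ ∅ (e.symm ((Real.exp (-t) : ℝ) : ℂ)) (e.symm ((Real.exp t : ℝ) : ℂ)) h ∧
      ∀ x ∈ e.source, |Real.log ‖e x‖| < t →
        h x = (e x - (Real.exp (-t) : ℝ)) * (e x - (Real.exp t : ℝ))⁻¹ := by
  set a : ℂ := ((Real.exp t : ℝ) : ℂ) with ha
  set b : ℂ := ((Real.exp (-t) : ℝ) : ℂ) with hb
  have hab : a * b = 1 := by rw [ha, hb, ← Complex.ofReal_mul, ← Real.exp_add]; simp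
  have ha0 : a ≠ 0 := left_ne_zero_of_mul_eq_one hab
  have hna : ‖a‖ = Real.exp t := by
    rw [ha, Complex.norm_real, Real.norm_of_nonneg (Real.exp_pos t).le]
  have hnb : ‖b‖ = Real.exp (-t) := by
    rw [hb, Complex.norm_real, Real.norm_of_nonneg (Real.exp_pos (-t)).le]
  have hat : a ∈ e.target := by rw [het]; exact exp_mem_annulus (by rwa [abs_of_pos ht])
  have hbt : b ∈ e.target := by
    rw [het]; exact exp_mem_annulus (by rwa [abs_neg, abs_of_pos ht])
  set p := e.symm b with hp
  set q := e.symm a with hq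
  have hps : p ∈ e.source := e.map_target hbt
  have hqs : q ∈ e.source := e.map_target hat
  have hep : e p = b := e.right_inv hbt
  have heq : e q = a := e.right_inv hat
  have hane : a ≠ b := by
    intro h
    have := congrArg norm h
    rw [hna, hnb] at this
    have := Real.exp_injective this
    linarith
  have hpq : p ≠ q := fun h => hane (by rw [← hep, ← heq, h])
  have he0 : ∀ x ∈ e.source, e x ≠ 0 := fun x hx => by
    have := e.map_source hx; rw [het] at this; exact this.1
  have hea : ∀ x ∈ e.source, x ≠ q → e x - a ≠ 0 := fun x hx hxq h =>
    hxq (e.injOn hx hqs (by rw [heq]; exact sub_eq_zero.1 h))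
  have heb : ∀ x ∈ e.source, x ≠ p → e x - b ≠ 0 := fun x hx hxq h =>
    hxq (e.injOn hx hps (by rw [hep]; exact sub_eq_zero.1 h))
  have hsa : ContMDiffOn (𝓡 2) 𝓘(ℝ, ℂ) ∞ (fun x => e x - a) e.source :=
    he.smooth.sub contMDiffOn_const
  have hsb : ContMDiffOn (𝓡 2) 𝓘(ℝ, ℂ) ∞ (fun x => e x - b) e.source :=
    he.smooth.sub contMDiffOn_const
  have hsi : ContMDiffOn (𝓡 2) 𝓘(ℝ, ℂ) ∞ (fun x => (e x)⁻¹) e.source :=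
    ContMDiffOn.cinv he.smooth he0
  have hO : IsOpen (e.source ∩ {p, q}ᶜ) :=
    e.open_source.inter (toFinite _).isClosed.isOpen_compl
  set Z : Set S := (e.source ∩ e ⁻¹' annulus ((t + ε) / 2))ᶜ with hZ
  have hZc : _root_.IsClosed Z := (e.isOpen_inter_preimage (isOpen_annulus _)).isClosed_compl
  set A : Set ℂ := Metric.closedBall 0 (Real.exp t) ∩ {z | Real.exp (-t) ≤ ‖z‖} with hA
  have hAmem : ∀ z : ℂ, z ≠ 0 → (z ∈ A ↔ |Real.log ‖z‖| ≤ t) := fun z hz => by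
    have h := norm_pos_iff.2 hz
    rw [abs_le, Real.log_le_iff_le_exp h, Real.le_log_iff_exp_le h]
    simp only [hA, mem_inter_iff, Metric.mem_closedBall, dist_zero_right]
    exact and_comm
  have hA0 : ∀ z ∈ A, z ≠ 0 := fun z hz => norm_pos_iff.1 ((Real.exp_pos _).trans_le hz.2)
  have hAε : A ⊆ e.target := fun z hz => by
    rw [het]; exact ⟨hA0 z hz, ((hAmem z (hA0 z hz)).1 hz).trans_lt htε⟩
  have hAc : IsCompact A := (isCompact_closedBall _ _).inter_right
    (isClosed_le continuous_const continuous_norm)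
  set N : Set S := (e.symm '' A)ᶜ with hN
  have hNo : IsOpen N :=
    (hAc.image_of_continuousOn (e.symm.continuousOn.mono hAε)).isClosed.isOpen_compl
  have hNmem : ∀ x ∈ e.source, |Real.log ‖e x‖| ≤ t → x ∉ N := fun x hx hxt hxN =>
    hxN ⟨e x, (hAmem _ (he0 x hx)).2 hxt, e.left_inv hx⟩
  have hNnot : ∀ x, x ∉ N → x ∈ e.source ∧ |Real.log ‖e x‖| ≤ t := by
    intro x hx
    obtain ⟨z, hz, rfl⟩ := not_notMem.1 hx
    have hz' := hAε hz
    refine ⟨e.map_target hz', ?_⟩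
    rw [e.right_inv hz']; exact (hAmem _ (hA0 z hz)).1 hz
  have hZN : Z ⊆ N := by
    intro x hxZ
    by_contra hxN
    obtain ⟨h1, h2⟩ := hNnot x hxN
    exact hxZ ⟨h1, he0 x h1, h2.trans_lt (by linarith)⟩
  -- The parts of the annulus beyond the radius e^t and below the radius e^(−t). The quotient has a
  -- logarithm on each of them.
  set P : Set S := e.source ∩ e ⁻¹' {z | Real.exp t < ‖z‖} with hP
  set Q : Set S := e.source ∩ e ⁻¹' {z | ‖z‖ < Real.exp (-t)} with hQ
  have hPo : IsOpen P := e.isOpen_inter_preimage (isOpen_lt continuous_const continuous_norm)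
  have hQo : IsOpen Q := e.isOpen_inter_preimage (isOpen_lt continuous_norm continuous_const)
  have hPQ : ∀ x ∈ Q, x ∉ P := fun x hx hx' => by
    have h1 : ‖e x‖ < Real.exp (-t) := hx.2
    have h2 : Real.exp t < ‖e x‖ := hx'.2
    have := Real.exp_lt_exp.1 (h2.trans h1)
    linarith
  have hNZ : N \ Z ⊆ P ∪ Q := by
    intro x hx
    have h1 := (not_notMem.1 hx.2).1
    have h2 := not_le.1 fun h => hNmem x h1 h hx.1
    have h := norm_pos_iff.2 (he0 x h1)
    rcases lt_abs.1 h2 with h3 | h3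
    · exact Or.inl ⟨h1, (Real.lt_log_iff_exp_lt h).1 h3⟩
    · exact Or.inr ⟨h1, (Real.log_lt_iff_lt_exp h).1 (by linarith)⟩
  have hP1 : ∀ x ∈ P, ‖a * (e x)⁻¹‖ < 1 := fun x hx => by
    have h2 : Real.exp t < ‖e x‖ := hx.2
    rw [norm_mul, norm_inv, hna, ← div_eq_mul_inv, div_lt_one ((Real.exp_pos t).trans h2)]
    exact h2
  have hP2 : ∀ x ∈ P, ‖b * (e x)⁻¹‖ < 1 := fun x hx => by
    have h2 : Real.exp t < ‖e x‖ := hx.2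
    rw [norm_mul, norm_inv, hnb, ← div_eq_mul_inv, div_lt_one ((Real.exp_pos t).trans h2)]
    exact (Real.exp_lt_exp.2 (by linarith)).trans h2
  have hQ1 : ∀ x ∈ Q, ‖a * e x‖ < 1 := fun x hx => by
    have h2 : ‖e x‖ < Real.exp (-t) := hx.2
    rw [norm_mul, hna]
    calc Real.exp t * ‖e x‖ < Real.exp t * Real.exp (-t) := by gcongr
      _ = 1 := by rw [← Real.exp_add]; simp
  have hQ2 : ∀ x ∈ Q, ‖b * e x‖ < 1 := fun x hx => by
    have h2 : ‖e x‖ < Real.exp (-t) := hx.2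
    rw [norm_mul, hnb]
    calc Real.exp (-t) * ‖e x‖ ≤ 1 * ‖e x‖ := by gcongr; simpa using ht.le
      _ < Real.exp (-t) := by rwa [one_mul]
      _ ≤ 1 := by simpa using ht.le
  classical
  -- On the outer part (z − b)/(z − a) = (1 − b/z)/(1 − a/z). On the inner part ab = 1 gives b²(1 −
  -- az)/(1 − bz). In both cases the terms subtracted from 1 have absolute value less than 1, so the
  -- logarithms are smooth.
  let v : S → ℂ := fun x => if x ∈ P then
    Complex.log (1 - b * (e x)⁻¹) - Complex.log (1 - a * (e x)⁻¹) else
    Complex.log (1 - a * e x) - Complex.log (1 - b * e x) + Complex.log (b * b)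
  have hvP : ∀ x ∈ P, v x = Complex.log (1 - b * (e x)⁻¹) - Complex.log (1 - a * (e x)⁻¹) :=
    fun x hx => if_pos hx
  have hvQ : ∀ x ∈ Q, v x = Complex.log (1 - a * e x) - Complex.log (1 - b * e x) +
      Complex.log (b * b) := fun x hx => if_neg (hPQ x hx)
  have hlog : ∀ {c : ℂ} {f : S → ℂ} {B : Set S}, ContMDiffOn (𝓡 2) 𝓘(ℝ, ℂ) ∞ f B →
      (∀ x ∈ B, ‖c * f x‖ < 1) →
      ContMDiffOn (𝓡 2) 𝓘(ℝ, ℂ) ∞ (fun x => Complex.log (1 - c * f x)) B := by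
    intro c f B hf hB
    exact ContMDiffOn.clog (contMDiffOn_const.sub (ContMDiffOn.cmul contMDiffOn_const hf))
      fun x hx => one_sub_mem_slitPlane (hB x hx)
  have hvs : ContMDiffOn (𝓡 2) 𝓘(ℝ, ℂ) ∞ v (P ∪ Q) := by
    refine ContMDiffOn.union_of_isOpen ?_ ?_ hPo hQo
    · exact ((hlog (hsi.mono inter_subset_left) hP2).sub
        (hlog (hsi.mono inter_subset_left) hP1)).congr hvP
    · exact (((hlog (he.smooth.mono inter_subset_left) hQ1).sub
        (hlog (he.smooth.mono inter_subset_left) hQ2)).add contMDiffOn_const).congr hvQ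
  have hb0 : b ≠ 0 := right_ne_zero_of_mul_eq_one hab
  have hkv : ∀ x ∈ N \ Z, (e x - b) * (e x - a)⁻¹ = 1 * Complex.exp (v x) := by
    intro x hx
    rcases hNZ hx with hx | hx
    · have h0 := he0 x hx.1
      have h1 := Complex.slitPlane_ne_zero (one_sub_mem_slitPlane (hP1 x hx))
      have h2 := Complex.slitPlane_ne_zero (one_sub_mem_slitPlane (hP2 x hx))
      have h3 : e x - a ≠ 0 := by
        intro h; apply h1; rw [← sub_eq_zero.1 h, mul_inv_cancel₀ h0, sub_self]
      rw [hvP x hx, one_mul, Complex.exp_sub, Complex.exp_log h1, Complex.exp_log h2]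
      field_simp
    · have h1 := Complex.slitPlane_ne_zero (one_sub_mem_slitPlane (hQ1 x hx))
      have h2 := Complex.slitPlane_ne_zero (one_sub_mem_slitPlane (hQ2 x hx))
      have h3 : e x - a = -a * (1 - b * e x) := by linear_combination (e x) * (-hab)
      have h4 : e x - b = -b * (1 - a * e x) := by linear_combination (e x) * (-hab)
      rw [hvQ x hx, one_mul, Complex.exp_add, Complex.exp_sub, Complex.exp_log h1,
        Complex.exp_log h2, Complex.exp_log (mul_ne_zero hb0 hb0), h3, h4]
      have h5 : a⁻¹ = b := inv_eq_of_mul_eq_one_right hab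
      rw [mul_inv, inv_neg, h5, div_eq_mul_inv]
      ring
  obtain ⟨f, C, N', hC, hCN, hN', hZN', -, hfC, hf1, hfs, hf0⟩ :=
    exists_modification (h := fun x => (e x - b) * (e x - a)⁻¹) (g := fun _ => 1)
      (v := v) hZc hNo hZN hO
      (ContMDiffOn.cmul (hsb.mono inter_subset_left) (ContMDiffOn.cinv
        (hsa.mono inter_subset_left) fun x hx => hea x hx.1 fun h => hx.2 (by simp [h])))
      (fun x hx => mul_ne_zero (heb x hx.1 fun h => hx.2 (by simp [h]))
        (inv_ne_zero (hea x hx.1 fun h => hx.2 (by simp [h]))))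
      contMDiffOn_const (fun _ _ => one_ne_zero) (hvs.mono hNZ) hkv
  have hsub : ({p, q}ᶜ : Set S) ⊆ (e.source ∩ {p, q}ᶜ) \ Z ∪ N := by
    intro x hx
    by_cases hxN : x ∈ N
    · exact Or.inr hxN
    · exact Or.inl ⟨⟨(hNnot x hxN).1, hx⟩, fun h => hxN (hZN h)⟩
  have hpC : p ∉ C := fun h => hNmem p hps (by
    rw [hep, hnb, Real.log_exp, abs_neg, abs_of_pos ht]) (hCN h)
  have hqC : q ∉ C := fun h => hNmem q hqs (by
    rw [heq, hna, Real.log_exp, abs_of_pos ht]) (hCN h)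
  refine ⟨f, ⟨hfs.mono hsub, fun x hx => hf0 x (hsub hx), ⟨∅, isOpen_empty, Subset.rfl, by simp⟩,
    ?_, ?_⟩, fun x hx hxt => hfC x fun h => hNmem x hx hxt.le (hCN h)⟩
  · refine ((he.hasZero hps).mul (u := fun x => (e x - a)⁻¹) (O := e.source ∩ {q}ᶜ)
      (e.open_source.inter isClosed_singleton.isOpen_compl) ⟨hps, hpq⟩
      (ContMDiffOn.cinv (hsa.mono inter_subset_left) fun x hx => hea x hx.1 hx.2)
      (inv_ne_zero (hea p hps hpq))).congr hC.isOpen_compl hpC fun x hx => ?_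
    rw [hfC x hx.1, hep]
  · refine ((he.hasZero hqs).mul (u := fun x => (e x - b)⁻¹) (O := e.source ∩ {p}ᶜ)
      (e.open_source.inter isClosed_singleton.isOpen_compl) ⟨hqs, hpq.symm⟩
      (ContMDiffOn.cinv (hsb.mono inter_subset_left) fun x hx => heb x hx.1 hx.2)
      (inv_ne_zero (heb q hqs hpq.symm))).congr hC.isOpen_compl hqC fun x hx => ?_
    rw [hfC x hx.1, mul_inv, inv_inv, heq, mul_comm]

/-- The angular coordinate around a part of the boundary of a connected set extends to a
circle-valued function on the surface. -/
theorem exists_angular_extension [IsManifold (𝓡 2) ∞ S] [T2Space S] [CompactSpace S]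
    (hσ : σ.IsSmooth) (hσ0 : σ.NowhereZero) {K : Set S} (hK : _root_.IsClosed K)
    (hKc : IsPreconnected Kᶜ) {e : OpenPartialHomeomorph S ℂ} {ε : ℝ} (hε : 0 < ε)
    (het : e.target = annulus ε) (hes : ContMDiffOn (𝓡 2) 𝓘(ℝ, ℂ) ∞ e e.source)
    (hes' : ContMDiffOn 𝓘(ℝ, ℂ) (𝓡 2) ∞ e.symm e.target)
    (heσ : ∀ x ∈ e.source, σ x = polarForm (𝓡 2) e x)
    (heK : ∀ x ∈ e.source, (x ∈ K ↔ ‖e x‖ = 1)) :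
    ∃ (h : S → ℂ) (δ : ℝ), ContMDiff (𝓡 2) 𝓘(ℝ, ℂ) ∞ h ∧ (∀ x, ‖h x‖ = 1) ∧ 0 < δ ∧ δ ≤ ε ∧
      ∀ x ∈ e.source, e x ∈ annulus δ → h x = e x * ((‖e x‖ : ℝ) : ℂ)⁻¹ := by
  have he0 : ∀ x ∈ e.source, e x ≠ 0 := fun x hx => by
    have := e.map_source hx; rw [het] at this; exact this.1
  have he : IsPositiveChart σ e := ⟨hes, hes', fun x hx => ⟨Complex.normSq (e x),
    Complex.normSq_pos.2 (he0 x hx), by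
      rw [heσ x hx]
      exact planeForm_eq_polarForm (((hes x hx).contMDiffAt
        (e.open_source.mem_nhds hx)).mdifferentiableAt (by simp)) (he0 x hx)⟩⟩
  have ht : 0 < ε / 2 := by linarith
  set t := ε / 2 with htdef
  -- The quotient (z − b)/(z − a), with b inside and a outside the unit circle, winds once around
  -- it, as the angular coordinate does.
  obtain ⟨h₁, hd₁, hk⟩ := exists_annular_dipole he ht (by linarith) het
  set a : ℂ := ((Real.exp t : ℝ) : ℂ) with ha
  set b : ℂ := ((Real.exp (-t) : ℝ) : ℂ) with hb
  have hab : a * b = 1 := by rw [ha, hb, ← Complex.ofReal_mul, ← Real.exp_add]; simp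
  have ha0 : a ≠ 0 := left_ne_zero_of_mul_eq_one hab
  have hb0 : b ≠ 0 := right_ne_zero_of_mul_eq_one hab
  have hna : ‖a‖ = Real.exp t := by
    rw [ha, Complex.norm_real, Real.norm_of_nonneg (Real.exp_pos t).le]
  have hnb : ‖b‖ = Real.exp (-t) := by
    rw [hb, Complex.norm_real, Real.norm_of_nonneg (Real.exp_pos (-t)).le]
  have hat : a ∈ e.target := by
    rw [het]; exact exp_mem_annulus (by rw [abs_of_pos ht]; linarith)
  have hbt : b ∈ e.target := by
    rw [het]; exact exp_mem_annulus (by rw [abs_neg, abs_of_pos ht]; linarith)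
  set p := e.symm b with hp
  set q := e.symm a with hq
  have hps : p ∈ e.source := e.map_target hbt
  have hqs : q ∈ e.source := e.map_target hat
  have hep : e p = b := e.right_inv hbt
  have heq : e q = a := e.right_inv hat
  have hpK : p ∉ K := by
    rw [heK p hps, hep, hnb, Real.exp_eq_one_iff]; linarith
  have hqK : q ∉ K := by
    rw [heK q hqs, heq, hna, Real.exp_eq_one_iff]; linarith
  have hpq : p ≠ q := by
    intro h
    have := congrArg norm (hep.symm.trans ((congrArg e h).trans heq))
    rw [hna, hnb] at this
    have := Real.exp_injective this
    linarith
  -- Connectedness of the complement of K enters here: the pole q and the zero p of `h₁`, on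
  -- opposite sides of the circle, are joined outside K. In the product of `h₁` with this dipole
  -- zeros and poles cancel, and near K the product agrees with `h₁`.
  obtain ⟨h₂, hd₂⟩ := exists_isDipole hσ hσ0 hK hKc hpq.symm hqK hpK
  obtain ⟨NR, hNR, hKNR, hR1⟩ := hd₂.eq_one
  obtain ⟨Np, vp, hNp, hpNp, hvp, hhp⟩ := hd₁.zero.mul_inv hd₂.pole
  obtain ⟨Nq, vq, hNq, hqNq, hvq, hhq⟩ := hd₂.zero.mul_inv hd₁.pole
  have hOo : IsOpen ({p, q}ᶜ : Set S) := (toFinite _).isClosed.isOpen_compl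
  have hKo := hK.isOpen_compl
  have hqo : IsOpen ({q}ᶜ : Set S) := isClosed_singleton.isOpen_compl
  -- The zero of `h₁` at p is cancelled against the pole of `h₂`. The next modification does the
  -- same at q, away from the set changed here.
  obtain ⟨f, C, -, hC, hCN, -, -, -, hfC, -, hfs, hf0⟩ :=
    exists_modification (Z := {p}) (N := Np ∩ Kᶜ ∩ {q}ᶜ) (h := fun x => h₁ x * h₂ x)
      (g := fun _ => 1) (v := vp) isClosed_singleton ((hNp.inter hKo).inter hqo)
      (by rintro _ rfl; exact ⟨⟨hpNp, hpK⟩, hpq⟩) hOo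
      (ContMDiffOn.cmul hd₁.smooth (by have := hd₂.smooth; rwa [pair_comm] at this))
      (fun x hx => mul_ne_zero (hd₁.ne_zero x hx) (hd₂.ne_zero x (by rwa [pair_comm])))
      contMDiffOn_const (fun _ _ => one_ne_zero) (hvp.mono fun x hx => ⟨hx.1.1.1, hx.2⟩)
      (fun x hx => by rw [one_mul]; exact hhp x ⟨hx.1.1.1, hx.2⟩)
  have hsub : ({q}ᶜ : Set S) ⊆ {p, q}ᶜ \ {p} ∪ Np ∩ Kᶜ ∩ {q}ᶜ := by
    intro x hx
    by_cases hxp : x = p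
    · right; rw [hxp]; exact ⟨⟨hpNp, hpK⟩, hpq⟩
    · left; simp at hx ⊢; tauto
  have hqC : q ∉ C := fun h => (hCN h).2 rfl
  obtain ⟨f', C', -, hC', hCN', -, -, -, hfC', -, hfs', hf0'⟩ :=
    exists_modification (Z := {q}) (N := Nq ∩ Kᶜ ∩ Cᶜ) (h := f)
      (g := fun _ => 1) (v := vq) isClosed_singleton ((hNq.inter hKo).inter hC.isOpen_compl)
      (by rintro _ rfl; exact ⟨⟨hqNq, hqK⟩, hqC⟩) hqo
      (hfs.mono hsub) (fun x hx => hf0 x (hsub hx))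
      contMDiffOn_const (fun _ _ => one_ne_zero) (hvq.mono fun x hx => ⟨hx.1.1.1, hx.2⟩)
      (fun x hx => by rw [one_mul, ← hhq x ⟨hx.1.1.1, hx.2⟩, hfC x hx.1.2, mul_comm])
  have hsub' : (univ : Set S) ⊆ {q}ᶜ \ {q} ∪ Nq ∩ Kᶜ ∩ Cᶜ := by
    intro x _
    by_cases hxp : x = q
    · right; rw [hxp]; exact ⟨⟨hqNq, hqK⟩, hqC⟩
    · left; exact ⟨hxp, hxp⟩
  have hKC : K ⊆ Cᶜ ∩ C'ᶜ := fun x hx => ⟨fun h => (hCN h).1.2 hx, fun h => (hCN' h).1.2 hx⟩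
  have htA := e.isOpen_inter_preimage (isOpen_annulus t)
  set M : Set S := (NR ∩ (Cᶜ ∩ C'ᶜ)) ∩ (e.source ∩ e ⁻¹' annulus t) with hM
  have hMo : IsOpen M := (hNR.inter (hC.isOpen_compl.inter hC'.isOpen_compl)).inter htA
  have hf'M : ∀ x ∈ M, f' x = (e x - b) * (e x - a)⁻¹ := by
    rintro x ⟨⟨hx1, hx2, hx3⟩, hx4, hx5⟩
    rw [hfC' x hx3, hfC x hx2, hR1 x hx1, mul_one, hk x hx4 hx5.2]
  have hsph : Metric.sphere (0 : ℂ) 1 ⊆ annulus t := fun z hz => by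
    simpa using coe_mem_annulus ⟨z, hz⟩ ht
  have htε : annulus t ⊆ e.target := by rw [het]; exact annulus_mono (by linarith)
  set Z : Set S := e.symm '' Metric.sphere 0 1 with hZ
  have hZc : _root_.IsClosed Z := ((isCompact_sphere (0 : ℂ) 1).image_of_continuousOn
    (e.symm.continuousOn.mono (hsph.trans htε))).isClosed
  have hZM : Z ⊆ M := by
    rintro _ ⟨z, hz, rfl⟩
    have h1 := hsph hz
    have h2 := e.map_target (htε h1)
    have h3 : e (e.symm z) = z := e.right_inv (htε h1)
    have h4 : e.symm z ∈ K := by rw [heK _ h2, h3]; simpa using hz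
    exact ⟨⟨hKNR h4, hKC h4⟩, h2, by rw [mem_preimage, h3]; exact h1⟩
  have hMe : M ⊆ e.source := fun x hx => hx.2.1
  have hM1 : ∀ x ∈ M, ‖b * e x‖ < 1 := fun x hx => by
    have h1 := norm_pos_iff.2 (he0 x (hMe hx))
    have h2 := (abs_lt.1 hx.2.2.2).2
    rw [norm_mul, hnb]
    calc Real.exp (-t) * ‖e x‖ < Real.exp (-t) * Real.exp t := by
          gcongr; exact (Real.log_lt_iff_lt_exp h1).1 h2
      _ = 1 := by rw [← Real.exp_add]; simp
  have hM2 : ∀ x ∈ M, ‖b * (e x)⁻¹‖ < 1 := fun x hx => by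
    have h1 := norm_pos_iff.2 (he0 x (hMe hx))
    have h2 := (abs_lt.1 hx.2.2.2).1
    rw [norm_mul, norm_inv, hnb, ← div_eq_mul_inv, div_lt_one h1]
    exact (Real.lt_log_iff_exp_lt h1).1 h2
  have hlog : ∀ {f : S → ℂ}, ContMDiffOn (𝓡 2) 𝓘(ℝ, ℂ) ∞ f M → (∀ x ∈ M, ‖b * f x‖ < 1) →
      ContMDiffOn (𝓡 2) 𝓘(ℝ, ℂ) ∞ (fun x => Complex.log (1 - b * f x)) M := fun hf hB =>
    ContMDiffOn.clog (contMDiffOn_const.sub (ContMDiffOn.cmul contMDiffOn_const hf))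
      fun x hx => one_sub_mem_slitPlane (hB x hx)
  have hln : ContDiffOn ℝ ∞ (fun z : ℂ => ((Real.log ‖z‖ : ℝ) : ℂ)) {z | z ≠ 0} := fun z hz =>
    (Complex.ofRealCLM.contDiff.contDiffAt.comp z (contDiffAt_log_norm hz)).contDiffWithinAt
  have heM := hes.mono hMe
  -- As 1/a = b, near the circle (z − b)/(z − a) = (z/|z|) · |z| · (−b) · (1 − b/z)/(1 − bz). All
  -- factors after the first have smooth logarithms, so the function can be replaced by z/|z| on a
  -- neighbourhood of the circle.
  obtain ⟨h, -, N', -, -, hN', hZN', -, -, hhe, hhs, hh0⟩ :=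
    exists_modification (Z := Z) (N := M) (O := univ) (h := f')
      (g := fun x => e x * ((‖e x‖ : ℝ) : ℂ)⁻¹)
      (v := fun x => ((Real.log ‖e x‖ : ℝ) : ℂ) + Complex.log (-b) +
        Complex.log (1 - b * (e x)⁻¹) - Complex.log (1 - b * e x)) hZc hMo hZM isOpen_univ
      (hfs'.mono hsub') (fun x hx => hf0' x (hsub' hx))
      (contDiffOn_mul_inv_norm.contMDiffOn.comp heM fun x hx => he0 x (hMe hx))
      (fun x hx => norm_ne_zero_iff.1 (by rw [norm_mul_inv_norm (he0 x (hMe hx))]; simp))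
      ((((hln.contMDiffOn.comp heM fun x hx => he0 x (hMe hx)).add contMDiffOn_const).add
        (hlog (ContMDiffOn.cinv heM fun x hx => he0 x (hMe hx)) hM2)).sub
          (hlog heM hM1) |>.mono sdiff_subset)
      (by
        intro x hx
        have h1 := he0 x (hMe hx.1)
        have h2 := Complex.slitPlane_ne_zero (one_sub_mem_slitPlane (hM1 x hx.1))
        have h3 := Complex.slitPlane_ne_zero (one_sub_mem_slitPlane (hM2 x hx.1))
        have h4 : e x - a = -a * (1 - b * e x) := by linear_combination (e x) * (-hab)
        have h5 : a⁻¹ = b := inv_eq_of_mul_eq_one_right hab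
        have h6 : ((‖e x‖ : ℝ) : ℂ) ≠ 0 := by simpa using h1
        rw [hf'M x hx.1, h4, Complex.exp_sub, Complex.exp_add, Complex.exp_add,
          Complex.exp_log (neg_ne_zero.2 hb0), Complex.exp_log h2, Complex.exp_log h3,
          ← Complex.ofReal_exp, Real.exp_log (norm_pos_iff.2 h1), mul_inv, inv_neg, h5]
        field_simp)
  have hu : (univ : Set S) ⊆ univ \ Z ∪ M := fun x _ => by
    by_cases hx : x ∈ Z
    · exact Or.inr (hZM hx)
    · exact Or.inl ⟨trivial, hx⟩
  have hV : IsOpen (e.target ∩ e.symm ⁻¹' N') := e.symm.isOpen_inter_preimage hN'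
  obtain ⟨δ, hδ, hδV⟩ := exists_annulus_subset hV fun θ =>
    ⟨htε (coe_mem_annulus θ ht), hZN' ⟨θ, mem_sphere_zero_iff_norm.2 (Circle.norm_coe θ), rfl⟩⟩
  refine ⟨fun x => h x * ((‖h x‖ : ℝ) : ℂ)⁻¹, min δ ε, ?_,
    fun x => norm_mul_inv_norm (hh0 x (hu trivial)), lt_min hδ hε, min_le_right _ _, ?_⟩
  · rw [← contMDiffOn_univ]
    exact contDiffOn_mul_inv_norm.contMDiffOn.comp (hhs.mono hu) fun x hx => hh0 x (hu hx)
  · intro x hx hxδ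
    have h1 := (hδV (annulus_mono (min_le_left _ _) hxδ)).2
    rw [mem_preimage, e.left_inv hx] at h1
    simp only [hhe x h1]
    rw [norm_mul_inv_norm (he0 x hx)]
    simp

end Angular

/-! ### Circle-valued maps. -/

section CircleValued

variable {E : Type*} [NormedAddCommGroup E] [NormedSpace ℝ E] {H : Type*} [TopologicalSpace H]
  {I : ModelWithCorners ℝ E H} {M : Type*} [TopologicalSpace M] [ChartedSpace H M]

theorem contDiffAt_arg {z : ℂ} (hz : z ∈ Complex.slitPlane) : ContDiffAt ℝ ∞ Complex.arg z :=
  (Complex.imCLM.contDiff.contDiffAt.comp z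
    ((Complex.contDiffAt_log hz).restrict_scalars ℝ)).congr_of_eventuallyEq
      (Filter.Eventually.of_forall fun z => (Complex.log_im z).symm)

/-- A circle valued map is smooth if it is smooth as a complex valued map. -/
theorem contMDiffWithinAt_circle {f : M → Circle} {s : Set M} {x : M}
    (h : ContMDiffWithinAt I 𝓘(ℝ, ℂ) ∞ (fun y => (f y : ℂ)) s x) :
    ContMDiffWithinAt I (𝓡 1) ∞ f s x := by
  have h1 : f = fun y => f x * Circle.exp (Complex.arg (((f x)⁻¹ : Circle) * (f y : ℂ))) := by
    ext y
    rw [← Circle.coe_mul, Circle.exp_arg, mul_inv_cancel_left]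
  have h2 : ContDiffAt ℝ ∞ (fun z : ℂ => Complex.arg (((f x)⁻¹ : Circle) * z)) (f x) := by
    refine ContDiffAt.comp (f x : ℂ) (contDiffAt_arg ?_) (contDiffAt_const.mul contDiffAt_id)
    rw [← Circle.coe_mul, inv_mul_cancel, Circle.coe_one]
    exact Complex.one_mem_slitPlane
  have h3 : ContMDiffWithinAt I 𝓘(ℝ, ℝ) ∞
      (fun y => Complex.arg (((f x)⁻¹ : Circle) * (f y : ℂ))) s x :=
    h2.contMDiffAt.comp_contMDiffWithinAt x h
  rw [h1]
  exact ((contMDiff_mul_left (I := 𝓡 1) (n := ∞) (a := f x)).contMDiffAt).comp_contMDiffWithinAt x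
    ((contMDiff_circleExp (m := ∞)).contMDiffAt.comp_contMDiffWithinAt x h3)

theorem contMDiffOn_circle {f : M → Circle} {s : Set M}
    (h : ContMDiffOn I 𝓘(ℝ, ℂ) ∞ (fun y => (f y : ℂ)) s) : ContMDiffOn I (𝓡 1) ∞ f s :=
  fun x hx => contMDiffWithinAt_circle (h x hx)

theorem contMDiff_circle {f : M → Circle}
    (h : ContMDiff I 𝓘(ℝ, ℂ) ∞ fun y => (f y : ℂ)) : ContMDiff I (𝓡 1) ∞ f :=
  contMDiffOn_univ.1 (contMDiffOn_circle h.contMDiffOn)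

end CircleValued

theorem exists_restr_annulus {S : Type*} [TopologicalSpace S]
    (e : OpenPartialHomeomorph S ℂ) {δ : ℝ}
    (h : annulus δ ⊆ e.target) :
    ∃ e' : OpenPartialHomeomorph S ℂ, ⇑e' = e ∧ ⇑e'.symm = e.symm ∧ e'.target = annulus δ ∧
      e'.source ⊆ e.source :=
  ⟨(e.symm.restrOpen _ (isOpen_annulus δ)).symm, rfl, rfl, inter_eq_right.2 h,
    fun _ hx => hx.1⟩

/-! ### Nonseparating circles and handle coordinates. -/

section Handle

variable {S : Type u} [TopologicalSpace S] [ChartedSpace (EuclideanSpace ℝ (Fin 2)) S]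

variable [IsManifold (𝓡 2) ∞ S] [T2Space S] [CompactSpace S] {σ : DiffForm (𝓡 2) S 2}

/-- In the annular coordinate, the points e^t θ with t > 0 lie off the circle and converge to the
point with parameter θ as t tends to 0. -/
theorem dense_compl_range {γ : Circle → S}
    (hγ : ContMDiff (𝓡 1) (𝓡 2) ∞ γ) (hγi : Function.Injective γ)
    (hγd : ∀ z, Function.Injective (mfderiv (𝓡 1) (𝓡 2) γ z))
    (hσ : σ.IsSmooth) (hσ0 : σ.NowhereZero) : Dense (range γ)ᶜ := by
  obtain ⟨ε, e, hε, het, -, -, heγ, -⟩ := exists_annular_coordinate hγ hγi hγd hσ hσ0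
  intro x
  by_cases hx : x ∈ range γ
  swap
  · exact subset_closure hx
  obtain ⟨θ, rfl⟩ := hx
  have hθ : (θ : ℂ) ∈ e.target := by rw [het]; exact coe_mem_annulus θ hε
  have h1 : e.symm θ = γ θ := by rw [← (heγ θ).2, e.left_inv (heγ θ).1]
  have h2 : Filter.Tendsto (fun t : ℝ => ((Real.exp t : ℝ) : ℂ) * θ) (𝓝[>] 0) (𝓝 (θ : ℂ)) := by
    have : Continuous fun t : ℝ => ((Real.exp t : ℝ) : ℂ) * θ := by fun_prop
    have h := this.tendsto 0
    simp only [Real.exp_zero, Complex.ofReal_one, one_mul] at h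
    exact h.mono_left nhdsWithin_le_nhds
  have h3 := (e.symm.continuousAt hθ).tendsto.comp h2
  rw [h1] at h3
  refine mem_closure_of_tendsto h3 ?_
  filter_upwards [h2 (e.open_target.mem_nhds hθ), self_mem_nhdsWithin] with t ht ht0
  rintro ⟨θ', h⟩
  have h4 := congrArg e h
  rw [(heγ θ').2] at h4
  have h5 : e ((e.symm ∘ fun t : ℝ => ((Real.exp t : ℝ) : ℂ) * θ) t) =
    ((Real.exp t : ℝ) : ℂ) * θ := e.right_inv ht
  rw [h5] at h4
  have h6 := congrArg norm h4
  rw [norm_mul, Circle.norm_coe, Circle.norm_coe, mul_one, Complex.norm_real,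
    Real.norm_of_nonneg (Real.exp_pos t).le] at h6
  have : (0 : ℝ) < t := ht0
  have := Real.exp_eq_one_iff t |>.1 h6.symm
  linarith

/-- A cylindrical coordinate around a nonseparating circle in a surface, whose angular part is
globally defined. -/
structure HandleCoordinate (σ : DiffForm (𝓡 2) S 2) (ε : ℝ) (e : OpenPartialHomeomorph S ℂ)
    (h : S → Circle) : Prop where
  pos : 0 < ε
  target_eq : e.target = annulus ε
  smooth : ContMDiffOn (𝓡 2) 𝓘(ℝ, ℂ) ∞ e e.source
  symm_smooth : ContMDiffOn 𝓘(ℝ, ℂ) (𝓡 2) ∞ e.symm e.target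
  form_eq : ∀ x ∈ e.source, σ x = polarForm (𝓡 2) e x
  angle_smooth : ContMDiff (𝓡 2) (𝓡 1) ∞ h
  angle_eq : ∀ x ∈ e.source, e x = ‖e x‖ * h x
  connected : IsConnected {x | x ∈ e.source → ‖e x‖ ≠ 1}
  dense : Dense {x | x ∈ e.source → ‖e x‖ ≠ 1}

/-- A single circle of the system is used. The annulus around it is shrunk until it misses the other
circles, so that the union K of all circles meets it exactly in ‖e‖ = 1. Connectedness of the
complement of K then yields the extended angle. -/
theorem exists_handleCoordinate {S : ClosedSurface.{u}} {σ : DiffForm (𝓡 2) S 2}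
    (hσ : σ.IsSmooth) (hσ0 : σ.NowhereZero) {g : ℕ} (hg : 0 < g)
    (hS : S.HasNonseparatingCircles g) :
    ∃ (ε : ℝ) (e : OpenPartialHomeomorph S ℂ) (h : S → Circle), HandleCoordinate σ ε e h := by
  obtain ⟨γ, hγ, hγd, hγi, hγγ, hγc⟩ := hS
  set K : Set S := ⋃ i, range (γ i) with hK
  have hr : ∀ i, _root_.IsClosed (range (γ i)) := fun i =>
    (isCompact_range (hγ i).continuous).isClosed
  have hKc : _root_.IsClosed K := isClosed_iUnion_of_finite hr
  have hdense : Dense Kᶜ := by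
    rw [hK, compl_iUnion]
    exact dense_iInter_of_isOpen (fun i => (hr i).isOpen_compl)
      fun i => dense_compl_range (hγ i) (hγi i) (hγd i) hσ hσ0
  let i₀ : Fin g := ⟨0, hg⟩
  obtain ⟨ε₀, e₀, hε₀, het₀, hes₀, hes₀', heγ₀, heσ₀⟩ :=
    exists_annular_coordinate (hγ i₀) (hγi i₀) (hγd i₀) hσ hσ0
  have hL : _root_.IsClosed (⋃ i : {i // i ≠ i₀}, range (γ i)) :=
    isClosed_iUnion_of_finite fun i => hr i
  have hV : IsOpen (e₀.target ∩ e₀.symm ⁻¹' (⋃ i : {i // i ≠ i₀}, range (γ i))ᶜ) :=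
    e₀.symm.isOpen_inter_preimage hL.isOpen_compl
  obtain ⟨ε₁, hε₁, hV₁⟩ := exists_annulus_subset hV fun θ => by
    refine ⟨by rw [← (heγ₀ θ).2]; exact e₀.map_source (heγ₀ θ).1, ?_⟩
    have h1 : e₀.symm θ = γ i₀ θ := by rw [← (heγ₀ θ).2, e₀.left_inv (heγ₀ θ).1]
    rw [mem_preimage, h1, mem_compl_iff, mem_iUnion, not_exists]
    rintro ⟨i, hi⟩ h
    exact disjoint_left.1 (hγγ hi) h (mem_range_self θ)
  obtain ⟨e₁, he₁, he₁', het₁, hes₁⟩ := exists_restr_annulus e₀ (hV₁.trans inter_subset_left)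
  have heK : ∀ x ∈ e₁.source, (x ∈ K ↔ ‖e₁ x‖ = 1) := by
    intro x hx
    rw [he₁]
    constructor
    · intro hxK
      obtain ⟨i, hi⟩ := mem_iUnion.1 hxK
      by_cases hi₀ : i = i₀
      · subst hi₀
        obtain ⟨θ, rfl⟩ := hi
        rw [(heγ₀ θ).2, Circle.norm_coe]
      · exfalso
        have h1 := e₁.map_source hx
        rw [het₁] at h1
        have h2 := (hV₁ h1).2
        rw [mem_preimage, he₁, e₀.left_inv (hes₁ hx)] at h2
        exact h2 (mem_iUnion.2 ⟨⟨i, hi₀⟩, hi⟩)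
    · intro h
      have h1 : e₀ x = e₀ (γ i₀ (⟨e₀ x, mem_sphere_zero_iff_norm.2 h⟩ : Circle)) :=
        ((heγ₀ (⟨e₀ x, mem_sphere_zero_iff_norm.2 h⟩ : Circle)).2).symm
      have h2 := e₀.injOn (hes₁ hx) (heγ₀ _).1 h1
      exact mem_iUnion.2 ⟨i₀, _, h2.symm⟩
  have hs₁ : ContMDiffOn (𝓡 2) 𝓘(ℝ, ℂ) ∞ e₁ e₁.source := by rw [he₁]; exact hes₀.mono hes₁
  have hs₁' : ContMDiffOn 𝓘(ℝ, ℂ) (𝓡 2) ∞ e₁.symm e₁.target := by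
    rw [he₁', het₁]; exact hes₀'.mono (hV₁.trans inter_subset_left)
  have hσ₁ : ∀ x ∈ e₁.source, σ x = polarForm (𝓡 2) e₁ x := fun x hx => by
    rw [he₁]; exact heσ₀ x (hes₁ hx)
  obtain ⟨h, δ, hh, hh1, hδ, hδε, hhe⟩ := exists_angular_extension hσ hσ0 hKc
    hγc.isPreconnected hε₁ het₁ hs₁ hs₁' hσ₁ heK
  have hδ₁ : annulus δ ⊆ e₁.target := by rw [het₁]; exact annulus_mono hδε
  obtain ⟨e, he, he', het, hes⟩ := exists_restr_annulus e₁ hδ₁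
  -- Putting the other circles back keeps connectedness, since the larger set lies between Kᶜ and
  -- its closure, which is the whole surface.
  have hsub : Kᶜ ⊆ {x | x ∈ e.source → ‖e x‖ ≠ 1} := fun x hx hxe h =>
    hx (by rw [heK x (hes hxe), ← he]; exact h)
  refine ⟨δ, e, fun x => ⟨h x, mem_sphere_zero_iff_norm.2 (hh1 x)⟩, hδ, het, ?_, ?_, ?_,
    contMDiff_circle hh, ?_, hγc.subset_closure hsub ?_, hdense.mono hsub⟩
  · rw [he]; exact hs₁.mono hes
  · rw [he', het]; exact hs₁'.mono hδ₁
  · intro x hx; rw [he]; exact hσ₁ x (hes hx)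
  · intro x hx
    have h1 := e.map_source hx
    rw [het] at h1
    have h2 : h x = e x * ((‖e x‖ : ℝ) : ℂ)⁻¹ := by
      rw [he] at h1 ⊢; exact hhe x (hes hx) h1
    have h3 : ((‖e x‖ : ℝ) : ℂ) ≠ 0 := by simpa using h1.1
    change e x = ‖e x‖ * h x
    rw [h2]
    field_simp
  · rw [hdense.closure_eq]; exact subset_univ _

end Handle

/-! ### Products of model spaces. -/

section Model

variable {E E' : Type*} [NormedAddCommGroup E] [NormedSpace ℝ E]
  [NormedAddCommGroup E'] [NormedSpace ℝ E']
  {H H' : Type*} [TopologicalSpace H] [TopologicalSpace H']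
  {I : ModelWithCorners ℝ E H} {I' : ModelWithCorners ℝ E' H'}
  {M : Type*} [TopologicalSpace M] [ChartedSpace H' M]

theorem contMDiffOn_of_model {f : M → H} {s : Set M}
    (h : ContMDiffOn I' 𝓘(ℝ, E) ∞ (fun y => I (f y)) s) : ContMDiffOn I' I ∞ f s :=
  ((I.contMDiffOn_symm (n := ∞)).comp h fun y _ => mem_range_self (f y)).congr
    fun y _ => (I.left_inv (f y)).symm

/-- A product of model spaces carries two equal, but differently built, charted space structures: as
a model space and as a product. The statement about products is transported to the first structure.
-/
theorem contMDiffOn_prodMap_model {E₁ E₂ E₃ E₄ : Type*}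
    [NormedAddCommGroup E₁] [NormedSpace ℝ E₁] [NormedAddCommGroup E₂] [NormedSpace ℝ E₂]
    [NormedAddCommGroup E₃] [NormedSpace ℝ E₃] [NormedAddCommGroup E₄] [NormedSpace ℝ E₄]
    {H₁ H₂ H₃ H₄ : Type*} [TopologicalSpace H₁] [TopologicalSpace H₂] [TopologicalSpace H₃]
    [TopologicalSpace H₄] {I₁ : ModelWithCorners ℝ E₁ H₁} {I₂ : ModelWithCorners ℝ E₂ H₂}
    {I₃ : ModelWithCorners ℝ E₃ H₃} {I₄ : ModelWithCorners ℝ E₄ H₄}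
    {f : H₁ → H₂} {g : H₃ → H₄} {s : Set H₁} {t : Set H₃} (hf : ContMDiffOn I₁ I₂ ∞ f s)
    (hg : ContMDiffOn I₃ I₄ ∞ g t) :
    ContMDiffOn (H := ModelProd H₁ H₃) (H' := ModelProd H₂ H₄) (M := ModelProd H₁ H₃)
      (M' := ModelProd H₂ H₄) (I₁.prod I₃) (I₂.prod I₄) ∞ (Prod.map f g) (s ×ˢ t) := by
  have h := hf.prodMap hg
  have e₁ : chartedSpaceSelf (ModelProd H₁ H₃) = prodChartedSpace H₁ H₁ H₃ H₃ :=
    chartedSpaceSelf_prod.symm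
  have e₂ : chartedSpaceSelf (ModelProd H₂ H₄) = prodChartedSpace H₂ H₂ H₄ H₄ :=
    chartedSpaceSelf_prod.symm
  rw [e₁, e₂]
  exact h

end Model

/-! ### The half-line as a one-dimensional model with boundary. -/

section HalfLine

/-- The vector in the line with given coordinate. -/
def lineVec : ℝ →L[ℝ] EuclideanSpace ℝ (Fin 1) :=
  (ContinuousLinearMap.id ℝ ℝ).smulRight (EuclideanSpace.single 0 1)

@[simp] theorem lineVec_apply (t : ℝ) : lineVec t 0 = t := by simp [lineVec]

theorem lineVec_coord (x : EuclideanSpace ℝ (Fin 1)) : lineVec (x 0) = x := by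
  ext i; fin_cases i; simp

/-- The point of the half-line closest to a given real number. -/
def toHalf (t : ℝ) : EuclideanHalfSpace 1 := ⟨lineVec (max t 0), by simp⟩

theorem toHalf_val {t : ℝ} (ht : 0 ≤ t) : (toHalf t).val 0 = t := by simp [toHalf, ht]

theorem toHalf_coord (x : EuclideanHalfSpace 1) : toHalf (x.val 0) = x := by
  apply Subtype.ext
  simp only [toHalf]
  rw [max_eq_left x.2, lineVec_coord]

theorem continuous_toHalf : Continuous toHalf := by
  refine Continuous.subtype_mk ?_ _
  exact lineVec.continuous.comp (by fun_prop)

theorem continuous_halfCoord : Continuous fun x : EuclideanHalfSpace 1 => x.val 0 :=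
  (EuclideanSpace.proj (0 : Fin 1)).continuous.comp continuous_subtype_val

theorem contMDiff_halfCoord :
    ContMDiff (𝓡∂ 1) 𝓘(ℝ, ℝ) ∞ fun x : EuclideanHalfSpace 1 => x.val 0 :=
  (EuclideanSpace.proj (𝕜 := ℝ) (0 : Fin 1)).contDiff.contMDiff.comp (𝓡∂ 1).contMDiff

theorem contMDiffOn_toHalf : ContMDiffOn 𝓘(ℝ, ℝ) (𝓡∂ 1) ∞ toHalf (Ici 0) := by
  refine contMDiffOn_of_model ?_
  refine lineVec.contDiff.contMDiff.contMDiffOn.congr fun t ht => ?_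
  change lineVec (max t 0) = _
  rw [max_eq_left ht]

/-- The embedding of the line as an open half-line. -/
def expHalf : OpenPartialHomeomorph (EuclideanSpace ℝ (Fin 1)) (EuclideanHalfSpace 1) where
  toFun x := toHalf (Real.exp (x 0))
  invFun y := lineVec (Real.log (y.val 0))
  source := univ
  target := {y | 0 < y.val 0}
  map_source' x _ := by
    change 0 < (toHalf _).val 0
    rw [toHalf_val (Real.exp_pos _).le]; exact Real.exp_pos _
  map_target' _ _ := trivial
  left_inv' x _ := by
    rw [toHalf_val (Real.exp_pos _).le, Real.log_exp, lineVec_coord]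
  right_inv' y hy := by
    rw [lineVec_apply, Real.exp_log hy, toHalf_coord]
  open_source := isOpen_univ
  open_target := isOpen_lt continuous_const continuous_halfCoord
  continuousOn_toFun := by
    refine Continuous.continuousOn (continuous_toHalf.comp (Real.continuous_exp.comp ?_))
    exact (EuclideanSpace.proj (0 : Fin 1)).continuous
  continuousOn_invFun := lineVec.continuous.comp_continuousOn
    (ContinuousOn.log continuous_halfCoord.continuousOn fun _ hy => (ne_of_gt hy))

theorem expHalf_val_pos (x : EuclideanSpace ℝ (Fin 1)) : 0 < (expHalf x).val 0 :=
  expHalf.map_source (mem_univ x)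

theorem contMDiffOn_expHalf : ContMDiffOn (𝓡 1) (𝓡∂ 1) ∞ expHalf expHalf.source := by
  refine contMDiffOn_toHalf.comp (t := Ici 0) ?_ fun x _ => (Real.exp_pos _).le
  exact (Real.contDiff_exp.comp (EuclideanSpace.proj (𝕜 := ℝ) (0 : Fin 1)).contDiff).contMDiff.contMDiffOn

theorem contMDiffOn_expHalf_symm : ContMDiffOn (𝓡∂ 1) (𝓡 1) ∞ expHalf.symm expHalf.target := by
  have h : ContDiffOn ℝ ∞ (fun t => lineVec (Real.log t)) (Ioi 0) :=
    lineVec.contDiff.comp_contDiffOn (contDiffOn_id.log fun t ht => ne_of_gt ht)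
  exact h.contMDiffOn.comp contMDiff_halfCoord.contMDiffOn fun y hy => hy

end HalfLine

/-! ### The torus with a disc removed. -/

section Torus

/-- The angular coordinates on the torus, as a complex number. -/
def angles (p : Circle × Circle) : ℂ := ⟨Complex.arg p.1, Complex.arg p.2⟩

/-- The point of the torus with given angular coordinates. -/
def ofAngles (w : ℂ) : Circle × Circle := (Circle.exp w.re, Circle.exp w.im)

theorem ofAngles_angles (p : Circle × Circle) : ofAngles (angles p) = p :=
  Prod.ext (Circle.exp_arg p.1) (Circle.exp_arg p.2)

theorem angles_ofAngles {w : ℂ} (hw : ‖w‖ < Real.pi) : angles (ofAngles w) = w := by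
  have h1 := abs_lt.1 ((Complex.abs_re_le_norm w).trans_lt hw)
  have h2 := abs_lt.1 ((Complex.abs_im_le_norm w).trans_lt hw)
  exact Complex.ext (Circle.arg_exp h1.1 h1.2.le) (Circle.arg_exp h2.1 h2.2.le)

/-- At t = −π the principal argument is π, so only the absolute values agree on the whole closed
interval. -/
theorem abs_arg_exp {t : ℝ} (ht : |t| ≤ Real.pi) : |Complex.arg (Circle.exp t)| = |t| := by
  obtain ⟨h1, h2⟩ := abs_le.1 ht
  rcases h1.lt_or_eq with h | h
  · rw [Circle.arg_exp h h2]
  · rw [← h, Circle.coe_exp]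
    simp

theorem norm_angles_ofAngles {w : ℂ} (h1 : |w.re| ≤ Real.pi) (h2 : |w.im| ≤ Real.pi) :
    ‖angles (ofAngles w)‖ = ‖w‖ := by
  rw [Complex.norm_def, Complex.norm_def, Complex.normSq_apply, Complex.normSq_apply]
  congr 1
  rw [← abs_mul_abs_self w.re, ← abs_mul_abs_self w.im, ← abs_arg_exp h1, ← abs_arg_exp h2,
    abs_mul_abs_self, abs_mul_abs_self]
  rfl

theorem contMDiff_ofAngles : ContMDiff 𝓘(ℝ, ℂ) ((𝓡 1).prod (𝓡 1)) ∞ ofAngles :=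
  ((contMDiff_circleExp (m := ∞)).comp Complex.reCLM.contDiff.contMDiff).prodMk
    ((contMDiff_circleExp (m := ∞)).comp Complex.imCLM.contDiff.contMDiff)

theorem mem_slitPlane_of_abs_arg_lt {z : Circle} (h : |Complex.arg z| < Real.pi) :
    (z : ℂ) ∈ Complex.slitPlane := by
  rw [Complex.mem_slitPlane_iff_arg]
  exact ⟨fun h' => by rw [h', abs_of_pos Real.pi_pos] at h; exact lt_irrefl _ h,
    Circle.coe_ne_zero z⟩

theorem contMDiffAt_angles {p : Circle × Circle} (hp : ‖angles p‖ < Real.pi) :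
    ContMDiffAt ((𝓡 1).prod (𝓡 1)) 𝓘(ℝ, ℂ) ∞ angles p := by
  have h1 := mem_slitPlane_of_abs_arg_lt ((Complex.abs_re_le_norm (angles p)).trans_lt hp)
  have h2 := mem_slitPlane_of_abs_arg_lt ((Complex.abs_im_le_norm (angles p)).trans_lt hp)
  have h3 : angles = fun p => ((Complex.arg p.1 : ℝ) : ℂ) + ((Complex.arg p.2 : ℝ) : ℂ) * Complex.I :=
    funext fun p => Complex.ext (by simp [angles]) (by simp [angles])
  rw [h3]
  have h4 : ∀ {z : ℂ}, z ∈ Complex.slitPlane → ∀ c : ℂ,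
      ContDiffAt ℝ ∞ (fun z : ℂ => ((Complex.arg z : ℝ) : ℂ) * c) z := fun hz c =>
    (Complex.ofRealCLM.contDiff.contDiffAt.comp _ (contDiffAt_arg hz)).mul contDiffAt_const
  have h5 := (h4 h1 1).contMDiffAt.comp p
    ((contMDiff_circle_coe.comp (contMDiff_fst (I := 𝓡 1) (J := 𝓡 1))).contMDiffAt (x := p))
  have h6 := (h4 h2 Complex.I).contMDiffAt.comp p
    ((contMDiff_circle_coe.comp (contMDiff_snd (I := 𝓡 1) (J := 𝓡 1))).contMDiffAt (x := p))
  exact (h5.add h6).congr_of_eventuallyEq (Filter.Eventually.of_forall fun p => by simp)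

/-- Inside the disc of radius π the angular coordinates are smooth, so the set is a neighbourhood of
each of its points. -/
theorem isOpen_norm_angles_lt {c : ℝ} (hc : c ≤ Real.pi) :
    IsOpen {p : Circle × Circle | ‖angles p‖ < c} := by
  rw [isOpen_iff_mem_nhds]
  intro p hp
  exact (contMDiffAt_angles (lt_of_lt_of_le hp hc)).continuousAt.norm.eventually_lt
    continuousAt_const hp

/-- The map `angles` jumps along the branch cut, so openness cannot be obtained as for a preimage.
The complement is the image of a closed disc under the continuous map `ofAngles`, hence compact. -/
theorem isOpen_lt_norm_angles {c : ℝ} (hc : c < Real.pi) :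
    IsOpen {p : Circle × Circle | c < ‖angles p‖} := by
  have h : {p : Circle × Circle | c < ‖angles p‖}ᶜ = ofAngles '' Metric.closedBall 0 c := by
    ext p
    simp only [mem_compl_iff, mem_ofPred_eq, not_lt, mem_image, Metric.mem_closedBall,
      dist_zero_right]
    constructor
    · intro h; exact ⟨_, h, ofAngles_angles p⟩
    · rintro ⟨w, hw, rfl⟩
      rwa [angles_ofAngles (hw.trans_lt hc)]
  rw [← isClosed_compl_iff, h]
  exact ((isCompact_closedBall _ _).image contMDiff_ofAngles.continuous).isClosed

/-- The direction of a complex number. -/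
def direction (w : ℂ) : Circle := Circle.exp (Complex.arg w)

theorem norm_mul_direction (w : ℂ) : (‖w‖ : ℂ) * direction w = w := by
  rw [direction, Circle.coe_exp, Complex.norm_mul_exp_arg_mul_I]

theorem direction_mul {r : ℝ} (hr : 0 < r) (z : Circle) : direction (r * z) = z := by
  rw [direction, Complex.arg_real_mul _ hr, Circle.exp_arg]

theorem contMDiffOn_direction : ContMDiffOn 𝓘(ℝ, ℂ) (𝓡 1) ∞ direction {w | w ≠ 0} := by
  refine contMDiffOn_circle (contDiffOn_mul_inv_norm.contMDiffOn.congr fun w hw => ?_)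
  have h : ((‖w‖ : ℝ) : ℂ) ≠ 0 := by simpa using hw
  rw [eq_comm, mul_inv_eq_iff_eq_mul₀ h, mul_comm, norm_mul_direction]

/-- The torus with an open disc removed. -/
structure TorusPiece : Type where
  /-- the underlying point of the torus -/
  val : Circle × Circle
  le_norm : 1 / 2 ≤ ‖angles val‖

namespace TorusPiece

@[ext] theorem ext {p q : TorusPiece} (h : p.val = q.val) : p = q := by
  cases p; cases q; cases h; rfl

instance : TopologicalSpace TorusPiece := TopologicalSpace.induced val inferInstance

theorem isEmbedding_val : IsEmbedding val := ⟨⟨rfl⟩, fun _ _ h => ext h⟩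

theorem continuous_val : Continuous val := isEmbedding_val.continuous

instance : T2Space TorusPiece := isEmbedding_val.t2Space

theorem pi_gt : (1 : ℝ) < Real.pi := by linarith [Real.pi_gt_three]

theorem range_val : range val = {p | ‖angles p‖ < 1 / 2}ᶜ := by
  ext p
  rw [mem_compl_iff, mem_ofPred_eq, not_lt]
  exact ⟨fun ⟨q, hq⟩ => hq ▸ q.le_norm, fun h => ⟨⟨p, h⟩, rfl⟩⟩

instance : CompactSpace TorusPiece := by
  refine IsClosedEmbedding.compactSpace (f := val) ⟨isEmbedding_val, ?_⟩
  rw [range_val]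
  exact (isOpen_norm_angles_lt (by linarith [pi_gt])).isClosed_compl

/-- A collar of the boundary. -/
def collarPt (z : Circle) (t : ℝ) : TorusPiece :=
  -- Clamping t to [0, 1/2] makes the map total. The radius t + 1/2 then stays between 1/2 and 1,
  -- where `angles` inverts `ofAngles`.
  ⟨ofAngles (((max (min t (1 / 2)) 0 + 1 / 2 : ℝ) : ℂ) * z), by
    have h0 : 0 ≤ max (min t (1 / 2)) 0 := le_max_right _ _
    have h2 : max (min t (1 / 2)) 0 ≤ 1 / 2 := max_le (min_le_right _ _) (by norm_num)
    have h1 : ‖((max (min t (1 / 2)) 0 + 1 / 2 : ℝ) : ℂ) * z‖ = max (min t (1 / 2)) 0 + 1 / 2 := by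
      rw [norm_mul, Circle.norm_coe, mul_one, Complex.norm_real, Real.norm_of_nonneg (by linarith)]
    rw [angles_ofAngles (by rw [h1]; linarith [pi_gt]), h1]
    linarith⟩

theorem collarPt_val {t : ℝ} (h0 : 0 ≤ t) (h1 : t ≤ 1 / 2) (z : Circle) :
    (collarPt z t).val = ofAngles (((t + 1 / 2 : ℝ) : ℂ) * z) := by
  simp only [collarPt, min_eq_left h1, max_eq_left h0]

theorem angles_collarPt {t : ℝ} (h0 : 0 ≤ t) (h1 : t ≤ 1 / 2) (z : Circle) :
    angles (collarPt z t).val = ((t + 1 / 2 : ℝ) : ℂ) * z := by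
  rw [collarPt_val h0 h1, angles_ofAngles]
  rw [norm_mul, Circle.norm_coe, mul_one, Complex.norm_real, Real.norm_of_nonneg (by linarith)]
  linarith [pi_gt]

theorem norm_angles_collarPt {t : ℝ} (h0 : 0 ≤ t) (h1 : t ≤ 1 / 2) (z : Circle) :
    ‖angles (collarPt z t).val‖ = t + 1 / 2 := by
  rw [angles_collarPt h0 h1, norm_mul, Circle.norm_coe, mul_one, Complex.norm_real,
    Real.norm_of_nonneg (by linarith)]

theorem continuous_collarPt : Continuous fun q : Circle × ℝ => collarPt q.1 q.2 := by
  refine isEmbedding_val.continuous_iff.2 (contMDiff_ofAngles.continuous.comp ?_)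
  fun_prop

theorem collarPt_angles (p : TorusPiece) (hp : ‖angles p.val‖ ≤ 1) :
    collarPt (direction (angles p.val)) (‖angles p.val‖ - 1 / 2) = p := by
  ext1
  rw [collarPt_val (by linarith [p.2]) (by linarith), sub_add_cancel, norm_mul_direction,
    ofAngles_angles]

theorem angles_ne_zero (p : TorusPiece) : angles p.val ≠ 0 := fun h => by
  have := p.2; rw [h, norm_zero] at this; linarith

/-- The collar as a chart with values in a half-cylinder. -/
def collar : OpenPartialHomeomorph TorusPiece (Circle × EuclideanHalfSpace 1) where
  toFun p := (direction (angles p.val), toHalf (‖angles p.val‖ - 1 / 2))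
  invFun q := collarPt q.1 (q.2.val 0)
  source := {p | ‖angles p.val‖ < 1}
  target := {q | q.2.val 0 < 1 / 2}
  map_source' p hp := by
    change (toHalf _).val 0 < _
    have : ‖angles p.val‖ < 1 := hp
    rw [toHalf_val (by linarith [p.2])]; linarith
  map_target' q hq := by
    have : q.2.val 0 < 1 / 2 := hq
    change ‖angles (collarPt _ _).val‖ < 1
    rw [norm_angles_collarPt q.2.2 this.le]; linarith
  left_inv' p hp := by
    have : ‖angles p.val‖ < 1 := hp
    change collarPt _ ((toHalf _).val 0) = p
    rw [toHalf_val (by linarith [p.2])]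
    exact collarPt_angles p this.le
  right_inv' q hq := by
    have h : q.2.val 0 < 1 / 2 := hq
    have h0 : 0 ≤ q.2.val 0 := q.2.2
    refine Prod.ext ?_ ?_
    · change direction (angles (collarPt _ _).val) = _
      rw [angles_collarPt h0 h.le, direction_mul (by linarith)]
    · change toHalf (‖angles (collarPt _ _).val‖ - 1 / 2) = _
      rw [norm_angles_collarPt h0 h.le, add_sub_cancel_right, toHalf_coord]
  open_source := (isOpen_norm_angles_lt pi_gt.le).preimage continuous_val
  open_target := isOpen_lt (continuous_halfCoord.comp continuous_snd) continuous_const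
  continuousOn_toFun := by
    intro p hp
    have h1 : ContinuousAt (fun p : TorusPiece => angles p.val) p :=
      ContinuousAt.comp (g := angles) (contMDiffAt_angles (lt_trans hp pi_gt)).continuousAt
        continuous_val.continuousAt
    have h2 : ContinuousAt direction (angles p.val) :=
      contMDiffOn_direction.continuousOn.continuousAt (isOpen_ne.mem_nhds (angles_ne_zero p))
    have h3 : ContinuousAt (fun p : TorusPiece => ‖angles p.val‖ - 1 / 2) p :=
      h1.norm.sub continuousAt_const
    exact ((ContinuousAt.comp (f := fun p : TorusPiece => angles p.val) h2 h1).prodMk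
      (ContinuousAt.comp (f := fun p : TorusPiece => ‖angles p.val‖ - 1 / 2)
        continuous_toHalf.continuousAt h3)).continuousWithinAt
  continuousOn_invFun := (continuous_collarPt.comp
    (continuous_fst.prodMk (continuous_halfCoord.comp continuous_snd))).continuousOn

theorem collar_val (p : TorusPiece) : (collar p).2.val 0 = ‖angles p.val‖ - 1 / 2 :=
  toHalf_val (by linarith [p.2])

open Classical in
/-- The interior of the piece as an open subset of the torus. -/
def inner : OpenPartialHomeomorph TorusPiece (Circle × Circle) where
  toFun p := p.val
  -- The value in the other case is arbitrary.
  invFun q := if h : 1 / 2 ≤ ‖angles q‖ then ⟨q, h⟩ else collarPt 1 0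
  source := {p | 1 / 2 < ‖angles p.val‖}
  target := {q | 1 / 2 < ‖angles q‖}
  map_source' _ hp := hp
  map_target' q hq := by
    have h : 1 / 2 ≤ ‖angles q‖ := le_of_lt hq
    change 1 / 2 < ‖angles _‖
    rw [dif_pos h]; exact hq
  left_inv' p _ := dif_pos p.2
  right_inv' q hq := by
    have h : 1 / 2 ≤ ‖angles q‖ := le_of_lt hq
    rw [dif_pos h]
  open_source := (isOpen_lt_norm_angles (by linarith [pi_gt])).preimage continuous_val
  open_target := isOpen_lt_norm_angles (by linarith [pi_gt])
  continuousOn_toFun := continuous_val.continuousOn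
  continuousOn_invFun := by
    refine isEmbedding_val.continuousOn_iff.2 ?_
    refine continuousOn_id.congr fun q hq => ?_
    have h : 1 / 2 ≤ ‖angles q‖ := le_of_lt hq
    rw [Function.comp, dif_pos h]; rfl

theorem inner_symm_val {q : Circle × Circle} (hq : 1 / 2 < ‖angles q‖) :
    (inner.symm q).val = q := inner.right_inv hq

/-- The smooth structure of the piece. -/
def cover : SmoothCover ((𝓡 1).prod (𝓡∂ 1)) ((𝓡 1).prod (𝓡∂ 1)) ((𝓡 1).prod (𝓡 1)) TorusPiece
    (Circle × EuclideanHalfSpace 1) (Circle × Circle) where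
  e₁ := collar
  e₂ := inner
  cover p := by
    rcases lt_or_ge ‖angles p.val‖ 1 with h | h
    · exact Or.inl h
    · right; change 1 / 2 < ‖angles p.val‖; linarith
  j₁ := OpenPartialHomeomorph.refl _
  -- Interior charts are placed in the open half-space by the exponential, so their last coordinate
  -- never takes the boundary value 0.
  j₂ := (OpenPartialHomeomorph.refl _).prod expHalf
  j₁_source := rfl
  j₂_source := univ_prod_univ
  j₁_smooth := contMDiffOn_id
  j₂_smooth := contMDiffOn_prodMap_model contMDiffOn_id contMDiffOn_expHalf
  j₁_symm_smooth := contMDiffOn_id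
  j₂_symm_smooth := contMDiffOn_prodMap_model contMDiffOn_id contMDiffOn_expHalf_symm
  trans₁₂ := by
    have h : ContMDiff ((𝓡 1).prod (𝓡∂ 1)) 𝓘(ℝ, ℂ) ∞ fun q : Circle × EuclideanHalfSpace 1 =>
        ((q.2.val 0 + 1 / 2 : ℝ) : ℂ) * q.1 := by
      have h1 : ContDiff ℝ ∞ fun q : ℝ × ℂ => ((q.1 + 1 / 2 : ℝ) : ℂ) * q.2 :=
        (Complex.ofRealCLM.contDiff.comp (contDiff_fst.add contDiff_const)).mul contDiff_snd
      exact h1.contMDiff.comp ((contMDiff_halfCoord.comp contMDiff_snd).prodMk_space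
        (contMDiff_circle_coe.comp contMDiff_fst))
    refine (contMDiff_ofAngles.comp h).contMDiffOn.congr fun q hq => ?_
    have h1 : q.2.val 0 < 1 / 2 := hq.1
    exact collarPt_val q.2.2 h1.le q.1
  trans₂₁ := by
    intro q hq
    have h1 : 1 / 2 < ‖angles q‖ := hq.1
    have h2 : ‖angles q‖ < 1 := by
      have h : ‖angles (inner.symm q).val‖ < 1 := hq.2
      rwa [inner_symm_val h1] at h
    have h3 := contMDiffAt_angles (h2.trans pi_gt)
    have h0 : angles q ≠ 0 := fun h => by rw [h, norm_zero] at h1; linarith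
    have h4 := (contMDiffOn_direction.contMDiffAt (isOpen_ne.mem_nhds h0)).comp q h3
    have h5 : ContMDiffAt ((𝓡 1).prod (𝓡 1)) 𝓘(ℝ, ℝ) ∞ (fun q => ‖angles q‖ - 1 / 2) q :=
      ((contDiffAt_norm ℝ h0).sub contDiffAt_const).contMDiffAt.comp q h3
    have h6 : ContMDiffAt ((𝓡 1).prod (𝓡 1)) (𝓡∂ 1) ∞ (fun q => toHalf (‖angles q‖ - 1 / 2)) q :=
      (contMDiffOn_toHalf.contMDiffAt (Ici_mem_nhds (by linarith))).comp q h5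
    have h7 : ∀ q' : Circle × Circle, 1 / 2 < ‖angles q'‖ → (collar ∘ inner.symm) q' =
        (direction (angles q'), toHalf (‖angles q'‖ - 1 / 2)) := fun q' h => by
      change (direction (angles (inner.symm q').val),
        toHalf (‖angles (inner.symm q').val‖ - 1 / 2)) = _
      rw [inner_symm_val h]
    exact ((h4.prodMk h6).contMDiffWithinAt).congr (fun q' hq' => h7 q' hq'.1) (h7 q h1)

end TorusPiece

end Torus

/-! ### Injectivity of differentials from left inverses. -/

section LeftInverse

variable {E E' : Type*} [NormedAddCommGroup E] [NormedSpace ℝ E]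
  [NormedAddCommGroup E'] [NormedSpace ℝ E']
  {H H' : Type*} [TopologicalSpace H] [TopologicalSpace H']
  {I : ModelWithCorners ℝ E H} {J : ModelWithCorners ℝ E' H'}
  {M N : Type*} [TopologicalSpace M] [ChartedSpace H M] [TopologicalSpace N] [ChartedSpace H' N]

/-- The chain rule for g ∘ f = id. It suffices that g is differentiable within a set containing the
nearby values of f; this covers boundary points, where a left inverse may exist on one side only. -/
theorem injective_mfderiv_of_leftInverse {f : M → N} {g : N → M} {s : Set N} {x : M}
    (hf : MDifferentiableAt I J f x) (hg : MDifferentiableWithinAt J I g s (f x))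
    (hs : ∀ᶠ y in 𝓝 x, f y ∈ s) (hgf : ∀ᶠ y in 𝓝 x, g (f y) = y) :
    Function.Injective (mfderiv I J f x) := by
  obtain ⟨O, hO, hOo, hxO⟩ := eventually_nhds_iff.1 hs
  have h1 : HasMFDerivWithinAt I J f O x (mfderiv I J f x) := hf.hasMFDerivAt.hasMFDerivWithinAt
  have h2 := (hg.hasMFDerivWithinAt.comp x h1 hO).hasMFDerivAt (hOo.mem_nhds hxO)
  have h3 : HasMFDerivAt I I (g ∘ f) x (ContinuousLinearMap.id ℝ (TangentSpace I x)) :=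
    (hasMFDerivAt_id x).congr_of_eventuallyEq hgf
  have h4 := hasMFDerivAt_unique h2 h3
  intro v w hvw
  have h5 : ∀ u : TangentSpace I x, mfderivWithin J I g s (f x) (mfderiv I J f x u) = u :=
    fun u => congrArg (fun L => L u) h4
  rw [← h5 v, ← h5 w, hvw]

end LeftInverse

/-! ### The angular form of the circle. -/

section CircleForm

theorem circle_eq_mul_exp (z z₀ : Circle) :
    z₀ * Circle.exp (Complex.arg ((z₀⁻¹ : Circle) * (z : ℂ))) = z := by
  rw [← Circle.coe_mul, Circle.exp_arg, mul_inv_cancel_left]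

theorem contMDiffAt_arg_circle (z : Circle) :
    ContMDiffAt (𝓡 1) 𝓘(ℝ, ℝ) ∞ (fun z' : Circle => Complex.arg ((z⁻¹ : Circle) * (z' : ℂ))) z := by
  have h : ContDiffAt ℝ ∞ (fun w : ℂ => Complex.arg ((z⁻¹ : Circle) * w)) z := by
    refine ContDiffAt.comp (z : ℂ) (contDiffAt_arg ?_) (contDiffAt_const.mul contDiffAt_id)
    rw [← Circle.coe_mul, inv_mul_cancel, Circle.coe_one]
    exact Complex.one_mem_slitPlane
  exact h.contMDiffAt.comp z contMDiff_circle_coe.contMDiffAt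

/-- At z the angular form is the differential of a branch of the argument, and t ↦ z exp(it) is a
left inverse of this branch. -/
theorem injective_ang_circle (z : Circle) :
    Function.Injective (ang (𝓡 1) (fun z' : Circle => (z' : ℂ)) z) := by
  set t : Circle → ℝ := fun z' => Complex.arg ((z⁻¹ : Circle) * (z' : ℂ)) with ht
  have htd : MDifferentiableAt (𝓡 1) 𝓘(ℝ, ℝ) t z :=
    (contMDiffAt_arg_circle z).mdifferentiableAt (by simp)
  have h1 : (fun z' : Circle => (z' : ℂ)) =
      fun z' => (z : ℂ) * Complex.exp (t z' * Complex.I) := by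
    funext z'
    rw [← Circle.coe_exp, ← Circle.coe_mul, circle_eq_mul_exp]
  have h2 : MDifferentiableAt (𝓡 1) 𝓘(ℝ, ℂ) (fun z' => Complex.exp (t z' * Complex.I)) z := by
    have : ContDiff ℝ ∞ fun s : ℝ => Complex.exp (s * Complex.I) :=
      (Complex.ofRealCLM.contDiff.mul contDiff_const).cexp
    exact (this.contMDiff.contMDiffAt.comp z (contMDiffAt_arg_circle z)).mdifferentiableAt (by simp)
  have h3 : ang (𝓡 1) (fun z' : Circle => (z' : ℂ)) z = mvfderiv (𝓡 1) t z := by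
    rw [h1, ang_mul mdifferentiableAt_const h2 (Circle.coe_ne_zero z) (Complex.exp_ne_zero _),
      ang_const, zero_add, ang_cexp_mul_I htd]
  rw [h3]
  refine injective_mfderiv_of_leftInverse (J := 𝓘(ℝ, ℝ)) (s := univ)
    (g := fun s => z * Circle.exp s) htd ?_ (by simp) (Filter.Eventually.of_forall fun y =>
      circle_eq_mul_exp y z)
  exact ((contMDiff_mul_circleExp z).mdifferentiable (by simp) _).mdifferentiableWithinAt

end CircleForm

/-! ### The twisting function on the torus. -/

section Twist

/-- The cut-off vanishes on the left half-plane, which contains the branch cut of the argument. -/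
theorem contDiffOn_cutAngle :
    ContDiffOn ℝ ∞ (fun z : ℂ => Real.smoothTransition (z.re / Real.cos 1) * Complex.arg z)
      {z | z ≠ 0} := by
  intro z hz
  refine ContDiffAt.contDiffWithinAt ?_
  have h1 : ContDiff ℝ ∞ fun z : ℂ => Real.smoothTransition (z.re / Real.cos 1) :=
    Real.smoothTransition.contDiff.comp (Complex.reCLM.contDiff.div_const _)
  by_cases h : z ∈ Complex.slitPlane
  · exact h1.contDiffAt.mul (contDiffAt_arg h)
  · have h2 : z.re < 0 := by
      rw [Complex.mem_slitPlane_iff, not_or, not_lt, not_not] at h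
      exact lt_of_le_of_ne h.1 fun h0 => hz (Complex.ext h0 h.2)
    refine (contDiffAt_const (c := (0 : ℝ))).congr_of_eventuallyEq ?_
    filter_upwards [Complex.continuous_re.continuousAt.eventually_lt continuousAt_const h2] with w hw
    rw [Real.smoothTransition.zero_of_nonpos, zero_mul]
    exact div_nonpos_of_nonpos_of_nonneg (le_of_lt hw) Real.cos_one_pos.le

/-- A circle valued function on the torus which is constant on a disc, and which is the first
coordinate outside of a larger cylinder. -/
def twist (q : Circle × Circle) : Circle :=
  -- The exponent removes the argument of q.1 where both cut-offs are 1, that is where both real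
  -- parts are at least cos 1; this includes the disc of radius 1 in angular coordinates. The
  -- cut-off in q.2 switches the correction off where Re q.2 ≤ 0.
  q.1 * Circle.exp (-(Real.smoothTransition ((q.2 : ℂ).re / Real.cos 1) *
    (Real.smoothTransition ((q.1 : ℂ).re / Real.cos 1) * Complex.arg q.1)))

theorem contMDiff_twist : ContMDiff ((𝓡 1).prod (𝓡 1)) (𝓡 1) ∞ twist := by
  have h1 : ContDiffOn ℝ ∞ (fun q : ℂ × ℂ => -(Real.smoothTransition (q.2.re / Real.cos 1) *
      (Real.smoothTransition (q.1.re / Real.cos 1) * Complex.arg q.1))) {q | q.1 ≠ 0} := by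
    refine (ContDiffOn.mul (ContDiff.contDiffOn ?_)
      (contDiffOn_cutAngle.comp contDiff_fst.contDiffOn fun q hq => hq)).neg
    exact Real.smoothTransition.contDiff.comp
      ((Complex.reCLM.contDiff.comp contDiff_snd).div_const _)
  have h2 : ContMDiff ((𝓡 1).prod (𝓡 1)) 𝓘(ℝ, ℂ × ℂ) ∞
      fun q : Circle × Circle => ((q.1 : ℂ), (q.2 : ℂ)) :=
    (contMDiff_circle_coe.comp contMDiff_fst).prodMk_space
      (contMDiff_circle_coe.comp contMDiff_snd)
  have h3 := contMDiffOn_univ.1 (h1.contMDiffOn.comp h2.contMDiffOn (s := univ) fun q _ =>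
    Circle.coe_ne_zero q.1)
  exact (contMDiff_fst (I := 𝓡 1) (J := 𝓡 1) (n := ∞)).mul ((contMDiff_circleExp (m := ∞)).comp h3)

theorem cos_one_le_re {z : Circle} (h : |Complex.arg z| ≤ 1) : Real.cos 1 ≤ (z : ℂ).re := by
  have h1 : (z : ℂ).re = Real.cos |Complex.arg z| := by
    rw [Real.cos_abs, Complex.cos_arg (Circle.coe_ne_zero z), Circle.norm_coe, div_one]
  rw [h1]
  exact Real.cos_le_cos_of_nonneg_of_le_pi (abs_nonneg _) TorusPiece.pi_gt.le h

theorem twist_of_norm_le {q : Circle × Circle} (h : ‖angles q‖ ≤ 1) : twist q = 1 := by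
  have h1 := cos_one_le_re ((Complex.abs_re_le_norm (angles q)).trans h)
  have h2 := cos_one_le_re ((Complex.abs_im_le_norm (angles q)).trans h)
  have hc := Real.cos_one_pos
  rw [twist, Real.smoothTransition.one_of_one_le ((one_le_div hc).2 h1),
    Real.smoothTransition.one_of_one_le ((one_le_div hc).2 h2), one_mul, one_mul, Circle.exp_neg,
    Circle.exp_arg, mul_inv_cancel]

theorem twist_of_re_nonpos {q : Circle × Circle} (h : (q.2 : ℂ).re ≤ 0) : twist q = q.1 := by
  rw [twist, Real.smoothTransition.zero_of_nonpos
    (div_nonpos_of_nonpos_of_nonneg h Real.cos_one_pos.le)]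
  simp

/-- An angle of absolute value at most 1 has positive cosine. Hence the half of the torus which
contains the tubes is disjoint from the collar. -/
theorem one_lt_norm_angles {q : Circle × Circle} (h : (q.2 : ℂ).re ≤ 0) : 1 < ‖angles q‖ := by
  by_contra! h1
  have := cos_one_le_re ((Complex.abs_im_le_norm (angles q)).trans h1)
  linarith [Real.cos_one_pos]

end Twist

/-! ### Smooth structure, boundary and connectedness of the torus piece. -/

namespace TorusPiece

instance : ChartedSpace (ModelProd (EuclideanSpace ℝ (Fin 1)) (EuclideanHalfSpace 1)) TorusPiece :=
  cover.chartedSpace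

instance : IsManifold ((𝓡 1).prod (𝓡∂ 1)) ∞ TorusPiece := cover.isManifold

theorem contMDiffOn_collar :
    ContMDiffOn ((𝓡 1).prod (𝓡∂ 1)) ((𝓡 1).prod (𝓡∂ 1)) ∞ collar collar.source := cover.e₁_smooth

theorem contMDiffOn_collar_symm :
    ContMDiffOn ((𝓡 1).prod (𝓡∂ 1)) ((𝓡 1).prod (𝓡∂ 1)) ∞ collar.symm collar.target :=
  cover.e₁_symm_smooth

theorem contMDiffOn_inner_symm :
    ContMDiffOn ((𝓡 1).prod (𝓡 1)) ((𝓡 1).prod (𝓡∂ 1)) ∞ inner.symm inner.target :=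
  cover.e₂_symm_smooth

theorem contMDiff_polar : ContMDiff ((𝓡 1).prod (𝓡∂ 1)) 𝓘(ℝ, ℂ) ∞
    fun q : Circle × EuclideanHalfSpace 1 => ((q.2.val 0 + 1 / 2 : ℝ) : ℂ) * q.1 := by
  have h1 : ContDiff ℝ ∞ fun q : ℝ × ℂ => ((q.1 + 1 / 2 : ℝ) : ℂ) * q.2 :=
    (Complex.ofRealCLM.contDiff.comp (contDiff_fst.add contDiff_const)).mul contDiff_snd
  exact h1.contMDiff.comp ((contMDiff_halfCoord.comp contMDiff_snd).prodMk_space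
    (contMDiff_circle_coe.comp contMDiff_fst))

theorem contMDiff_val : ContMDiff ((𝓡 1).prod (𝓡∂ 1)) ((𝓡 1).prod (𝓡 1)) ∞ val := by
  rw [← contMDiffOn_univ]
  have h1 : ContMDiffOn ((𝓡 1).prod (𝓡∂ 1)) ((𝓡 1).prod (𝓡 1)) ∞ val collar.source := by
    refine ((contMDiff_ofAngles.comp contMDiff_polar).comp_contMDiffOn contMDiffOn_collar).congr
      fun p hp => ?_
    have h : (collar.symm (collar p)).val = _ :=
      collarPt_val (collar p).2.2 (le_of_lt (collar.map_source hp)) (collar p).1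
    rw [collar.left_inv hp] at h
    exact h
  have h2 : ContMDiffOn ((𝓡 1).prod (𝓡∂ 1)) ((𝓡 1).prod (𝓡 1)) ∞ val inner.source := cover.e₂_smooth
  refine (h1.union_of_isOpen h2 collar.open_source inner.open_source).mono fun p _ => ?_
  exact cover.cover p

/-- The parametrization of the boundary. -/
def boundaryPt (z : Circle) : TorusPiece := collarPt z 0

theorem contMDiff_boundaryPt : ContMDiff (𝓡 1) ((𝓡 1).prod (𝓡∂ 1)) ∞ boundaryPt := by
  have h : ContMDiff (𝓡 1) ((𝓡 1).prod (𝓡∂ 1)) ∞ fun z : Circle => (z, toHalf 0) :=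
    contMDiff_id.prodMk contMDiff_const
  rw [← contMDiffOn_univ] at h ⊢
  have h0 : (toHalf 0).val 0 = 0 := toHalf_val le_rfl
  refine (contMDiffOn_collar_symm.comp h fun z _ => ?_).congr fun z _ => ?_
  · change (toHalf 0).val 0 < 1 / 2
    rw [h0]; norm_num
  · change _ = collarPt z ((toHalf 0).val 0)
    rw [h0]; rfl

theorem angles_boundaryPt (z : Circle) : angles (boundaryPt z).val = ((1 / 2 : ℝ) : ℂ) * z := by
  rw [boundaryPt, angles_collarPt le_rfl (by norm_num), zero_add]

theorem norm_angles_boundaryPt (z : Circle) : ‖angles (boundaryPt z).val‖ = 1 / 2 := by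
  rw [boundaryPt, norm_angles_collarPt le_rfl (by norm_num), zero_add]

theorem direction_boundaryPt (z : Circle) : direction (angles (boundaryPt z).val) = z := by
  rw [angles_boundaryPt, direction_mul (by norm_num)]

theorem boundaryPt_direction {p : TorusPiece} (hp : ‖angles p.val‖ = 1 / 2) :
    boundaryPt (direction (angles p.val)) = p := by
  have := collarPt_angles p (by linarith)
  rwa [hp, sub_self] at this

/-- On the collar the chart is built from `collar`, whose second component is the radial distance
from the boundary circle. Together with positivity at all other points, this locates the boundary of
the glued manifold. -/
theorem chartAt_snd_of_lt {p : TorusPiece} (hp : ‖angles p.val‖ < 1) (q : TorusPiece) :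
    (chartAt (ModelProd (EuclideanSpace ℝ (Fin 1)) (EuclideanHalfSpace 1)) p q).2.val 0 =
      ‖angles q.val‖ - 1 / 2 := by
  have h := cover.chartAt_of_mem (w := p) hp
  have h2 : chartAt (ModelProd (EuclideanSpace ℝ (Fin 1)) (EuclideanHalfSpace 1)) p q =
      (cover.e₁ ≫ₕ cover.chart₁ (cover.e₁ p)) q := congrArg (fun c => c q) h
  rw [h2]
  exact collar_val q

theorem chartAt_snd_pos {p : TorusPiece} (hp : 1 ≤ ‖angles p.val‖) (q : TorusPiece) :
    0 < (chartAt (ModelProd (EuclideanSpace ℝ (Fin 1)) (EuclideanHalfSpace 1)) p q).2.val 0 := by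
  have h := cover.chartAt_of_notMem (w := p) (not_lt.2 hp)
  have h2 : chartAt (ModelProd (EuclideanSpace ℝ (Fin 1)) (EuclideanHalfSpace 1)) p q =
      (cover.e₂ ≫ₕ cover.chart₂ (cover.e₂ p)) q := congrArg (fun c => c q) h
  rw [h2]
  exact expHalf_val_pos _

/-- At collar points a smooth left inverse is given only on the set ‖angles‖ ≥ 1/2, so
differentiability within that set is used. Elsewhere `inner` has a smooth inverse on an open set. -/
theorem injective_mfderiv_val (p : TorusPiece) :
    Function.Injective (mfderiv ((𝓡 1).prod (𝓡∂ 1)) ((𝓡 1).prod (𝓡 1)) val p) := by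
  have hd := contMDiff_val.mdifferentiableAt (x := p) (by simp)
  rcases lt_or_ge ‖angles p.val‖ 1 with h | h
  · set s : Set (Circle × Circle) := {q | 1 / 2 ≤ ‖angles q‖ ∧ ‖angles q‖ < 1} with hs
    refine injective_mfderiv_of_leftInverse (s := s)
      (g := fun q => collar.symm (direction (angles q), toHalf (‖angles q‖ - 1 / 2))) hd ?_ ?_ ?_
    · have h1 : ContMDiffOn ((𝓡 1).prod (𝓡 1)) 𝓘(ℝ, ℂ) ∞ angles s := fun q hq =>
        (contMDiffAt_angles (hq.2.trans pi_gt)).contMDiffWithinAt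
      have h0 : ∀ q ∈ s, angles q ≠ 0 := fun q hq h => by
        have := hq.1; rw [h, norm_zero] at this; linarith
      have h2 := contMDiffOn_direction.comp h1 h0
      have h3 : ContMDiffOn ((𝓡 1).prod (𝓡 1)) 𝓘(ℝ, ℝ) ∞ (fun q => ‖angles q‖ - 1 / 2) s := by
        have : ContDiffOn ℝ ∞ (fun w : ℂ => ‖w‖ - 1 / 2) {w | w ≠ 0} := fun w hw =>
          ((contDiffAt_norm ℝ hw).sub contDiffAt_const).contDiffWithinAt
        exact this.contMDiffOn.comp h1 h0
      have h4 := contMDiffOn_toHalf.comp h3 fun q hq => sub_nonneg.2 hq.1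
      exact ((contMDiffOn_collar_symm.comp (h2.prodMk h4) fun q hq => by
        change (toHalf _).val 0 < 1 / 2
        rw [toHalf_val (sub_nonneg.2 hq.1)]; linarith [hq.2]) p.val
          ⟨p.le_norm, h⟩).mdifferentiableWithinAt (by simp)
    · filter_upwards [collar.open_source.mem_nhds h] with q hq using ⟨q.le_norm, hq⟩
    · filter_upwards [collar.open_source.mem_nhds h] with q hq using collar.left_inv hq
  · have hp : p ∈ inner.source := by change 1 / 2 < ‖angles p.val‖; linarith
    refine injective_mfderiv_of_leftInverse (s := inner.target) (g := inner.symm) hd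
      ((contMDiffOn_inner_symm _ (inner.map_source hp)).mdifferentiableWithinAt (by simp)) ?_ ?_
    · filter_upwards [inner.open_source.mem_nhds hp] with q hq using inner.map_source hq
    · filter_upwards [inner.open_source.mem_nhds hp] with q hq using inner.left_inv hq

/-- The first coordinate. -/
def fstCoord (p : TorusPiece) : ℂ := p.val.1

/-- The second coordinate. -/
def sndCoord (p : TorusPiece) : ℂ := p.val.2

theorem contMDiff_fstCoord : ContMDiff ((𝓡 1).prod (𝓡∂ 1)) 𝓘(ℝ, ℂ) ∞ fstCoord :=
  contMDiff_circle_coe.comp (contMDiff_fst.comp contMDiff_val)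

theorem contMDiff_sndCoord : ContMDiff ((𝓡 1).prod (𝓡∂ 1)) 𝓘(ℝ, ℂ) ∞ sndCoord :=
  contMDiff_circle_coe.comp (contMDiff_snd.comp contMDiff_val)

/-- The inclusion into the torus is an immersion, and the angular form of each circle factor is
injective on tangent lines. -/
theorem eq_zero_of_ang_eq_zero {p : TorusPiece} {v : TangentSpace ((𝓡 1).prod (𝓡∂ 1)) p}
    (h1 : ang ((𝓡 1).prod (𝓡∂ 1)) fstCoord p v = 0)
    (h2 : ang ((𝓡 1).prod (𝓡∂ 1)) sndCoord p v = 0) : v = 0 := by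
  have hd := contMDiff_val.mdifferentiableAt (x := p) (by simp)
  have hc : ∀ z : Circle, MDifferentiableAt (𝓡 1) 𝓘(ℝ, ℂ) (fun z : Circle => (z : ℂ)) z :=
    fun z => contMDiff_circle_coe.mdifferentiableAt (by simp)
  have hdfst : MDifferentiableAt ((𝓡 1).prod (𝓡∂ 1)) (𝓡 1) (fun q => (val q).1) p :=
    (mdifferentiableAt_fst (I := 𝓡 1) (I' := 𝓡 1)).comp p hd
  have hdsnd : MDifferentiableAt ((𝓡 1).prod (𝓡∂ 1)) (𝓡 1) (fun q => (val q).2) p :=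
    (mdifferentiableAt_snd (I := 𝓡 1) (I' := 𝓡 1)).comp p hd
  have h3 : mfderiv ((𝓡 1).prod (𝓡∂ 1)) (𝓡 1) (fun q => (val q).1) p v = 0 := by
    apply injective_ang_circle
    rw [map_zero, ← h1]
    exact (congrArg (fun L => L v) (ang_comp (f := fun q => (val q).1)
      (hc p.val.1) (hdfst))).symm
  have h4 : mfderiv ((𝓡 1).prod (𝓡∂ 1)) (𝓡 1) (fun q => (val q).2) p v = 0 := by
    apply injective_ang_circle
    rw [map_zero, ← h2]
    exact (congrArg (fun L => L v) (ang_comp (f := fun q => (val q).2)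
      (hc p.val.2) (hdsnd))).symm
  apply injective_mfderiv_val p
  rw [map_zero]
  have h5 := mfderiv_comp p (mdifferentiableAt_fst (I := 𝓡 1) (I' := 𝓡 1)) hd
  have h6 := mfderiv_comp p (mdifferentiableAt_snd (I := 𝓡 1) (I' := 𝓡 1)) hd
  rw [mfderiv_fst] at h5
  rw [mfderiv_snd] at h6
  exact Prod.ext ((congrArg (fun L => L v) h5).symm.trans h3)
    ((congrArg (fun L => L v) h6).symm.trans h4)

instance : ConnectedSpace TorusPiece := by
  -- The distance from the centre of the square [−π, π]² to its boundary in the direction θ. The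
  -- piece is the continuous image of the strip ℝ × [0, 1], which sweeps out the radii from 1/2 to R
  -- θ.
  let R : ℝ → ℝ := fun θ => Real.pi / max |Real.cos θ| |Real.sin θ|
  have hm : ∀ θ, 0 < max |Real.cos θ| |Real.sin θ| := by
    intro θ
    by_contra! h
    have h1 := abs_nonpos_iff.1 ((le_max_left _ _).trans h)
    have h2 := abs_nonpos_iff.1 ((le_max_right _ _).trans h)
    have := Real.sin_sq_add_cos_sq θ
    rw [h1, h2] at this; norm_num at this
  have hR : ∀ θ, 1 < R θ := fun θ => by
    refine pi_gt.trans_le ?_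
    rw [le_div_iff₀ (hm θ)]
    exact mul_le_of_le_one_right Real.pi_pos.le
      (max_le (Real.abs_cos_le_one θ) (Real.abs_sin_le_one θ))
  have hRc : Continuous R := by
    refine continuous_const.div ?_ fun θ => (hm θ).ne'
    exact Real.continuous_cos.abs.max Real.continuous_sin.abs
  let f : ℝ × ℝ → Circle × Circle := fun q =>
    ofAngles ((((1 - q.2) * (1 / 2) + q.2 * R q.1 : ℝ) : ℂ) * Circle.exp q.1)
  have hf : Continuous f := by
    refine contMDiff_ofAngles.continuous.comp ?_
    have := hRc.comp continuous_fst (X := ℝ × ℝ)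
    fun_prop
  have himg : f '' (univ ×ˢ Icc 0 1) = range val := by
    ext p
    constructor
    · rintro ⟨⟨θ, t⟩, ⟨-, h0, h1⟩, rfl⟩
      simp only at h0 h1
      set ρ : ℝ := (1 - t) * (1 / 2) + t * R θ with hρ
      have h2 : 1 / 2 ≤ ρ := by nlinarith [hR θ]
      have h3 : ρ ≤ R θ := by nlinarith [hR θ]
      have h4 : R θ * max |Real.cos θ| |Real.sin θ| = Real.pi := div_mul_cancel₀ _ (hm θ).ne'
      have h5 : ∀ c : ℝ, |c| ≤ max |Real.cos θ| |Real.sin θ| → |ρ * c| ≤ Real.pi := by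
        intro c hc
        rw [abs_mul, abs_of_nonneg (by linarith), ← h4]
        exact mul_le_mul h3 hc (abs_nonneg _) (by linarith)
      have h6 : ((Circle.exp θ : ℂ)).re = Real.cos θ := by
        rw [Circle.coe_exp, Complex.exp_ofReal_mul_I_re]
      have h7 : ((Circle.exp θ : ℂ)).im = Real.sin θ := by
        rw [Circle.coe_exp, Complex.exp_ofReal_mul_I_im]
      rw [range_val, mem_compl_iff, mem_ofPred_eq, not_lt]
      change _ ≤ ‖angles (ofAngles ((ρ : ℂ) * Circle.exp θ))‖
      rw [norm_angles_ofAngles, norm_mul, Circle.norm_coe, mul_one, Complex.norm_real,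
        Real.norm_of_nonneg (by linarith)]
      · exact h2
      · rw [Complex.re_ofReal_mul, h6]; exact h5 _ (le_max_left _ _)
      · rw [Complex.im_ofReal_mul, h7]; exact h5 _ (le_max_right _ _)
    · rintro ⟨p, rfl⟩
      set w := angles p.val with hw
      set θ := Complex.arg w with hθ
      have h0 := p.le_norm
      have hn : 0 < ‖w‖ := by linarith
      have h1 : ‖w‖ ≤ R θ := by
        rw [le_div_iff₀ (hm θ)]
        have h2 : ‖w‖ * |Real.cos θ| ≤ Real.pi := by
          have : ‖w‖ * |Real.cos θ| = |w.re| := by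
            rw [← Complex.norm_mul_cos_arg w, abs_mul, abs_norm]
          rw [this]; exact Complex.abs_arg_le_pi _
        have h3 : ‖w‖ * |Real.sin θ| ≤ Real.pi := by
          have : ‖w‖ * |Real.sin θ| = |w.im| := by
            rw [← Complex.norm_mul_sin_arg w, abs_mul, abs_norm]
          rw [this]; exact Complex.abs_arg_le_pi _
        rcases max_choice |Real.cos θ| |Real.sin θ| with h | h <;> rw [h] <;> assumption
      have hR' := hR θ
      refine ⟨(θ, (‖w‖ - 1 / 2) / (R θ - 1 / 2)), ⟨trivial, ?_, ?_⟩, ?_⟩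
      · exact div_nonneg (by linarith) (by linarith)
      · rw [div_le_one (by linarith)]; linarith
      · have h2 : (1 - (‖w‖ - 1 / 2) / (R θ - 1 / 2)) * (1 / 2) +
            (‖w‖ - 1 / 2) / (R θ - 1 / 2) * R θ = ‖w‖ := by
          have : R θ - 1 / 2 ≠ 0 := by linarith
          linear_combination div_mul_cancel₀ (‖w‖ - 1 / 2) this
        change ofAngles ((((1 - (‖w‖ - 1 / 2) / (R θ - 1 / 2)) * (1 / 2) +
            (‖w‖ - 1 / 2) / (R θ - 1 / 2) * R θ : ℝ) : ℂ) * direction w) = p.val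
        rw [h2, norm_mul_direction, hw, ofAngles_angles]
  have hconn : IsPreconnected (range val) := by
    rw [← himg]
    exact (isPreconnected_univ.prod isPreconnected_Icc).image f hf.continuousOn
  have : PreconnectedSpace TorusPiece :=
    ⟨isEmbedding_val.toIsInducing.isPreconnected_image.1 (by rwa [image_univ])⟩
  exact ⟨⟨boundaryPt 1⟩⟩

end TorusPiece

/-! ### The symplectic form on surface times torus piece. -/

section Side

/-- The model of the product of a surface and the torus with a disc removed. -/
abbrev sideModel : ModelWithCorners ℝ
    (EuclideanSpace ℝ (Fin 2) × (EuclideanSpace ℝ (Fin 1) × EuclideanSpace ℝ (Fin 1)))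
    (ModelProd (EuclideanSpace ℝ (Fin 2))
      (ModelProd (EuclideanSpace ℝ (Fin 1)) (EuclideanHalfSpace 1))) :=
  (𝓡 2).prod ((𝓡 1).prod (𝓡∂ 1))

/-- The model of the product of a torus and the plane. -/
abbrev tubeModel : ModelWithCorners ℝ
    ((EuclideanSpace ℝ (Fin 1) × EuclideanSpace ℝ (Fin 1)) × ℂ)
    (ModelProd (ModelProd (EuclideanSpace ℝ (Fin 1)) (EuclideanSpace ℝ (Fin 1))) ℂ) :=
  ((𝓡 1).prod (𝓡 1)).prod 𝓘(ℝ, ℂ)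

variable {S : Type u} [TopologicalSpace S] [ChartedSpace (EuclideanSpace ℝ (Fin 2)) S]
  (σ : DiffForm (𝓡 2) S 2) (h : S → Circle)

/-- The symplectic form on the product of a surface and the torus with a disc removed. -/
def sideForm : DiffForm sideModel (S × TorusPiece) 2 := fun m =>
  σ.pullback sideModel Prod.fst m +
    wedge (ang sideModel (fun m : S × TorusPiece => m.2.fstCoord) m)
      (ang sideModel (fun m : S × TorusPiece => m.2.sndCoord) m) +
    -- Without this term, the product of the handle circle with a circle of the torus would be
    -- Lagrangian. The term is closed, makes that product symplectic where the twist is nontrivial,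
    -- and vanishes where it is constant.
    wedge (ang sideModel (fun m : S × TorusPiece => (h m.1 : ℂ)) m)
      (ang sideModel (fun m : S × TorusPiece => (twist m.2.val : ℂ)) m)

variable {σ h}

theorem contMDiff_side_fstCoord :
    ContMDiff sideModel 𝓘(ℝ, ℂ) ∞ fun m : S × TorusPiece => m.2.fstCoord :=
  TorusPiece.contMDiff_fstCoord.comp (contMDiff_snd (I := 𝓡 2))

theorem contMDiff_side_sndCoord :
    ContMDiff sideModel 𝓘(ℝ, ℂ) ∞ fun m : S × TorusPiece => m.2.sndCoord :=
  TorusPiece.contMDiff_sndCoord.comp (contMDiff_snd (I := 𝓡 2))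

theorem contMDiff_side_angle (hh : ContMDiff (𝓡 2) (𝓡 1) ∞ h) :
    ContMDiff sideModel 𝓘(ℝ, ℂ) ∞ fun m : S × TorusPiece => (h m.1 : ℂ) :=
  contMDiff_circle_coe.comp (hh.comp contMDiff_fst)

theorem contMDiff_side_twist :
    ContMDiff sideModel 𝓘(ℝ, ℂ) ∞ fun m : S × TorusPiece => (twist m.2.val : ℂ) :=
  contMDiff_circle_coe.comp (contMDiff_twist.comp
    (TorusPiece.contMDiff_val.comp (contMDiff_snd (I := 𝓡 2))))

theorem isSmoothClosed_sideForm [IsManifold (𝓡 2) ∞ S] (hσ : σ.IsSmooth)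
    (hh : ContMDiff (𝓡 2) (𝓡 1) ∞ h) : (sideForm σ h).IsSmoothClosed := by
  have h1 : (σ.pullback sideModel (Prod.fst : S × TorusPiece → S)).IsSmoothClosed :=
    (DiffForm.IsSmooth.isSmoothClosed (by simp) hσ).pullback contMDiff_fst
  have h2 : ∀ {f g : S × TorusPiece → ℂ}, ContMDiff sideModel 𝓘(ℝ, ℂ) ∞ f →
      ContMDiff sideModel 𝓘(ℝ, ℂ) ∞ g → (∀ m, f m ≠ 0) → (∀ m, g m ≠ 0) →
      DiffForm.IsSmoothClosed (fun m => wedge (ang sideModel f m) (ang sideModel g m) :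
        DiffForm sideModel (S × TorusPiece) 2) := fun hf hg hf0 hg0 =>
    DiffForm.isSmoothClosed_of_locallyInduced fun m =>
      (locallyExact_ang isOpen_univ (mem_univ m) hf.contMDiffOn fun m _ => hf0 m).wedge
        (locallyExact_ang isOpen_univ (mem_univ m) hg.contMDiffOn fun m _ => hg0 m)
  exact (h1.add (h2 contMDiff_side_fstCoord contMDiff_side_sndCoord
    (fun m => Circle.coe_ne_zero _) fun m => Circle.coe_ne_zero _)).add
      (h2 (contMDiff_side_angle hh) contMDiff_side_twist
        (fun m => Circle.coe_ne_zero _) fun m => Circle.coe_ne_zero _)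

/-- The sum of two symplectic forms and the wedge product of a form on the first factor and a form
on the second factor is nondegenerate. -/
theorem eq_zero_of_forall_sum_eq_zero {U V : Type*} [Zero U] [Zero V]
    {σ : U → U → ℝ} {τ : V → V → ℝ} {α : U → ℝ} {κ : V → ℝ}
    (hα0 : α 0 = 0) (hκ0 : κ 0 = 0)
    (hσ : ∀ u, (∀ u', σ u u' = 0) → u = 0) (hτ : ∀ v, (∀ v', τ v v' = 0) → v = 0)
    (hσ' : ∀ u, σ u u = 0) (hσ0 : ∀ u, σ u 0 = 0) (hτ0 : ∀ v, τ v 0 = 0) {u : U} {v : V}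
    (h : ∀ u' v', σ u u' + τ v v' + (α u * κ v' - α u' * κ v) = 0) : u = 0 ∧ v = 0 := by
  have h1 : ∀ u', σ u u' = α u' * κ v := fun u' => by
    have := h u' 0
    rw [hτ0, hκ0] at this
    linarith
  have h2 : ∀ v', τ v v' = - (α u * κ v') := fun v' => by
    have := h 0 v'
    rw [hσ0, hα0] at this
    linarith
  -- Testing u against itself shows that one of the two factors vanishes. The mixed term then drops
  -- out of one equation, and the two forms can be treated in turn.
  have h3 : α u * κ v = 0 := by rw [← h1, hσ']
  rcases mul_eq_zero.1 h3 with h4 | h4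
  · have hv : v = 0 := hτ v fun v' => by rw [h2, h4, zero_mul, neg_zero]
    exact ⟨hσ u fun u' => by rw [h1, hv, hκ0, mul_zero], hv⟩
  · have hu : u = 0 := hσ u fun u' => by rw [h1, h4, mul_zero]
    exact ⟨hu, hτ v fun v' => by rw [h2, hu, hα0, zero_mul, neg_zero]⟩

/-- Otherwise v can be completed to a basis, on which the 2-covector vanishes; on a plane it would
then be zero. -/
theorem DiffForm.eq_zero_of_forall_of_ne_zero {V : Type*} [AddCommGroup V] [Module ℝ V]
    [TopologicalSpace V] (hV : Module.finrank ℝ V = 2) {η : V [⋀^Fin 2]→L[ℝ] ℝ} (hη : η ≠ 0)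
    {v : V} (hv : ∀ w, η ![v, w] = 0) : v = 0 := by
  by_contra hv0
  have : FiniteDimensional ℝ V := Module.finite_of_finrank_pos (by omega)
  apply hη
  obtain ⟨w, hw⟩ : ∃ w, LinearIndependent ℝ ![v, w] :=
    exists_linearIndependent_pair_of_one_lt_finrank (by omega) hv0
  let b := basisOfLinearIndependentOfCardEqFinrank hw (by simp [hV])
  have hb : ⇑b = ![v, w] := coe_basisOfLinearIndependentOfCardEqFinrank _ _
  apply ContinuousAlternatingMap.toAlternatingMap_injective
  refine b.ext_alternating fun f hf => ?_
  have h2 : ∀ f : Fin 2 → Fin 2, Function.Injective f → f = ![0, 1] ∨ f = ![1, 0] := by decide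
  rcases h2 f hf with rfl | rfl
  · have : (fun i => b (![0, 1] i)) = ![v, w] := by rw [hb]; ext i; fin_cases i <;> rfl
    change η (fun i => b (![0, 1] i)) = 0
    rw [this, hv]
  · have : (fun i => b (![1, 0] i)) = ![v, w] ∘ Equiv.swap 0 1 := by
      rw [hb]; funext i; fin_cases i <;> rfl
    change η (fun i => b (![1, 0] i)) = 0
    rw [this, ← ContinuousAlternatingMap.coe_toAlternatingMap, AlternatingMap.map_swap _ _ (by decide)]
    change - η ![v, w] = 0
    rw [hv, neg_zero]

theorem eq_zero_of_forall_wedge_eq_zero {V : Type*} [AddCommGroup V] [Module ℝ V]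
    [TopologicalSpace V] (hV : Module.finrank ℝ V = 2) {a b : V →L[ℝ] ℝ}
    (hab : ∀ v, a v = 0 → b v = 0 → v = 0) {v : V} (hv : ∀ w, wedge a b ![v, w] = 0) : v = 0 := by
  have : FiniteDimensional ℝ V := Module.finite_of_finrank_pos (by omega)
  have hi : Function.Injective (a.toLinearMap.prod b.toLinearMap) := by
    rw [← LinearMap.ker_eq_bot, LinearMap.ker_eq_bot']
    intro w hw
    exact hab w (congrArg Prod.fst hw) (congrArg Prod.snd hw)
  have hs := (LinearMap.injective_iff_surjective_of_finrank_eq_finrank (by simp [hV])).1 hi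
  have h1 : ∀ w, a v * b w - a w * b v = 0 := fun w => by
    have := hv w
    rwa [wedge_apply] at this
  refine hab v ?_ ?_
  · obtain ⟨w, hw⟩ := hs (0, 1)
    have h2 : a w = 0 := congrArg Prod.fst hw
    have h3 : b w = 1 := congrArg Prod.snd hw
    simpa [h2, h3] using h1 w
  · obtain ⟨w, hw⟩ := hs (1, 0)
    have h2 : a w = 1 := congrArg Prod.fst hw
    have h3 : b w = 0 := congrArg Prod.snd hw
    simpa [h2, h3] using h1 w

theorem ang_comp_fst {f : S → ℂ} (hf : ContMDiff (𝓡 2) 𝓘(ℝ, ℂ) ∞ f) (m : S × TorusPiece)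
    (w : TangentSpace sideModel m) :
    ang sideModel (fun m : S × TorusPiece => f m.1) m w = ang (𝓡 2) f m.1 w.1 := by
  rw [ang_comp (f := Prod.fst) (J := 𝓡 2) (hf.mdifferentiableAt (by simp))
    mdifferentiableAt_fst, mfderiv_fst]
  rfl

theorem ang_comp_snd {f : TorusPiece → ℂ} (hf : ContMDiff ((𝓡 1).prod (𝓡∂ 1)) 𝓘(ℝ, ℂ) ∞ f)
    (m : S × TorusPiece) (w : TangentSpace sideModel m) :
    ang sideModel (fun m : S × TorusPiece => f m.2) m w =
      ang ((𝓡 1).prod (𝓡∂ 1)) f m.2 w.2 := by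
  rw [ang_comp (f := Prod.snd) (J := (𝓡 1).prod (𝓡∂ 1)) (hf.mdifferentiableAt (by simp))
    mdifferentiableAt_snd, mfderiv_snd]
  rfl

theorem pullback_fst_apply (m : S × TorusPiece) (v w : TangentSpace sideModel m) :
    σ.pullback sideModel Prod.fst m ![v, w] = σ m.1 ![v.1, w.1] := by
  have h2 : (fun i => mfderiv sideModel (𝓡 2) Prod.fst m (![v, w] i)) = ![v.1, w.1] := by
    rw [mfderiv_fst]; funext i; fin_cases i <;> rfl
  exact congrArg (σ m.1) h2

theorem sideForm_apply (hh : ContMDiff (𝓡 2) (𝓡 1) ∞ h) (m : S × TorusPiece)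
    (v w : TangentSpace sideModel m) :
    sideForm σ h m ![v, w] = σ m.1 ![v.1, w.1] +
      wedge (ang ((𝓡 1).prod (𝓡∂ 1)) TorusPiece.fstCoord m.2)
        (ang ((𝓡 1).prod (𝓡∂ 1)) TorusPiece.sndCoord m.2) ![v.2, w.2] +
      (ang (𝓡 2) (fun x => (h x : ℂ)) m.1 v.1 *
          ang ((𝓡 1).prod (𝓡∂ 1)) (fun p => (twist p.val : ℂ)) m.2 w.2 -
        ang (𝓡 2) (fun x => (h x : ℂ)) m.1 w.1 *
          ang ((𝓡 1).prod (𝓡∂ 1)) (fun p => (twist p.val : ℂ)) m.2 v.2) := by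
  have hA := ang_comp_fst (contMDiff_circle_coe.comp hh) m
  have hB := ang_comp_snd (contMDiff_circle_coe.comp
    (contMDiff_twist.comp TorusPiece.contMDiff_val)) m
  change σ.pullback sideModel Prod.fst m ![v, w] +
          wedge (ang sideModel (fun m : S × TorusPiece => m.2.fstCoord) m)
            (ang sideModel (fun m : S × TorusPiece => m.2.sndCoord) m) ![v, w] +
          wedge (ang sideModel (fun m : S × TorusPiece => (h m.1 : ℂ)) m)
            (ang sideModel (fun m : S × TorusPiece => (twist m.2.val : ℂ)) m) ![v, w] = _
  rw [pullback_fst_apply, wedge_apply, wedge_apply, wedge_apply]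
  congr 1
  · congr 1
    exact congrArg₂ (· - ·)
      (congrArg₂ (· * ·) (ang_comp_snd TorusPiece.contMDiff_fstCoord m v)
        (ang_comp_snd TorusPiece.contMDiff_sndCoord m w))
      (congrArg₂ (· * ·) (ang_comp_snd TorusPiece.contMDiff_fstCoord m w)
        (ang_comp_snd TorusPiece.contMDiff_sndCoord m v))
  · exact congrArg₂ (· - ·) (congrArg₂ (· * ·) (hA v) (hB w)) (congrArg₂ (· * ·) (hA w) (hB v))

/-- Both factors carry area forms, and the mixed term is a product of one covector from each factor.
Such a term cannot destroy nondegeneracy, whatever its size. -/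
theorem nondegenerate_sideForm (hσ0 : σ.NowhereZero)
    (hh : ContMDiff (𝓡 2) (𝓡 1) ∞ h) : (sideForm σ h).Nondegenerate := by
  intro m v hv
  have hS : Module.finrank ℝ (TangentSpace (𝓡 2) m.1) = 2 := by
    change Module.finrank ℝ (EuclideanSpace ℝ (Fin 2)) = 2; simp
  have hF : Module.finrank ℝ (TangentSpace ((𝓡 1).prod (𝓡∂ 1)) m.2) = 2 := by
    change Module.finrank ℝ (EuclideanSpace ℝ (Fin 1) × EuclideanSpace ℝ (Fin 1)) = 2; simp
  have key := eq_zero_of_forall_sum_eq_zero (U := TangentSpace (𝓡 2) m.1)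
    (V := TangentSpace ((𝓡 1).prod (𝓡∂ 1)) m.2)
    (σ := fun u u' => σ m.1 ![u, u'])
    (τ := fun v v' =>
      wedge (ang ((𝓡 1).prod (𝓡∂ 1)) TorusPiece.fstCoord m.2)
        (ang ((𝓡 1).prod (𝓡∂ 1)) TorusPiece.sndCoord m.2) ![v, v'])
    (α := fun u => ang (𝓡 2) (fun x => (h x : ℂ)) m.1 u)
    (κ := fun v => ang ((𝓡 1).prod (𝓡∂ 1)) (fun p => (twist p.val : ℂ)) m.2 v)
    (u := v.1) (v := v.2) (map_zero _) (map_zero _)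
    (fun u hu => DiffForm.eq_zero_of_forall_of_ne_zero hS (hσ0 m.1) hu)
    (fun v hv => eq_zero_of_forall_wedge_eq_zero hF
      (fun w h1 h2 => TorusPiece.eq_zero_of_ang_eq_zero h1 h2) hv)
    (fun u => (σ m.1).map_eq_zero_of_eq ![u, u] (i := 0) (j := 1) rfl (by decide))
    (fun u => (σ m.1).map_coord_zero (m := ![u, 0]) 1 rfl)
    (fun v => ContinuousAlternatingMap.map_coord_zero _ (m := ![v, 0]) 1 rfl)
    (fun u' v' => (sideForm_apply hh m v (u', v')).symm.trans (hv (u', v')))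
  exact Prod.ext key.1 key.2

end Side

/-! ### The form near the boundary. -/

section Collar

variable {S : Type u} [TopologicalSpace S] [ChartedSpace (EuclideanSpace ℝ (Fin 2)) S]
  {σ : DiffForm (𝓡 2) S 2} {h : S → Circle}

theorem contMDiffAt_side_angles {m : S × TorusPiece} (hm : ‖angles m.2.val‖ < 1) :
    ContMDiffAt sideModel 𝓘(ℝ, ℂ) ∞ (fun m : S × TorusPiece => angles m.2.val) m :=
  (contMDiffAt_angles (hm.trans TorusPiece.pi_gt)).comp m
    ((TorusPiece.contMDiff_val.comp (contMDiff_snd (I := 𝓡 2))).contMDiffAt)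

theorem isOpen_side_collar {S : Type u} [TopologicalSpace S] : IsOpen {m : S × TorusPiece | ‖angles m.2.val‖ < 1} :=
  (isOpen_norm_angles_lt TorusPiece.pi_gt.le).preimage
    (TorusPiece.continuous_val.comp continuous_snd)

/-- The twisting function is constant on the collar, so the mixed term vanishes there. What remains
of the torus factor is dx ∧ dy in polar coordinates. -/
theorem sideForm_of_lt {m : S × TorusPiece} (hm : ‖angles m.2.val‖ < 1) :
    sideForm σ h m = σ.pullback sideModel Prod.fst m + (1 / 2 : ℝ) •
      wedge (mvfderiv sideModel (fun m : S × TorusPiece => Complex.normSq (angles m.2.val)) m)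
        (ang sideModel (fun m : S × TorusPiece => angles m.2.val) m) := by
  have hL := (contMDiffAt_side_angles hm).mdifferentiableAt (by simp)
  have h1 : ang sideModel (fun m : S × TorusPiece => (twist m.2.val : ℂ)) m = 0 := by
    rw [← ang_const (I := sideModel) (x := m) 1]
    refine ang_congr ?_
    filter_upwards [isOpen_side_collar.mem_nhds hm] with m' hm'
    rw [twist_of_norm_le (le_of_lt hm'), Circle.coe_one]
  have hre : MDifferentiableAt sideModel 𝓘(ℝ, ℝ)
      (fun m : S × TorusPiece => (angles m.2.val).re) m :=
    (Complex.reCLM.contDiff.contMDiff.contMDiffAt.comp m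
      (contMDiffAt_side_angles hm)).mdifferentiableAt (by simp)
  have him : MDifferentiableAt sideModel 𝓘(ℝ, ℝ)
      (fun m : S × TorusPiece => (angles m.2.val).im) m :=
    (Complex.imCLM.contDiff.contMDiff.contMDiffAt.comp m
      (contMDiffAt_side_angles hm)).mdifferentiableAt (by simp)
  have hX : (fun m : S × TorusPiece => m.2.fstCoord) =
      fun m => Complex.exp ((angles m.2.val).re * Complex.I) := by
    funext m; rw [← Circle.coe_exp]; exact congrArg _ (Circle.exp_arg m.2.val.1).symm
  have hY : (fun m : S × TorusPiece => m.2.sndCoord) =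
      fun m => Complex.exp ((angles m.2.val).im * Complex.I) := by
    funext m; rw [← Circle.coe_exp]; exact congrArg _ (Circle.exp_arg m.2.val.2).symm
  have h0 : ∀ a : TangentSpace sideModel m →L[ℝ] ℝ, wedge a 0 = 0 := fun a => by
    ext v; simp [wedge_apply]
  rw [sideForm, h1, h0, add_zero, hX, hY, ang_cexp_mul_I hre, ang_cexp_mul_I him,
    wedge_re_im_eq hL (TorusPiece.angles_ne_zero m.2)]

end Collar

/-! ### Coordinates around the gluing torus. -/

section Tube

theorem exp_pi_mul_exp_pi : Circle.exp Real.pi * Circle.exp Real.pi = 1 := by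
  ext; simp

theorem exp_pi_mul_re (z : Circle) : ((Circle.exp Real.pi * z : Circle) : ℂ).re = -(z : ℂ).re := by
  simp

theorem exp_re (t : ℝ) : (Circle.exp t : ℂ).re = Real.cos t := by
  rw [Circle.coe_exp, Complex.exp_ofReal_mul_I_re]

variable {S : Type u} [TopologicalSpace S] [ChartedSpace (EuclideanSpace ℝ (Fin 2)) S]
  {σ : DiffForm (𝓡 2) S 2} {h : S → Circle} {ε : ℝ} {e : OpenPartialHomeomorph S ℂ}

/-- The normal coordinate of the torus along which two sides are glued. -/
def tubeNormal (e : OpenPartialHomeomorph S ℂ) (m : S × TorusPiece) : ℂ :=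
  -- The second angle is measured from −1, that is as the argument of −y, which is smooth where Re y
  -- < 0.
  ⟨Real.log ‖e m.1‖, Complex.arg (Circle.exp Real.pi * m.2.val.2 : Circle)⟩

/-- Coordinates around the torus along which two sides are glued. -/
def tubeMap (e : OpenPartialHomeomorph S ℂ) (h : S → Circle) (m : S × TorusPiece) :
    (Circle × Circle) × ℂ :=
  -- Let a be the angle of h, let x and y be the torus angles (y measured from −1), and let s =
  -- log‖e‖. The shear (a, x) ↦ (a − y, x − s) brings the form to product shape, because d(a − y) ∧
  -- d(x − s) + ds ∧ dy = ds ∧ da + dx ∧ dy + da ∧ dx.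
  ((h m.1 * Circle.exp (-(tubeNormal e m).im),
    m.2.val.1 * Circle.exp (-(tubeNormal e m).re)), tubeNormal e m)

/-- The inverse of `tubeMap`. -/
def tubeInv (e : OpenPartialHomeomorph S ℂ) (q : (Circle × Circle) × ℂ) : S × TorusPiece :=
  (e.symm (Real.exp q.2.re * (q.1.1 * Circle.exp q.2.im : Circle)),
    TorusPiece.inner.symm (q.1.2 * Circle.exp q.2.re, Circle.exp Real.pi * Circle.exp q.2.im))

/-- The domain of `tubeMap`. -/
def tubeSource (e : OpenPartialHomeomorph S ℂ) (δ : ℝ) : Set (S × TorusPiece) :=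
  {m | (m.1 ∈ e.source ∧ (m.2.val.2 : ℂ).re < 0) ∧ ‖tubeNormal e m‖ < δ}

theorem contMDiffOn_tubeNormal (H : HandleCoordinate σ ε e h) :
    ContMDiffOn sideModel 𝓘(ℝ, ℂ) ∞ (tubeNormal e)
      {m : S × TorusPiece | m.1 ∈ e.source ∧ (m.2.val.2 : ℂ).re < 0} := by
  have h0 : ∀ x ∈ e.source, e x ≠ 0 := fun x hx => by
    have := e.map_source hx; rw [H.target_eq] at this; exact this.1
  have h1 : ContMDiffOn sideModel 𝓘(ℝ, ℝ) ∞ (fun m : S × TorusPiece => Real.log ‖e m.1‖)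
      {m | m.1 ∈ e.source ∧ (m.2.val.2 : ℂ).re < 0} := by
    have h2 : ContDiffOn ℝ ∞ (fun z : ℂ => Real.log ‖z‖) {z | z ≠ 0} := fun z hz =>
      (contDiffAt_log_norm hz).contDiffWithinAt
    exact (h2.contMDiffOn.comp H.smooth h0).comp contMDiff_fst.contMDiffOn fun m hm => hm.1
  have h2 : ContMDiffOn sideModel 𝓘(ℝ, ℝ) ∞
      (fun m : S × TorusPiece => Complex.arg (Circle.exp Real.pi * m.2.val.2 : Circle))
      {m | m.1 ∈ e.source ∧ (m.2.val.2 : ℂ).re < 0} := by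
    have h3 : ContDiffOn ℝ ∞ Complex.arg Complex.slitPlane := fun z hz =>
      (contDiffAt_arg hz).contDiffWithinAt
    have h4 : ContMDiff sideModel 𝓘(ℝ, ℂ) ∞
        fun m : S × TorusPiece => ((Circle.exp Real.pi * m.2.val.2 : Circle) : ℂ) :=
      contMDiff_circle_coe.comp ((contMDiff_mul_left (I := 𝓡 1) (n := ∞)
        (a := Circle.exp Real.pi)).comp (contMDiff_snd.comp
          (TorusPiece.contMDiff_val.comp (contMDiff_snd (I := 𝓡 2)))))
    refine h3.contMDiffOn.comp h4.contMDiffOn fun m hm => Or.inl ?_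
    rw [exp_pi_mul_re]
    exact neg_pos.2 hm.2
  have h5 : ContDiff ℝ ∞ fun p : ℝ × ℝ => (⟨p.1, p.2⟩ : ℂ) :=
    Complex.equivRealProdCLM.symm.contDiff
  exact h5.contMDiff.comp_contMDiffOn (h1.prodMk_space h2)

theorem contMDiffOn_tubeMap (H : HandleCoordinate σ ε e h) {δ : ℝ} :
    ContMDiffOn sideModel tubeModel ∞ (tubeMap e h) (tubeSource e δ) := by
  have h1 := (contMDiffOn_tubeNormal H).mono fun m (hm : m ∈ tubeSource e δ) => hm.1
  have h2 : ContMDiff 𝓘(ℝ, ℂ) (𝓡 1) ∞ fun w : ℂ => Circle.exp (-w.im) :=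
    (contMDiff_circleExp (m := ∞)).comp Complex.imCLM.contDiff.neg.contMDiff
  have h3 : ContMDiff 𝓘(ℝ, ℂ) (𝓡 1) ∞ fun w : ℂ => Circle.exp (-w.re) :=
    (contMDiff_circleExp (m := ∞)).comp Complex.reCLM.contDiff.neg.contMDiff
  have h4 : ContMDiff sideModel (𝓡 1) ∞ fun m : S × TorusPiece => m.2.val.1 :=
    contMDiff_fst.comp (TorusPiece.contMDiff_val.comp (contMDiff_snd (I := 𝓡 2)))
  have h5 : ContMDiff sideModel (𝓡 1) ∞ fun m : S × TorusPiece => h m.1 :=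
    H.angle_smooth.comp contMDiff_fst
  exact ((h5.contMDiffOn.mul (h2.comp_contMDiffOn h1)).prodMk
    (h4.contMDiffOn.mul (h3.comp_contMDiffOn h1))).prodMk h1

theorem norm_exp_mul_circle (t : ℝ) (z : Circle) : ‖(Real.exp t : ℂ) * z‖ = Real.exp t := by
  rw [norm_mul, Circle.norm_coe, mul_one, Complex.norm_real, Real.norm_of_nonneg (Real.exp_pos t).le]

theorem exp_mul_mem_annulus {t : ℝ} (ht : |t| < ε) (z : Circle) :
    (Real.exp t : ℂ) * z ∈ annulus ε := by
  refine ⟨norm_ne_zero_iff.1 ?_, ?_⟩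
  · rw [norm_exp_mul_circle]; exact (Real.exp_pos t).ne'
  · rwa [norm_exp_mul_circle, Real.log_exp]

/-- As 1 < π/2, points within angle 1 of −1 stay in the left half-plane, where the twisting function
is the first coordinate. -/
theorem re_exp_pi_mul_exp_neg {t : ℝ} (ht : |t| < 1) :
    ((Circle.exp Real.pi * Circle.exp t : Circle) : ℂ).re < 0 := by
  rw [exp_pi_mul_re, exp_re, neg_lt_zero]
  have := abs_lt.1 ht
  exact Real.cos_pos_of_mem_Ioo ⟨by linarith [Real.pi_gt_three], by linarith [Real.pi_gt_three]⟩

theorem contMDiffOn_tubeInv (H : HandleCoordinate σ ε e h) {δ : ℝ} (hδ : δ ≤ ε) (hδ' : δ ≤ 1) :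
    ContMDiffOn tubeModel sideModel ∞ (tubeInv e) {q | ‖q.2‖ < δ} := by
  have h1 : ContMDiff tubeModel 𝓘(ℝ, ℂ) ∞ fun q : (Circle × Circle) × ℂ => q.2 := contMDiff_snd
  have h2 : ContMDiff tubeModel (𝓡 1) ∞ fun q : (Circle × Circle) × ℂ => q.1.1 :=
    contMDiff_fst.comp contMDiff_fst
  have h3 : ContMDiff tubeModel (𝓡 1) ∞ fun q : (Circle × Circle) × ℂ => q.1.2 :=
    contMDiff_snd.comp contMDiff_fst
  have h4 : ContMDiff tubeModel (𝓡 1) ∞ fun q : (Circle × Circle) × ℂ => Circle.exp q.2.re :=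
    (contMDiff_circleExp (m := ∞)).comp (Complex.reCLM.contDiff.contMDiff.comp h1)
  have h5 : ContMDiff tubeModel (𝓡 1) ∞ fun q : (Circle × Circle) × ℂ => Circle.exp q.2.im :=
    (contMDiff_circleExp (m := ∞)).comp (Complex.imCLM.contDiff.contMDiff.comp h1)
  refine ContMDiffOn.prodMk ?_ ?_
  · have h6 : ContDiff ℝ ∞ fun p : ℂ × ℂ => ((Real.exp p.1.re : ℝ) : ℂ) * p.2 :=
      (Complex.ofRealCLM.contDiff.comp (Real.contDiff_exp.comp
        (Complex.reCLM.contDiff.comp contDiff_fst))).mul contDiff_snd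
    refine H.symm_smooth.comp (h6.contMDiff.comp
      (h1.prodMk_space (contMDiff_circle_coe.comp (h2.mul h5)))).contMDiffOn fun q hq => ?_
    rw [H.target_eq]
    exact exp_mul_mem_annulus (((Complex.abs_re_le_norm q.2).trans_lt hq).trans_le hδ) _
  · refine TorusPiece.contMDiffOn_inner_symm.comp ((h3.mul h4).prodMk
      ((contMDiff_mul_left (I := 𝓡 1) (n := ∞) (a := Circle.exp Real.pi)).comp h5)).contMDiffOn
        fun q hq => ?_
    have := one_lt_norm_angles (q := (q.1.2 * Circle.exp q.2.re,
      Circle.exp Real.pi * Circle.exp q.2.im)) (re_exp_pi_mul_exp_neg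
        (((Complex.abs_im_le_norm q.2).trans_lt hq).trans_le hδ')).le
    change 1 / 2 < ‖angles _‖
    linarith

theorem tubeInv_snd_val {S : Type u} [TopologicalSpace S] {e : OpenPartialHomeomorph S ℂ}
    {δ : ℝ} (hδ' : δ ≤ 1) {q : (Circle × Circle) × ℂ} (hq : ‖q.2‖ < δ) :
    (tubeInv e q).2.val = (q.1.2 * Circle.exp q.2.re, Circle.exp Real.pi * Circle.exp q.2.im) := by
  refine TorusPiece.inner_symm_val ?_
  have := one_lt_norm_angles (q := (q.1.2 * Circle.exp q.2.re,
    Circle.exp Real.pi * Circle.exp q.2.im)) (re_exp_pi_mul_exp_neg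
      (((Complex.abs_im_le_norm q.2).trans_lt hq).trans_le hδ')).le
  linarith

theorem e_tubeInv_fst (H : HandleCoordinate σ ε e h) {δ : ℝ} (hδ : δ ≤ ε)
    {q : (Circle × Circle) × ℂ} (hq : ‖q.2‖ < δ) : (tubeInv e q).1 ∈ e.source ∧
      e (tubeInv e q).1 = Real.exp q.2.re * (q.1.1 * Circle.exp q.2.im : Circle) := by
  have h1 : (Real.exp q.2.re : ℂ) * (q.1.1 * Circle.exp q.2.im : Circle) ∈ e.target := by
    rw [H.target_eq]
    exact exp_mul_mem_annulus (((Complex.abs_re_le_norm q.2).trans_lt hq).trans_le hδ) _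
  exact ⟨e.map_target h1, e.right_inv h1⟩

theorem tubeNormal_tubeInv (H : HandleCoordinate σ ε e h) {δ : ℝ} (hδ : δ ≤ ε) (hδ' : δ ≤ 1)
    {q : (Circle × Circle) × ℂ} (hq : ‖q.2‖ < δ) : tubeNormal e (tubeInv e q) = q.2 := by
  have h1 := abs_lt.1 (((Complex.abs_im_le_norm q.2).trans_lt hq).trans_le hδ')
  refine Complex.ext ?_ ?_
  · change Real.log ‖e (tubeInv e q).1‖ = _
    rw [(e_tubeInv_fst H hδ hq).2, norm_exp_mul_circle, Real.log_exp]
  · change Complex.arg (Circle.exp Real.pi * (tubeInv e q).2.val.2 : Circle) = _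
    rw [tubeInv_snd_val hδ' hq, ← mul_assoc, exp_pi_mul_exp_pi, one_mul, Circle.arg_exp]
    · linarith [Real.pi_gt_three]
    · linarith [Real.pi_gt_three]

/-- The coordinates around the torus along which two sides are glued. -/
def tube (H : HandleCoordinate σ ε e h) {δ : ℝ} (hδ : δ ≤ ε) (hδ' : δ ≤ 1) :
    OpenPartialHomeomorph (S × TorusPiece) ((Circle × Circle) × ℂ) where
  toFun := tubeMap e h
  invFun := tubeInv e
  source := tubeSource e δ
  target := {q | ‖q.2‖ < δ}
  map_source' _ hm := hm.2
  map_target' q hq := by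
    refine ⟨⟨(e_tubeInv_fst H hδ hq).1, ?_⟩, by rw [tubeNormal_tubeInv H hδ hδ' hq]; exact hq⟩
    rw [tubeInv_snd_val hδ' hq]
    exact re_exp_pi_mul_exp_neg (((Complex.abs_im_le_norm q.2).trans_lt hq).trans_le hδ')
  left_inv' m hm := by
    have h0 : e m.1 ≠ 0 := by
      have := e.map_source hm.1.1; rw [H.target_eq] at this; exact this.1
    refine Prod.ext ?_ ?_
    · change e.symm (Real.exp (Real.log ‖e m.1‖) *
        (h m.1 * Circle.exp (-(tubeNormal e m).im) * Circle.exp (tubeNormal e m).im : Circle)) = m.1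
      rw [Real.exp_log (norm_pos_iff.2 h0), mul_assoc, ← Circle.exp_add, neg_add_cancel,
        Circle.exp_zero, mul_one, ← H.angle_eq m.1 hm.1.1, e.left_inv hm.1.1]
    · change TorusPiece.inner.symm (m.2.val.1 * Circle.exp (-(tubeNormal e m).re) *
        Circle.exp (tubeNormal e m).re, Circle.exp Real.pi * Circle.exp
          (Complex.arg (Circle.exp Real.pi * m.2.val.2 : Circle))) = m.2
      rw [mul_assoc, ← Circle.exp_add, neg_add_cancel, Circle.exp_zero, mul_one, Circle.exp_arg,
        ← mul_assoc, exp_pi_mul_exp_pi, one_mul]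
      refine TorusPiece.inner.left_inv ?_
      have := one_lt_norm_angles (q := m.2.val) hm.1.2.le
      change 1 / 2 < ‖angles m.2.val‖
      linarith
  right_inv' q hq := by
    have h1 := tubeNormal_tubeInv H hδ hδ' hq
    obtain ⟨h2, h3⟩ := e_tubeInv_fst H hδ hq
    have h4 : h (tubeInv e q).1 = q.1.1 * Circle.exp q.2.im := by
      have h5 := H.angle_eq _ h2
      rw [h3, norm_exp_mul_circle] at h5
      have h6 : ((Real.exp q.2.re : ℝ) : ℂ) ≠ 0 := by exact_mod_cast (Real.exp_pos _).ne'
      exact (Circle.ext (mul_left_cancel₀ h6 h5)).symm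
    refine Prod.ext (Prod.ext ?_ ?_) h1
    · change h (tubeInv e q).1 * Circle.exp (-(tubeNormal e (tubeInv e q)).im) = _
      rw [h1, h4, mul_assoc, ← Circle.exp_add, add_neg_cancel, Circle.exp_zero, mul_one]
    · change (tubeInv e q).2.val.1 * Circle.exp (-(tubeNormal e (tubeInv e q)).re) = _
      rw [h1, tubeInv_snd_val hδ' hq, mul_assoc, ← Circle.exp_add, add_neg_cancel,
        Circle.exp_zero, mul_one]
  open_source := by
    have h1 : IsOpen {m : S × TorusPiece | m.1 ∈ e.source ∧ (m.2.val.2 : ℂ).re < 0} :=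
      (e.open_source.preimage continuous_fst).inter (isOpen_lt (Complex.continuous_re.comp
        (contMDiff_circle_coe.continuous.comp (continuous_snd.comp
          (TorusPiece.continuous_val.comp continuous_snd)))) continuous_const)
    exact (contMDiffOn_tubeNormal H).continuousOn.norm.isOpen_inter_preimage h1 isOpen_Iio
  open_target := isOpen_lt continuous_snd.norm continuous_const
  continuousOn_toFun := (contMDiffOn_tubeMap H).continuousOn
  continuousOn_invFun := (contMDiffOn_tubeInv H hδ hδ').continuousOn

end Tube

/-! ### The standard form on the tube and its inversion. -/

section TubeForm

variable {E : Type*} [NormedAddCommGroup E] [NormedSpace ℝ E] {H : Type*} [TopologicalSpace H]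
  {I : ModelWithCorners ℝ E H} {M : Type*} [TopologicalSpace M] [ChartedSpace H M]

/-- The standard symplectic form on the product of a torus and the plane. -/
def tubeForm : DiffForm tubeModel ((Circle × Circle) × ℂ) 2 := fun q =>
  wedge (ang tubeModel (fun q : (Circle × Circle) × ℂ => (q.1.1 : ℂ)) q)
    (ang tubeModel (fun q : (Circle × Circle) × ℂ => (q.1.2 : ℂ)) q) +
  wedge (mvfderiv tubeModel (fun q : (Circle × Circle) × ℂ => q.2.re) q)
    (mvfderiv tubeModel (fun q : (Circle × Circle) × ℂ => q.2.im) q)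

theorem contMDiff_tube_fst :
    ContMDiff tubeModel 𝓘(ℝ, ℂ) ∞ fun q : (Circle × Circle) × ℂ => (q.1.1 : ℂ) :=
  contMDiff_circle_coe.comp (contMDiff_fst.comp contMDiff_fst)

theorem contMDiff_tube_snd :
    ContMDiff tubeModel 𝓘(ℝ, ℂ) ∞ fun q : (Circle × Circle) × ℂ => (q.1.2 : ℂ) :=
  contMDiff_circle_coe.comp (contMDiff_snd.comp contMDiff_fst)

theorem tubeForm_pullback {f : M → (Circle × Circle) × ℂ} {x : M}
    (hf : MDifferentiableAt I tubeModel f x) :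
    tubeForm.pullback I f x = wedge (ang I (fun y => ((f y).1.1 : ℂ)) x)
        (ang I (fun y => ((f y).1.2 : ℂ)) x) +
      wedge (mvfderiv I (fun y => (f y).2.re) x) (mvfderiv I (fun y => (f y).2.im) x) := by
  have h1 : ContMDiff tubeModel 𝓘(ℝ, ℝ) ∞ fun q : (Circle × Circle) × ℂ => q.2.re :=
    Complex.reCLM.contDiff.contMDiff.comp contMDiff_snd
  have h2 : ContMDiff tubeModel 𝓘(ℝ, ℝ) ∞ fun q : (Circle × Circle) × ℂ => q.2.im :=
    Complex.imCLM.contDiff.contMDiff.comp contMDiff_snd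
  rw [ang_comp (f := f) (contMDiff_tube_fst.mdifferentiableAt (by simp)) hf,
    ang_comp (f := f) (contMDiff_tube_snd.mdifferentiableAt (by simp)) hf,
    mvfderiv_comp' (f := f) (h1.mdifferentiableAt (by simp)) hf,
    mvfderiv_comp' (f := f) (h2.mdifferentiableAt (by simp)) hf,
    ← wedge_comp, ← wedge_comp]
  rfl

/-- The symplectic inversion of a punctured disc of radius `δ`. -/
def invert (δ : ℝ) (w : ℂ) : ℂ := ((√(δ ^ 2 - ‖w‖ ^ 2) / ‖w‖ : ℝ) : ℂ) * (starRingEnd ℂ) w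

variable {δ : ℝ} {w : ℂ}

theorem norm_invert (hw : w ≠ 0) : ‖invert δ w‖ = √(δ ^ 2 - ‖w‖ ^ 2) := by
  rw [invert, norm_mul, RCLike.norm_conj, Complex.norm_real,
    Real.norm_of_nonneg (by positivity), div_mul_cancel₀ _ (norm_ne_zero_iff.2 hw)]

theorem sub_sq_pos (h : ‖w‖ < δ) : 0 < δ ^ 2 - ‖w‖ ^ 2 := by
  nlinarith [norm_nonneg w]

theorem invert_mem (hδ : 0 < δ) (hw : w ≠ 0) (h : ‖w‖ < δ) : invert δ w ≠ 0 ∧ ‖invert δ w‖ < δ := by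
  have h1 := sub_sq_pos h
  have h2 := norm_pos_iff.2 hw
  constructor
  · rw [← norm_pos_iff, norm_invert hw]; exact Real.sqrt_pos.2 h1
  · rw [norm_invert hw, Real.sqrt_lt' hδ]; nlinarith

theorem invert_invert (hw : w ≠ 0) (h : ‖w‖ < δ) : invert δ (invert δ w) = w := by
  have h1 := sub_sq_pos h
  have h2 := norm_pos_iff.2 hw
  have h3 := Real.sqrt_pos.2 h1
  rw [invert, norm_invert hw, Real.sq_sqrt h1.le, sub_sub_cancel, Real.sqrt_sq h2.le, invert,
    map_mul, Complex.conj_ofReal, Complex.conj_conj, ← mul_assoc, ← Complex.ofReal_mul]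
  have : ‖w‖ / √(δ ^ 2 - ‖w‖ ^ 2) * (√(δ ^ 2 - ‖w‖ ^ 2) / ‖w‖) = 1 := by field_simp
  rw [this, Complex.ofReal_one, one_mul]

theorem contDiffOn_invert_factor :
    ContDiffOn ℝ ∞ (fun w : ℂ => √(δ ^ 2 - ‖w‖ ^ 2) / ‖w‖) {w | w ≠ 0 ∧ ‖w‖ < δ} := by
  intro w hw
  have h1 := contDiffAt_norm ℝ hw.1 (n := ∞)
  exact (((contDiffAt_const.sub (h1.pow 2)).sqrt (sub_sq_pos hw.2).ne').div h1
    (norm_ne_zero_iff.2 hw.1)).contDiffWithinAt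

theorem contDiffOn_invert : ContDiffOn ℝ ∞ (invert δ) {w | w ≠ 0 ∧ ‖w‖ < δ} :=
  (Complex.ofRealCLM.contDiff.comp_contDiffOn contDiffOn_invert_factor).mul
    Complex.conjCLE.contDiff.contDiffOn

/-- The gluing map of the punctured tubes. -/
def flip (δ : ℝ) (q : (Circle × Circle) × ℂ) : (Circle × Circle) × ℂ := (q.1, invert δ q.2)

theorem isOpen_punctured : IsOpen {q : (Circle × Circle) × ℂ | q.2 ≠ 0 ∧ ‖q.2‖ < δ} :=
  (isOpen_ne.preimage continuous_snd).inter (isOpen_lt continuous_snd.norm continuous_const)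

theorem contMDiffOn_flip :
    ContMDiffOn tubeModel tubeModel ∞ (flip δ) {q | q.2 ≠ 0 ∧ ‖q.2‖ < δ} :=
  contMDiff_fst.contMDiffOn.prodMk
    (contDiffOn_invert.contMDiffOn.comp contMDiff_snd.contMDiffOn fun _ hq => hq)

/-- The inversion sends |w|² to δ² − |w|² and the angle to its negative, so both factors of ½ d|w|²
∧ dθ change sign. The torus factor is untouched. -/
theorem tubeForm_pullback_flip {q : (Circle × Circle) × ℂ} (h0 : q.2 ≠ 0) (hδ : ‖q.2‖ < δ) :
    tubeForm.pullback tubeModel (flip δ) q = tubeForm q := by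
  have hf := (contMDiffOn_flip.contMDiffAt (isOpen_punctured.mem_nhds ⟨h0, hδ⟩)).mdifferentiableAt
    (by simp)
  rw [tubeForm_pullback hf, tubeForm]
  congr 1
  have hs : ContMDiff tubeModel 𝓘(ℝ, ℂ) ∞ fun q : (Circle × Circle) × ℂ => q.2 := contMDiff_snd
  have hw : MDifferentiableAt tubeModel 𝓘(ℝ, ℂ) (fun q : (Circle × Circle) × ℂ => q.2) q :=
    hs.mdifferentiableAt (by simp)
  have hi : ContDiffAt ℝ ∞ (invert δ) q.2 := contDiffOn_invert.contDiffAt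
    ((isOpen_ne.inter (isOpen_lt continuous_norm continuous_const)).mem_nhds ⟨h0, hδ⟩)
  have hw' : MDifferentiableAt tubeModel 𝓘(ℝ, ℂ)
      (fun q : (Circle × Circle) × ℂ => invert δ q.2) q :=
    (hi.contMDiffAt.comp q hs.contMDiffAt).mdifferentiableAt (by simp)
  have hr : ContDiffAt ℝ ∞ (fun w : ℂ => √(δ ^ 2 - ‖w‖ ^ 2) / ‖w‖) q.2 :=
    contDiffOn_invert_factor.contDiffAt
      ((isOpen_ne.inter (isOpen_lt continuous_norm continuous_const)).mem_nhds ⟨h0, hδ⟩)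
  have hr' : MDifferentiableAt tubeModel 𝓘(ℝ, ℝ)
      (fun q : (Circle × Circle) × ℂ => √(δ ^ 2 - ‖q.2‖ ^ 2) / ‖q.2‖) q :=
    (hr.contMDiffAt.comp q hs.contMDiffAt).mdifferentiableAt (by simp)
  have hc' : MDifferentiableAt tubeModel 𝓘(ℝ, ℂ)
      (fun q : (Circle × Circle) × ℂ => (starRingEnd ℂ) q.2) q :=
    (Complex.conjCLE.contDiff.contMDiff.contMDiffAt.comp q hs.contMDiffAt).mdifferentiableAt
      (by simp)
  have h1 : invert δ q.2 ≠ 0 := by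
    rw [← norm_pos_iff, norm_invert h0]; exact Real.sqrt_pos.2 (sub_sq_pos hδ)
  have h2 : ang tubeModel (fun q : (Circle × Circle) × ℂ => invert δ q.2) q =
      - ang tubeModel (fun q : (Circle × Circle) × ℂ => q.2) q := by
    rw [← ang_conj hw]
    refine ang_ofReal_mul hr' hc' ?_ ?_
    · exact (div_pos (Real.sqrt_pos.2 (sub_sq_pos hδ)) (norm_pos_iff.2 h0)).ne'
    · simpa using h0
  have h3 : mvfderiv tubeModel (fun q : (Circle × Circle) × ℂ => Complex.normSq (invert δ q.2)) q =
      - mvfderiv tubeModel (fun q : (Circle × Circle) × ℂ => Complex.normSq q.2) q := by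
    have hn : ContMDiff tubeModel 𝓘(ℝ, ℝ) ∞
        (fun q : (Circle × Circle) × ℂ => Complex.normSq q.2) := by
      have : ContDiff ℝ ∞ fun z : ℂ => z.re * z.re + z.im * z.im :=
        (Complex.reCLM.contDiff.mul Complex.reCLM.contDiff).add
          (Complex.imCLM.contDiff.mul Complex.imCLM.contDiff)
      refine (this.contMDiff.comp hs).congr fun q => Complex.normSq_apply _
    have h4 : mvfderiv tubeModel
        (fun q : (Circle × Circle) × ℂ => Complex.normSq (invert δ q.2)) q =
        mvfderiv tubeModel (fun q : (Circle × Circle) × ℂ => δ ^ 2 - Complex.normSq q.2) q := by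
      refine mvfderiv_congr ?_
      filter_upwards [isOpen_punctured.mem_nhds ⟨h0, hδ⟩] with q' hq'
      rw [Complex.normSq_eq_norm_sq, norm_invert hq'.1, Real.sq_sqrt (sub_sq_pos hq'.2).le,
        Complex.normSq_eq_norm_sq]
    have h5 : HasFDerivAt (fun t : ℝ => δ ^ 2 - t) (-ContinuousLinearMap.id ℝ ℝ)
        (Complex.normSq q.2) := (hasFDerivAt_id _).const_sub _
    rw [h4, mvfderiv_comp_of_hasFDerivAt (w := fun q : (Circle × Circle) × ℂ => Complex.normSq q.2)
      h5 (hn.mdifferentiableAt (by simp))]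
    ext v
    rfl
  change wedge (mvfderiv tubeModel (fun q : (Circle × Circle) × ℂ => (invert δ q.2).re) q)
    (mvfderiv tubeModel (fun q : (Circle × Circle) × ℂ => (invert δ q.2).im) q) = _
  rw [wedge_re_im_eq hw' h1, wedge_re_im_eq hw h0, h2, h3]
  congr 1
  ext v
  simp [wedge_apply]

end TubeForm

/-! ### Comparison of the symplectic form with the standard tube. -/

section SideTube

variable {S : Type u} [TopologicalSpace S] [ChartedSpace (EuclideanSpace ℝ (Fin 2)) S]
  {σ : DiffForm (𝓡 2) S 2} {h : S → Circle} {ε δ : ℝ} {e : OpenPartialHomeomorph S ℂ}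

/-- On the tube σ = ds ∧ da by the annular normal form, and the twisting function is the first torus
coordinate because Re y < 0. The rest is the algebraic identity behind the shear in `tubeMap`. -/
theorem sideForm_eq_pullback_tubeForm (H : HandleCoordinate σ ε e h) (hδ : δ ≤ ε) (hδ' : δ ≤ 1)
    {m : S × TorusPiece} (hm : m ∈ (tube H hδ hδ').source) :
    sideForm σ h m = tubeForm.pullback sideModel (tube H hδ hδ') m := by
  have hO := (tube H hδ hδ').open_source.mem_nhds hm
  have hm1 : m.1 ∈ e.source := hm.1.1
  have h0 : ∀ x ∈ e.source, e x ≠ 0 := fun x hx => by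
    have := e.map_source hx; rw [H.target_eq] at this; exact this.1
  have hf : MDifferentiableAt sideModel tubeModel (tube H hδ hδ') m :=
    ((contMDiffOn_tubeMap H).contMDiffAt hO).mdifferentiableAt (by simp)
  have hN : ContMDiffAt sideModel 𝓘(ℝ, ℂ) ∞ (tubeNormal e) m :=
    ((contMDiffOn_tubeNormal H).mono fun m (hm : m ∈ tubeSource e δ) => hm.1).contMDiffAt hO
  have hs : MDifferentiableAt sideModel 𝓘(ℝ, ℝ) (fun m => (tubeNormal e m).re) m :=
    (Complex.reCLM.contDiff.contMDiff.contMDiffAt.comp m hN).mdifferentiableAt (by simp)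
  have hy : MDifferentiableAt sideModel 𝓘(ℝ, ℝ) (fun m => (tubeNormal e m).im) m :=
    (Complex.imCLM.contDiff.contMDiff.contMDiffAt.comp m hN).mdifferentiableAt (by simp)
  have hA : MDifferentiableAt sideModel 𝓘(ℝ, ℂ) (fun m : S × TorusPiece => (h m.1 : ℂ)) m :=
    (contMDiff_side_angle H.angle_smooth).mdifferentiableAt (by simp)
  have hX : MDifferentiableAt sideModel 𝓘(ℝ, ℂ) (fun m : S × TorusPiece => m.2.fstCoord) m :=
    contMDiff_side_fstCoord.mdifferentiableAt (by simp)
  have hexp : ∀ {f : S × TorusPiece → ℝ}, MDifferentiableAt sideModel 𝓘(ℝ, ℝ) f m →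
      MDifferentiableAt sideModel 𝓘(ℝ, ℂ) (fun m => Complex.exp (f m * Complex.I)) m ∧
      MDifferentiableAt sideModel 𝓘(ℝ, ℂ) (fun m => (Complex.exp (f m * Complex.I))⁻¹) m := by
    intro f hf
    have h1 : ContDiff ℝ ∞ fun t : ℝ => Complex.exp (t * Complex.I) :=
      (Complex.ofRealCLM.contDiff.mul contDiff_const).cexp
    have h2 : ContDiff ℝ ∞ fun t : ℝ => (Complex.exp (t * Complex.I))⁻¹ :=
      h1.inv fun t => Complex.exp_ne_zero _
    exact ⟨((h1.contMDiff.mdifferentiable (by simp)).mdifferentiableAt).comp m hf,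
      ((h2.contMDiff.mdifferentiable (by simp)).mdifferentiableAt).comp m hf⟩
  have hinv : ∀ {f : S × TorusPiece → ℝ}, MDifferentiableAt sideModel 𝓘(ℝ, ℝ) f m →
      ang sideModel (fun m => (Complex.exp (f m * Complex.I))⁻¹) m = - mvfderiv sideModel f m := by
    intro f hf
    rw [ang_inv (hexp hf).1 (Complex.exp_ne_zero _), ang_cexp_mul_I hf]
  have hcoe : ∀ t : ℝ, ((Circle.exp (-t) : Circle) : ℂ) = (Complex.exp (t * Complex.I))⁻¹ := by
    intro t; rw [Circle.exp_neg, Circle.coe_inv, Circle.coe_exp]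
  -- the coordinates of the tube
  have ha : ang sideModel (fun m => ((tube H hδ hδ' m).1.1 : ℂ)) m =
      ang sideModel (fun m : S × TorusPiece => (h m.1 : ℂ)) m -
        mvfderiv sideModel (fun m => (tubeNormal e m).im) m := by
    have : (fun m => ((tube H hδ hδ' m).1.1 : ℂ)) =
        fun m => (h m.1 : ℂ) * (Complex.exp ((tubeNormal e m).im * Complex.I))⁻¹ := by
      funext m; rw [← hcoe]; rfl
    rw [this, ang_mul hA (hexp hy).2 (Circle.coe_ne_zero _) (inv_ne_zero (Complex.exp_ne_zero _)),
      hinv hy, sub_eq_add_neg]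
  have hb : ang sideModel (fun m => ((tube H hδ hδ' m).1.2 : ℂ)) m =
      ang sideModel (fun m : S × TorusPiece => m.2.fstCoord) m -
        mvfderiv sideModel (fun m => (tubeNormal e m).re) m := by
    have : (fun m => ((tube H hδ hδ' m).1.2 : ℂ)) =
        fun m => m.2.fstCoord * (Complex.exp ((tubeNormal e m).re * Complex.I))⁻¹ := by
      funext m; rw [← hcoe]; rfl
    rw [this, ang_mul hX (hexp hs).2 (Circle.coe_ne_zero _) (inv_ne_zero (Complex.exp_ne_zero _)),
      hinv hs, sub_eq_add_neg]
  -- the terms of the symplectic form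
  have hY : ang sideModel (fun m : S × TorusPiece => m.2.sndCoord) m =
      mvfderiv sideModel (fun m => (tubeNormal e m).im) m := by
    have : (fun m : S × TorusPiece => m.2.sndCoord) =
        fun m => (-1 : ℂ) * Complex.exp ((tubeNormal e m).im * Complex.I) := by
      funext m
      have h1 : Circle.exp (tubeNormal e m).im = Circle.exp Real.pi * m.2.val.2 :=
        Circle.exp_arg _
      rw [← Circle.coe_exp, h1]
      change (m.2.val.2 : ℂ) = _
      simp
    rw [this, ang_mul mdifferentiableAt_const (hexp hy).1 (by simp) (Complex.exp_ne_zero _),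
      ang_const, zero_add, ang_cexp_mul_I hy]
  have hB : ang sideModel (fun m : S × TorusPiece => (twist m.2.val : ℂ)) m =
      ang sideModel (fun m : S × TorusPiece => m.2.fstCoord) m := by
    refine ang_congr ?_
    filter_upwards [hO] with m' hm'
    rw [twist_of_re_nonpos (le_of_lt hm'.1.2)]; rfl
  have hσ : σ.pullback sideModel Prod.fst m =
      wedge (mvfderiv sideModel (fun m => (tubeNormal e m).re) m)
        (ang sideModel (fun m : S × TorusPiece => (h m.1 : ℂ)) m) := by
    have he : MDifferentiableAt (𝓡 2) 𝓘(ℝ, ℂ) e m.1 :=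
      ((H.smooth.contMDiffAt (e.open_source.mem_nhds hm1))).mdifferentiableAt (by simp)
    have hl : MDifferentiableAt (𝓡 2) 𝓘(ℝ, ℝ) (fun x => Real.log ‖e x‖) m.1 :=
      ((contDiffAt_log_norm (h0 _ hm1)).contMDiffAt.comp m.1
        (H.smooth.contMDiffAt (e.open_source.mem_nhds hm1))).mdifferentiableAt (by simp)
    have h1 : ang (𝓡 2) e m.1 = ang (𝓡 2) (fun x => (h x : ℂ)) m.1 := by
      have h2 : ang (𝓡 2) e m.1 = ang (𝓡 2) (fun x => ((‖e x‖ : ℝ) : ℂ) * (h x : ℂ)) m.1 := by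
        refine ang_congr ?_
        filter_upwards [e.open_source.mem_nhds hm1] with x hx using H.angle_eq x hx
      rw [h2]
      refine ang_ofReal_mul ?_ ((contMDiff_circle_coe.comp H.angle_smooth).mdifferentiableAt
        (by simp)) (norm_ne_zero_iff.2 (h0 _ hm1)) (Circle.coe_ne_zero _)
      exact (((contDiffAt_norm ℝ (h0 _ hm1) (n := ∞)).contMDiffAt.comp m.1
        (H.smooth.contMDiffAt (e.open_source.mem_nhds hm1))).mdifferentiableAt (by simp))
    have h2 : σ.pullback sideModel Prod.fst m =
        (wedge (mvfderiv (𝓡 2) (fun x => Real.log ‖e x‖) m.1)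
          (ang (𝓡 2) (fun x => (h x : ℂ)) m.1)).compContinuousLinearMap
            (mfderiv sideModel (𝓡 2) Prod.fst m) := by
      rw [DiffForm.pullback, H.form_eq m.1 hm1, polarForm, h1]
    rw [h2, wedge_comp, ← mvfderiv_comp' hl mdifferentiableAt_fst,
      ← ang_comp (w := fun x => (h x : ℂ)) ((contMDiff_circle_coe.comp
        H.angle_smooth).mdifferentiableAt (by simp)) mdifferentiableAt_fst]
    rfl
  have hre : (fun m => (tube H hδ hδ' m).2.re) = fun m => (tubeNormal e m).re := rfl
  have him : (fun m => (tube H hδ hδ' m).2.im) = fun m => (tubeNormal e m).im := rfl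
  rw [tubeForm_pullback hf, ha, hb, hre, him, sideForm, hσ, hY, hB]
  ext v
  have hadd : ∀ (η ζ : TangentSpace sideModel m [⋀^Fin 2]→L[ℝ] ℝ), (η + ζ) v = η v + ζ v :=
    fun _ _ => rfl
  simp only [hadd, wedge_apply]
  have hsub : ∀ (η ζ : TangentSpace sideModel m →L[ℝ] ℝ) (u : TangentSpace sideModel m),
    (η - ζ) u = η u - ζ u := fun _ _ _ => rfl
  simp only [hsub]
  ring

/-- The complement of the circle times the torus piece is connected, avoids the core and is dense,
so every set that contains it is connected. -/
theorem isConnected_compl_core (H : HandleCoordinate σ ε e h) (hδ : δ ≤ ε) (hδ' : δ ≤ 1) :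
    IsConnected {m | m ∈ (tube H hδ hδ').source → (tube H hδ hδ' m).2 ≠ 0} := by
  set U := {x | x ∈ e.source → ‖e x‖ ≠ 1} with hU
  refine (H.connected.prod (isConnected_univ (α := TorusPiece))).subset_closure ?_ ?_
  · rintro m ⟨hm, -⟩ hms h0
    have h1 : Real.log ‖e m.1‖ = 0 := congrArg Complex.re h0
    have h2 : e m.1 ≠ 0 := by
      have := e.map_source hms.1.1; rw [H.target_eq] at this; exact this.1
    exact hm hms.1.1 (Real.eq_one_of_pos_of_log_eq_zero (norm_pos_iff.2 h2) h1)
  · rw [closure_prod_eq, H.dense.closure_eq, closure_univ, univ_prod_univ]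
    exact subset_univ _

end SideTube

/-! ### The inversion as a gluing map. -/

section Flip

variable {δ : ℝ}

/-- The gluing map of the punctured tubes as a partial homeomorphism. -/
def flipHomeomorph (hδ : 0 < δ) :
    OpenPartialHomeomorph ((Circle × Circle) × ℂ) ((Circle × Circle) × ℂ) where
  toFun := flip δ
  invFun := flip δ
  source := {q | q.2 ≠ 0 ∧ ‖q.2‖ < δ}
  target := {q | q.2 ≠ 0 ∧ ‖q.2‖ < δ}
  map_source' _ hq := invert_mem hδ hq.1 hq.2
  map_target' _ hq := invert_mem hδ hq.1 hq.2
  left_inv' _ hq := Prod.ext rfl (invert_invert hq.1 hq.2)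
  right_inv' _ hq := Prod.ext rfl (invert_invert hq.1 hq.2)
  open_source := isOpen_punctured
  open_target := isOpen_punctured
  continuousOn_toFun := contMDiffOn_flip.continuousOn
  continuousOn_invFun := contMDiffOn_flip.continuousOn

theorem norm_sq_invert {w : ℂ} (hw : w ≠ 0) (h : ‖w‖ < δ) : ‖invert δ w‖ ^ 2 = δ ^ 2 - ‖w‖ ^ 2 := by
  rw [norm_invert hw, Real.sq_sqrt (sub_sq_pos h).le]

end Flip

/-! ### Gluing two compact spaces along punctured tubes. -/

section TubeGluing

variable {X Y : Type u} [TopologicalSpace X] [TopologicalSpace Y] {δ : ℝ}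

theorem isClosed_graph_on [T2Space Y] {f : X → Y} {K : Set X} (hK : _root_.IsClosed K)
    (hf : ContinuousOn f K) : _root_.IsClosed {p : X × Y | p.1 ∈ K ∧ f p.1 = p.2} := by
  have h : ContinuousOn (fun p : X × Y => (f p.1, p.2)) (K ×ˢ univ) :=
    (hf.comp continuousOn_fst fun p hp => hp.1).prodMk continuousOn_snd
  have h2 := h.preimage_isClosed_of_isClosed (hK.prod isClosed_univ) (isClosed_diagonal (X := Y))
  convert h2 using 1
  ext p
  simp

/-- The complement of the core of a tube. -/
def coreCompl (E : OpenPartialHomeomorph X ((Circle × Circle) × ℂ)) : Set X :=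
  {m | m ∈ E.source → (E m).2 ≠ 0}

variable {EX : OpenPartialHomeomorph X ((Circle × Circle) × ℂ)}
  {EY : OpenPartialHomeomorph Y ((Circle × Circle) × ℂ)}

/-- The closed subtube is the image, under the inverse coordinates, of a compact subset of their
target. -/
theorem isClosed_symm_image [T2Space X] (hX : EX.target = {q | ‖q.2‖ < δ}) {r : ℝ} (hr : r < δ ^ 2)
    (hδ : 0 < δ) : _root_.IsClosed {m | m ∈ EX.source ∧ ‖(EX m).2‖ ^ 2 ≤ r} := by
  have hc : IsCompact {q : (Circle × Circle) × ℂ | ‖q.2‖ ^ 2 ≤ r} := by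
    have h1 : IsCompact ((univ : Set (Circle × Circle)) ×ˢ {w : ℂ | ‖w‖ ^ 2 ≤ r}) := by
      refine isCompact_univ.prod (Metric.isCompact_of_isClosed_isBounded
        (isClosed_le (by fun_prop) continuous_const) ?_)
      refine (Metric.isBounded_closedBall (x := (0 : ℂ)) (r := δ)).subset fun w hw => ?_
      have hw' : ‖w‖ ^ 2 ≤ r := hw
      rw [mem_closedBall_zero_iff]
      exact (abs_le_of_sq_le_sq' (hw'.trans hr.le) hδ.le).2
    convert h1 using 1
    ext q; simp
  have hsub : {q : (Circle × Circle) × ℂ | ‖q.2‖ ^ 2 ≤ r} ⊆ EX.target := fun q hq => by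
    have hq' : ‖q.2‖ ^ 2 ≤ r := hq
    rw [hX]
    exact lt_of_pow_lt_pow_left₀ 2 hδ.le (hq'.trans_lt hr)
  have : {m | m ∈ EX.source ∧ ‖(EX m).2‖ ^ 2 ≤ r} =
      EX.symm '' {q : (Circle × Circle) × ℂ | ‖q.2‖ ^ 2 ≤ r} := by
    ext m
    constructor
    · rintro ⟨h1, h2⟩; exact ⟨EX m, h2, EX.left_inv h1⟩
    · rintro ⟨q, hq, rfl⟩
      refine ⟨EX.map_target (hsub hq), ?_⟩
      rw [EX.right_inv (hsub hq)]; exact hq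
  rw [this]
  exact (hc.image_of_continuousOn (EX.symm.continuousOn.mono hsub)).isClosed

theorem isOpen_coreCompl [T2Space X] (hX : EX.target = {q | ‖q.2‖ < δ}) (hδ : 0 < δ) :
    IsOpen (coreCompl EX) := by
  have h := isClosed_symm_image hX (r := 0) (by positivity) hδ
  have h2 : coreCompl EX = {m | m ∈ EX.source ∧ ‖(EX m).2‖ ^ 2 ≤ 0}ᶜ := by
    ext m
    simp only [coreCompl, mem_ofPred_eq, mem_compl_iff, not_and]
    refine forall_congr' fun _ => not_congr ⟨fun h => by rw [h]; simp, fun h => ?_⟩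
    exact norm_eq_zero.1 (pow_eq_zero_iff two_ne_zero |>.1 (le_antisymm h (by positivity)))
  rw [h2]
  exact h.isOpen_compl

theorem isCompact_compl_tube {X : Type*} [TopologicalSpace X] [CompactSpace X] {c : ℝ}
    (E : OpenPartialHomeomorph X ((Circle × Circle) × ℂ)) (hc : 0 < c) :
    IsCompact {x : {m // m ∈ coreCompl E} | ¬ (x.val ∈ E.source ∧ ‖(E x.val).2‖ ^ 2 < c)} := by
  have h0 : IsOpen {q : (Circle × Circle) × ℂ | ‖q.2‖ ^ 2 < c} :=
    isOpen_lt (by fun_prop) continuous_const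
  have h1 : _root_.IsClosed {m | ¬ (m ∈ E.source ∧ ‖(E m).2‖ ^ 2 < c)} :=
    (E.isOpen_inter_preimage h0).isClosed_compl
  refine (Topology.IsEmbedding.subtypeVal (p := fun m => m ∈ coreCompl E)).isCompact_iff.2 ?_
  convert h1.isCompact using 1
  ext m
  constructor
  · rintro ⟨x, hx, rfl⟩
    exact hx
  · intro hm
    refine ⟨⟨m, fun h h0 => hm ⟨h, ?_⟩⟩, hm, rfl⟩
    rw [h0]
    simpa using hc

/-- Gluing two compact spaces along the complements of the cores of tubes. -/
theorem exists_tube_gluing [T2Space X] [T2Space Y] [CompactSpace X] [CompactSpace Y]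
    (hδ : 0 < δ) (hX : EX.target = {q | ‖q.2‖ < δ}) (hY : EY.target = {q | ‖q.2‖ < δ})
    (hXc : IsConnected (coreCompl EX)) (hYc : IsConnected (coreCompl EY)) :
    ∃ (W : Type u) (_ : TopologicalSpace W) (e₁ : OpenPartialHomeomorph W X)
      (e₂ : OpenPartialHomeomorph W Y), T2Space W ∧ CompactSpace W ∧ ConnectedSpace W ∧
      e₁.target = coreCompl EX ∧ e₂.target = coreCompl EY ∧
      (∀ w, w ∈ e₁.source ∨ w ∈ e₂.source) ∧
      ∀ w, w ∈ e₁.source → w ∈ e₂.source → e₁ w ∈ EX.source ∧ e₂ w ∈ EY.source ∧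
        EY (e₂ w) = flip δ (EX (e₁ w)) := by
  have hXo := isOpen_coreCompl hX hδ
  have hYo := isOpen_coreCompl hY hδ
  set PX : TopologicalSpace.Opens X := ⟨coreCompl EX, hXo⟩ with hPX
  set PY : TopologicalSpace.Opens Y := ⟨coreCompl EY, hYo⟩ with hPY
  have neX : Nonempty PX := hXc.nonempty.to_subtype
  have neY : Nonempty PY := hYc.nonempty.to_subtype
  set G : OpenPartialHomeomorph X Y := EX ≫ₕ flipHomeomorph hδ ≫ₕ EY.symm with hG
  have hGs : ∀ m, m ∈ G.source ↔ m ∈ EX.source ∧ (EX m).2 ≠ 0 := by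
    intro m
    constructor
    · intro hm
      exact ⟨hm.1, hm.2.1.1⟩
    · intro hm
      have h1 : ‖(EX m).2‖ < δ := by have := EX.map_source hm.1; rw [hX] at this; exact this
      refine ⟨hm.1, ⟨hm.2, h1⟩, ?_⟩
      change flip δ (EX m) ∈ EY.target
      rw [hY]; exact (invert_mem hδ hm.2 h1).2
  have hGv : ∀ m ∈ G.source, G m ∈ EY.source ∧ EY (G m) = flip δ (EX m) ∧ (EY (G m)).2 ≠ 0 ∧
      ‖(EY (G m)).2‖ ^ 2 = δ ^ 2 - ‖(EX m).2‖ ^ 2 := by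
    intro m hm
    have h0 := (hGs m).1 hm
    have h1 : ‖(EX m).2‖ < δ := by have := EX.map_source h0.1; rw [hX] at this; exact this
    have h2 : flip δ (EX m) ∈ EY.target := by rw [hY]; exact (invert_mem hδ h0.2 h1).2
    have h3 : EY (G m) = flip δ (EX m) := EY.right_inv h2
    refine ⟨EY.map_target h2, h3, ?_, ?_⟩
    · rw [h3]; exact (invert_mem hδ h0.2 h1).1
    · rw [h3]; exact norm_sq_invert h0.2 h1
  have hGt : ∀ m, m ∈ EY.source → (EY m).2 ≠ 0 → m ∈ G.target := by
    intro m hm hm0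
    have h1 : ‖(EY m).2‖ < δ := by have := EY.map_source hm; rw [hY] at this; exact this
    have h2 : flip δ (EY m) ∈ EX.target := by rw [hX]; exact (invert_mem hδ hm0 h1).2
    have h3 : EX.symm (flip δ (EY m)) ∈ G.source := by
      rw [hGs, EX.right_inv h2]
      exact ⟨EX.map_target h2, (invert_mem hδ hm0 h1).1⟩
    have h4 : G (EX.symm (flip δ (EY m))) = m := by
      change EY.symm (flip δ (EX (EX.symm (flip δ (EY m))))) = m
      rw [EX.right_inv h2]
      have : flip δ (flip δ (EY m)) = EY m := Prod.ext rfl (invert_invert hm0 h1)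
      rw [this, EY.left_inv hm]
    rw [← h4]; exact G.map_source h3
  set ιX := PX.openPartialHomeomorphSubtypeCoe neX
  set ιY := PY.openPartialHomeomorphSubtypeCoe neY
  set e : OpenPartialHomeomorph PX PY := ιX ≫ₕ G ≫ₕ ιY.symm with he
  have hιY : ιY.target = coreCompl EY := PY.openPartialHomeomorphSubtypeCoe_target neY
  have hιX : ιX.target = coreCompl EX := PX.openPartialHomeomorphSubtypeCoe_target neX
  have hes : ∀ x : PX, x ∈ e.source ↔ x.val ∈ G.source := by
    intro x
    constructor
    · intro hx; exact hx.2.1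
    · intro hx
      refine ⟨trivial, hx, ?_⟩
      change G x.val ∈ ιY.target
      rw [hιY]; exact fun _ => (hGv _ hx).2.2.1
  have hev : ∀ x ∈ e.source, (e x).val = G x.val := by
    intro x hx
    refine ιY.right_inv ?_
    rw [hιY]; exact fun _ => (hGv _ ((hes x).1 hx)).2.2.1
  have hPXs : ∀ x : PX, x.val ∈ EX.source → x ∈ e.source := fun x hx =>
    (hes x).2 ((hGs _).2 ⟨hx, x.2 hx⟩)
  have hPYt : ∀ y : PY, y.val ∈ EY.source → y ∈ e.target := by
    intro y hy
    have h1 := hGt y.val hy (y.2 hy)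
    have h2 := G.map_target h1
    have h3 : G.symm y.val ∈ coreCompl EX := fun _ => ((hGs _).1 h2).2
    have h4 : (⟨G.symm y.val, h3⟩ : PX) ∈ e.source := (hes _).2 h2
    have h5 : e ⟨G.symm y.val, h3⟩ = y := Subtype.ext ((hev _ h4).trans (G.right_inv h1))
    rw [← h5]; exact e.map_source h4
  have hhalf : δ ^ 2 / 2 < δ ^ 2 := by have := sq_pos_of_pos hδ; linarith
  -- Glued points satisfy ‖w‖² + ‖w'‖² = δ², so one of the two is at most δ²/2. The graph is
  -- therefore the union of its parts over the two closed subtubes, and each part is the graph of a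
  -- continuous map on a closed set.
  have hgraph : _root_.IsClosed {p : PX × PY | p.1 ∈ e.source ∧ e p.1 = p.2} := by
    have h1 : _root_.IsClosed {x : PX | x.val ∈ EX.source ∧ ‖(EX x.val).2‖ ^ 2 ≤ δ ^ 2 / 2} :=
      (isClosed_symm_image hX hhalf hδ).preimage continuous_subtype_val
    have h2 : _root_.IsClosed {x : PY | x.val ∈ EY.source ∧ ‖(EY x.val).2‖ ^ 2 ≤ δ ^ 2 / 2} :=
      (isClosed_symm_image hY hhalf hδ).preimage continuous_subtype_val
    have h3 := isClosed_graph_on h1 (e.continuousOn.mono fun x hx => hPXs x hx.1)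
    have h4 := (isClosed_graph_on h2 (e.symm.continuousOn.mono fun x hx => hPYt x hx.1)).preimage
      continuous_swap
    convert h3.union h4 using 1
    ext p
    constructor
    · rintro ⟨hp, hpe⟩
      have h5 := (hes _).1 hp
      obtain ⟨h6, -, -, h7⟩ := hGv _ h5
      have h8 : p.2.val = G p.1.val := by rw [← hpe, hev _ hp]
      rcases le_or_gt (‖(EX p.1.val).2‖ ^ 2) (δ ^ 2 / 2) with h | h
      · exact Or.inl ⟨⟨((hGs _).1 h5).1, h⟩, hpe⟩
      · refine Or.inr ⟨⟨?_, ?_⟩, ?_⟩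
        · change p.2.val ∈ _; rw [h8]; exact h6
        · change ‖(EY p.2.val).2‖ ^ 2 ≤ _; rw [h8, h7]; linarith
        · change e.symm p.2 = p.1
          rw [← hpe, e.left_inv hp]
    · rintro (⟨h5, h6⟩ | ⟨h5, h6⟩)
      · exact ⟨hPXs _ h5.1, h6⟩
      · have h7 := hPYt p.2 h5.1
        have h8 : e.symm p.2 = p.1 := h6
        rw [mem_ofPred_eq, ← h8]
        exact ⟨e.map_target h7, e.right_inv h7⟩
  obtain ⟨W, tW, f, g, hT2, hf, hg, hcov, hfg⟩ := exists_gluing e hgraph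
  set fH := hf.toOpenPartialHomeomorph f
  set gH := hg.toOpenPartialHomeomorph g
  have hfs : (fH.symm ≫ₕ ιX).source = range f := by
    ext w
    constructor
    · intro hw
      have : w ∈ fH.target := hw.1
      rwa [hf.toOpenPartialHomeomorph_target] at this
    · intro hw
      refine ⟨?_, trivial⟩
      change w ∈ fH.target
      rwa [hf.toOpenPartialHomeomorph_target]
  have hgs : (gH.symm ≫ₕ ιY).source = range g := by
    ext w
    constructor
    · intro hw
      have : w ∈ gH.target := hw.1
      rwa [hg.toOpenPartialHomeomorph_target] at this
    · intro hw
      refine ⟨?_, trivial⟩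
      change w ∈ gH.target
      rwa [hg.toOpenPartialHomeomorph_target]
  have hfv : ∀ x : PX, (fH.symm ≫ₕ ιX) (f x) = x.val := fun x =>
    congrArg Subtype.val (hf.toOpenPartialHomeomorph_left_inv f (x := x))
  have hgv : ∀ x : PY, (gH.symm ≫ₕ ιY) (g x) = x.val := fun x =>
    congrArg Subtype.val (hg.toOpenPartialHomeomorph_left_inv g (x := x))
  refine ⟨W, tW, fH.symm ≫ₕ ιX, gH.symm ≫ₕ ιY, hT2, ?_, ?_, ?_, ?_, ?_, ?_⟩
  · -- compactness
    set CX : Set PX := {x | ¬ (x.val ∈ EX.source ∧ ‖(EX x.val).2‖ ^ 2 < δ ^ 2 / 2)}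
    set CY : Set PY := {x | ¬ (x.val ∈ EY.source ∧ ‖(EY x.val).2‖ ^ 2 < δ ^ 2 / 2)}
    have hCX : IsCompact CX := isCompact_compl_tube (c := δ ^ 2 / 2) EX (by positivity)
    have hCY : IsCompact CY := isCompact_compl_tube (c := δ ^ 2 / 2) EY (by positivity)
    refine ⟨((hCX.image hf.continuous).union (hCY.image hg.continuous)).of_isClosed_subset
      isClosed_univ ?_⟩
    -- By the same relation, a point deep in the tube of one side is outside the inner part of the
    -- tube on the other side. So the images of two compact sets cover W.
    have key : ∀ x : PX, f x ∈ f '' CX ∪ g '' CY := by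
      intro x
      by_cases hx : x ∈ CX
      · exact Or.inl ⟨x, hx, rfl⟩
      · obtain ⟨h1, h2⟩ := not_not.1 hx
        have h3 := hPXs x h1
        refine Or.inr ⟨e x, fun h4 => ?_, ((hfg x (e x)).2 ⟨h3, rfl⟩).symm⟩
        have h5 := (hGv _ ((hes x).1 h3)).2.2.2
        rw [hev x h3] at h4
        linarith [h4.2]
    rintro w -
    rcases hcov w with ⟨x, rfl⟩ | ⟨y, rfl⟩
    · exact key x
    · by_cases hy : y ∈ CY
      · exact Or.inr ⟨y, hy, rfl⟩
      · obtain ⟨h1, h2⟩ := not_not.1 hy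
        have h3 := hPYt y h1
        have h4 : f (e.symm y) = g y := (hfg _ _).2 ⟨e.map_target h3, e.right_inv h3⟩
        rw [← h4]; exact key _
  · -- connectedness
    have cX : ConnectedSpace PX := isConnected_iff_connectedSpace.1 hXc
    have cY : ConnectedSpace PY := isConnected_iff_connectedSpace.1 hYc
    -- Any point of the punctured tube lies in the images of both pieces, which are therefore not
    -- disjoint; this one has normal coordinate δ/2.
    have hq : (((1, 1), ((δ / 2 : ℝ) : ℂ)) : (Circle × Circle) × ℂ) ∈ EX.target := by
      rw [hX]
      change ‖((δ / 2 : ℝ) : ℂ)‖ < δ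
      rw [Complex.norm_real, Real.norm_of_nonneg (by linarith)]; linarith
    have hm : EX.symm ((1, 1), ((δ / 2 : ℝ) : ℂ)) ∈ coreCompl EX := by
      intro _
      rw [EX.right_inv hq]
      simpa using hδ.ne'
    have hx := hPXs ⟨_, hm⟩ (EX.map_target hq)
    have h1 := (hfg ⟨_, hm⟩ _).2 ⟨hx, rfl⟩
    have h3 : f ⟨_, hm⟩ ∈ range g := by rw [h1]; exact mem_range_self _
    have h2 := (isConnected_range hf.continuous).union ⟨_, mem_range_self _, h3⟩
      (isConnected_range hg.continuous)
    rw [connectedSpace_iff_univ]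
    convert h2
    ext w; simpa using hcov w
  · ext x
    constructor
    · intro hx; rw [← hιX]; exact hx.1
    · intro hx
      have h1 : x ∈ ιX.target := by rw [hιX]; exact hx
      refine ⟨h1, ?_⟩
      change ιX.symm x ∈ fH.symm.target
      trivial
  · ext x
    constructor
    · intro hx; rw [← hιY]; exact hx.1
    · intro hx
      have h1 : x ∈ ιY.target := by rw [hιY]; exact hx
      refine ⟨h1, ?_⟩
      change ιY.symm x ∈ gH.symm.target
      trivial
  · intro w; rw [hfs, hgs]; exact hcov w
  · intro w hw hw'
    rw [hfs] at hw
    rw [hgs] at hw'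
    obtain ⟨x, rfl⟩ := hw
    obtain ⟨y, hy⟩ := hw'
    obtain ⟨h1, h2⟩ := (hfg x y).1 hy.symm
    rw [hfv, ← hy, hgv, ← h2, hev x h1]
    have h3 := (hes x).1 h1
    exact ⟨((hGs _).1 h3).1, (hGv _ h3).1, (hGv _ h3).2.1⟩

end TubeGluing

/-! ### Identification of the product model with the four-dimensional half-space. -/

section ModelEmbedding

/-- The reordering of coordinates which moves the half-line to the front. -/
def modelReorder : (EuclideanSpace ℝ (Fin 2) × (EuclideanSpace ℝ (Fin 1) × EuclideanSpace ℝ (Fin 1)))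
    →L[ℝ] EuclideanSpace ℝ (Fin 4) :=
  LinearMap.toContinuousLinearMap
    { toFun := fun p => !₂[p.2.2 0, p.2.1 0, p.1 0, p.1 1]
      map_add' := fun p q => by ext i; fin_cases i <;> simp
      map_smul' := fun c p => by ext i; fin_cases i <;> simp }

/-- The inverse of `modelReorder`. -/
def modelReorderInv : EuclideanSpace ℝ (Fin 4) →L[ℝ]
    (EuclideanSpace ℝ (Fin 2) × (EuclideanSpace ℝ (Fin 1) × EuclideanSpace ℝ (Fin 1))) :=
  LinearMap.toContinuousLinearMap
    { toFun := fun x => (!₂[x 2, x 3], (lineVec (x 1), lineVec (x 0)))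
      map_add' := fun p q => by
        refine Prod.ext ?_ (Prod.ext ?_ ?_)
        · ext i; fin_cases i <;> simp
        · simp
        · simp
      map_smul' := fun c p => by
        refine Prod.ext ?_ (Prod.ext ?_ ?_)
        · ext i; fin_cases i <;> simp
        · exact lineVec.map_smul c _
        · exact lineVec.map_smul c _ }

theorem modelReorderInv_modelReorder
    (p : EuclideanSpace ℝ (Fin 2) × (EuclideanSpace ℝ (Fin 1) × EuclideanSpace ℝ (Fin 1))) :
    modelReorderInv (modelReorder p) = p := by
  refine Prod.ext ?_ (Prod.ext (lineVec_coord _) (lineVec_coord _))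
  ext i; fin_cases i <;> rfl

theorem modelReorder_modelReorderInv (x : EuclideanSpace ℝ (Fin 4)) :
    modelReorder (modelReorderInv x) = x := by
  ext i; fin_cases i
  · exact lineVec_apply _
  · exact lineVec_apply _
  · rfl
  · rfl

/-- The homeomorphism of the product model with the half-space. -/
def modelEmbedding : OpenPartialHomeomorph (ModelProd (EuclideanSpace ℝ (Fin 2))
    (ModelProd (EuclideanSpace ℝ (Fin 1)) (EuclideanHalfSpace 1))) (EuclideanHalfSpace 4) where
  toFun q := ⟨modelReorder (sideModel q), q.2.2.2⟩
  invFun x := ((modelReorderInv x.val).1, ((modelReorderInv x.val).2.1,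
    ⟨(modelReorderInv x.val).2.2, (lineVec_apply (x.val 0)).symm ▸ x.2⟩))
  source := univ
  target := univ
  map_source' _ _ := trivial
  map_target' _ _ := trivial
  left_inv' q _ := by
    have h := modelReorderInv_modelReorder (sideModel q)
    exact Prod.ext (congrArg (fun p => p.1) h) (Prod.ext (congrArg (fun p => p.2.1) h)
      (Subtype.ext (congrArg (fun p => p.2.2) h)))
  right_inv' x _ := Subtype.ext (modelReorder_modelReorderInv x.val)
  open_source := isOpen_univ
  open_target := isOpen_univ
  continuousOn_toFun := ((modelReorder.continuous.comp sideModel.continuous).subtype_mk _).continuousOn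
  continuousOn_invFun := by
    have h : Continuous fun x : EuclideanHalfSpace 4 => modelReorderInv x.val :=
      modelReorderInv.continuous.comp continuous_subtype_val
    exact (h.fst.prodMk (h.snd.fst.prodMk (h.snd.snd.subtype_mk _))).continuousOn

theorem contMDiffOn_modelEmbedding :
    ContMDiffOn sideModel (𝓡∂ 4) ∞ modelEmbedding modelEmbedding.source :=
  contMDiffOn_of_model (modelReorder.contDiff.contMDiff.comp sideModel.contMDiff).contMDiffOn

theorem contMDiffOn_modelEmbedding_symm :
    ContMDiffOn (𝓡∂ 4) sideModel ∞ modelEmbedding.symm modelEmbedding.target :=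
  contMDiffOn_of_model (modelReorderInv.contDiff.contMDiff.comp (𝓡∂ 4).contMDiff).contMDiffOn

end ModelEmbedding

/-! ### The two halves of the cobordism. -/

/-- A closed surface with an area form and a coordinate along which a handle can be attached. -/
structure Side : Type (u + 1) where
  /-- the surface -/
  surface : ClosedSurface.{u}
  /-- the area form -/
  form : DiffForm (𝓡 2) surface 2
  smooth : form.IsSmooth
  nowhereZero : form.NowhereZero
  /-- the width of the annulus -/
  width : ℝ
  /-- the coordinate on the annulus -/
  coord : OpenPartialHomeomorph surface ℂ
  /-- the extension of the angular coordinate -/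
  angle : surface → Circle
  isCoord : HandleCoordinate form width coord angle

namespace Side

/-- The product of the surface with the torus piece. -/
abbrev Total (A : Side.{u}) : Type u := A.surface × TorusPiece

/-- The symplectic form on the product. -/
def omega (A : Side.{u}) : DiffForm sideModel A.Total 2 := sideForm A.form A.angle

/-- The coordinates around the torus to be removed. -/
def core (A : Side.{u}) {δ : ℝ} (h : δ ≤ A.width) (h' : δ ≤ 1) :
    OpenPartialHomeomorph A.Total ((Circle × Circle) × ℂ) := tube A.isCoord h h'

variable (A : Side.{u}) {δ : ℝ} (h : δ ≤ A.width) (h' : δ ≤ 1)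

theorem core_target : (A.core h h').target = {q | ‖q.2‖ < δ} := rfl

theorem contMDiffOn_core : ContMDiffOn sideModel tubeModel ∞ (A.core h h') (A.core h h').source :=
  contMDiffOn_tubeMap A.isCoord

theorem contMDiffOn_core_symm :
    ContMDiffOn tubeModel sideModel ∞ (A.core h h').symm {q | ‖q.2‖ < δ} :=
  contMDiffOn_tubeInv A.isCoord h h'

theorem one_lt_of_mem_core {m : A.Total} (hm : m ∈ (A.core h h').source) :
    1 < ‖angles m.2.val‖ := one_lt_norm_angles (le_of_lt hm.1.2)

theorem isConnected_coreCompl : IsConnected (coreCompl (A.core h h')) :=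
  isConnected_compl_core A.isCoord h h'

theorem isSmoothClosed_omega : A.omega.IsSmoothClosed :=
  isSmoothClosed_sideForm A.smooth A.isCoord.angle_smooth

theorem nondegenerate_omega : A.omega.Nondegenerate :=
  nondegenerate_sideForm A.nowhereZero A.isCoord.angle_smooth

theorem omega_eq_pullback {m : A.Total} (hm : m ∈ (A.core h h').source) :
    A.omega m = tubeForm.pullback sideModel (A.core h h') m :=
  sideForm_eq_pullback_tubeForm A.isCoord h h' hm

end Side

/-! ### Transition maps and forms on the overlap. -/

section Glued

variable {W : Type u} [TopologicalSpace W] [ChartedSpace (EuclideanHalfSpace 4) W]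

/-- The map `e` identifies a part of `W` that contains a neighbourhood of some boundary components
with an open part of `A.Total`. -/
structure IsEnd (A : Side.{u}) (Ω : DiffForm (𝓡∂ 4) W 2) (e : OpenPartialHomeomorph W A.Total) :
    Prop where
  smooth : ContMDiffOn (𝓡∂ 4) sideModel ∞ e e.source
  symm_smooth : ContMDiffOn sideModel (𝓡∂ 4) ∞ e.symm e.target
  collar_subset : ∀ m : A.Total, ‖angles m.2.val‖ < 1 → m ∈ e.target
  form_eq : ∀ w ∈ e.source, Ω w = A.omega.pullback (𝓡∂ 4) e w
  coord_of_lt : ∀ w ∈ e.source, ‖angles (e w).2.val‖ < 1 → ∀ w' : W,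
    extChartAt (𝓡∂ 4) w w' 0 = ‖angles (e w').2.val‖ - 1 / 2

theorem mfderiv_bijective {M N : Type*} [TopologicalSpace M] [TopologicalSpace N]
    {E E' H H' : Type*} [NormedAddCommGroup E] [NormedSpace ℝ E] [NormedAddCommGroup E']
    [NormedSpace ℝ E'] [TopologicalSpace H] [TopologicalSpace H'] [ChartedSpace H M]
    [ChartedSpace H' N] {I : ModelWithCorners ℝ E H} {J : ModelWithCorners ℝ E' H'}
    [FiniteDimensional ℝ E] [FiniteDimensional ℝ E']
    (hE : Module.finrank ℝ E = Module.finrank ℝ E') {e : OpenPartialHomeomorph M N}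
    (he : ContMDiffOn I J ∞ e e.source) (he' : ContMDiffOn J I ∞ e.symm e.target) {x : M}
    (hx : x ∈ e.source) : Function.Bijective (mfderiv I J e x) := by
  have h1 : Function.Injective (mfderiv I J e x) :=
    injective_mfderiv_of_leftInverse (s := univ) (g := e.symm)
      ((he.contMDiffAt (e.open_source.mem_nhds hx)).mdifferentiableAt (by simp))
      ((he'.contMDiffAt (e.open_target.mem_nhds (e.map_source hx))).mdifferentiableAt
        (by simp)).mdifferentiableWithinAt (by simp)
      (Filter.eventually_of_mem (e.open_source.mem_nhds hx) fun y hy => e.left_inv hy)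
  refine ⟨h1, ?_⟩
  let L : E →L[ℝ] E' := mfderiv I J e x
  exact (LinearMap.injective_iff_surjective_of_finrank_eq_finrank (f := L.toLinearMap) hE).1 h1

theorem nondegenerate_pullback {A : Side.{u}} {e : OpenPartialHomeomorph W A.Total}
    (he : ContMDiffOn (𝓡∂ 4) sideModel ∞ e e.source)
    (he' : ContMDiffOn sideModel (𝓡∂ 4) ∞ e.symm e.target) {w : W} (hw : w ∈ e.source)
    (v : TangentSpace (𝓡∂ 4) w) (hv : ∀ v', A.omega.pullback (𝓡∂ 4) e w ![v, v'] = 0) : v = 0 := by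
  have hb := mfderiv_bijective (by simp) he he' hw
  refine hb.1 ((A.nondegenerate_omega (e w) _ fun u => ?_).trans (map_zero _).symm)
  obtain ⟨v', rfl⟩ := hb.2 u
  refine Eq.trans ?_ (hv v')
  change A.omega (e w) _ = A.omega (e w) _
  congr 1
  funext i; fin_cases i <;> rfl

/-- Each form is the pull-back of `tubeForm` in the tube coordinates of its side. These coordinates
differ by `flip`, which preserves `tubeForm`. -/
theorem pullback_eq_of_flip {A B : Side.{u}} {δ : ℝ} (hA : δ ≤ A.width)
    (hB : δ ≤ B.width) (h' : δ ≤ 1) {e₁ : OpenPartialHomeomorph W A.Total}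
    {e₂ : OpenPartialHomeomorph W B.Total}
    (he₁ : ContMDiffOn (𝓡∂ 4) sideModel ∞ e₁ e₁.source)
    (he₂ : ContMDiffOn (𝓡∂ 4) sideModel ∞ e₂ e₂.source)
    (ht : e₁.target = coreCompl (A.core hA h'))
    (hg : ∀ w, w ∈ e₁.source → w ∈ e₂.source → e₁ w ∈ (A.core hA h').source ∧
      e₂ w ∈ (B.core hB h').source ∧ B.core hB h' (e₂ w) = flip δ (A.core hA h' (e₁ w)))
    {w : W} (hw₁ : w ∈ e₁.source) (hw₂ : w ∈ e₂.source) :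
    A.omega.pullback (𝓡∂ 4) e₁ w = B.omega.pullback (𝓡∂ 4) e₂ w := by
  obtain ⟨h1, h2, h3⟩ := hg w hw₁ hw₂
  have key : ∀ (C : Side.{u}) (hC : δ ≤ C.width) (e : OpenPartialHomeomorph W C.Total),
      ContMDiffOn (𝓡∂ 4) sideModel ∞ e e.source → w ∈ e.source → e w ∈ (C.core hC h').source →
      MDifferentiableAt (𝓡∂ 4) tubeModel (C.core hC h' ∘ e) w ∧
      C.omega.pullback (𝓡∂ 4) e w = tubeForm.pullback (𝓡∂ 4) (C.core hC h' ∘ e) w := by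
    intro C hC e he hw hm
    have hd := (he.contMDiffAt (e.open_source.mem_nhds hw)).mdifferentiableAt (by simp)
    have hc := ((C.contMDiffOn_core hC h').contMDiffAt
      ((C.core hC h').open_source.mem_nhds hm)).mdifferentiableAt (by simp)
    refine ⟨hc.comp w hd, ?_⟩
    rw [DiffForm.pullback_comp tubeForm hc hd]
    exact congrArg (fun η => ContinuousAlternatingMap.compContinuousLinearMap η
      (mfderiv (𝓡∂ 4) sideModel e w)) (C.omega_eq_pullback hC h' hm)
  have k1 := key A hA e₁ he₁ hw₁ h1
  rw [k1.2, (key B hB e₂ he₂ hw₂ h2).2]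
  have h0 : (A.core hA h' (e₁ w)).2 ≠ 0 := by
    have := e₁.map_source hw₁; rw [ht] at this; exact this h1
  have hn : ‖(A.core hA h' (e₁ w)).2‖ < δ := (A.core hA h').map_source h1
  have h4 : B.core hB h' ∘ e₂ =ᶠ[𝓝 w] flip δ ∘ (A.core hA h' ∘ e₁) :=
    Filter.eventually_of_mem ((e₁.open_source.inter e₂.open_source).mem_nhds ⟨hw₁, hw₂⟩)
      fun y hy => (hg y hy.1 hy.2).2.2
  rw [DiffForm.pullback_congr h4, DiffForm.pullback_comp (f := A.core hA h' ∘ e₁) tubeForm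
    ((contMDiffOn_flip.contMDiffAt (isOpen_punctured.mem_nhds ⟨h0, hn⟩)).mdifferentiableAt
      (by simp)) k1.1]
  exact congrArg (fun η => ContinuousAlternatingMap.compContinuousLinearMap η
      (mfderiv (𝓡∂ 4) tubeModel (A.core hA h' ∘ e₁) w)) (tubeForm_pullback_flip h0 hn).symm

/-- On the overlap the transition map factors through the tubes: coordinates of `A`, then `flip`,
then inverse coordinates of `B`. -/
theorem transition_smooth {A B : Side.{u}} {δ : ℝ} (hA : δ ≤ A.width)
    (hB : δ ≤ B.width) (h' : δ ≤ 1) (hδ : 0 < δ) {W : Type u} [TopologicalSpace W]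
    {e₁ : OpenPartialHomeomorph W A.Total} {e₂ : OpenPartialHomeomorph W B.Total}
    (ht : e₁.target = coreCompl (A.core hA h'))
    (hg : ∀ w, w ∈ e₁.source → w ∈ e₂.source → e₁ w ∈ (A.core hA h').source ∧
      e₂ w ∈ (B.core hB h').source ∧ B.core hB h' (e₂ w) = flip δ (A.core hA h' (e₁ w))) :
    ContMDiffOn sideModel sideModel ∞ (e₂ ∘ e₁.symm) (e₁.symm ≫ₕ e₂).source := by
  have hs : ∀ m ∈ (e₁.symm ≫ₕ e₂).source, m ∈ (A.core hA h').source ∧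
      (A.core hA h' m).2 ≠ 0 ∧ e₂ (e₁.symm m) ∈ (B.core hB h').source ∧
      B.core hB h' (e₂ (e₁.symm m)) = flip δ (A.core hA h' m) := by
    rintro m ⟨hm1, hm2⟩
    have h1 := hg (e₁.symm m) (e₁.map_target hm1) hm2
    rw [e₁.right_inv hm1] at h1
    have h2 : m ∈ coreCompl (A.core hA h') := ht ▸ hm1
    exact ⟨h1.1, h2 h1.1, h1.2.1, h1.2.2⟩
  have hn : ∀ m ∈ (e₁.symm ≫ₕ e₂).source, ‖(A.core hA h' m).2‖ < δ := fun m hm =>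
    (A.core hA h').map_source (hs m hm).1
  refine ((B.contMDiffOn_core_symm hB h').comp (contMDiffOn_flip.comp
    ((A.contMDiffOn_core hA h').mono fun m hm => (hs m hm).1) fun m hm =>
      ⟨(hs m hm).2.1, hn m hm⟩) fun m hm =>
      (invert_mem hδ (hs m hm).2.1 (hn m hm)).2).congr fun m hm => ?_
  change e₂ (e₁.symm m) = (B.core hB h').symm (flip δ (A.core hA h' m))
  rw [← (hs m hm).2.2.2, (B.core hB h').left_inv (hs m hm).2.2.1]

theorem flip_flip {δ : ℝ} {q : (Circle × Circle) × ℂ} (h0 : q.2 ≠ 0) (hδ : ‖q.2‖ < δ) :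
    flip δ (flip δ q) = q := Prod.ext rfl (invert_invert h0 hδ)

end Glued

/-! ### The symplectic sum. -/

section ExistsGlued

/-- The tubes lie in ‖angles‖ > 1 and the collars in ‖angles‖ < 1. Hence gluing does not affect the
boundary of either side, and the two collars are disjoint in W. The last clause provides that points
outside the collars are interior. -/
theorem exists_glued (A B : Side.{u}) :
    ∃ (W : Type u) (_ : TopologicalSpace W) (_ : ChartedSpace (EuclideanHalfSpace 4) W)
      (_ : IsManifold (𝓡∂ 4) ∞ W) (_ : T2Space W) (_ : CompactSpace W) (_ : ConnectedSpace W)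
      (Ω : DiffForm (𝓡∂ 4) W 2) (e₁ : OpenPartialHomeomorph W A.Total)
      (e₂ : OpenPartialHomeomorph W B.Total), Ω.IsSymplectic ∧ IsEnd A Ω e₁ ∧ IsEnd B Ω e₂ ∧
      (∀ w ∈ e₁.source, w ∈ e₂.source → 1 < ‖angles (e₁ w).2.val‖) ∧
      ∀ w, (w ∈ e₁.source ∧ ‖angles (e₁ w).2.val‖ < 1) ∨
        (w ∈ e₂.source ∧ ‖angles (e₂ w).2.val‖ < 1) ∨ 0 < extChartAt (𝓡∂ 4) w w 0 := by
  -- One radius has to fit into both annuli; the bound 1 keeps the tubes in the region Re y < 0.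
  set δ := min (min A.width B.width) 1
  have hA : δ ≤ A.width := (min_le_left _ _).trans (min_le_left _ _)
  have hB : δ ≤ B.width := (min_le_left _ _).trans (min_le_right _ _)
  have h' : δ ≤ 1 := min_le_right _ _
  have hδ : 0 < δ := lt_min (lt_min A.isCoord.pos B.isCoord.pos) one_pos
  obtain ⟨W, tW, e₁, e₂, hT2, hcp, hcn, ht₁, ht₂, hcov, hg⟩ := exists_tube_gluing hδ
    (A.core_target hA h') (B.core_target hB h') (A.isConnected_coreCompl hA h')
    (B.isConnected_coreCompl hB h')
  have hg' : ∀ w, w ∈ e₂.source → w ∈ e₁.source → e₂ w ∈ (B.core hB h').source ∧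
      e₁ w ∈ (A.core hA h').source ∧ A.core hA h' (e₁ w) = flip δ (B.core hB h' (e₂ w)) := by
    intro w h2 h1
    obtain ⟨k1, k2, k3⟩ := hg w h1 h2
    have h3 : e₁ w ∈ coreCompl (A.core hA h') := ht₁ ▸ e₁.map_source h1
    exact ⟨k2, k1, by rw [k3, flip_flip (h3 k1) ((A.core hA h').map_source k1)]⟩
  let 𝒞 : SmoothCover (𝓡∂ 4) sideModel sideModel W A.Total B.Total :=
    { e₁ := e₁
      e₂ := e₂
      cover := hcov
      j₁ := modelEmbedding
      j₂ := modelEmbedding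
      j₁_source := rfl
      j₂_source := rfl
      j₁_smooth := contMDiffOn_modelEmbedding
      j₂_smooth := contMDiffOn_modelEmbedding
      j₁_symm_smooth := contMDiffOn_modelEmbedding_symm
      j₂_symm_smooth := contMDiffOn_modelEmbedding_symm
      trans₁₂ := transition_smooth hA hB h' hδ ht₁ hg
      trans₂₁ := transition_smooth hB hA h' hδ ht₂ hg' }
  let cW : ChartedSpace (EuclideanHalfSpace 4) W := 𝒞.chartedSpace
  have mW : IsManifold (𝓡∂ 4) ∞ W := 𝒞.isManifold
  have s₁ : ContMDiffOn (𝓡∂ 4) sideModel ∞ e₁ e₁.source := 𝒞.e₁_smooth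
  have s₂ : ContMDiffOn (𝓡∂ 4) sideModel ∞ e₂ e₂.source := 𝒞.e₂_smooth
  have s₁' : ContMDiffOn sideModel (𝓡∂ 4) ∞ e₁.symm e₁.target := 𝒞.e₁_symm_smooth
  have s₂' : ContMDiffOn sideModel (𝓡∂ 4) ∞ e₂.symm e₂.target := 𝒞.e₂_symm_smooth
  have c₁ : ∀ w ∈ e₁.source, ∀ w' : W, extChartAt (𝓡∂ 4) w w' 0 = (chartAt (ModelProd
      (EuclideanSpace ℝ (Fin 1)) (EuclideanHalfSpace 1)) (e₁ w).2 (e₁ w').2).2.val 0 := by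
    intro w hw w'
    have h := congrArg (fun c : OpenPartialHomeomorph W (EuclideanHalfSpace 4) => (c w').val 0)
      (𝒞.chartAt_of_mem hw)
    exact h
  have c₂ : ∀ w ∉ e₁.source, ∀ w' : W, extChartAt (𝓡∂ 4) w w' 0 = (chartAt (ModelProd
      (EuclideanSpace ℝ (Fin 1)) (EuclideanHalfSpace 1)) (e₂ w).2 (e₂ w').2).2.val 0 := by
    intro w hw w'
    have h := congrArg (fun c : OpenPartialHomeomorph W (EuclideanHalfSpace 4) => (c w').val 0)
      (𝒞.chartAt_of_notMem hw)
    exact h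
  classical
  -- The case distinction is harmless: on the overlap the two pull-backs agree, so each formula
  -- holds on the whole of its piece.
  set Ω : DiffForm (𝓡∂ 4) W 2 := fun w => if w ∈ e₁.source then A.omega.pullback (𝓡∂ 4) e₁ w
    else B.omega.pullback (𝓡∂ 4) e₂ w with hΩ
  have o₁ : ∀ w ∈ e₁.source, Ω w = A.omega.pullback (𝓡∂ 4) e₁ w := fun w hw => if_pos hw
  have o₂ : ∀ w ∈ e₂.source, Ω w = B.omega.pullback (𝓡∂ 4) e₂ w := by
    intro w hw
    by_cases hw1 : w ∈ e₁.source
    · rw [o₁ w hw1]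
      exact pullback_eq_of_flip hA hB h' s₁ s₂ ht₁ hg hw1 hw
    · exact if_neg hw1
  have hsc : Ω.IsSmoothClosed := DiffForm.isSmoothClosed_of_locallyInduced fun w => by
    rcases hcov w with hw | hw
    · exact A.isSmoothClosed_omega.locallyInduced_of_eq_pullback e₁.open_source s₁ o₁ hw
    · exact B.isSmoothClosed_omega.locallyInduced_of_eq_pullback e₂.open_source s₂ o₂ hw
  have f₁ : ∀ w ∈ e₁.source, w ∈ e₂.source → 1 < ‖angles (e₁ w).2.val‖ := fun w h1 h2 =>
    A.one_lt_of_mem_core hA h' (hg w h1 h2).1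
  have f₂ : ∀ w ∈ e₂.source, ‖angles (e₂ w).2.val‖ ≤ 1 → w ∉ e₁.source := fun w h2 hn h1 =>
    absurd (B.one_lt_of_mem_core hB h' (hg w h1 h2).2.1) (not_lt.2 hn)
  refine ⟨W, tW, cW, mW, hT2, hcp, hcn, Ω, e₁, e₂, ⟨hsc.smooth, hsc.closed, ?_⟩,
    ⟨s₁, s₁', ?_, o₁, ?_⟩, ⟨s₂, s₂', ?_, o₂, ?_⟩, f₁, ?_⟩
  · intro w v hv
    rcases hcov w with hw | hw
    · exact nondegenerate_pullback s₁ s₁' hw v (by rw [← o₁ w hw]; exact hv)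
    · exact nondegenerate_pullback s₂ s₂' hw v (by rw [← o₂ w hw]; exact hv)
  · intro m hm
    rw [ht₁]
    exact fun h => absurd (A.one_lt_of_mem_core hA h' h) (not_lt.2 hm.le)
  · intro w hw hn w'
    rw [c₁ w hw, TorusPiece.chartAt_snd_of_lt hn]
  · intro m hm
    rw [ht₂]
    exact fun h => absurd (B.one_lt_of_mem_core hB h' h) (not_lt.2 hm.le)
  · intro w hw hn w'
    rw [c₂ w (f₂ w hw hn.le), TorusPiece.chartAt_snd_of_lt hn]
  · intro w
    by_cases hw : w ∈ e₁.source
    · rcases lt_or_ge ‖angles (e₁ w).2.val‖ 1 with h | h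
      · exact Or.inl ⟨hw, h⟩
      · exact Or.inr (Or.inr (by rw [c₁ w hw]; exact TorusPiece.chartAt_snd_pos h _))
    · rcases lt_or_ge ‖angles (e₂ w).2.val‖ 1 with h | h
      · exact Or.inr (Or.inl ⟨(hcov w).resolve_left hw, h⟩)
      · exact Or.inr (Or.inr (by rw [c₂ w hw]; exact TorusPiece.chartAt_snd_pos h _))

end ExistsGlued

/-! ### The form and the outward direction at the boundary. -/

section EndForm

variable {W : Type u} [TopologicalSpace W] [ChartedSpace (EuclideanHalfSpace 4) W]
  {A : Side.{u}} {Ω : DiffForm (𝓡∂ 4) W 2} {e : OpenPartialHomeomorph W A.Total}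

theorem contDiff_normSq : ContDiff ℝ ∞ Complex.normSq := by
  have : ContDiff ℝ ∞ fun z : ℂ => z.re * z.re + z.im * z.im :=
    (Complex.reCLM.contDiff.mul Complex.reCLM.contDiff).add
      (Complex.imCLM.contDiff.mul Complex.imCLM.contDiff)
  exact this

namespace IsEnd

theorem contMDiffAt (hE : IsEnd A Ω e) {w : W} (hw : w ∈ e.source) : ContMDiffAt (𝓡∂ 4) sideModel ∞ e w :=
  hE.smooth.contMDiffAt (e.open_source.mem_nhds hw)

theorem contMDiffAt_angles (hE : IsEnd A Ω e) {w : W} (hw : w ∈ e.source) (hn : ‖angles (e w).2.val‖ < 1) :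
    ContMDiffAt (𝓡∂ 4) 𝓘(ℝ, ℂ) ∞ (fun w => angles (e w).2.val) w :=
  (contMDiffAt_side_angles hn).comp w (hE.contMDiffAt hw)

theorem form_of_lt (hE : IsEnd A Ω e) {w : W} (hw : w ∈ e.source) (hn : ‖angles (e w).2.val‖ < 1) :
    Ω w = A.form.pullback (𝓡∂ 4) (fun w => (e w).1) w + (1 / 2 : ℝ) •
      wedge (mvfderiv (𝓡∂ 4) (fun w => Complex.normSq (angles (e w).2.val)) w)
        (ang (𝓡∂ 4) (fun w => angles (e w).2.val) w) := by
  have hd := (hE.contMDiffAt hw).mdifferentiableAt (by simp)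
  have hL := (contMDiffAt_side_angles hn).mdifferentiableAt (by simp)
  have hN : MDifferentiableAt sideModel 𝓘(ℝ, ℝ)
      (fun m : A.Total => Complex.normSq (angles m.2.val)) (e w) := by
    exact (contDiff_normSq.contMDiff.contMDiffAt.comp (e w) (contMDiffAt_side_angles hn)).mdifferentiableAt
      (by simp)
  rw [hE.form_eq w hw, mvfderiv_comp' hN hd, ang_comp hL hd]
  rw [show (fun w => (e w).1) = Prod.fst ∘ e from rfl,
    DiffForm.pullback_comp A.form (mdifferentiableAt_fst (I := 𝓡 2)) hd]
  exact congrArg (fun η => ContinuousAlternatingMap.compContinuousLinearMap η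
    (mfderiv (𝓡∂ 4) sideModel e w)) (sideForm_of_lt hn)

/-- In the chart ‖angles‖² is (x₀ + 1/2)², whose differential at x₀ = 0 is exactly dx₀, and dx₀ is
negative on outward vectors. -/
theorem mvfderiv_normSq_neg (hE : IsEnd A Ω e) [IsManifold (𝓡∂ 4) ∞ W] {w : W}
    (hw : w ∈ e.source) (hn : ‖angles (e w).2.val‖ = 1 / 2) {n : TangentSpace (𝓡∂ 4) w} (hout : IsOutward n) :
    mvfderiv (𝓡∂ 4) (fun w => Complex.normSq (angles (e w).2.val)) w n < 0 := by
  have hc : MDifferentiableAt (𝓡∂ 4) 𝓘(ℝ, EuclideanSpace ℝ (Fin 4)) (extChartAt (𝓡∂ 4) w) w :=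
    mdifferentiableAt_extChartAt (mem_chart_source _ w)
  have h1 : (fun w => Complex.normSq (angles (e w).2.val)) =
      fun w' => (extChartAt (𝓡∂ 4) w w' 0 + 1 / 2) ^ 2 := by
    funext w'
    rw [hE.coord_of_lt w hw (by linarith) w', sub_add_cancel, Complex.normSq_eq_norm_sq]
  have h2 : extChartAt (𝓡∂ 4) w w 0 = 0 := by
    rw [hE.coord_of_lt w hw (by linarith) w]; linarith
  have hf : HasFDerivAt (fun y : EuclideanSpace ℝ (Fin 4) => (y 0 + 1 / 2) ^ 2)
      (EuclideanSpace.proj (𝕜 := ℝ) (0 : Fin 4)) (extChartAt (𝓡∂ 4) w w) := by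
    have h := (((EuclideanSpace.proj (𝕜 := ℝ) (0 : Fin 4)).hasFDerivAt
      (x := extChartAt (𝓡∂ 4) w w)).add_const (1 / 2 : ℝ)).pow 2
    rw [PiLp.proj_apply, h2] at h
    simpa using h
  rw [h1, mvfderiv_comp_of_hasFDerivAt (f := fun y : EuclideanSpace ℝ (Fin 4) => (y 0 + 1 / 2) ^ 2)
    hf hc]
  exact hout

end IsEnd

/-- This is σ ∧ σ = 0 on a plane. Each value of σ is a 2 × 2 determinant times a constant, and the
identity is the Plücker relation. -/
theorem plucker_dim_two {a b c d : EuclideanSpace ℝ (Fin 2)}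
    (σ : EuclideanSpace ℝ (Fin 2) [⋀^Fin 2]→L[ℝ] ℝ) :
    σ ![a, b] * σ ![c, d] - σ ![a, c] * σ ![b, d] + σ ![a, d] * σ ![b, c] = 0 := by
  have h : ∀ u v : EuclideanSpace ℝ (Fin 2), σ ![u, v] =
      (u 0 * v 1 - u 1 * v 0) * σ (EuclideanSpace.basisFun (Fin 2) ℝ).toBasis := by
    intro u v
    have h1 := congrArg (fun f => f ![u, v])
      (σ.toAlternatingMap.eq_smul_basis_det (EuclideanSpace.basisFun (Fin 2) ℝ).toBasis)
    refine h1.trans ?_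
    simp [Module.Basis.det_apply, Matrix.det_fin_two, Module.Basis.toMatrix_apply]
    ring
  simp only [h]
  ring

/-- For β = α + ½ N ∧ θ with α ∧ α = 0 one has β ∧ β = N ∧ θ ∧ α. If a, b, c lie in the kernel of N,
only the terms containing N n remain. -/
theorem wedgeSelf_of_collar {Z : Type*} {α : Z → Z → ℝ} {N θ : Z → ℝ} {n a b c : Z}
    (hα : α n a * α b c - α n b * α a c + α n c * α a b = 0) (ha : N a = 0) (hb : N b = 0)
    (hc : N c = 0) (β : Z → Z → ℝ)
    (hβ : ∀ x y, β x y = α x y + 1 / 2 * (N x * θ y - N y * θ x)) :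
    2 * (β n a * β b c - β n b * β a c + β n c * β a b) =
      N n * (θ a * α b c - θ b * α a c + θ c * α a b) := by
  simp only [hβ, ha, hb, hc]
  linear_combination 2 * hα

end EndForm

/-! ### Boundary components parametrized by trivial fibrations. -/

section EndMap

/-- An involution of the circle which multiplies the angular form by `s`. -/
structure IsReflection (r : Circle → Circle) (s : ℝ) : Prop where
  smooth : ContMDiff (𝓡 1) (𝓡 1) ∞ r
  involutive : Function.Involutive r
  ang_eq : ∀ z, ang (𝓡 1) (fun z => (r z : ℂ)) z = s • ang (𝓡 1) (fun z : Circle => (z : ℂ)) z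

theorem isReflection_id : IsReflection id 1 where
  smooth := contMDiff_id
  involutive _ := rfl
  ang_eq _ := (one_smul ℝ _).symm

theorem isReflection_inv : IsReflection (fun z => z⁻¹) (-1) where
  smooth := contMDiff_inv (𝓡 1) ∞
  involutive := inv_inv
  ang_eq z := by
    have h : (fun z : Circle => ((z⁻¹ : Circle) : ℂ)) =
        fun z : Circle => (starRingEnd ℂ) (z : ℂ) := by
      funext z; rw [Circle.coe_inv_eq_conj]
    rw [h, ang_conj (contMDiff_circle_coe.mdifferentiableAt (by simp))]
    exact (neg_one_smul ℝ _).symm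

variable {W : Type u} [TopologicalSpace W] [ChartedSpace (EuclideanHalfSpace 4) W]
  {A : Side.{u}} {Ω : DiffForm (𝓡∂ 4) W 2} {e : OpenPartialHomeomorph W A.Total}
  {V : SymplecticFibration.{u}}
  (Φ : Diffeomorph ((𝓡 2).prod (𝓡 1)) (𝓡 3) (A.surface × Circle) V ∞) (r : Circle → Circle)

/-- The boundary component parametrized by a trivial fibration. -/
def endMap (x : V) : A.Total := ((Φ.symm x).1, TorusPiece.boundaryPt (r (Φ.symm x).2))

/-- A left inverse of `endMap`. -/
def endInv (m : A.Total) : V := Φ (m.1, r (direction (angles m.2.val)))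

variable {Φ r} {s : ℝ}

theorem norm_angles_endMap (x : V) : ‖angles (endMap Φ r x).2.val‖ = 1 / 2 :=
  TorusPiece.norm_angles_boundaryPt _

theorem endInv_endMap (hr : IsReflection r s) (x : V) : endInv Φ r (endMap Φ r x) = x := by
  simp only [endInv, endMap]
  rw [TorusPiece.direction_boundaryPt, hr.involutive]
  exact Φ.apply_symm_apply x

theorem endMap_endInv (hr : IsReflection r s) {m : A.Total} (hm : ‖angles m.2.val‖ = 1 / 2) :
    endMap Φ r (endInv Φ r m) = m := by
  simp only [endInv, endMap]
  rw [Φ.symm_apply_apply, hr.involutive, TorusPiece.boundaryPt_direction hm]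

theorem contMDiff_endMap (hr : IsReflection r s) : ContMDiff (𝓡 3) sideModel ∞ (endMap Φ r) :=
  (contMDiff_fst.comp Φ.symm.contMDiff).prodMk (TorusPiece.contMDiff_boundaryPt.comp
    (hr.smooth.comp (contMDiff_snd.comp Φ.symm.contMDiff)))

theorem contMDiffAt_endInv (hr : IsReflection r s) {m : A.Total} (hm : ‖angles m.2.val‖ < 1) :
    ContMDiffAt sideModel (𝓡 3) ∞ (endInv Φ r) m := by
  have h1 := (contMDiffOn_direction.contMDiffAt (isOpen_ne.mem_nhds
    (TorusPiece.angles_ne_zero m.2))).comp m (contMDiffAt_side_angles hm)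
  have h2 : ContMDiffAt sideModel (𝓡 2) ∞ (fun m : A.Total => m.1) m := contMDiffAt_fst
  exact Φ.contMDiff.contMDiffAt.comp m (h2.prodMk (hr.smooth.contMDiffAt.comp m h1))

/-- The inclusion of the boundary component. -/
def endIncl (e : OpenPartialHomeomorph W A.Total)
    (Φ : Diffeomorph ((𝓡 2).prod (𝓡 1)) (𝓡 3) (A.surface × Circle) V ∞) (r : Circle → Circle)
    (x : V) : W := e.symm (endMap Φ r x)

namespace IsEnd

theorem endMap_mem (hE : IsEnd A Ω e) (x : V) : endMap Φ r x ∈ e.target :=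
  hE.collar_subset _ (by rw [norm_angles_endMap]; norm_num)

theorem endIncl_mem (hE : IsEnd A Ω e) (x : V) : endIncl e Φ r x ∈ e.source :=
  e.map_target (hE.endMap_mem x)

theorem apply_endIncl (hE : IsEnd A Ω e) (x : V) : e (endIncl e Φ r x) = endMap Φ r x :=
  e.right_inv (hE.endMap_mem x)

theorem norm_angles_endIncl (hE : IsEnd A Ω e) (x : V) :
    ‖angles (e (endIncl e Φ r x)).2.val‖ = 1 / 2 := by
  rw [hE.apply_endIncl, norm_angles_endMap]

theorem contMDiff_endIncl (hE : IsEnd A Ω e) (hr : IsReflection r s) :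
    ContMDiff (𝓡 3) (𝓡∂ 4) ∞ (endIncl e Φ r) := by
  rw [← contMDiffOn_univ]
  exact hE.symm_smooth.comp (contMDiff_endMap hr).contMDiffOn fun x _ => hE.endMap_mem x

theorem endInv_endIncl (hE : IsEnd A Ω e) (hr : IsReflection r s) (x : V) :
    endInv Φ r (e (endIncl e Φ r x)) = x := by rw [hE.apply_endIncl, endInv_endMap hr]

theorem injective_endIncl (hE : IsEnd A Ω e) (hr : IsReflection r s) :
    Function.Injective (endIncl e Φ r) :=
  Function.LeftInverse.injective (g := fun w => endInv Φ r (e w)) (hE.endInv_endIncl hr)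

theorem injective_mfderiv_endIncl (hE : IsEnd A Ω e) (hr : IsReflection r s) (x : V) :
    Function.Injective (mfderiv (𝓡 3) (𝓡∂ 4) (endIncl e Φ r) x) := by
  have hm : ‖angles (e (endIncl e Φ r x)).2.val‖ < 1 := by
    rw [hE.norm_angles_endIncl]; norm_num
  refine injective_mfderiv_of_leftInverse (s := univ) (g := fun w => endInv Φ r (e w))
    ((hE.contMDiff_endIncl hr).mdifferentiableAt (by simp)) ?_ (by simp)
    (Filter.Eventually.of_forall (hE.endInv_endIncl hr))
  exact (((contMDiffAt_endInv hr hm).comp (endIncl e Φ r x)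
    (hE.contMDiffAt (hE.endIncl_mem x))).mdifferentiableAt (by simp)).mdifferentiableWithinAt

theorem range_endIncl (hE : IsEnd A Ω e) (hr : IsReflection r s) :
    range (endIncl e Φ r) = {w | w ∈ e.source ∧ ‖angles (e w).2.val‖ = 1 / 2} := by
  ext w
  constructor
  · rintro ⟨x, rfl⟩
    exact ⟨hE.endIncl_mem x, hE.norm_angles_endIncl x⟩
  · rintro ⟨hw, hn⟩
    refine ⟨endInv Φ r (e w), ?_⟩
    rw [endIncl, endMap_endInv hr hn, e.left_inv hw]

theorem mvfderiv_normSq_endIncl (hE : IsEnd A Ω e) (hr : IsReflection r s) (x : V)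
    (v : TangentSpace (𝓡 3) x) :
    mvfderiv (𝓡∂ 4) (fun w => Complex.normSq (angles (e w).2.val)) (endIncl e Φ r x)
      (mfderiv (𝓡 3) (𝓡∂ 4) (endIncl e Φ r) x v) = 0 := by
  have hm : ‖angles (e (endIncl e Φ r x)).2.val‖ < 1 := by
    rw [hE.norm_angles_endIncl]; norm_num
  have hN : MDifferentiableAt (𝓡∂ 4) 𝓘(ℝ, ℝ) (fun w => Complex.normSq (angles (e w).2.val))
      (endIncl e Φ r x) :=
    (contDiff_normSq.contMDiff.contMDiffAt.comp _
      (hE.contMDiffAt_angles (hE.endIncl_mem x) hm)).mdifferentiableAt (by simp)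
  have h := mvfderiv_comp' (f := endIncl e Φ r) hN
    ((hE.contMDiff_endIncl hr).mdifferentiableAt (by simp))
  have h1 : (fun x => Complex.normSq (angles (e (endIncl e Φ r x)).2.val)) = fun _ => 1 / 4 := by
    funext x
    rw [Complex.normSq_eq_norm_sq, hE.norm_angles_endIncl]; norm_num
  rw [h1] at h
  have h2 : mvfderiv (𝓡 3) (fun _ : V => (1 / 4 : ℝ)) x = 0 := mvfderiv_const _
  rw [h2] at h
  exact (congrArg (fun L => L v) h).symm

/-- On the boundary, `angles` is half of the projection to the circle after the reflection. The
angular form does not see the factor 1/2, and the reflection contributes s. -/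
theorem ang_angles_endIncl (hE : IsEnd A Ω e) (hr : IsReflection r s)
    (hproj : ∀ p, V.proj (Φ p) = p.2) (x : V) (v : TangentSpace (𝓡 3) x) :
    ang (𝓡∂ 4) (fun w => angles (e w).2.val) (endIncl e Φ r x)
      (mfderiv (𝓡 3) (𝓡∂ 4) (endIncl e Φ r) x v) =
      s * ang (𝓡 3) (fun x => (V.proj x : ℂ)) x v := by
  have hm : ‖angles (e (endIncl e Φ r x)).2.val‖ < 1 := by
    rw [hE.norm_angles_endIncl]; norm_num
  have hp : V.proj = fun x => (Φ.symm x).2 := by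
    funext x; rw [← hproj, Φ.apply_symm_apply]
  have hps : MDifferentiableAt (𝓡 3) (𝓡 1) V.proj x := by
    have : ContMDiff (𝓡 3) (𝓡 1) ∞ V.proj := by
      rw [hp]; exact contMDiff_snd.comp Φ.symm.contMDiff
    exact this.mdifferentiableAt (by simp)
  have hrs : MDifferentiableAt (𝓡 1) 𝓘(ℝ, ℂ) (fun z => (r z : ℂ)) (V.proj x) :=
    (contMDiff_circle_coe.comp hr.smooth).mdifferentiableAt (by simp)
  have h := ang_comp (f := endIncl e Φ r)
    ((hE.contMDiffAt_angles (hE.endIncl_mem x) hm).mdifferentiableAt (by simp))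
    ((hE.contMDiff_endIncl hr).mdifferentiableAt (by simp))
  have h1 : (fun x => angles (e (endIncl e Φ r x)).2.val) =
      fun x => ((1 / 2 : ℝ) : ℂ) * (r (V.proj x) : ℂ) := by
    funext x
    rw [hE.apply_endIncl, hp]
    exact TorusPiece.angles_boundaryPt _
  rw [h1, ang_ofReal_mul (r := fun _ => 1 / 2) (w := fun x => (r (V.proj x) : ℂ))
    mdifferentiableAt_const (hrs.comp x hps) (by norm_num) (Circle.coe_ne_zero _),
    ang_comp (f := V.proj) hrs hps, hr.ang_eq] at h
  rw [ang_comp (f := V.proj) (contMDiff_circle_coe.mdifferentiableAt (by simp)) hps]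
  exact (congrArg (fun L => L v) h).symm

theorem pullback_fst_endIncl (hE : IsEnd A Ω e) (hr : IsReflection r s)
    (hform : V.form.pullback ((𝓡 2).prod (𝓡 1)) Φ = A.form.pullback ((𝓡 2).prod (𝓡 1)) Prod.fst) :
    (A.form.pullback (𝓡∂ 4) fun w => (e w).1).pullback (𝓡 3) (endIncl e Φ r) = V.form := by
  funext x
  have hd : MDifferentiableAt (𝓡∂ 4) (𝓡 2) (fun w => (e w).1) (endIncl e Φ r x) :=
    (contMDiffAt_fst.comp _ (hE.contMDiffAt (hE.endIncl_mem x))).mdifferentiableAt (by simp)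
  have hs := Φ.symm.contMDiff.mdifferentiableAt (x := x) (by simp)
  rw [← DiffForm.pullback_comp A.form hd ((hE.contMDiff_endIncl hr).mdifferentiableAt (by simp))]
  have h1 : (fun w => (e w).1) ∘ endIncl e Φ r = Prod.fst ∘ Φ.symm := by
    funext x
    exact congrArg Prod.fst (hE.apply_endIncl x)
  rw [h1, DiffForm.pullback_comp A.form mdifferentiableAt_fst hs, ← hform,
    ← DiffForm.pullback_comp V.form (Φ.contMDiff.mdifferentiableAt (by simp)) hs]
  have h2 : Φ ∘ Φ.symm = id := funext Φ.apply_symm_apply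
  rw [h2]
  ext v
  rw [DiffForm.pullback, mfderiv_id]
  rfl

/-- The function ‖angles‖² is constant on the boundary, so in the collar formula only the pull-back
of the area form survives the restriction. -/
theorem form_endIncl (hE : IsEnd A Ω e) (hr : IsReflection r s)
    (hform : V.form.pullback ((𝓡 2).prod (𝓡 1)) Φ = A.form.pullback ((𝓡 2).prod (𝓡 1)) Prod.fst) :
    Ω.pullback (𝓡 3) (endIncl e Φ r) = V.form := by
  rw [← hE.pullback_fst_endIncl hr hform]
  funext x
  ext v
  have hm : ‖angles (e (endIncl e Φ r x)).2.val‖ < 1 := by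
    rw [hE.norm_angles_endIncl]; norm_num
  have h := congrArg (fun η => η fun i => mfderiv (𝓡 3) (𝓡∂ 4) (endIncl e Φ r) x (v i))
    (hE.form_of_lt (hE.endIncl_mem x) hm)
  refine h.trans ?_
  have h1 := wedge_apply (mvfderiv (𝓡∂ 4) (fun w => Complex.normSq (angles (e w).2.val))
    (endIncl e Φ r x)) (ang (𝓡∂ 4) (fun w => angles (e w).2.val) (endIncl e Φ r x))
    (fun i => mfderiv (𝓡 3) (𝓡∂ 4) (endIncl e Φ r) x (v i))
  rw [hE.mvfderiv_normSq_endIncl hr, hE.mvfderiv_normSq_endIncl hr, zero_mul, zero_mul,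
    sub_zero] at h1
  refine (congrArg (fun t => (A.form.pullback (𝓡∂ 4) (fun w => (e w).1) (endIncl e Φ r x))
    (fun i => mfderiv (𝓡 3) (𝓡∂ 4) (endIncl e Φ r) x (v i)) + (1 / 2 : ℝ) * t) h1).trans ?_
  rw [mul_zero, add_zero]
  rfl

end IsEnd

variable (V) in
/-- The exterior product of the angular form of the projection with the form of the fibration. -/
def fibreVolume (x : V) (v : Fin 3 → TangentSpace (𝓡 3) x) : ℝ :=
  ang (𝓡 3) (fun x => (V.proj x : ℂ)) x (v 0) * V.form x ![v 1, v 2] -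
    ang (𝓡 3) (fun x => (V.proj x : ℂ)) x (v 1) * V.form x ![v 0, v 2] +
    ang (𝓡 3) (fun x => (V.proj x : ℂ)) x (v 2) * V.form x ![v 0, v 1]

theorem IsEnd.wedgeSelf_endIncl (hE : IsEnd A Ω e) (hr : IsReflection r s)
    (hproj : ∀ p, V.proj (Φ p) = p.2)
    (hform : V.form.pullback ((𝓡 2).prod (𝓡 1)) Φ = A.form.pullback ((𝓡 2).prod (𝓡 1)) Prod.fst)
    (x : V) (n : TangentSpace (𝓡∂ 4) (endIncl e Φ r x)) (v : Fin 3 → TangentSpace (𝓡 3) x) :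
    Ω.wedgeSelf (endIncl e Φ r x) n (mfderiv (𝓡 3) (𝓡∂ 4) (endIncl e Φ r) x (v 0))
      (mfderiv (𝓡 3) (𝓡∂ 4) (endIncl e Φ r) x (v 1))
      (mfderiv (𝓡 3) (𝓡∂ 4) (endIncl e Φ r) x (v 2)) =
    mvfderiv (𝓡∂ 4) (fun w => Complex.normSq (angles (e w).2.val)) (endIncl e Φ r x) n *
      (s * fibreVolume V x v) := by
  have hm : ‖angles (e (endIncl e Φ r x)).2.val‖ < 1 := by
    rw [hE.norm_angles_endIncl]; norm_num
  set α : TangentSpace (𝓡∂ 4) (endIncl e Φ r x) → TangentSpace (𝓡∂ 4) (endIncl e Φ r x) → ℝ :=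
    fun p q => A.form.pullback (𝓡∂ 4) (fun w => (e w).1) (endIncl e Φ r x) ![p, q] with hα
  have hαV : ∀ p q, α (mfderiv (𝓡 3) (𝓡∂ 4) (endIncl e Φ r) x p)
      (mfderiv (𝓡 3) (𝓡∂ 4) (endIncl e Φ r) x q) = V.form x ![p, q] := by
    intro p q
    rw [← hE.pullback_fst_endIncl hr hform]
    change A.form.pullback (𝓡∂ 4) (fun w => (e w).1) (endIncl e Φ r x) _ =
      A.form.pullback (𝓡∂ 4) (fun w => (e w).1) (endIncl e Φ r x) _
    congr 1
    funext i; fin_cases i <;> rfl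
  have hαd : ∀ p q, α p q = A.form (e (endIncl e Φ r x)).1
      ![mfderiv (𝓡∂ 4) (𝓡 2) (fun w => (e w).1) (endIncl e Φ r x) p,
        mfderiv (𝓡∂ 4) (𝓡 2) (fun w => (e w).1) (endIncl e Φ r x) q] := by
    intro p q
    change A.form (e (endIncl e Φ r x)).1 _ = A.form (e (endIncl e Φ r x)).1 _
    congr 1
    funext i; fin_cases i <;> rfl
  have h := wedgeSelf_of_collar (α := α)
    (N := mvfderiv (𝓡∂ 4) (fun w => Complex.normSq (angles (e w).2.val)) (endIncl e Φ r x))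
    (θ := ang (𝓡∂ 4) (fun w => angles (e w).2.val) (endIncl e Φ r x)) (n := n)
    (by simp only [hαd]; exact plucker_dim_two _) (hE.mvfderiv_normSq_endIncl hr x (v 0))
    (hE.mvfderiv_normSq_endIncl hr x (v 1)) (hE.mvfderiv_normSq_endIncl hr x (v 2))
    (fun p q => Ω (endIncl e Φ r x) ![p, q]) (fun p q => by
      refine (congrArg (fun η => η ![p, q]) (hE.form_of_lt (hE.endIncl_mem x) hm)).trans ?_
      exact congrArg (fun t => α p q + 1 / 2 * t) (wedge_apply _ _ _))
  refine h.trans ?_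
  simp only [hαV, hE.ang_angles_endIncl hr hproj, fibreVolume]
  ring

/-- Along the boundary Ω ∧ Ω is d‖angles‖² ∧ s·dθ ∧ ω, and d‖angles‖² is negative on outward
vectors. The inclusion therefore reverses an orientation on which s·dθ ∧ ω is positive and preserves
one on which it is negative. -/
theorem IsEnd.orientation_endIncl [IsManifold (𝓡∂ 4) ∞ W] (hE : IsEnd A Ω e)
    (hr : IsReflection r s) (hproj : ∀ p, V.proj (Φ p) = p.2)
    (hform : V.form.pullback ((𝓡 2).prod (𝓡 1)) Φ = A.form.pullback ((𝓡 2).prod (𝓡 1)) Prod.fst) :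
    ((∀ x v, 0 < V.vol x v → 0 < s * fibreVolume V x v) →
      ReversesOrientation Ω V (endIncl e Φ r)) ∧
    ((∀ x v, 0 < V.vol x v → s * fibreVolume V x v < 0) →
      PreservesOrientation Ω V (endIncl e Φ r)) := by
  constructor <;> intro hs x n v hn hv <;> rw [hE.wedgeSelf_endIncl hr hproj hform] <;>
    have h1 := hE.mvfderiv_normSq_neg (hE.endIncl_mem x) (hE.norm_angles_endIncl x) hn
  · exact mul_neg_of_neg_of_pos h1 (hs x v hv)
  · exact mul_pos_of_neg_of_neg h1 (hs x v hv)

end EndMap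

/-! ### Orientations of trivial fibrations. -/

section Sign

/-- Both forms are multiples of the determinant of one basis. -/
theorem alternating_mul_comm {Z : Type*} [AddCommGroup Z] [Module ℝ Z]
    (hZ : Module.finrank ℝ Z = 3) (f g : Z [⋀^Fin 3]→ₗ[ℝ] ℝ) (u v : Fin 3 → Z) :
    f u * g v = f v * g u := by
  have : FiniteDimensional ℝ Z := Module.finite_of_finrank_pos (by omega)
  let b := Module.finBasisOfFinrankEq ℝ Z hZ
  rw [f.eq_smul_basis_det b, g.eq_smul_basis_det b]
  simp only [AlternatingMap.smul_apply, smul_eq_mul]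
  ring

/-- The exterior product of a linear form and an alternating `2`-form. -/
def wedgeThree {Z : Type*} [AddCommGroup Z] [Module ℝ Z] (a : Z →ₗ[ℝ] ℝ) (b : Z [⋀^Fin 2]→ₗ[ℝ] ℝ) :
    Z [⋀^Fin 3]→ₗ[ℝ] ℝ := AlternatingMap.alternatizeUncurryFin (a.smulRight b)

theorem wedgeThree_apply {Z : Type*} [AddCommGroup Z] [Module ℝ Z] (a : Z →ₗ[ℝ] ℝ)
    (b : Z [⋀^Fin 2]→ₗ[ℝ] ℝ) (v : Fin 3 → Z) :
    wedgeThree a b v = a (v 0) * b ![v 1, v 2] - a (v 1) * b ![v 0, v 2] +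
      a (v 2) * b ![v 0, v 1] := by
  have h0 : Fin.removeNth 0 v = ![v 1, v 2] := by funext i; fin_cases i <;> rfl
  have h1 : Fin.removeNth 1 v = ![v 0, v 2] := by funext i; fin_cases i <;> rfl
  have h2 : Fin.removeNth 2 v = ![v 0, v 1] := by funext i; fin_cases i <;> rfl
  rw [wedgeThree, AlternatingMap.alternatizeUncurryFin_apply, Fin.sum_univ_three, h0, h1, h2]
  simp
  ring

variable {V : SymplecticFibration.{u}}

theorem fibreVolume_eq (x : V) (v : Fin 3 → TangentSpace (𝓡 3) x) :
    fibreVolume V x v = wedgeThree (ang (𝓡 3) (fun x => (V.proj x : ℂ)) x).toLinearMap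
      (V.form x).toAlternatingMap v := by
  rw [wedgeThree_apply]
  rfl

theorem vol_mul_fibreVolume (x : V) (u v : Fin 3 → TangentSpace (𝓡 3) x) :
    V.vol x u * fibreVolume V x v = V.vol x v * fibreVolume V x u := by
  rw [fibreVolume_eq, fibreVolume_eq]
  refine alternating_mul_comm ?_ (V.vol x).toAlternatingMap _ u v
  change Module.finrank ℝ (EuclideanSpace ℝ (Fin 3)) = 3
  simp

/-- In the product structure, evaluate on one vector along the circle and two along the surface.
Only the product of dθ and σ remains, and neither factor vanishes for a suitable choice. -/
theorem exists_fibreVolume_ne_zero {σ : DiffForm (𝓡 2) V.fibre 2} (hσ0 : σ.NowhereZero)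
    {Φ : Diffeomorph ((𝓡 2).prod (𝓡 1)) (𝓡 3) (V.fibre × Circle) V ∞}
    (hV : ContMDiff (𝓡 3) (𝓡 1) ∞ V.proj) (hproj : ∀ p, V.proj (Φ p) = p.2)
    (hform : V.form.pullback ((𝓡 2).prod (𝓡 1)) Φ = σ.pullback ((𝓡 2).prod (𝓡 1)) Prod.fst)
    (x : V) : ∃ v, fibreVolume V x v ≠ 0 := by
  obtain ⟨p, rfl⟩ : ∃ p, Φ p = x := ⟨Φ.symm x, Φ.apply_symm_apply x⟩
  obtain ⟨w, hw⟩ : ∃ w, σ p.1 w ≠ 0 := by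
    by_contra! h
    exact hσ0 p.1 (ContinuousAlternatingMap.ext h)
  let D : EuclideanSpace ℝ (Fin 2) × EuclideanSpace ℝ (Fin 1) →L[ℝ] TangentSpace (𝓡 3) (Φ p) :=
    mfderiv ((𝓡 2).prod (𝓡 1)) (𝓡 3) Φ p
  let t : EuclideanSpace ℝ (Fin 1) := EuclideanSpace.single 0 1
  have hang : ∀ q, ang (𝓡 3) (fun x => (V.proj x : ℂ)) (Φ p) (D q) =
      ang (𝓡 1) (fun z : Circle => (z : ℂ)) p.2 q.2 := by
    intro q
    have h1 := ang_comp (f := Φ) (((contMDiff_circle_coe.comp hV).mdifferentiableAt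
      (x := Φ p) (by simp))) (Φ.contMDiff.mdifferentiableAt (x := p) (by simp))
    have h2 : (fun p => ((V.proj (Φ p) : Circle) : ℂ)) = fun p : V.fibre × Circle => (p.2 : ℂ) := by
      funext p; rw [hproj]
    have h3 := ang_comp (x := p) (f := Prod.snd) (I := (𝓡 2).prod (𝓡 1)) (J := 𝓡 1)
      (contMDiff_circle_coe.mdifferentiableAt (by simp)) mdifferentiableAt_snd
    rw [mfderiv_snd] at h3
    have h4 : ang ((𝓡 2).prod (𝓡 1)) (fun p => ((V.proj (Φ p) : Circle) : ℂ)) p =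
      ang ((𝓡 2).prod (𝓡 1)) (fun p : V.fibre × Circle => (p.2 : ℂ)) p := by rw [h2]
    exact (congrArg (fun L => L q) (h1.symm.trans (h4.trans h3)))
  have hf : ∀ u v, V.form (Φ p) ![D u, D v] = σ p.1 ![u.1, v.1] := by
    intro u v
    have h := congrArg (fun η => η p ![u, v]) hform
    refine Eq.trans ?_ (h.trans ?_)
    · change V.form (Φ p) _ = V.form (Φ p) _
      congr 1
      funext i; fin_cases i <;> rfl
    · change σ p.1 _ = σ p.1 _
      congr 1
      rw [mfderiv_fst]
      funext i; fin_cases i <;> rfl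
  refine ⟨![D (0, t), D (w 0, 0), D (w 1, 0)], ?_⟩
  have hw2 : w = ![w 0, w 1] := by funext i; fin_cases i <;> rfl
  have h0 : ang (𝓡 1) (fun z : Circle => (z : ℂ)) p.2 0 = 0 := map_zero _
  have ht : ang (𝓡 1) (fun z : Circle => (z : ℂ)) p.2 t ≠ 0 := by
    intro h
    have h1 := injective_ang_circle p.2 (h.trans h0.symm)
    have h2 : t 0 = (0 : EuclideanSpace ℝ (Fin 1)) 0 :=
      congrArg (fun v : EuclideanSpace ℝ (Fin 1) => v 0) h1
    simp [t] at h2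
  have key : fibreVolume V (Φ p) ![D (0, t), D (w 0, 0), D (w 1, 0)] =
      ang (𝓡 3) (fun x => (V.proj x : ℂ)) (Φ p) (D (0, t)) * V.form (Φ p) ![D (w 0, 0), D (w 1, 0)] -
      ang (𝓡 3) (fun x => (V.proj x : ℂ)) (Φ p) (D (w 0, 0)) * V.form (Φ p) ![D (0, t), D (w 1, 0)] +
      ang (𝓡 3) (fun x => (V.proj x : ℂ)) (Φ p) (D (w 1, 0)) * V.form (Φ p) ![D (0, t), D (w 0, 0)] :=
    rfl
  have k1 : ang (𝓡 3) (fun x => (V.proj x : ℂ)) (Φ p) (D (w 0, 0)) = 0 := (hang _).trans h0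
  have k2 : ang (𝓡 3) (fun x => (V.proj x : ℂ)) (Φ p) (D (w 1, 0)) = 0 := (hang _).trans h0
  rw [key, k1, k2, hang, hf, zero_mul, zero_mul, sub_zero, add_zero]
  exact mul_ne_zero ht (by rwa [hw2] at hw)

/-- The derivative of the inverse of a chart. -/
def chartFrame (x₀ : V) (y : EuclideanSpace ℝ (Fin 3)) :
    EuclideanSpace ℝ (Fin 3) →L[ℝ] TangentSpace (𝓡 3) ((extChartAt (𝓡 3) x₀).symm y) :=
  mfderivWithin 𝓘(ℝ, EuclideanSpace ℝ (Fin 3)) (𝓡 3) (extChartAt (𝓡 3) x₀).symm (range (𝓡 3)) y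

theorem continuousOn_inChart_apply {k : ℕ} {η : DiffForm (𝓡 3) V k} (hη : η.IsSmooth) (x₀ : V)
    (w : Fin k → EuclideanSpace ℝ (Fin 3)) :
    ContinuousOn (fun y => η ((extChartAt (𝓡 3) x₀).symm y) fun i => chartFrame x₀ y (w i))
      (extChartAt (𝓡 3) x₀).target :=
  (ContinuousAlternatingMap.apply ℝ (EuclideanSpace ℝ (Fin 3)) ℝ w).continuous.comp_continuousOn
    (hη x₀).continuousOn

theorem continuousOn_ang_chartFrame (hV : ContMDiff (𝓡 3) (𝓡 1) ∞ V.proj) (x₀ : V)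
    (w : EuclideanSpace ℝ (Fin 3)) :
    ContinuousOn (fun y => ang (𝓡 3) (fun x => (V.proj x : ℂ)) ((extChartAt (𝓡 3) x₀).symm y)
      (chartFrame x₀ y w)) (extChartAt (𝓡 3) x₀).target := by
  set T := (extChartAt (𝓡 3) x₀).target with hT
  have hTo : IsOpen T := isOpen_extChartAt_target x₀
  set f : EuclideanSpace ℝ (Fin 3) → ℂ := fun y => (V.proj ((extChartAt (𝓡 3) x₀).symm y) : ℂ)
  have hs : ContMDiffOn 𝓘(ℝ, EuclideanSpace ℝ (Fin 3)) (𝓡 3) ∞ (extChartAt (𝓡 3) x₀).symm T :=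
    contMDiffOn_extChartAt_symm x₀
  have hf : ContDiffOn ℝ ∞ f T :=
    contMDiffOn_iff_contDiffOn.1 ((contMDiff_circle_coe.comp hV).comp_contMDiffOn hs)
  have h1 : ContinuousOn (fun y => ((f y)⁻¹ * fderiv ℝ f y w).im) T := by
    refine Complex.continuous_im.comp_continuousOn ((hf.continuousOn.inv₀
      fun y _ => Circle.coe_ne_zero _).mul ?_)
    exact (hf.continuousOn_fderiv_of_isOpen hTo (by simp)).clm_apply continuousOn_const
  refine h1.congr fun y hy => ?_
  have h2 := ang_comp (x := y) (f := (extChartAt (𝓡 3) x₀).symm)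
    ((contMDiff_circle_coe.comp hV).mdifferentiableAt (by simp))
    ((hs.contMDiffAt (hTo.mem_nhds hy)).mdifferentiableAt (by simp))
  have h3 : chartFrame x₀ y =
      mfderiv 𝓘(ℝ, EuclideanSpace ℝ (Fin 3)) (𝓡 3) (extChartAt (𝓡 3) x₀).symm y := by
    rw [chartFrame, (𝓡 3).range_eq_univ, mfderivWithin_univ]
  rw [h3]
  refine (congrArg (fun L => L w) h2).symm.trans ?_
  have h4 : mvfderiv 𝓘(ℝ, EuclideanSpace ℝ (Fin 3)) f y w = fderiv ℝ f y w :=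
    congrArg (fun L : EuclideanSpace ℝ (Fin 3) →L[ℝ] ℂ => L w)
      (mfderiv_eq_fderiv (𝕜 := ℝ) (f := f) (x := y))
  exact congrArg (fun z => ((f y)⁻¹ * z).im) h4

theorem continuousOn_fibreVolume (hV : ContMDiff (𝓡 3) (𝓡 1) ∞ V.proj) (x₀ : V)
    (w : Fin 3 → EuclideanSpace ℝ (Fin 3)) :
    ContinuousOn (fun y => fibreVolume V ((extChartAt (𝓡 3) x₀).symm y)
      fun i => chartFrame x₀ y (w i)) (extChartAt (𝓡 3) x₀).target := by
  have h1 : ∀ i j, ContinuousOn (fun y => V.form ((extChartAt (𝓡 3) x₀).symm y)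
      ![chartFrame x₀ y (w i), chartFrame x₀ y (w j)]) (extChartAt (𝓡 3) x₀).target := by
    intro i j
    refine (continuousOn_inChart_apply V.form_smooth x₀ ![w i, w j]).congr fun y _ => ?_
    change V.form _ _ = V.form _ _
    congr 1
    funext k; fin_cases k <;> rfl
  have h2 := fun i => continuousOn_ang_chartFrame hV x₀ (w i)
  exact (((h2 0).mul (h1 1 2)).sub ((h2 1).mul (h1 0 2))).add ((h2 2).mul (h1 0 1))

/-- The vectors at x₀ are expressed through the derivative of the inverse chart and continued with
constant coordinates; the inequality then involves a continuous function of the point. -/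
theorem isOpen_sign (hV : ContMDiff (𝓡 3) (𝓡 1) ∞ V.proj) (s : ℝ) :
    IsOpen {x : V | ∃ v, 0 < s * (V.vol x v * fibreVolume V x v)} := by
  rw [isOpen_iff_mem_nhds]
  rintro x₀ ⟨v, hv⟩
  set c := extChartAt (𝓡 3) x₀ with hc
  have hs : c.symm (c x₀) = x₀ := c.left_inv (mem_extChartAt_source x₀)
  obtain ⟨w, hw⟩ : ∃ w : Fin 3 → EuclideanSpace ℝ (Fin 3),
      0 < s * (V.vol (c.symm (c x₀)) (fun i => chartFrame x₀ (c x₀) (w i)) *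
        fibreVolume V (c.symm (c x₀)) fun i => chartFrame x₀ (c x₀) (w i)) := by
    have hi : Function.Surjective (chartFrame x₀ (c x₀)) := by
      obtain ⟨L, hL⟩ := isInvertible_mfderivWithin_extChartAt_symm (I := 𝓡 3)
        (mem_extChartAt_target x₀)
      rw [chartFrame, ← hL]
      exact L.surjective
    have h2 : ∀ x : V, x = x₀ → ∃ v : Fin 3 → TangentSpace (𝓡 3) x,
        0 < s * (V.vol x v * fibreVolume V x v) := by
      rintro x rfl; exact ⟨v, hv⟩
    obtain ⟨v', hv'⟩ := h2 _ hs
    choose w hw using fun i => hi (v' i)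
    exact ⟨w, by simpa only [hw] using hv'⟩
  have hcont : ContinuousOn (fun y => s * (V.vol (c.symm y) (fun i => chartFrame x₀ y (w i)) *
      fibreVolume V (c.symm y) fun i => chartFrame x₀ y (w i))) c.target :=
    continuousOn_const.mul ((continuousOn_inChart_apply V.vol_smooth x₀ w).mul
      (continuousOn_fibreVolume hV x₀ w))
  have hev := ((hcont.continuousAt (extChartAt_target_mem_nhds x₀)).eventually
    (lt_mem_nhds hw))
  filter_upwards [(continuousAt_extChartAt (I := 𝓡 3) x₀).eventually hev,
    extChartAt_source_mem_nhds (I := 𝓡 3) x₀]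
    with x hx hxs
  have h3 : c.symm (c x) = x := c.left_inv hxs
  have h4 : ∀ x' : V, x' = x → (∃ v : Fin 3 → TangentSpace (𝓡 3) x',
      0 < s * (V.vol x' v * fibreVolume V x' v)) → ∃ v : Fin 3 → TangentSpace (𝓡 3) x,
      0 < s * (V.vol x v * fibreVolume V x v) := by
    rintro x' rfl h; exact h
  exact h4 _ h3 ⟨_, hx⟩

/-- Both `vol` and dθ ∧ ω are nowhere vanishing 3-forms, hence proportional at each point. The sign
of the factor is locally constant, and V is connected. -/
theorem sign_fibreVolume {σ : DiffForm (𝓡 2) V.fibre 2} (hσ0 : σ.NowhereZero)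
    {Φ : Diffeomorph ((𝓡 2).prod (𝓡 1)) (𝓡 3) (V.fibre × Circle) V ∞}
    (hproj : ∀ p, V.proj (Φ p) = p.2)
    (hform : V.form.pullback ((𝓡 2).prod (𝓡 1)) Φ = σ.pullback ((𝓡 2).prod (𝓡 1)) Prod.fst) :
    (∀ x v, 0 < V.vol x v → 0 < fibreVolume V x v) ∨
      (∀ x v, 0 < V.vol x v → fibreVolume V x v < 0) := by
  have hV : ContMDiff (𝓡 3) (𝓡 1) ∞ V.proj := by
    have hp : V.proj = fun x => (Φ.symm x).2 := by
      funext x; rw [← hproj, Φ.apply_symm_apply]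
    rw [hp]; exact contMDiff_snd.comp Φ.symm.contMDiff
  have hne : ∀ x v, V.vol x v ≠ 0 → fibreVolume V x v ≠ 0 := by
    intro x v hv h0
    obtain ⟨w, hw⟩ := exists_fibreVolume_ne_zero hσ0 hV hproj hform x
    have := vol_mul_fibreVolume x v w
    rw [h0, mul_zero] at this
    exact mul_ne_zero hv hw this
  have hsign : ∀ (x : V) (u v : Fin 3 → TangentSpace (𝓡 3) x) (s : ℝ), V.vol x v ≠ 0 →
      0 < s * (V.vol x u * fibreVolume V x u) → 0 < s * (V.vol x v * fibreVolume V x v) := by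
    intro x u v s hv hu
    have h := vol_mul_fibreVolume x u v
    have h1 : s * (V.vol x v * fibreVolume V x v) * V.vol x u ^ 2 =
        s * (V.vol x u * fibreVolume V x u) * V.vol x v ^ 2 := by
      linear_combination (s * V.vol x v * V.vol x u) * h
    refine pos_of_mul_pos_left (b := V.vol x u ^ 2) ?_ (sq_nonneg _)
    rw [h1]
    exact mul_pos hu (sq_pos_of_ne_zero hv)
  have hcov : ∀ x : V, (∃ v, 0 < (1 : ℝ) * (V.vol x v * fibreVolume V x v)) ∨
      ∃ v, 0 < (-1 : ℝ) * (V.vol x v * fibreVolume V x v) := by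
    intro x
    obtain ⟨v, hv⟩ : ∃ v, V.vol x v ≠ 0 := by
      by_contra! h
      exact V.vol_nowhereZero x (ContinuousAlternatingMap.ext h)
    rcases lt_or_gt_of_ne (mul_ne_zero hv (hne x v hv)) with h | h
    · exact Or.inr ⟨v, by linarith⟩
    · exact Or.inl ⟨v, by linarith⟩
  have hall : (∀ x : V, ∃ v, 0 < (1 : ℝ) * (V.vol x v * fibreVolume V x v)) ∨
      ∀ x : V, ∃ v, 0 < (-1 : ℝ) * (V.vol x v * fibreVolume V x v) := by
    by_contra! h
    obtain ⟨⟨x, hx⟩, y, hy⟩ := h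
    obtain ⟨z, -, ⟨u, hu⟩, v, hv⟩ := isPreconnected_univ (α := V) _ _ (isOpen_sign hV 1)
      (isOpen_sign hV (-1)) (fun x _ => hcov x)
      ⟨y, trivial, (hcov y).resolve_right fun ⟨v, hv⟩ => absurd hv (not_lt.2 (hy v))⟩
      ⟨x, trivial, (hcov x).resolve_left fun ⟨v, hv⟩ => absurd hv (not_lt.2 (hx v))⟩
    have hv0 : V.vol z v ≠ 0 := fun h0 => by rw [h0] at hv; simp at hv
    have := hsign z u v 1 hv0 hu
    linarith
  rcases hall with h | h
  · refine Or.inl fun x v hv => ?_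
    obtain ⟨u, hu⟩ := h x
    have := hsign x u v 1 hv.ne' hu
    rw [one_mul] at this
    exact pos_of_mul_pos_right this hv.le
  · refine Or.inr fun x v hv => ?_
    obtain ⟨u, hu⟩ := h x
    have := hsign x u v (-1) hv.ne' hu
    by_contra! h0
    nlinarith [mul_nonneg hv.le h0]

/-- Inversion of the circle changes the sign of dθ, so one of the identity and the inversion
produces the required sign, whichever orientation V carries. -/
theorem exists_reflection {σ : DiffForm (𝓡 2) V.fibre 2} (hσ0 : σ.NowhereZero)
    {Φ : Diffeomorph ((𝓡 2).prod (𝓡 1)) (𝓡 3) (V.fibre × Circle) V ∞}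
    (hproj : ∀ p, V.proj (Φ p) = p.2)
    (hform : V.form.pullback ((𝓡 2).prod (𝓡 1)) Φ = σ.pullback ((𝓡 2).prod (𝓡 1)) Prod.fst) :
    (∃ r s, IsReflection r s ∧ ∀ x v, 0 < V.vol x v → 0 < s * fibreVolume V x v) ∧
      ∃ r s, IsReflection r s ∧ ∀ x v, 0 < V.vol x v → s * fibreVolume V x v < 0 := by
  rcases sign_fibreVolume hσ0 hproj hform with h | h
  · exact ⟨⟨_, _, isReflection_id, fun x v hv => by linarith [h x v hv]⟩,
      ⟨_, _, isReflection_inv, fun x v hv => by linarith [h x v hv]⟩⟩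
  · exact ⟨⟨_, _, isReflection_inv, fun x v hv => by linarith [h x v hv]⟩,
      ⟨_, _, isReflection_id, fun x v hv => by linarith [h x v hv]⟩⟩

end Sign

/-! ### Assembly of the cobordism. -/

theorem exists_side {V : SymplecticFibration.{u}} {g : ℕ} (hg : 0 < g) (hV : V.IsTrivial)
    (hVg : V.HasGenus g) :
    ∃ (A : Side.{u}) (Φ : Diffeomorph ((𝓡 2).prod (𝓡 1)) (𝓡 3) (A.surface × Circle) V ∞),
      (∀ p, V.proj (Φ p) = p.2) ∧
      V.form.pullback ((𝓡 2).prod (𝓡 1)) Φ = A.form.pullback ((𝓡 2).prod (𝓡 1)) Prod.fst ∧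
      (∃ r s, IsReflection r s ∧ ∀ x v, 0 < V.vol x v → 0 < s * fibreVolume V x v) ∧
      ∃ r s, IsReflection r s ∧ ∀ x v, 0 < V.vol x v → s * fibreVolume V x v < 0 := by
  obtain ⟨σ, Φ, hσ, hσ0, hproj, hform⟩ := hV
  obtain ⟨ε, e, h, H⟩ := exists_handleCoordinate hσ hσ0 hg hVg.1
  exact ⟨⟨V.fibre, σ, hσ, hσ0, ε, e, h, H⟩, Φ, hproj, hform, exists_reflection hσ0 hproj hform⟩

/-- Boundary points of the symplectic sum are those at which the first chart coordinate is 0. They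
lie in one of the two collars at ‖angles‖ = 1/2, which is the image of the corresponding inclusion.
-/
theorem nonempty_cobordism {V V' : SymplecticFibration.{u}} {A B : Side.{u}}
    {Φ : Diffeomorph ((𝓡 2).prod (𝓡 1)) (𝓡 3) (A.surface × Circle) V ∞}
    {Φ' : Diffeomorph ((𝓡 2).prod (𝓡 1)) (𝓡 3) (B.surface × Circle) V' ∞}
    (hproj : ∀ p, V.proj (Φ p) = p.2) (hproj' : ∀ p, V'.proj (Φ' p) = p.2)
    (hform : V.form.pullback ((𝓡 2).prod (𝓡 1)) Φ = A.form.pullback ((𝓡 2).prod (𝓡 1)) Prod.fst)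
    (hform' : V'.form.pullback ((𝓡 2).prod (𝓡 1)) Φ' =
      B.form.pullback ((𝓡 2).prod (𝓡 1)) Prod.fst)
    {r r' : Circle → Circle} {s s' : ℝ} (hr : IsReflection r s) (hr' : IsReflection r' s')
    (hs : ∀ x v, 0 < V.vol x v → 0 < s * fibreVolume V x v)
    (hs' : ∀ x v, 0 < V'.vol x v → s' * fibreVolume V' x v < 0) : Nonempty (Cobordism V V') := by
  obtain ⟨W, tW, cW, mW, hT2, hcp, hcn, Ω, e₁, e₂, hΩ, h₁, h₂, hdisj, hcov⟩ := exists_glued A B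
  have hR₁ := h₁.range_endIncl (V := V) (Φ := Φ) hr
  have hR₂ := h₂.range_endIncl (V := V') (Φ := Φ') hr'
  have hb : ∀ w : W, w ∈ (𝓡∂ 4).boundary W ↔ extChartAt (𝓡∂ 4) w w 0 = 0 := by
    intro w
    rw [ModelWithCorners.boundary, mem_ofPred_eq, ModelWithCorners.IsBoundaryPoint,
      frontier_range_modelWithCornersEuclideanHalfSpace]
    exact eq_comm
  refine ⟨{
    total := W
    form := Ω
    form_symplectic := hΩ
    j₀ := endIncl e₁ Φ r
    j₁ := endIncl e₂ Φ' r'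
    j₀_smooth := h₁.contMDiff_endIncl hr
    j₁_smooth := h₂.contMDiff_endIncl hr'
    j₀_injective := h₁.injective_endIncl hr
    j₁_injective := h₂.injective_endIncl hr'
    j₀_immersion := h₁.injective_mfderiv_endIncl hr
    j₁_immersion := h₂.injective_mfderiv_endIncl hr'
    disjoint := ?_
    boundary_eq := ?_
    j₀_form := h₁.form_endIncl hr hform
    j₁_form := h₂.form_endIncl hr' hform'
    j₀_orientation := (h₁.orientation_endIncl hr hproj hform).1 hs
    j₁_orientation := (h₂.orientation_endIncl hr' hproj' hform').2 hs' }⟩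
  · rw [hR₁, hR₂, disjoint_left]
    rintro w ⟨hw1, hn⟩ ⟨hw2, -⟩
    have := hdisj w hw1 hw2
    linarith
  · rw [hR₁, hR₂]
    ext w
    rw [hb, mem_union, mem_ofPred_eq, mem_ofPred_eq]
    constructor
    · intro h0
      rcases hcov w with ⟨hw, hn⟩ | ⟨hw, hn⟩ | hpos
      · rw [h₁.coord_of_lt w hw hn w] at h0
        exact Or.inl ⟨hw, by linarith⟩
      · rw [h₂.coord_of_lt w hw hn w] at h0
        exact Or.inr ⟨hw, by linarith⟩
      · exact absurd h0 hpos.ne'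
    · rintro (⟨hw, hn⟩ | ⟨hw, hn⟩)
      · rw [h₁.coord_of_lt w hw (by linarith) w, hn, sub_self]
      · rw [h₂.coord_of_lt w hw (by linarith) w, hn, sub_self]

end SympFib

end

theorem lemma3p2 (g g' : ℕ) (hg : 0 < g) (hg' : 0 < g')
    (V V' : SympFib.SymplecticFibration.{u})
    (hV : V.IsTrivial) (hV' : V'.IsTrivial)
    (hVg : V.HasGenus g) (hVg' : V'.HasGenus g') :
    Nonempty (SympFib.Cobordism V V') := by
  -- The incoming end takes the reflection for which the inclusion reverses orientation, the
  -- outgoing end the one for which it preserves orientation.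
  obtain ⟨A, Φ, hp, hf, ⟨r, s, hr, hs⟩, -⟩ := SympFib.exists_side hg hV hVg
  obtain ⟨B, Φ', hp', hf', -, r', s', hr', hs'⟩ := SympFib.exists_side hg' hV' hVg'
  exact SympFib.nonempty_cobordism hp hp' hf hf' hr hr' hs hs'
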